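/- Let $X$ be a finite simplicial complex of dimension at most $2$. For a finite complex $W$ write $f_i(W)$ for the number of its $i$-dimensional faces, and $\chi(W)=f_0(W)-f_1(W)+f_2(W)$ when $\dim W\le 2$. Suppose that $2f_0(W)>f_2(W)$ for every nonempty subcomplex $W\subseteq X$. (1) Every connected component of the geometric realization $|X|$ is homotopy equivalent to a wedge of $a$ circles, $b$ two-dimensional spheres and $c$ real projective planes for some integers $a,b,c\ge 0$ depending on the component (the empty wedge is a point); and for every base point $x$ in that component, $\pi_1(|X|,x)$ is isomorphic to the free product of $a$ copies of $\mathbb Z$ and $c$ copies of $\mathbb Z/2$, and it is a word-hyperbolic group. (2) There is a subcomplex $Z\subseteq X$ with the same vertices and the same edges as $X$ such that the inclusion $|Z|\to|X|$ induces an isomorphism $\pi_1(|Z|,z)\to\pi_1(|X|,z)$ for every $z\in|Z|$, and such that $\chi(Z')\le 1$ for every connected subcomplex $Z'\subseteq Z$. -/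

import Mathlib

open scoped ContinuousMap Monoid.Coprod

noncomputable section

namespace TwoComplex

/-! ### Finite simplicial complexes

An abstract simplicial complex on vertices drawn from `V` is a `PreAbstractSimplicialComplex V`:
a family of nonempty finite subsets of `V`, closed under passing to nonempty subsets. Not every
`v : V` has to be a vertex. A subcomplex of `X` is a complex `W` with `W ≤ X`. -/

section Complexes

variable {V : Type*}

/-- The number `f_i(X)` of `i`-dimensional faces of `X` (faces with `i + 1` vertices); only used
for complexes with finitely many faces. -/
def numFaces (X : PreAbstractSimplicialComplex V) (i : ℕ) : ℕ :=
  {s : Finset V | s ∈ X ∧ s.card = i + 1}.ncard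

/-- The Euler characteristic of a finite complex of dimension at most `2`. -/
def eulerChar (X : PreAbstractSimplicialComplex V) : ℤ :=
  (numFaces X 0 : ℤ) - numFaces X 1 + numFaces X 2

/-- The points of the geometric realization of `X`, in barycentric coordinates: nonnegative
weights on the vertices that sum to `1` and are supported on a face. -/
def realizationSet (X : PreAbstractSimplicialComplex V) : Set (V → ℝ) :=
  {p | ∃ s ∈ X, (∀ v, 0 ≤ p v) ∧ (∀ v, v ∉ s → p v = 0) ∧ ∑ v ∈ s, p v = 1}

/-- The geometric realization `|X|`, with the subspace topology of the barycentric coordinates.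
For a complex with finitely many faces this is the usual topology of `|X|`. -/
abbrev Realization (X : PreAbstractSimplicialComplex V) : Type _ :=
  realizationSet X

theorem realizationSet_mono {Z X : PreAbstractSimplicialComplex V} (h : Z ≤ X) :
    realizationSet Z ⊆ realizationSet X := by
  rintro p ⟨s, hs, hp⟩
  exact ⟨s, h hs, hp⟩

/-- The inclusion `|Z| → |X|` of the realization of a subcomplex. -/
def realizationIncl {Z X : PreAbstractSimplicialComplex V} (h : Z ≤ X) :
    C(Realization Z, Realization X) :=
  ⟨Set.inclusion (realizationSet_mono h), continuous_inclusion _⟩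

end Complexes

/-! ### Wedges -/

section Wedges

variable {ι : Type*} (X : ι → Type*) (p : ∀ i, X i)

/-- The points that become the base point of the wedge. The extra point `inl ()` ensures that the
wedge of the empty family is a point. -/
def wedgeBase : Set (Unit ⊕ Σ i, X i) :=
  insert (Sum.inl ()) (Set.range fun i => Sum.inr ⟨i, p i⟩)

/-- The equivalence relation that identifies all base points with each other. -/
def wedgeSetoid : Setoid (Unit ⊕ Σ i, X i) where
  r x y := x = y ∨ (x ∈ wedgeBase X p ∧ y ∈ wedgeBase X p)
  iseqv :=
    { refl := fun _ => Or.inl rfl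
      symm := by
        rintro x y (h | ⟨hx, hy⟩)
        · exact Or.inl h.symm
        · exact Or.inr ⟨hy, hx⟩
      trans := by
        rintro x y z (rfl | ⟨hx, hy⟩) (rfl | ⟨hy', hz⟩)
        · exact Or.inl rfl
        · exact Or.inr ⟨hy', hz⟩
        · exact Or.inr ⟨hx, hy⟩
        · exact Or.inr ⟨hx, hz⟩ }

/-- The wedge of a family of pointed spaces: the disjoint union of the spaces and of one more
point, with all the base points and the extra point identified. -/
def Wedge : Type _ := Quotient (wedgeSetoid X p)

instance [∀ i, TopologicalSpace (X i)] : TopologicalSpace (Wedge X p) :=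
  inferInstanceAs (TopologicalSpace (Quotient (wedgeSetoid X p)))

end Wedges

/-- The unit sphere of Euclidean 3-space. -/
abbrev Sphere2 : Type := Metric.sphere (0 : EuclideanSpace ℝ (Fin 3)) 1

/-- A base point of the 2-sphere. -/
def sphere2Pt : Sphere2 :=
  ⟨EuclideanSpace.single 0 1, by simp⟩

/-- The antipodal equivalence relation on the 2-sphere. -/
def antipodal : Setoid Sphere2 where
  r x y := x = y ∨ x = -y
  iseqv :=
    { refl := fun _ => Or.inl rfl
      symm := by
        rintro x y (rfl | rfl)
        · exact Or.inl rfl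
        · exact Or.inr (neg_neg y).symm
      trans := by
        rintro x y z (rfl | rfl) (rfl | rfl)
        · exact Or.inl rfl
        · exact Or.inr rfl
        · exact Or.inr rfl
        · exact Or.inl (neg_neg z) }

/-- The real projective plane: the 2-sphere modulo the antipodal map, with the quotient
topology. -/
abbrev ProjPlane : Type := Quotient antipodal

/-- The family consisting of `a` circles, `b` spheres and `c` projective planes. -/
def Piece (a b c : ℕ) : Fin a ⊕ (Fin b ⊕ Fin c) → Type
  | .inl _ => Circle
  | .inr (.inl _) => Sphere2
  | .inr (.inr _) => ProjPlane

instance (a b c : ℕ) : ∀ i, TopologicalSpace (Piece a b c i)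
  | .inl _ => inferInstanceAs (TopologicalSpace Circle)
  | .inr (.inl _) => inferInstanceAs (TopologicalSpace Sphere2)
  | .inr (.inr _) => inferInstanceAs (TopologicalSpace ProjPlane)

/-- The base points of the pieces. -/
def piecePt (a b c : ℕ) : ∀ i, Piece a b c i
  | .inl _ => (1 : Circle)
  | .inr (.inl _) => sphere2Pt
  | .inr (.inr _) => Quotient.mk antipodal sphere2Pt

/-- The wedge of `a` circles, `b` two-dimensional spheres and `c` real projective planes. -/
abbrev WedgeOfPieces (a b c : ℕ) : Type := Wedge (Piece a b c) (piecePt a b c)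

/-! ### Groups -/

/-- The free product of `a` copies of `ℤ` and `c` copies of `ℤ/2`. -/
abbrev FreeProductZZ2 (a c : ℕ) : Type :=
  Monoid.Coprod (Monoid.CoprodI fun _ : Fin a => Multiplicative ℤ)
    (Monoid.CoprodI fun _ : Fin c => Multiplicative (ZMod 2))

section Hyperbolic

variable {G : Type*} [Group G]

/-- The word length of `g` with respect to a generating set `S`: the least length of a word in
the elements of `S` and their inverses that represents `g`. -/
def wordLength (S : Set G) (g : G) : ℕ :=
  sInf {n | ∃ l : List G, l.length = n ∧ (∀ x ∈ l, x ∈ S ∨ x⁻¹ ∈ S) ∧ l.prod = g}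

/-- The word metric of `G` with respect to a generating set `S`. -/
def wordDist (S : Set G) (g h : G) : ℕ := wordLength S (g⁻¹ * h)

variable (G) in
/-- Word hyperbolic groups: `G` has a finite generating set whose word metric is hyperbolic in the
sense of Gromov's four-point condition. -/
def IsHyperbolicGroup : Prop :=
  ∃ S : Set G, S.Finite ∧ Subgroup.closure S = ⊤ ∧ ∃ δ : ℕ, ∀ x y z w : G,
    wordDist S x y + wordDist S z w ≤
      max (wordDist S x z + wordDist S y w) (wordDist S x w + wordDist S y z) + δ

end Hyperbolic

end TwoComplex

end

/-!
Write `excess T = |T| - b₁` for a family `T` of triangles, where `b₁` is the cyclomatic number of the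
graph of their edges, so that the complex generated by `T` has Euler characteristic `excess T` plus
the number of its components. Sparsity says `2 f₀ - f₂ > 0` for the complex generated by `T`; for
triangles whose edges form a connected graph, this leaves little room for edges that lie in more than
two triangles, since `2 f₀ - f₂ = 2 χ - Σ (deg e - 2)`.

*Positive excess.* A minimal family `S` of positive excess has excess one and no free edges. If it
properly contains a family without free edges, then exactly three edges of `S` have degree three and
the others have degree two; two different minimal such subfamilies would give three surfaces with the
same boundary of three edges, and these have too few vertices. Hence some triangle `σ` of `S` is such
that `S` without `σ` collapses to a graph, which is a tree as the excess of `S` is one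
(`exists_triangle_collapsible`). So the boundary of `σ` is null-homotopic in the complex without `σ`,
and `σ` contributes a sphere to the homotopy type and nothing to the fundamental group. Removing such
triangles one after the other leads to a complex all of whose families have nonpositive excess, and
this is the subcomplex `Z`: the Euler characteristic of a connected complex with triangles `T` is at
most `1 + excess T`.

*Nonpositive excess.* The largest family without free edges is a union of edge-disjoint closed
pseudosurfaces. After one triangle is cut out of each, the complex collapses to a graph in which each
pseudosurface leaves one circuit (`exists_coreData`). Integer cocycles dual to the edges outside of a
suitable spanning tree define a homotopy equivalence to a bouquet of circles, such that the boundary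
of a cut triangle is mapped to a circle of its own with degree `0` or `±2`, by a count of signs in the
pseudosurface (`Coll.boundary_sum`, `CoreData.exists_model`). Gluing the triangles back yields spheres
and projective planes (`exists_homotopyEquiv`).

*Fundamental groups.* All gluings are described by spaces `Att f` with cones attached to a base. When
the bases of the cones are path connected, paths between points of the base can be deformed into the
base (`Att.pathSurj_inl`); so the circles and the equators of the projective planes generate the
fundamental group of the wedge. The resulting homomorphism from the free product is injective because
the free product acts simply transitively on the fibre of a covering that is glued from coverings of
the pieces (`piecesPotential_monodromy`). The free product is hyperbolic with constant `0`, as its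
Cayley graph is a tree of reduced words (`isHyperbolicGroup_of_letterPerm`).
-/

noncomputable section

namespace TwoComplex

/-! ### The rank of a graph -/

section GraphRank

open Finset

variable {V : Type*} [DecidableEq V]

/-- The indicator vector of a set of vertices, over the field with two elements. -/
def ind (e : Finset V) : V → ZMod 2 := fun v => if v ∈ e then 1 else 0

/-- The span of the indicator vectors of a family of edges. -/
def spn (E : Finset (Finset V)) : Submodule (ZMod 2) (V → ZMod 2) :=
  Submodule.span (ZMod 2) (ind '' (E : Set (Finset V)))

/-- The rank of a graph, given by its edges: the number of vertices minus the number of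
components. -/
def rk (E : Finset (Finset V)) : ℕ := Module.finrank (ZMod 2) (spn E)

/-- The cyclomatic number of a graph, given by its edges. -/
def cyc (E : Finset (Finset V)) : ℤ := (E.card : ℤ) - rk E

theorem ind_injective : Function.Injective (ind : Finset V → V → ZMod 2) := by
  intro a b h
  ext v
  have := congrFun h v
  by_cases h1 : v ∈ a <;> by_cases h2 : v ∈ b <;> simp_all [ind]

instance (E : Finset (Finset V)) : FiniteDimensional (ZMod 2) (spn E) :=
  FiniteDimensional.span_of_finite _ ((E.finite_toSet).image _)

theorem ind_mem_spn {E : Finset (Finset V)} {e : Finset V} (h : e ∈ E) : ind e ∈ spn E :=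
  Submodule.subset_span ⟨e, h, rfl⟩

theorem spn_mono {E F : Finset (Finset V)} (h : E ⊆ F) : spn E ≤ spn F :=
  Submodule.span_mono (Set.image_mono (by exact_mod_cast h))

theorem spn_union (E F : Finset (Finset V)) : spn (E ∪ F) = spn E ⊔ spn F := by
  simp [spn, Set.image_union, Submodule.span_union]

theorem rk_le_card (E : Finset (Finset V)) : rk E ≤ E.card := by
  classical
  have := finrank_span_finset_le_card (R := ZMod 2) (E.image (ind : Finset V → V → ZMod 2))
  rw [Finset.coe_image] at this
  exact this.trans Finset.card_image_le

theorem cyc_nonneg (E : Finset (Finset V)) : 0 ≤ cyc E := by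
  have := rk_le_card E
  unfold cyc; omega

/-- The cyclomatic number is supermodular. -/
theorem cyc_union (E F : Finset (Finset V)) : cyc E + cyc F ≤ cyc (E ∪ F) + cyc (E ∩ F) := by
  have h1 := Submodule.finrank_sup_add_finrank_inf_eq (spn E) (spn F)
  have h2 : rk (E ∩ F) ≤ Module.finrank (ZMod 2) (spn E ⊓ spn F : Submodule _ _) :=
    Submodule.finrank_mono (le_inf (spn_mono inter_subset_left) (spn_mono inter_subset_right))
  rw [← spn_union] at h1
  have h3 := Finset.card_union_add_card_inter E F
  unfold cyc
  change rk (E ∪ F) + _ = rk E + rk F at h1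
  omega

theorem cyc_mono {E F : Finset (Finset V)} (h : E ⊆ F) : cyc E ≤ cyc F := by
  have := cyc_union E (F \ E)
  rw [Finset.union_sdiff_of_subset h, Finset.inter_sdiff_self] at this
  have h2 := cyc_nonneg (F \ E)
  have h3 : cyc (∅ : Finset (Finset V)) ≤ 0 := by simp [cyc]
  linarith

theorem linearIndepOn_of_cyc {E : Finset (Finset V)} (h : cyc E = 0) :
    LinearIndepOn (ZMod 2) ind (E : Set (Finset V)) := by
  have h1 : rk E = E.card := by unfold cyc at h; omega
  unfold LinearIndepOn
  rw [linearIndependent_iff_card_eq_finrank_span]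
  have : Set.range (fun x : (E : Set (Finset V)) => ind (x : Finset V)) = ind '' (E : Set (Finset V)) := by
    rw [Set.image_eq_range]
  rw [this]
  exact (Fintype.card_coe E).trans h1.symm

theorem cyc_of_linearIndepOn {E : Finset (Finset V)}
    (h : LinearIndepOn (ZMod 2) ind (E : Set (Finset V))) : cyc E = 0 := by
  unfold LinearIndepOn at h
  rw [linearIndependent_iff_card_eq_finrank_span] at h
  have : Set.range (fun x : (E : Set (Finset V)) => ind (x : Finset V)) = ind '' (E : Set (Finset V)) := by
    rw [Set.image_eq_range]
  rw [this] at h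
  have h1 : rk E = E.card := h.symm.trans (Fintype.card_coe E)
  unfold cyc; omega

theorem spn_erase_of_mem {E : Finset (Finset V)} {e : Finset V}
    (h : ind e ∈ spn (E.erase e)) : spn (E.erase e) = spn E := by
  refine le_antisymm (spn_mono (erase_subset _ _)) (Submodule.span_le.2 ?_)
  rintro _ ⟨x, hx, rfl⟩
  by_cases hxe : x = e
  · rw [hxe]; exact h
  · exact ind_mem_spn (mem_erase.2 ⟨hxe, hx⟩)

theorem cyc_erase_of_mem {E : Finset (Finset V)} {e : Finset V} (he : e ∈ E)
    (h : ind e ∈ spn (E.erase e)) : cyc E = cyc (E.erase e) + 1 := by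
  have := card_erase_add_one he
  unfold cyc rk
  rw [spn_erase_of_mem h]
  omega

/-- A graph with positive cyclomatic number has an edge that is spanned by the others. -/
theorem exists_mem_spn_erase {E : Finset (Finset V)} (h : 0 < cyc E) :
    ∃ e ∈ E, ind e ∈ spn (E.erase e) := by
  by_contra! hc
  have : LinearIndepOn (ZMod 2) ind (E : Set (Finset V)) := by
    rw [linearIndepOn_iff_notMem_span]
    intro e he
    have := hc e he
    simpa [spn] using this
  rw [cyc_of_linearIndepOn this] at h
  exact lt_irrefl _ h

/-- A sum of indicator vectors of edges vanishes only for a set that is empty or has at least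
three edges. -/
theorem three_le_card_of_sum_eq_zero {E : Finset (Finset V)} (hE : ∀ e ∈ E, e.Nonempty)
    (hne : E.Nonempty) (h : ∑ e ∈ E, ind e = 0) : 3 ≤ E.card := by
  by_contra! hlt
  have h0 := hne.card_pos
  have : E.card = 1 ∨ E.card = 2 := by omega
  have hz : ind (∅ : Finset V) = 0 := by ext; simp [ind]
  rcases this with h1 | h2
  · obtain ⟨a, rfl⟩ := card_eq_one.1 h1
    rw [sum_singleton, ← hz] at h
    exact (hE a (by simp)).ne_empty (ind_injective h)
  · obtain ⟨a, b, hab, rfl⟩ := card_eq_two.1 h2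
    rw [sum_pair hab, ← ZModModule.sub_eq_add, sub_eq_zero] at h
    exact hab (ind_injective h)

theorem three_le_card_of_cyc_pos {E : Finset (Finset V)} (hE : ∀ e ∈ E, e.Nonempty)
    (h : 0 < cyc E) : 3 ≤ E.card := by
  by_contra! hlt
  have : LinearIndepOn (ZMod 2) ind (E : Set (Finset V)) := by
    rw [linearIndepOn_finset_iff]
    intro f hf
    by_contra! hc
    obtain ⟨i, hi, hfi⟩ := hc
    have h1 : ∑ e ∈ E.filter (fun e => f e ≠ 0), ind e = 0 := by
      rw [← hf, sum_filter]
      refine sum_congr rfl fun e _ => ?_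
      have : f e = 0 ∨ f e = 1 := by generalize f e = x; revert x; decide
      rcases this with h | h <;> simp [h]
    have := three_le_card_of_sum_eq_zero (fun e he => hE e (mem_filter.1 he).1)
      ⟨i, mem_filter.2 ⟨hi, hfi⟩⟩ h1
    have h3 := card_filter_le E (fun e => f e ≠ 0)
    omega
  rw [cyc_of_linearIndepOn this] at h
  exact lt_irrefl _ h

/-- A graph given by a set of vertices and a set of edges is connected if every proper nonempty
set of vertices is left by an edge. -/
def ConnGraph (U : Finset V) (E : Finset (Finset V)) : Prop :=
  ∀ A ⊆ U, A.Nonempty → A ≠ U → ∃ e ∈ E, ∃ a ∈ e, ∃ b ∈ e, a ∈ A ∧ b ∉ A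

theorem ind_pair {a b : V} (h : a ≠ b) : ind {a, b} = Pi.single a 1 + Pi.single b 1 := by
  ext v
  by_cases h1 : v = a <;> by_cases h2 : v = b <;> simp_all [ind]

theorem rk_add_one_le {U : Finset V} {E : Finset (Finset V)} (hU : U.Nonempty)
    (hE : ∀ e ∈ E, e ⊆ U ∧ e.card = 2) : rk E + 1 ≤ U.card := by
  classical
  obtain ⟨v, hv⟩ := hU
  have h1 : spn E ≤ Submodule.span (ZMod 2)
      (((U.erase v).image fun u => (Pi.single v 1 + Pi.single u 1 : V → ZMod 2) : Finset _) : Set _) := by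
    refine Submodule.span_le.2 ?_
    rintro _ ⟨e, he, rfl⟩
    obtain ⟨heU, hc⟩ := hE e he
    obtain ⟨a, b, hab, rfl⟩ := card_eq_two.1 hc
    have key : ∀ u ∈ U, (Pi.single v 1 + Pi.single u 1 : V → ZMod 2) ∈ Submodule.span (ZMod 2)
      (((U.erase v).image fun u => (Pi.single v 1 + Pi.single u 1 : V → ZMod 2) : Finset _) : Set _) := by
      intro u hu
      by_cases huv : u = v
      · rw [huv, ZModModule.add_self]; exact Submodule.zero_mem _
      · refine Submodule.subset_span ?_
        simp only [coe_image, Set.mem_image]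
        exact ⟨u, mem_coe.2 (mem_erase.2 ⟨huv, hu⟩), rfl⟩
    have ha := key a (heU (by simp))
    have hb := key b (heU (by simp))
    have := Submodule.add_mem _ ha hb
    rw [SetLike.mem_coe, ind_pair hab]
    convert this using 1
    rw [add_add_add_comm, ZModModule.add_self, zero_add]
  have h2 := Submodule.finrank_mono h1
  have h3 := finrank_span_finset_le_card (R := ZMod 2)
    ((U.erase v).image fun u => (Pi.single v 1 + Pi.single u 1 : V → ZMod 2))
  have h4 : ((U.erase v).image fun u => (Pi.single v 1 + Pi.single u 1 : V → ZMod 2)).card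
    ≤ (U.erase v).card := card_image_le
  have h5 := card_erase_add_one hv
  unfold Set.finrank at h3
  unfold rk
  omega

/-- For a connected graph the number of vertices exceeds the rank by at most one. The functionals
that vanish on all edges are the functions that are constant on edges. -/
theorem card_le_rk_add_one {U : Finset V} {E : Finset (Finset V)}
    (hE : ∀ e ∈ E, e ⊆ U ∧ e.card = 2) (h : ConnGraph U E) : U.card ≤ rk E + 1 := by
  by_contra! hlt
  let r : (V → ZMod 2) →ₗ[ZMod 2] (U → ZMod 2) := LinearMap.funLeft _ _ Subtype.val
  let S : Submodule (ZMod 2) (U → ZMod 2) := (spn E).map r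
  have hS : Module.finrank (ZMod 2) S ≤ rk E := Submodule.finrank_map_le r (spn E)
  have h1 := Subspace.finrank_add_finrank_dualAnnihilator_eq S
  have h2 : Module.finrank (ZMod 2) (U → ZMod 2) = U.card := by simp
  have h3 : 1 < Module.finrank (ZMod 2) S.dualAnnihilator := by omega
  have hone : ∃ φ ∈ S.dualAnnihilator, ∃ a b : U, φ (Pi.single a 1) ≠ φ (Pi.single b 1) := by
    by_contra! hc
    have hUne : U.Nonempty := by
      rw [← card_pos]; omega
    obtain ⟨u, hu⟩ := hUne
    let L : S.dualAnnihilator →ₗ[ZMod 2] ZMod 2 :=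
      (LinearMap.applyₗ (Pi.single (⟨u, hu⟩ : U) 1)).comp S.dualAnnihilator.subtype
    have hL : Function.Injective L := by
      rw [injective_iff_map_eq_zero]
      rintro ⟨φ, hφ⟩ h0
      ext i
      have := hc φ hφ i ⟨u, hu⟩
      simp only [LinearMap.coe_comp, LinearMap.coe_single, Function.comp_apply, L] at h0 ⊢
      rw [this]
      exact h0
    have := LinearMap.finrank_le_finrank_of_injective hL
    simp at this
    omega
  obtain ⟨φ, hφ, a, b, hab⟩ := hone
  have h01 : ∀ x : ZMod 2, x = 0 ∨ x = 1 := by decide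
  let A : Finset V := U.filter fun v => ∃ hv : v ∈ U, φ (Pi.single ⟨v, hv⟩ 1) = φ (Pi.single a 1)
  obtain ⟨e, he, x, hx, y, hy, hxA, hyA⟩ := h A (filter_subset _ _)
    ⟨a, mem_filter.2 ⟨a.2, a.2, rfl⟩⟩ (by
      intro hA
      have hb : (b : V) ∈ A := by rw [hA]; exact b.2
      obtain ⟨_, hv, hb⟩ := mem_filter.1 hb
      exact hab hb.symm)
  obtain ⟨heU, hc⟩ := hE e he
  have hxy : x ≠ y := by rintro rfl; exact hyA hxA
  have hexy : e = {x, y} := by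
    symm
    apply eq_of_subset_of_card_le
    · intro z hz
      simp only [mem_insert, mem_singleton] at hz
      rcases hz with rfl | rfl <;> assumption
    · rw [hc, card_pair hxy]
  have hz : φ (r (ind e)) = 0 :=
    (Submodule.mem_dualAnnihilator φ).1 hφ _ (Submodule.mem_map_of_mem (ind_mem_spn he))
  have hr : r (ind e) = Pi.single ⟨x, heU hx⟩ 1 + Pi.single ⟨y, heU hy⟩ 1 := by
    rw [hexy, ind_pair hxy]
    ext ⟨v, hv⟩
    simp [r, LinearMap.funLeft_apply, Pi.single_apply, Subtype.ext_iff]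
  rw [hr, map_add, ← ZModModule.sub_eq_add, sub_eq_zero] at hz
  obtain ⟨_, hv, hxa⟩ := mem_filter.1 hxA
  exact hyA (mem_filter.2 ⟨heU hy, heU hy, by rw [← hz, hxa]⟩)

/-- The rank is additive over edge sets with disjoint supports. -/
theorem rk_add_rk_le_of_disjoint {E F : Finset (Finset V)} {A B : Finset V} (hAB : Disjoint A B)
    (hE : ∀ e ∈ E, e ⊆ A) (hF : ∀ e ∈ F, e ⊆ B) : rk E + rk F ≤ rk (E ∪ F) := by
  have hsupp : ∀ (E : Finset (Finset V)) (A : Finset V), (∀ e ∈ E, e ⊆ A) →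
      ∀ x ∈ spn E, ∀ v ∉ A, x v = 0 := by
    intro E A hE x hx v hv
    have : spn E ≤ LinearMap.ker (LinearMap.proj v : (V → ZMod 2) →ₗ[ZMod 2] ZMod 2) := by
      refine Submodule.span_le.2 ?_
      rintro _ ⟨e, he, rfl⟩
      have : v ∉ e := fun h => hv (hE e he h)
      simp [ind, this]
    exact this hx
  have hd : spn E ⊓ spn F = ⊥ := by
    rw [eq_bot_iff]
    rintro x ⟨h1, h2⟩
    rw [Submodule.mem_bot]
    ext v
    by_cases hv : v ∈ A
    · exact hsupp F B hF x h2 v (disjoint_left.1 hAB hv)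
    · exact hsupp E A hE x h1 v hv
  have h1 := Submodule.finrank_sup_add_finrank_inf_eq (spn E) (spn F)
  rw [hd, ← spn_union, finrank_bot] at h1
  unfold rk
  omega

end GraphRank

/-! ### Families of triangles -/

section Triangles

open Finset

variable {V : Type*} [DecidableEq V]

/-- The edges of a family of triangles. -/
def edges (T : Finset (Finset V)) : Finset (Finset V) := T.biUnion (powersetCard 2)

/-- The vertices of a family of triangles. -/
def verts (T : Finset (Finset V)) : Finset V := T.biUnion id

/-- The number of triangles that contain an edge. -/
def deg (T : Finset (Finset V)) (e : Finset V) : ℕ := (T.filter (e ⊆ ·)).card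

/-- The number of triangles minus the cyclomatic number of the graph of their edges. For the
complex `W` generated by the triangles this is `χ(W)` minus the number of components of `W`. -/
def excess (T : Finset (Finset V)) : ℤ := T.card - cyc (edges T)

/-- A family of triangles is closed if no edge lies in exactly one of them, so that the complex
that they generate admits no collapse. -/
def IsClosedFam (T : Finset (Finset V)) : Prop := ∀ e ∈ edges T, 2 ≤ deg T e

/-- The quantity `2 f₀ - f₂` of the complex generated by a family of triangles. -/
def slack (T : Finset (Finset V)) : ℤ := 2 * (verts T).card - T.card

/-- All members have three vertices. -/
def Triangular (T : Finset (Finset V)) : Prop := ∀ t ∈ T, t.card = 3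

/-- The sparsity condition for a family of triangles. -/
def Sparse (T : Finset (Finset V)) : Prop := ∀ S ⊆ T, S.Nonempty → 0 < slack S

/-- A minimal nonempty closed family of triangles. -/
def MinClosed (Y : Finset (Finset V)) : Prop :=
  Y.Nonempty ∧ IsClosedFam Y ∧ ∀ A ⊆ Y, A.Nonempty → IsClosedFam A → A = Y

/-- A family of triangles is unsplittable if it is not the union of two nonempty parts without
common vertices. -/
def Unsplittable (T : Finset (Finset V)) : Prop :=
  ∀ A ⊆ T, A.Nonempty → Disjoint (verts A) (verts (T \ A)) → A = T

theorem mem_edges {T : Finset (Finset V)} {e : Finset V} :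
    e ∈ edges T ↔ ∃ t ∈ T, e ⊆ t ∧ e.card = 2 := by
  simp [edges, mem_powersetCard]

theorem mem_verts {T : Finset (Finset V)} {v : V} : v ∈ verts T ↔ ∃ t ∈ T, v ∈ t := by
  simp [verts]

theorem edges_mono {S T : Finset (Finset V)} (h : S ⊆ T) : edges S ⊆ edges T :=
  biUnion_subset_biUnion_of_subset_left _ h

theorem verts_mono {S T : Finset (Finset V)} (h : S ⊆ T) : verts S ⊆ verts T :=
  biUnion_subset_biUnion_of_subset_left _ h

theorem edges_union (S T : Finset (Finset V)) : edges (S ∪ T) = edges S ∪ edges T :=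
  union_biUnion

theorem verts_union (S T : Finset (Finset V)) : verts (S ∪ T) = verts S ∪ verts T :=
  union_biUnion

theorem card_of_mem_edges {T : Finset (Finset V)} {e : Finset V} (h : e ∈ edges T) :
    e.card = 2 := by
  obtain ⟨_, _, _, h⟩ := mem_edges.1 h; exact h

theorem subset_verts_of_mem_edges {T : Finset (Finset V)} {e : Finset V} (h : e ∈ edges T) :
    e ⊆ verts T := by
  obtain ⟨t, ht, he, _⟩ := mem_edges.1 h
  exact fun v hv => mem_verts.2 ⟨t, ht, he hv⟩

theorem nonempty_of_mem_edges {T : Finset (Finset V)} {e : Finset V} (h : e ∈ edges T) :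
    e.Nonempty := by
  rw [← card_pos, card_of_mem_edges h]; omega

theorem deg_mono {S T : Finset (Finset V)} (h : S ⊆ T) (e : Finset V) : deg S e ≤ deg T e :=
  card_le_card (filter_subset_filter _ h)

theorem deg_pos {T : Finset (Finset V)} {e : Finset V} (h : e ∈ edges T) : 1 ≤ deg T e := by
  obtain ⟨t, ht, he, _⟩ := mem_edges.1 h
  exact card_pos.2 ⟨t, mem_filter.2 ⟨ht, he⟩⟩

theorem mem_edges_of_deg_pos {T : Finset (Finset V)} {e : Finset V} (h : 1 ≤ deg T e)
    (he : e.card = 2) : e ∈ edges T := by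
  obtain ⟨t, ht⟩ := card_pos.1 h
  exact mem_edges.2 ⟨t, (mem_filter.1 ht).1, (mem_filter.1 ht).2, he⟩

theorem deg_union_of_disjoint {S T : Finset (Finset V)} (h : Disjoint S T) (e : Finset V) :
    deg (S ∪ T) e = deg S e + deg T e := by
  unfold deg
  rw [filter_union, card_union_of_disjoint (disjoint_filter_filter h)]

theorem deg_sdiff_add {S T : Finset (Finset V)} (h : S ⊆ T) (e : Finset V) :
    deg (T \ S) e + deg S e = deg T e := by
  rw [← deg_union_of_disjoint sdiff_disjoint, sdiff_union_of_subset h]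

theorem deg_union_add_inter (S T : Finset (Finset V)) (e : Finset V) :
    deg (S ∪ T) e + deg (S ∩ T) e = deg S e + deg T e := by
  unfold deg
  rw [filter_union, filter_inter_distrib, card_union_add_card_inter]

/-- Each triangle has three edges. -/
theorem sum_deg {T F : Finset (Finset V)} (hT : Triangular T) (hF : edges T ⊆ F)
    (hF2 : ∀ e ∈ F, e.card = 2) : ∑ e ∈ F, deg T e = 3 * T.card := by
  have h1 : ∑ e ∈ F, deg T e = ∑ t ∈ T, (F.filter (· ⊆ t)).card := by
    simp only [deg, card_filter]
    exact sum_comm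
  rw [h1, mul_comm]
  refine Finset.sum_const_nat fun t ht => ?_
  have : F.filter (· ⊆ t) = powersetCard 2 t := by
    ext e
    rw [mem_filter, mem_powersetCard]
    exact ⟨fun h => ⟨h.2, hF2 e h.1⟩, fun h => ⟨hF (mem_edges.2 ⟨t, ht, h⟩), h.1⟩⟩
  rw [this, card_powersetCard, hT t ht]
  rfl

/-- The sum of the edges of a triangle vanishes modulo two. -/
theorem sum_ind_powersetCard {t : Finset V} (ht : t.card = 3) :
    ∑ e ∈ powersetCard 2 t, ind e = 0 := by
  obtain ⟨a, b, c, hab, hac, hbc, rfl⟩ := card_eq_three.1 ht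
  have h1 : ({a, b} : Finset V) ≠ {a, c} := fun h => by
    have : b ∈ ({a, c} : Finset V) := h ▸ (by simp)
    simp at this; tauto
  have h2 : ({a, b} : Finset V) ≠ {b, c} := fun h => by
    have : a ∈ ({b, c} : Finset V) := h ▸ (by simp)
    simp at this; tauto
  have h3 : ({a, c} : Finset V) ≠ {b, c} := fun h => by
    have : a ∈ ({b, c} : Finset V) := h ▸ (by simp)
    simp at this; tauto
  have h : powersetCard 2 ({a, b, c} : Finset V) = {{a, b}, {a, c}, {b, c}} := by
    symm
    apply eq_of_subset_of_card_le
    · intro e he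
      simp only [mem_insert, mem_singleton] at he
      rw [mem_powersetCard]
      rcases he with rfl | rfl | rfl
      · exact ⟨by intro x; simp; tauto, card_pair hab⟩
      · exact ⟨by intro x; simp; tauto, card_pair hac⟩
      · exact ⟨by intro x; simp; tauto, card_pair hbc⟩
    · rw [card_powersetCard, ht]
      rw [card_insert_of_notMem (by simp [h1, h2]), card_pair h3]
      decide
  rw [h, sum_insert (by simp [h1, h2]), sum_pair h3, ind_pair hab, ind_pair hac, ind_pair hbc]
  have key : ∀ x y z : V → ZMod 2, x + y + (x + z + (y + z)) = 0 := by
    intro x y z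
    ext v
    simp only [Pi.add_apply, Pi.zero_apply]
    generalize x v = p; generalize y v = q; generalize z v = r
    revert p q r; decide
  exact key _ _ _

/-- The boundary modulo two of a family of triangles is a cycle. -/
theorem sum_deg_smul_ind {T F : Finset (Finset V)} (hT : Triangular T) (hF : edges T ⊆ F)
    (hF2 : ∀ e ∈ F, e.card = 2) : ∑ e ∈ F, (deg T e : ZMod 2) • ind e = 0 := by
  have h1 : ∀ e, (deg T e : ZMod 2) • ind e = ∑ t ∈ T, if e ⊆ t then ind e else 0 := by
    intro e
    rw [← sum_filter, sum_const, Nat.cast_smul_eq_nsmul]; rfl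
  simp_rw [h1]
  rw [sum_comm]
  refine sum_eq_zero fun t ht => ?_
  rw [← sum_filter]
  have : F.filter (· ⊆ t) = powersetCard 2 t := by
    ext e
    rw [mem_filter, mem_powersetCard]
    exact ⟨fun h => ⟨h.2, hF2 e h.1⟩, fun h => ⟨hF (mem_edges.2 ⟨t, ht, h⟩), h.1⟩⟩
  rw [this, sum_ind_powersetCard (hT t ht)]

/-- The set of edges of odd degree is empty or has at least three elements. -/
theorem three_le_card_odd {T D : Finset (Finset V)} (hT : Triangular T) (hD : D ⊆ edges T)
    (hne : D.Nonempty) (hodd : ∀ e ∈ edges T, e ∈ D ↔ Odd (deg T e)) : 3 ≤ D.card := by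
  refine three_le_card_of_sum_eq_zero (fun e he => nonempty_of_mem_edges (hD he)) hne ?_
  have h := sum_deg_smul_ind hT (Subset.refl _) (fun e he => card_of_mem_edges he)
  rw [← h, ← inter_eq_right.2 hD, ← filter_mem_eq_inter, sum_filter]
  refine sum_congr rfl fun e he => ?_
  split_ifs with h1
  · rw [(ZMod.natCast_eq_one_iff_odd).2 ((hodd e he).1 h1), one_smul]
  · rw [(ZMod.natCast_eq_zero_iff_even).2 (Nat.not_odd_iff_even.1 fun h2 => h1 ((hodd e he).2 h2)),
      zero_smul]

theorem slack_submodular (A B : Finset (Finset V)) :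
    slack (A ∪ B) + slack (A ∩ B) ≤ slack A + slack B := by
  have h1 := card_union_add_card_inter A B
  have h2 := card_union_add_card_inter (verts A) (verts B)
  have h3 : (verts (A ∩ B)).card ≤ (verts A ∩ verts B).card :=
    card_le_card (subset_inter (verts_mono inter_subset_left) (verts_mono inter_subset_right))
  rw [← verts_union] at h2
  unfold slack
  omega

theorem excess_union_le {P Q : Finset (Finset V)} (h : Disjoint P Q) :
    excess (P ∪ Q) ≤ excess P + excess Q + cyc (edges P ∩ edges Q) := by
  have h1 := cyc_union (edges P) (edges Q)
  unfold excess
  rw [edges_union, card_union_of_disjoint h]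
  push_cast
  linarith

theorem disjoint_edges_of_disjoint_verts {A B : Finset (Finset V)}
    (h : Disjoint (verts A) (verts B)) : Disjoint (edges A) (edges B) := by
  rw [disjoint_left]
  intro e h1 h2
  obtain ⟨v, hv⟩ := nonempty_of_mem_edges h1
  exact disjoint_left.1 h (subset_verts_of_mem_edges h1 hv) (subset_verts_of_mem_edges h2 hv)

theorem Unsplittable.connGraph {T : Finset (Finset V)} (h : Unsplittable T) :
    ConnGraph (verts T) (edges T) := by
  intro A hA hne hAU
  by_contra! hc
  -- each triangle lies in `A` or is disjoint from it
  have key : ∀ t ∈ T, ∀ a ∈ t, ∀ b ∈ t, a ∈ A → b ∈ A := by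
    intro t ht a ha b hb haA
    by_cases hab : a = b
    · rwa [← hab]
    · refine hc {a, b} (mem_edges.2 ⟨t, ht, ?_, card_pair hab⟩) a (by simp) b (by simp) haA
      intro x hx
      simp only [mem_insert, mem_singleton] at hx
      rcases hx with rfl | rfl <;> assumption
  have := h (T.filter (fun t => t ⊆ A)) (filter_subset _ _) (by
    obtain ⟨a, ha⟩ := hne
    obtain ⟨t, ht, hat⟩ := mem_verts.1 (hA ha)
    exact ⟨t, mem_filter.2 ⟨ht, fun b hb => key t ht a hat b hb ha⟩⟩) (by
    rw [disjoint_left]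
    intro v h1 h2
    obtain ⟨t, ht, hvt⟩ := mem_verts.1 h1
    obtain ⟨s, hs, hvs⟩ := mem_verts.1 h2
    rw [mem_filter] at ht
    rw [mem_sdiff, mem_filter] at hs
    exact hs.2 ⟨hs.1, fun b hb => key s hs.1 v hvs b hb (ht.2 hvt)⟩)
  apply hAU
  refine Subset.antisymm hA fun v hv => ?_
  obtain ⟨t, ht, hvt⟩ := mem_verts.1 hv
  rw [← this, mem_filter] at ht
  exact ht.2 hvt

theorem edges_subset_verts_and_card (T : Finset (Finset V)) :
    ∀ e ∈ edges T, e ⊆ verts T ∧ e.card = 2 :=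
  fun _ he => ⟨subset_verts_of_mem_edges he, card_of_mem_edges he⟩

/-- For an unsplittable family, `2 f₀ - f₂ = 2 χ - Σ (deg - 2)`. -/
theorem slack_le_of_unsplittable {T : Finset (Finset V)} (h : Unsplittable T) :
    slack T + 3 * T.card ≤ 2 * excess T + 2 + 2 * (edges T).card := by
  have h1 := card_le_rk_add_one (edges_subset_verts_and_card T) (h.connGraph)
  unfold slack excess cyc
  omega

theorem MinClosed.unsplittable {Y : Finset (Finset V)} (h : MinClosed Y) : Unsplittable Y := by
  intro A hA hne hd
  refine h.2.2 A hA hne fun e he => ?_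
  have h1 := h.2.1 e (edges_mono hA he)
  rw [← deg_sdiff_add hA] at h1
  have : deg (Y \ A) e = 0 := by
    by_contra h0
    have := mem_edges_of_deg_pos (Nat.one_le_iff_ne_zero.2 h0) (card_of_mem_edges he)
    exact disjoint_left.1 (disjoint_edges_of_disjoint_verts hd) he this
  omega

theorem exists_minClosed {T : Finset (Finset V)} (hne : T.Nonempty) (hT : IsClosedFam T) :
    ∃ Y ⊆ T, MinClosed Y := by
  classical
  obtain ⟨Y, hY, hmin⟩ := exists_min_image
    ((T.powerset).filter fun Y => Y.Nonempty ∧ IsClosedFam Y) card ⟨T, by simp [hne, hT]⟩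
  simp only [mem_filter, mem_powerset, and_imp] at hY hmin
  refine ⟨Y, hY.1, hY.2.1, hY.2.2, fun A hA hAne hAc => ?_⟩
  exact eq_of_subset_of_card_le hA (hmin A (hA.trans hY.1) hAne hAc)

/-- The degrees of a closed family add up to at least `2 f₁`, with equality only if all degrees
are `2`. -/
theorem deg_eq_two_of_card_le {T : Finset (Finset V)} (hT : Triangular T) (hc : IsClosedFam T)
    (h : 3 * T.card ≤ 2 * (edges T).card) : ∀ e ∈ edges T, deg T e = 2 := by
  have h1 := sum_deg hT (Subset.refl _) (fun e he => card_of_mem_edges he)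
  have h2 : ∑ e ∈ edges T, 2 ≤ ∑ e ∈ edges T, deg T e := sum_le_sum hc
  have h3 : ∑ e ∈ edges T, 2 = ∑ e ∈ edges T, deg T e := by
    refine le_antisymm h2 ?_
    rw [h1, sum_const, smul_eq_mul]; omega
  intro e he
  exact ((sum_eq_sum_iff_of_le hc).1 h3 e he).symm

/-- In a sparse complex, a closed unsplittable family of nonpositive excess is a closed
pseudosurface, of Euler characteristic `1`. -/
theorem deg_eq_two_of_excess_nonpos {T : Finset (Finset V)} (hT : Triangular T)
    (hs : Sparse T) (hne : T.Nonempty) (hc : IsClosedFam T) (hu : Unsplittable T)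
    (hx : excess T ≤ 0) : (∀ e ∈ edges T, deg T e = 2) ∧ excess T = 0 ∧ slack T ≤ 2 := by
  have h0 := hs T (Subset.refl _) hne
  have h1 := slack_le_of_unsplittable hu
  have h2 := sum_deg hT (Subset.refl _) (fun e he => card_of_mem_edges he)
  have h3 : ∑ e ∈ edges T, 2 ≤ ∑ e ∈ edges T, deg T e := sum_le_sum hc
  rw [h2, sum_const, smul_eq_mul] at h3
  have hle : 3 * T.card ≤ 2 * (edges T).card + 1 := by omega
  have key : 3 * T.card ≠ 2 * (edges T).card + 1 := by
    -- otherwise exactly one edge has odd degree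
    intro heq
    have h4 : ∑ e ∈ edges T, (deg T e - 2) = 1 := by
      have : ∑ e ∈ edges T, (deg T e - 2) + ∑ e ∈ edges T, 2 = ∑ e ∈ edges T, deg T e := by
        rw [← sum_add_distrib]
        exact sum_congr rfl fun e he => Nat.sub_add_cancel (hc e he)
      rw [h2, sum_const, smul_eq_mul] at this
      omega
    obtain ⟨e, he, hpos⟩ : ∃ e ∈ edges T, 0 < deg T e - 2 := by
      by_contra! hcon
      rw [sum_eq_zero fun e he => by have := hcon e he; omega] at h4
      omega
    have hrest : ∀ e' ∈ edges T, e' ≠ e → deg T e' = 2 := by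
      intro e' he' hne'
      have := sum_le_sum_of_subset (f := fun e => deg T e - 2)
        (show ({e, e'} : Finset _) ⊆ edges T by
          intro x hx; simp only [mem_insert, mem_singleton] at hx
          rcases hx with rfl | rfl <;> assumption)
      rw [sum_pair hne'.symm] at this
      have := hc e' he'
      omega
    have hdeg : deg T e = 3 := by
      have : deg T e - 2 ≤ ∑ e ∈ edges T, (deg T e - 2) :=
        single_le_sum (f := fun e => deg T e - 2) (fun _ _ => Nat.zero_le _) he
      omega
    have := three_le_card_odd hT (D := {e}) (by simpa using he) (by simp) (by
      intro e' he'
      rw [mem_singleton]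
      constructor
      · rintro rfl; rw [hdeg]; decide
      · intro ho
        by_contra hne'
        rw [hrest e' he' hne'] at ho
        exact absurd ho (by decide))
    simp at this
  refine ⟨deg_eq_two_of_card_le hT hc (by omega), ?_, ?_⟩ <;> omega

end Triangles

/-! ### Minimal families of positive excess -/

section MinimalExcess

open Finset

variable {V : Type*} [DecidableEq V]

/-- A minimal family of triangles of positive excess. -/
def MinExcess (S : Finset (Finset V)) : Prop :=
  1 ≤ excess S ∧ ∀ A ⊆ S, A ≠ S → excess A ≤ 0

theorem exists_minExcess {T S : Finset (Finset V)} (hS : S ⊆ T) (h : 1 ≤ excess S) :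
    ∃ S ⊆ T, MinExcess S := by
  classical
  obtain ⟨Y, hY, hmin⟩ := exists_min_image
    ((T.powerset).filter fun Y => 1 ≤ excess Y) card ⟨S, by simp [hS, h]⟩
  simp only [mem_filter, mem_powerset, and_imp] at hY hmin
  refine ⟨Y, hY.1, hY.2, fun A hA hne => ?_⟩
  by_contra! hcon
  exact hne (eq_of_subset_of_card_le hA (hmin A (hA.trans hY.1) hcon))

omit [DecidableEq V] in
theorem Triangular.mono {S T : Finset (Finset V)} (hT : Triangular T) (h : S ⊆ T) :
    Triangular S := fun t ht => hT t (h ht)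

theorem Sparse.mono {S T : Finset (Finset V)} (hT : Sparse T) (h : S ⊆ T) :
    Sparse S := fun A hA => hT A (hA.trans h)

theorem ind_mem_spn_of_triangle {t e : Finset V} {F : Finset (Finset V)} (ht : t.card = 3)
    (he : e ∈ powersetCard 2 t) (hF : (powersetCard 2 t).erase e ⊆ F) : ind e ∈ spn F := by
  have h := sum_ind_powersetCard ht
  rw [← add_sum_erase _ _ he, ← ZModModule.sub_eq_add, sub_eq_zero] at h
  rw [h]
  exact Submodule.sum_mem _ fun x hx => ind_mem_spn (hF hx)

theorem excess_empty : excess (∅ : Finset (Finset V)) = 0 := by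
  have := rk_le_card (∅ : Finset (Finset V))
  simp only [card_empty, nonpos_iff_eq_zero] at this
  simp [excess, edges, cyc, this]

theorem MinExcess.nonempty {S : Finset (Finset V)} (h : MinExcess S) : S.Nonempty := by
  rw [nonempty_iff_ne_empty]
  rintro rfl
  have := h.1
  rw [excess_empty] at this
  omega

theorem edges_erase_subset {S : Finset (Finset V)} {t e : Finset V}
    (ht : t ∈ S) (het : e ⊆ t) (hd : deg S e = 1) : edges (S.erase t) ⊆ (edges S).erase e := by
  intro x hx
  refine mem_erase.2 ⟨?_, edges_mono (erase_subset _ _) hx⟩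
  rintro rfl
  obtain ⟨s, hs, hxs, _⟩ := mem_edges.1 hx
  obtain ⟨u, hu⟩ := card_eq_one.1 hd
  have h1 : t ∈ S.filter (x ⊆ ·) := mem_filter.2 ⟨ht, het⟩
  have h2 : s ∈ S.filter (x ⊆ ·) := mem_filter.2 ⟨mem_of_mem_erase hs, hxs⟩
  rw [hu, mem_singleton] at h1 h2
  exact ne_of_mem_erase hs (h2.trans h1.symm)

/-- A triangle with a free edge could be removed without lowering the excess. -/
theorem MinExcess.isClosedFam {S : Finset (Finset V)} (hT : Triangular S) (h : MinExcess S) :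
    IsClosedFam S := by
  intro e he
  by_contra hlt
  have hd : deg S e = 1 := by have := deg_pos he; omega
  obtain ⟨t, ht, het, hce⟩ := mem_edges.1 he
  have h1 := cyc_mono (edges_erase_subset ht het hd)
  have h2 := cyc_erase_of_mem he (ind_mem_spn_of_triangle (hT t ht)
    (mem_powersetCard.2 ⟨het, hce⟩) (fun x hx => mem_erase.2 ⟨ne_of_mem_erase hx,
      mem_edges.2 ⟨t, ht, mem_powersetCard.1 (mem_of_mem_erase hx)⟩⟩))
  have h3 := h.2 (S.erase t) (erase_subset _ _) (fun hc => by
    rw [← hc] at ht; exact absurd ht (notMem_erase _ _))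
  have h4 := h.1
  have h5 := card_erase_add_one ht
  unfold excess at h3 h4
  omega

/-- The excess is additive over parts without common vertices. -/
theorem MinExcess.unsplittable {S : Finset (Finset V)} (h : MinExcess S) : Unsplittable S := by
  intro A hA hne hd
  by_contra hAS
  have h1 := h.2 A hA hAS
  have h2 := h.2 (S \ A) sdiff_subset (fun hc => by
    obtain ⟨a, ha⟩ := hne
    have := hA ha
    rw [← hc] at this
    exact (mem_sdiff.1 this).2 ha)
  have h3 := excess_union_le (P := A) (Q := S \ A) disjoint_sdiff
  have h4 : edges A ∩ edges (S \ A) = ∅ :=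
    disjoint_iff_inter_eq_empty.1 (disjoint_edges_of_disjoint_verts hd)
  rw [union_sdiff_of_subset hA, h4] at h3
  have h5 : cyc (∅ : Finset (Finset V)) ≤ 0 := by simp [cyc]
  have := h.1
  omega

theorem edges_erase_of_closed {S : Finset (Finset V)} (hc : IsClosedFam S) (t : Finset V) :
    edges (S.erase t) = edges S := by
  refine Subset.antisymm (edges_mono (erase_subset _ _)) fun e he => ?_
  have h1 := hc e he
  obtain ⟨s, hs, hst⟩ := exists_mem_ne (by exact h1 : 1 < (S.filter (e ⊆ ·)).card) t
  exact mem_edges.2 ⟨s, mem_erase.2 ⟨hst, (mem_filter.1 hs).1⟩, (mem_filter.1 hs).2,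
    card_of_mem_edges he⟩

theorem MinExcess.excess_eq {S : Finset (Finset V)} (hT : Triangular S) (h : MinExcess S) :
    excess S = 1 := by
  obtain ⟨t, ht⟩ := h.nonempty
  have h1 := edges_erase_of_closed (h.isClosedFam hT) t
  have h2 := h.2 (S.erase t) (erase_subset _ _) (fun hc => by
    rw [← hc] at ht; exact absurd ht (notMem_erase _ _))
  have h3 := h.1
  have h5 := card_erase_add_one ht
  unfold excess at *
  rw [h1] at h2
  omega

/-- The edges whose degree is not two. -/
def singularEdges (S : Finset (Finset V)) : Finset (Finset V) :=
  (edges S).filter fun e => deg S e ≠ 2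

/-- If a minimal family of positive excess properly contains a closed family, then it has exactly
three singular edges, each of degree three, and they are edges of the closed family. -/
theorem MinExcess.singularEdges_of_minClosed {S Y : Finset (Finset V)} (hT : Triangular S)
    (hs : Sparse S) (h : MinExcess S) (hYS : Y ⊆ S) (hne : Y ≠ S) (hY : MinClosed Y) :
    (∀ e ∈ edges Y, deg Y e = 2) ∧ slack Y ≤ 2 ∧ (singularEdges S).card = 3 ∧
      singularEdges S ⊆ edges Y ∧ ∀ e ∈ singularEdges S, deg S e = 3 := by
  obtain ⟨h2, -, h3⟩ := deg_eq_two_of_excess_nonpos (hT.mono hYS) (hs.mono hYS) hY.1 hY.2.1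
    hY.unsplittable (h.2 Y hYS hne)
  have hcl := h.isClosedFam hT
  have hsum := sum_deg hT (Subset.refl _) (fun e he => card_of_mem_edges he)
  have hl : 3 * S.card ≤ 2 * (edges S).card + 3 := by
    have h4 := slack_le_of_unsplittable h.unsplittable
    have h5 := hs S (Subset.refl _) h.nonempty
    rw [h.excess_eq hT] at h4
    omega
  -- the intersection with the complement carries a cycle
  have hD : 3 ≤ (edges Y ∩ edges (S \ Y)).card := by
    refine three_le_card_of_cyc_pos (fun e he => nonempty_of_mem_edges (mem_inter.1 he).1) ?_
    have h4 := excess_union_le (P := Y) (Q := S \ Y) disjoint_sdiff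
    rw [union_sdiff_of_subset hYS] at h4
    have h5 := h.2 Y hYS hne
    have h6 := h.2 (S \ Y) sdiff_subset (fun hc => by
      obtain ⟨a, ha⟩ := hY.1
      have := hYS ha
      rw [← hc] at this
      exact (mem_sdiff.1 this).2 ha)
    have := h.1
    omega
  have hsub : edges Y ∩ edges (S \ Y) ⊆ singularEdges S := by
    intro e he
    rw [mem_inter] at he
    refine mem_filter.2 ⟨edges_mono hYS he.1, ?_⟩
    have h4 := deg_sdiff_add hYS e
    have h5 := deg_pos he.2
    have h6 := h2 e he.1
    omega
  have hsum2 : ∑ e ∈ edges S, deg S e = ∑ e ∈ edges S, (deg S e - 2) + 2 * (edges S).card := by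
    rw [mul_comm, ← smul_eq_mul, ← sum_const, ← sum_add_distrib]
    exact sum_congr rfl fun e he => (Nat.sub_add_cancel (hcl e he)).symm
  have hsum3 : ∑ e ∈ singularEdges S, (deg S e - 2) ≤ 3 := by
    have : ∑ e ∈ singularEdges S, (deg S e - 2) ≤ ∑ e ∈ edges S, (deg S e - 2) :=
      sum_le_sum_of_subset (filter_subset _ _)
    omega
  have hpos : ∀ e ∈ singularEdges S, 1 ≤ deg S e - 2 := by
    intro e he
    have := mem_filter.1 he
    have h5 := hcl e this.1
    have := this.2
    omega
  have hcard : (singularEdges S).card ≤ ∑ e ∈ singularEdges S, (deg S e - 2) := by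
    rw [card_eq_sum_ones]; exact sum_le_sum hpos
  have heq : edges Y ∩ edges (S \ Y) = singularEdges S :=
    eq_of_subset_of_card_le hsub (by omega)
  refine ⟨h2, h3, by rw [heq] at hD; omega, ?_, ?_⟩
  · rw [← heq]; exact inter_subset_left
  · have h7 : ∑ e ∈ singularEdges S, 1 = ∑ e ∈ singularEdges S, (deg S e - 2) := by
      rw [← card_eq_sum_ones, ← heq]; rw [← heq] at hcard hsum3; omega
    intro e he
    have := (sum_eq_sum_iff_of_le hpos).1 h7 e he
    omega

/-- Two distinct closed families in a minimal family of positive excess meet in a family of degree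
one at all singular edges. -/
theorem MinExcess.deg_inter {S Y Y' : Finset (Finset V)} (hT : Triangular S)
    (hs : Sparse S) (h : MinExcess S) (hYS : Y ⊆ S) (hne : Y ≠ S) (hY : MinClosed Y)
    (hYS' : Y' ⊆ S) (hne' : Y' ≠ S) (hY' : MinClosed Y') (hYY : Y ≠ Y') :
    (Y ∩ Y').Nonempty ∧ (∀ e ∈ edges (Y ∩ Y'), e ∈ singularEdges S ∨ deg (Y ∩ Y') e = 2) ∧
      (∀ e ∈ singularEdges S, deg (Y ∩ Y') e = 1) ∧ slack (Y ∩ Y') ≤ 3 := by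
  obtain ⟨h1, h2, h3, h4, h5⟩ := h.singularEdges_of_minClosed hT hs hYS hne hY
  obtain ⟨h1', h2', -, h4', -⟩ := h.singularEdges_of_minClosed hT hs hYS' hne' hY'
  have hreg : ∀ e ∈ edges (Y ∩ Y'), e ∈ singularEdges S ∨ deg (Y ∩ Y') e = 2 := by
    intro e he
    by_cases hes : e ∈ singularEdges S
    · exact Or.inl hes
    · right
      have heY := edges_mono inter_subset_left he
      have heY' := edges_mono inter_subset_right he
      have hd : deg S e = 2 := by
        by_contra hd
        exact hes (mem_filter.2 ⟨edges_mono hYS heY, hd⟩)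
      have := deg_union_add_inter Y Y' e
      have hu := deg_mono (union_subset hYS hYS') e
      have := h1 e heY
      have := h1' e heY'
      have := deg_mono (inter_subset_left : Y ∩ Y' ⊆ Y) e
      omega
  have hdeg : ∀ e ∈ singularEdges S, deg (Y ∩ Y') e = 1 ∨ deg (Y ∩ Y') e = 2 := by
    intro e he
    have := deg_union_add_inter Y Y' e
    have hu := deg_mono (union_subset hYS hYS') e
    have := h1 e (h4 he)
    have := h1' e (h4' he)
    have := h5 e he
    have := deg_mono (inter_subset_left : Y ∩ Y' ⊆ Y) e
    omega
  obtain ⟨e₀, he₀⟩ : (singularEdges S).Nonempty := by rw [← card_pos]; omega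
  have hKne : (Y ∩ Y').Nonempty := by
    obtain ⟨t, ht⟩ := card_pos.1 (show 0 < deg (Y ∩ Y') e₀ by
      rcases hdeg e₀ he₀ with h | h <;> omega)
    exact ⟨t, (mem_filter.1 ht).1⟩
  have hKcl : ¬ IsClosedFam (Y ∩ Y') := fun hc =>
    hYY ((hY.2.2 _ inter_subset_left hKne hc).symm.trans (hY'.2.2 _ inter_subset_right hKne hc))
  have hodd : 3 ≤ ((edges (Y ∩ Y')).filter fun e => Odd (deg (Y ∩ Y') e)).card := by
    refine three_le_card_odd (hT.mono (inter_subset_left.trans hYS)) (filter_subset _ _) ?_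
      (fun e he => by simp [he])
    by_contra hemp
    refine hKcl fun e he => ?_
    rcases hreg e he with hes | h2
    · rcases hdeg e hes with hd | hd
      · exact (hemp ⟨e, mem_filter.2 ⟨he, by rw [hd]; exact odd_one⟩⟩).elim
      · omega
    · omega
  have hsub : (edges (Y ∩ Y')).filter (fun e => Odd (deg (Y ∩ Y') e)) ⊆ singularEdges S := by
    intro e he
    obtain ⟨he, ho⟩ := mem_filter.1 he
    rcases hreg e he with hes | h2
    · exact hes
    · rw [h2] at ho; exact absurd ho (by decide)
  have heq := eq_of_subset_of_card_le hsub (by omega)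
  refine ⟨hKne, hreg, fun e he => ?_, ?_⟩
  · rcases hdeg e he with hd | hd
    · exact hd
    · rw [← heq, mem_filter, hd] at he
      exact absurd he.2 (by decide)
  · have := slack_submodular Y Y'
    have := hs (Y ∪ Y') (union_subset hYS hYS') (hY.1.mono subset_union_left)
    omega

/-- A minimal family of positive excess has a triangle whose removal leaves no closed family. If
the family is not itself minimal closed, it contains only one proper closed family: two such would
give three surfaces bounded by the same three edges, and there are not enough vertices for that. -/
theorem MinExcess.exists_triangle {S : Finset (Finset V)} (hT : Triangular S)
    (hs : Sparse S) (h : MinExcess S) :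
    ∃ σ ∈ S, ∀ A ⊆ S.erase σ, A.Nonempty → ¬ IsClosedFam A := by
  obtain ⟨Y, hYS, hY⟩ := exists_minClosed h.nonempty (h.isClosedFam hT)
  obtain ⟨σ, hσ⟩ := hY.1
  refine ⟨σ, hYS hσ, fun A hA hAne hAc => ?_⟩
  obtain ⟨Y', hYA', hY'⟩ := exists_minClosed hAne hAc
  have hσ' : σ ∉ Y' := fun hc => notMem_erase _ _ (hA (hYA' hc))
  have hYS' : Y' ⊆ S := (hYA'.trans hA).trans (erase_subset _ _)
  have hYY : Y ≠ Y' := by rintro rfl; exact hσ' hσ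
  have hne' : Y' ≠ S := by rintro rfl; exact hσ' (hYS hσ)
  have hne : Y ≠ S := by rintro rfl; exact hYY (hY.2.2 Y' hYS' hY'.1 hY'.2.1).symm
  obtain ⟨h1, h2, h3, h4, h5⟩ := h.singularEdges_of_minClosed hT hs hYS hne hY
  obtain ⟨h1', h2', -, h4', -⟩ := h.singularEdges_of_minClosed hT hs hYS' hne' hY'
  obtain ⟨k1, k2, k3, k4⟩ := h.deg_inter hT hs hYS hne hY hYS' hne' hY' hYY
  -- the symmetric difference is closed
  have hW : IsClosedFam ((Y \ (Y ∩ Y')) ∪ (Y' \ (Y ∩ Y'))) := by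
    have hdisj : Disjoint (Y \ (Y ∩ Y')) (Y' \ (Y ∩ Y')) := by
      rw [disjoint_left]; intro t; simp only [mem_sdiff, mem_inter]; tauto
    intro e he
    have hd := deg_union_of_disjoint hdisj e
    have ha := deg_sdiff_add (inter_subset_left : Y ∩ Y' ⊆ Y) e
    have hb := deg_sdiff_add (inter_subset_right : Y ∩ Y' ⊆ Y') e
    by_cases hes : e ∈ singularEdges S
    · have := k3 e hes; have := h1 e (h4 hes); have := h1' e (h4' hes); omega
    · have hK : deg (Y ∩ Y') e = 0 ∨ deg (Y ∩ Y') e = 2 := by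
        by_cases hK : e ∈ edges (Y ∩ Y')
        · exact Or.inr ((k2 e hK).resolve_left hes)
        · left
          by_contra h0
          exact hK (mem_edges_of_deg_pos (by omega) (card_of_mem_edges he))
      have hY0 : deg Y e = 0 ∨ deg Y e = 2 := by
        by_cases hK : e ∈ edges Y
        · exact Or.inr (h1 e hK)
        · left
          by_contra h0
          exact hK (mem_edges_of_deg_pos (by omega) (card_of_mem_edges he))
      have hY0' : deg Y' e = 0 ∨ deg Y' e = 2 := by
        by_cases hK : e ∈ edges Y'
        · exact Or.inr (h1' e hK)
        · left
          by_contra h0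
          exact hK (mem_edges_of_deg_pos (by omega) (card_of_mem_edges he))
      have := deg_pos he
      omega
  obtain ⟨Y'', hYW, hY''⟩ := exists_minClosed (by
    refine ⟨σ, mem_union_left _ (mem_sdiff.2 ⟨hσ, fun hc => hσ' (mem_inter.1 hc).2⟩)⟩) hW
  obtain ⟨κ, hκ⟩ := k1
  have hdK : Disjoint Y'' (Y ∩ Y') := by
    rw [disjoint_left]; intro t ht
    have := hYW ht
    simp only [mem_union, mem_sdiff, mem_inter] at this ⊢
    tauto
  have hκ' : κ ∉ Y'' := fun hc => disjoint_left.1 hdK hc hκ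
  have hYS'' : Y'' ⊆ S := hYW.trans (union_subset (sdiff_subset.trans hYS)
    (sdiff_subset.trans hYS'))
  have hne'' : Y'' ≠ S := by rintro rfl; exact hκ' (hYS (mem_inter.1 hκ).1)
  have hYY'' : Y ≠ Y'' := by rintro rfl; exact hκ' (mem_inter.1 hκ).1
  obtain ⟨a1, a2, a3, a4⟩ := h.deg_inter hT hs hYS hne hY hYS'' hne'' hY'' hYY''
  have hdisj : Disjoint (Y ∩ Y') (Y ∩ Y'') :=
    (hdK.symm).mono_right inter_subset_right
  have hun : (Y ∩ Y') ∪ (Y ∩ Y'') = Y := by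
    refine hY.2.2 _ (union_subset inter_subset_left inter_subset_left)
      ⟨κ, mem_union_left _ hκ⟩ fun e he => ?_
    have hd := deg_union_of_disjoint hdisj e
    by_cases hes : e ∈ singularEdges S
    · have := k3 e hes; have := a3 e hes; omega
    · rw [edges_union, mem_union] at he
      rcases he with he | he
      · have := (k2 e he).resolve_left hes; omega
      · have := (a2 e he).resolve_left hes; omega
  have hslack : slack Y + 2 * ((verts (Y ∩ Y') ∩ verts (Y ∩ Y'')).card : ℤ) =
      slack (Y ∩ Y') + slack (Y ∩ Y'') := by
    have c1 := card_union_of_disjoint hdisj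
    have c2 := card_union_add_card_inter (verts (Y ∩ Y')) (verts (Y ∩ Y''))
    rw [← verts_union] at c2
    rw [hun] at c1 c2
    unfold slack
    omega
  have hcard : 3 ≤ (verts (Y ∩ Y') ∩ verts (Y ∩ Y'')).card := by
    by_contra hlt
    have hsub : singularEdges S ⊆ powersetCard 2 (verts (Y ∩ Y') ∩ verts (Y ∩ Y'')) := by
      intro e he
      have hc2 : e.card = 2 := card_of_mem_edges (h4 he)
      refine mem_powersetCard.2 ⟨subset_inter ?_ ?_, hc2⟩
      · exact subset_verts_of_mem_edges (mem_edges_of_deg_pos (k3 e he).ge hc2)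
      · exact subset_verts_of_mem_edges (mem_edges_of_deg_pos (a3 e he).ge hc2)
    have hc := card_le_card hsub
    rw [h3, card_powersetCard] at hc
    have : (verts (Y ∩ Y') ∩ verts (Y ∩ Y'')).card.choose 2 ≤ Nat.choose 2 2 :=
      Nat.choose_le_choose _ (by omega)
    rw [Nat.choose_self] at this
    omega
  have := hs Y hYS hY.1
  omega

end MinimalExcess

/-! ### Collapses -/

section Collapse

open Finset

variable {V : Type*} [DecidableEq V]

/-- `Coll R T E`: the triangles `T` can be removed one after the other, together with the edges
`E`, in such a way that each triangle is removed through an edge that lies in no other triangle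
that is still there; the triangles `R` are present all the time. The constructor `cons` adds the
triangle that is removed first. -/
inductive Coll (R : Finset (Finset V)) : Finset (Finset V) → Finset (Finset V) → Prop
  | nil : Coll R ∅ ∅
  | cons {T E : Finset (Finset V)} {t e : Finset V} : Coll R T E → t ∉ T →
      e ∈ powersetCard 2 t → e ∉ edges (T ∪ R) → Coll R (insert t T) (insert e E)

theorem Coll.subset_edges {R T E : Finset (Finset V)} (h : Coll R T E) : E ⊆ edges T := by
  induction h with
  | nil => simp
  | cons h ht he hf ih =>
    refine insert_subset ?_ (ih.trans (edges_mono (subset_insert _ _)))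
    exact mem_edges.2 ⟨_, mem_insert_self _ _, mem_powersetCard.1 he⟩

theorem Coll.disjoint_edges {R T E : Finset (Finset V)} (h : Coll R T E) :
    Disjoint E (edges R) := by
  induction h with
  | nil => simp
  | cons h ht he hf ih =>
    rw [disjoint_insert_left]
    refine ⟨fun hc => hf (edges_mono subset_union_right hc), ih⟩

theorem exists_coll {R : Finset (Finset V)} : ∀ (n : ℕ) (T : Finset (Finset V)), T.card = n →
    (∀ A ⊆ T, A.Nonempty → ∃ e ∈ edges A, deg A e = 1 ∧ e ∉ edges R) → ∃ E, Coll R T E := by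
  intro n
  induction n with
  | zero =>
    intro T hT _
    rw [card_eq_zero.1 hT]
    exact ⟨∅, Coll.nil⟩
  | succ n ih =>
    intro T hT h
    obtain ⟨e, he, hd, heR⟩ := h T (Subset.refl _) (by rw [← card_pos]; omega)
    obtain ⟨t, ht, het, hce⟩ := mem_edges.1 he
    obtain ⟨E, hE⟩ := ih (T.erase t) (by rw [card_erase_of_mem ht]; omega)
      (fun A hA => h A (hA.trans (erase_subset _ _)))
    refine ⟨insert e E, ?_⟩
    rw [← insert_erase ht]
    refine Coll.cons hE (notMem_erase _ _) (mem_powersetCard.2 ⟨het, hce⟩) ?_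
    rw [edges_union, mem_union, not_or]
    exact ⟨fun hc => notMem_erase _ _ (edges_erase_subset ht het hd hc), heR⟩

/-- Removing the edges of a collapse does not change the span of the edges, and it lowers the
cyclomatic number by the number of triangles. -/
theorem Coll.cyc_sdiff {R T E : Finset (Finset V)} (h : Coll R T E) (hT : Triangular T) :
    ∀ F : Finset (Finset V), edges T ⊆ F → spn (F \ E) = spn F ∧
      cyc F = cyc (F \ E) + T.card := by
  induction h with
  | nil => intro F _; simp
  | @cons T E t e h ht he hf ih =>
    intro F hF
    have heF : e ∈ F := hF (mem_edges.2 ⟨_, mem_insert_self _ _, mem_powersetCard.1 he⟩)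
    have hsp : ind e ∈ spn (F.erase e) := ind_mem_spn_of_triangle (hT t (mem_insert_self _ _)) he
      (erase_subset_erase _ fun x hx =>
        hF (mem_edges.2 ⟨_, mem_insert_self _ _, mem_powersetCard.1 hx⟩))
    have hFe : edges T ⊆ F.erase e := by
      intro x hx
      refine mem_erase.2 ⟨?_, hF (edges_mono (subset_insert _ _) hx)⟩
      rintro rfl
      exact hf (edges_mono subset_union_left hx)
    obtain ⟨h1, h2⟩ := ih (hT.mono (subset_insert _ _)) (F.erase e) hFe
    have h3 : F \ insert e E = F.erase e \ E := by
      ext x; simp only [mem_sdiff, mem_insert, mem_erase]; tauto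
    rw [h3, h1, spn_erase_of_mem hsp, cyc_erase_of_mem heF hsp, h2, card_insert_of_notMem ht]
    refine ⟨rfl, ?_⟩
    push_cast; ring

/-- A collapse restricts to a part that shares no edges with the rest. -/
theorem Coll.inter {R T E Y : Finset (Finset V)} (h : Coll R T E)
    (hY : Disjoint (edges Y) (edges (T \ Y))) : Coll R (T ∩ Y) (E ∩ edges Y) := by
  induction h with
  | nil => simpa using Coll.nil
  | @cons T E t e h ht he hf ih =>
    have ih' := ih (hY.mono_right (edges_mono (sdiff_subset_sdiff (subset_insert _ _)
      (Subset.refl _))))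
    by_cases htY : t ∈ Y
    · have heY : e ∈ edges Y := mem_edges.2 ⟨t, htY, mem_powersetCard.1 he⟩
      rw [insert_inter_of_mem htY, insert_inter_of_mem heY]
      refine Coll.cons ih' (fun hc => ht (mem_inter.1 hc).1) he fun hc => hf ?_
      exact edges_mono (union_subset_union_left inter_subset_left) hc
    · have heY : e ∉ edges Y := fun hc => disjoint_left.1 hY hc
        (mem_edges.2 ⟨t, mem_sdiff.2 ⟨mem_insert_self _ _, htY⟩, mem_powersetCard.1 he⟩)
      rwa [insert_inter_of_notMem htY, insert_inter_of_notMem heY]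

/-- In a complex with positive excess somewhere, there is a triangle whose boundary lies in a
family of other triangles that collapses to a tree. -/
theorem exists_triangle_collapsible {T A : Finset (Finset V)} (hT : Triangular T)
    (hs : Sparse T) (hA : A ⊆ T) (hx : 1 ≤ excess A) :
    ∃ S ⊆ T, ∃ σ ∈ S, ∃ E, Coll ∅ (S.erase σ) E ∧ edges (S.erase σ) = edges S ∧
      cyc (edges S \ E) = 0 ∧ (verts S).card = (edges S \ E).card + 1 := by
  obtain ⟨S, hST, hm⟩ := exists_minExcess hA hx
  have hTS := hT.mono hST
  obtain ⟨σ, hσ, hno⟩ := hm.exists_triangle hTS (hs.mono hST)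
  obtain ⟨E, hE⟩ := exists_coll (R := ∅) _ (S.erase σ) rfl (fun A hA hne => by
    have := hno A hA hne
    unfold IsClosedFam at this
    push Not at this
    obtain ⟨e, he, hd⟩ := this
    exact ⟨e, he, by have := deg_pos he; omega, by simp [edges]⟩)
  have hcl := hm.isClosedFam hTS
  have hedge := edges_erase_of_closed hcl σ
  obtain ⟨h1, h2⟩ := hE.cyc_sdiff (hTS.mono (erase_subset _ _)) (edges S) (edges_mono (erase_subset _ _))
  have h3 := hm.excess_eq hTS
  have h4 := card_erase_add_one hσ
  have h5 : cyc (edges S \ E) = 0 := by unfold excess at h3; omega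
  refine ⟨S, hST, σ, hσ, E, hE, hedge, h5, ?_⟩
  have h6 := card_le_rk_add_one (edges_subset_verts_and_card S) hm.unsplittable.connGraph
  have hne : (verts S).Nonempty := by
    obtain ⟨v, hv⟩ := card_pos.1 (show 0 < σ.card by rw [hTS σ hσ]; omega)
    exact ⟨v, mem_verts.2 ⟨σ, hσ, hv⟩⟩
  have h7 := rk_add_one_le hne (edges_subset_verts_and_card S)
  have h8 : rk (edges S \ E) = rk (edges S) := by unfold rk; rw [h1]
  unfold cyc at h5
  omega

end Collapse

/-! ### Integer cocycles and collapses -/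

section Cocycles

open Finset

variable {V : Type*} [DecidableEq V]

/-- An antisymmetric integer function on pairs of vertices is a cocycle on a family of triangles
if its sum over the boundary of each of them vanishes. -/
def IsCocycle (T : Finset (Finset V)) (n : V → V → ℤ) : Prop :=
  ∀ a b c, a ≠ b → a ≠ c → b ≠ c → {a, b, c} ∈ T → n a b + n b c + n c a = 0

/-- The three sums around a triangle agree up to sign. -/
theorem boundary_sum_perm {n : V → V → ℤ} (hn : ∀ u v, n v u = -n u v) {a b c x y z : V}
    (hxy : x ≠ y) (hxz : x ≠ z) (hyz : y ≠ z)
    (h : ({x, y, z} : Finset V) = {a, b, c}) :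
    n x y + n y z + n z x = n a b + n b c + n c a ∨
      n x y + n y z + n z x = -(n a b + n b c + n c a) := by
  have hx : x ∈ ({a, b, c} : Finset V) := h ▸ (by simp)
  have hy : y ∈ ({a, b, c} : Finset V) := h ▸ (by simp)
  have hz : z ∈ ({a, b, c} : Finset V) := h ▸ (by simp)
  simp only [mem_insert, mem_singleton] at hx hy hz
  have h1 := hn a b
  have h2 := hn b c
  have h3 := hn c a
  rcases hx with rfl | rfl | rfl <;> rcases hy with rfl | rfl | rfl <;>
    rcases hz with rfl | rfl | rfl <;> first | contradiction | omega

theorem pair_eq_of_mem {a b c : V} {e : Finset V} (hc : e.card = 2)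
    (he : e ⊆ {a, b, c}) : e = {a, b} ∨ e = {b, c} ∨ e = {c, a} := by
  obtain ⟨x, y, hxy, rfl⟩ := card_eq_two.1 hc
  have hx : x ∈ ({a, b, c} : Finset V) := he (by simp)
  have hy : y ∈ ({a, b, c} : Finset V) := he (by simp)
  simp only [mem_insert, mem_singleton] at hx hy
  rcases hx with rfl | rfl | rfl <;> rcases hy with rfl | rfl | rfl <;>
    first | contradiction | simp [pair_comm]

theorem pair_eq_iff {a b u v : V} :
    ({u, v} : Finset V) = {a, b} ↔ (u = a ∧ v = b) ∨ (u = b ∧ v = a) := by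
  rw [← Finset.coe_inj]
  push_cast
  exact Set.pair_eq_pair_iff

/-- Integer functions extend to cocycles along a collapse. -/
theorem Coll.exists_cocycle {R T E : Finset (Finset V)} (h : Coll R T E) (hT : Triangular T)
    (n₀ : V → V → ℤ) (hn₀ : ∀ u v, n₀ v u = -n₀ u v) :
    ∃ n : V → V → ℤ, (∀ u v, n v u = -n u v) ∧ (∀ u v, {u, v} ∉ E → n u v = n₀ u v) ∧
      IsCocycle T n := by
  induction h with
  | nil => exact ⟨n₀, hn₀, fun _ _ _ => rfl, fun a b c _ _ _ h => by simp at h⟩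
  | @cons T E t e h ht he hf ih =>
    obtain ⟨n, h1, h2, h3⟩ := ih (hT.mono (subset_insert _ _))
    rw [mem_powersetCard] at he
    obtain ⟨a, b, hab, rfl⟩ := card_eq_two.1 he.2
    obtain ⟨c, hc, hcab⟩ : ∃ c ∈ t, c ∉ ({a, b} : Finset V) := by
      by_contra! hcon
      have := card_le_card (show t ⊆ {a, b} from hcon)
      rw [he.2, hT t (mem_insert_self _ _)] at this
      omega
    have hca : c ≠ a := by rintro rfl; simp at hcab
    have hcb : c ≠ b := by rintro rfl; simp at hcab
    have htabc : t = {a, b, c} := by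
      symm
      apply eq_of_subset_of_card_le
      · intro x hx
        simp only [mem_insert, mem_singleton] at hx
        rcases hx with rfl | rfl | rfl
        · exact he.1 (by simp)
        · exact he.1 (by simp)
        · exact hc
      · rw [hT t (mem_insert_self _ _), card_eq_three.2 ⟨a, b, c, hab, hca.symm, hcb.symm, rfl⟩]
    let n' : V → V → ℤ := fun u v =>
      if u = a ∧ v = b then n a c + n c b else if u = b ∧ v = a then -(n a c + n c b) else n u v
    have hn' : ∀ u v, ({u, v} : Finset V) ≠ {a, b} → n' u v = n u v := by
      intro u v huv
      rw [Ne, pair_eq_iff, not_or] at huv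
      simp only [n']
      rw [if_neg huv.1, if_neg huv.2]
    have hanti : ∀ u v, n' v u = -n' u v := by
      intro u v
      by_cases huv : ({u, v} : Finset V) = {a, b}
      · rcases pair_eq_iff.1 huv with ⟨rfl, rfl⟩ | ⟨rfl, rfl⟩
        · simp [n', hab, hab.symm]
        · simp [n', hab]
      · rw [hn' u v huv, hn' v u (by rwa [pair_comm]), h1]
    refine ⟨n', hanti, fun u v huv => ?_, fun x y z hxy hxz hyz hm => ?_⟩
    · rw [mem_insert, not_or] at huv
      rw [hn' u v huv.1, h2 u v huv.2]
    · rcases mem_insert.1 hm with hm | hm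
      · have hz : n' a b + n' b c + n' c a = 0 := by
          rw [hn' b c, hn' c a]
          · simp only [n', and_self, if_true]
            have := h1 c a; have := h1 b c
            omega
          · rw [Ne, pair_eq_iff]; tauto
          · rw [Ne, pair_eq_iff]; tauto
        rw [htabc] at hm
        rcases boundary_sum_perm hanti hxy hxz hyz hm with h | h <;> omega
      · have key : ∀ p q, p ≠ q → p ∈ ({x, y, z} : Finset V) → q ∈ ({x, y, z} : Finset V) →
            n' p q = n p q := by
          intro p q hpq hp hq
          refine hn' p q fun hc => hf ?_
          rw [← hc]
          refine edges_mono subset_union_left (mem_edges.2 ⟨_, hm, ?_, card_pair hpq⟩)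
          intro w hw
          simp only [mem_insert, mem_singleton] at hw
          rcases hw with rfl | rfl <;> assumption
        rw [key x y hxy (by simp) (by simp), key y z hyz (by simp) (by simp),
          key z x hxz.symm (by simp) (by simp)]
        exact h3 x y z hxy hxz hyz hm

/-- In a pseudosurface, the triangles of a collapse can be given signs such that the triangles on
both sides of each edge of the collapse cancel there. -/
theorem Coll.exists_signs {R T E Y : Finset (Finset V)} (h : Coll R T E) (hTY : T ⊆ Y)
    (hd : ∀ e ∈ edges Y, deg Y e = 2) (inc : Finset V → Finset V → ℤ)
    (hinc : ∀ t e, inc t e = 1 ∨ inc t e = -1) (s₀ : Finset V → ℤ)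
    (hs₀ : ∀ t, s₀ t = 1 ∨ s₀ t = -1) :
    ∃ s : Finset V → ℤ, (∀ t, s t = 1 ∨ s t = -1) ∧ (∀ t ∉ T, s t = s₀ t) ∧
      ∀ e ∈ E, ∑ t ∈ Y.filter (e ⊆ ·), s t * inc t e = 0 := by
  induction h generalizing s₀ with
  | nil => exact ⟨s₀, hs₀, fun _ _ => rfl, by simp⟩
  | @cons T E t e h ht he hf ih =>
    rw [mem_powersetCard] at he
    have htY := hTY (mem_insert_self _ _)
    have htf : t ∈ Y.filter (e ⊆ ·) := mem_filter.2 ⟨htY, he.1⟩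
    obtain ⟨t', ht', htt'⟩ := exists_mem_ne (show 1 < (Y.filter (e ⊆ ·)).card by
      have := hd e (mem_edges.2 ⟨t, htY, he⟩)
      unfold deg at this; omega) t
    have hfil : Y.filter (e ⊆ ·) = {t, t'} := by
      symm
      apply eq_of_subset_of_card_le
      · intro x hx
        simp only [mem_insert, mem_singleton] at hx
        rcases hx with rfl | rfl <;> assumption
      · have := hd e (mem_edges.2 ⟨t, htY, he⟩)
        unfold deg at this
        rw [this, card_pair htt'.symm]
    have ht'T : t' ∉ T := fun hc => hf (mem_edges.2 ⟨t', mem_union_left _ hc,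
      (mem_filter.1 ht').2, he.2⟩)
    obtain ⟨s, h1, h2, h3⟩ := ih ((subset_insert _ _).trans hTY)
      (Function.update s₀ t (-(s₀ t' * inc t' e * inc t e))) (by
        intro u
        by_cases hu : u = t
        · subst hu
          rw [Function.update_self]
          rcases hs₀ t' with h | h <;> rcases hinc t' e with h' | h' <;>
            rcases hinc u e with h'' | h'' <;> rw [h, h', h''] <;> simp
        · rw [Function.update_of_ne hu]; exact hs₀ u)
    refine ⟨s, h1, fun u hu => ?_, fun x hx => ?_⟩
    · rw [mem_insert, not_or] at hu
      rw [h2 u hu.2, Function.update_of_ne hu.1]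
    · rcases mem_insert.1 hx with rfl | hx
      · rw [hfil, sum_pair htt'.symm, h2 t ht, h2 t' ht'T, Function.update_self,
          Function.update_of_ne htt']
        rcases hinc t x with h'' | h'' <;> rw [h''] <;> ring
      · exact h3 x hx

/-- In a pseudosurface that collapses, after the removal of a triangle `σ`, to a graph, let `n` be
a cocycle that vanishes on all but one edge of the graph and is `±1` there. Then the sum of `n`
over the boundary of `σ` is `0` or `±2`, since the exceptional edge lies in two triangles. -/
theorem Coll.boundary_sum {R Y E : Finset (Finset V)} {σ e₀ : Finset V} (h : Coll R (Y.erase σ) E)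
    (hT : Triangular Y) (hσ : σ ∈ Y) (hd : ∀ e ∈ edges Y, deg Y e = 2) {n : V → V → ℤ}
    (hn : ∀ u v, n v u = -n u v) (hco : IsCocycle (Y.erase σ) n) (he₀ : e₀ ∈ edges Y)
    (hzero : ∀ u v, {u, v} ∈ edges Y → {u, v} ∉ E → ({u, v} : Finset V) ≠ e₀ → n u v = 0)
    (hone : ∀ u v, u ≠ v → {u, v} = e₀ → n u v = 1 ∨ n u v = -1)
    {a b c : V} (hab : a ≠ b) (hac : a ≠ c) (hbc : b ≠ c) (habc : σ = {a, b, c}) :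
    n a b + n b c + n c a = 0 ∨ n a b + n b c + n c a = 2 ∨ n a b + n b c + n c a = -2 := by
  classical
  -- orientations of the edges and of the triangles
  have hp : ∀ e : Finset V, ∃ p : V × V, e.card = 2 → p.1 ≠ p.2 ∧ e = {p.1, p.2} := by
    intro e
    by_cases he : e.card = 2
    · obtain ⟨x, y, hxy, rfl⟩ := card_eq_two.1 he
      exact ⟨(x, y), fun _ => ⟨hxy, rfl⟩⟩
    · exact ⟨(a, a), fun h => absurd h he⟩
  choose p hp using hp
  have hq : ∀ t : Finset V, ∃ q : V × V × V, t.card = 3 →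
      q.1 ≠ q.2.1 ∧ q.1 ≠ q.2.2 ∧ q.2.1 ≠ q.2.2 ∧ t = {q.1, q.2.1, q.2.2} := by
    intro t
    by_cases ht : t.card = 3
    · obtain ⟨x, y, z, h1, h2, h3, rfl⟩ := card_eq_three.1 ht
      exact ⟨(x, y, z), fun _ => ⟨h1, h2, h3, rfl⟩⟩
    · exact ⟨(a, a, a), fun h => absurd h ht⟩
  choose q hq using hq
  let inc : Finset V → Finset V → ℤ := fun t e =>
    if p e = ((q t).1, (q t).2.1) ∨ p e = ((q t).2.1, (q t).2.2) ∨ p e = ((q t).2.2, (q t).1)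
    then 1 else -1
  let N : Finset V → ℤ := fun e => n (p e).1 (p e).2
  have hbd : ∀ t ∈ Y, n (q t).1 (q t).2.1 + n (q t).2.1 (q t).2.2 + n (q t).2.2 (q t).1 =
      ∑ e ∈ powersetCard 2 t, inc t e * N e := by
    intro t ht
    obtain ⟨h1, h2, h3, h4⟩ := hq t (hT t ht)
    set x := (q t).1
    set y := (q t).2.1
    set z := (q t).2.2
    have hps : powersetCard 2 t = {{x, y}, {y, z}, {z, x}} := by
      ext e
      rw [mem_powersetCard]
      simp only [mem_insert, mem_singleton]
      constructor
      · rintro ⟨he, hc⟩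
        rw [h4] at he
        exact pair_eq_of_mem hc he
      · rw [h4]
        rintro (rfl | rfl | rfl)
        · exact ⟨by intro w; simp; tauto, card_pair h1⟩
        · exact ⟨by intro w; simp; tauto, card_pair h3⟩
        · exact ⟨by intro w; simp; tauto, card_pair h2.symm⟩
    rw [hps, sum_insert, sum_pair]
    · have key : ∀ u v, u ≠ v →
          ((u, v) = (x, y) ∨ (u, v) = (y, z) ∨ (u, v) = (z, x)) →
          inc t {u, v} * N {u, v} = n u v := by
        intro u v huv hor
        obtain ⟨h5, h6⟩ := hp {u, v} (card_pair huv)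
        rcases pair_eq_iff.1 h6 with ⟨h7, h8⟩ | ⟨h7, h8⟩
        · have hpe : p {u, v} = (u, v) := Prod.ext h7.symm h8.symm
          simp only [inc, N, hpe]
          rw [if_pos hor, one_mul]
        · have hpe : p {u, v} = (v, u) := Prod.ext h8.symm h7.symm
          simp only [inc, N, hpe]
          rw [if_neg, hn]
          · ring
          · simp only [Prod.mk.injEq] at hor ⊢
            change ¬ ((v = x ∧ u = y) ∨ (v = y ∧ u = z) ∨ (v = z ∧ u = x))
            rintro (⟨rfl, rfl⟩ | ⟨rfl, rfl⟩ | ⟨rfl, rfl⟩) <;>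
            rcases hor with ⟨e1, e2⟩ | ⟨e1, e2⟩ | ⟨e1, e2⟩ <;>
            first
            | exact h1 e1
            | exact h1 e2
            | exact h2 e1
            | exact h2 e2
            | exact h3 e1
            | exact h3 e2
            | exact h1 e1.symm
            | exact h2 e1.symm
            | exact h3 e1.symm
            | exact h1 e2.symm
            | exact h2 e2.symm
            | exact h3 e2.symm
      rw [key x y h1 (by simp), key y z h3 (by simp), key z x h2.symm (by simp)]
      ring
    · rw [Ne, pair_eq_iff]; tauto
    · simp only [mem_insert, mem_singleton, pair_eq_iff]; tauto
  obtain ⟨s, hs1, -, hs3⟩ := h.exists_signs (erase_subset _ _) hd inc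
    (fun t e => by simp only [inc]; split_ifs <;> simp) (fun _ => 1) (fun _ => Or.inl rfl)
  -- evaluate the signed sum of the boundaries in two ways
  have hA : ∑ t ∈ Y, s t * ∑ e ∈ powersetCard 2 t, inc t e * N e =
      s σ * (n (q σ).1 (q σ).2.1 + n (q σ).2.1 (q σ).2.2 + n (q σ).2.2 (q σ).1) := by
    have hz : ∑ t ∈ Y.erase σ, s t * ∑ e ∈ powersetCard 2 t, inc t e * N e = 0 := by
      refine sum_eq_zero fun t ht => ?_
      have htY := mem_of_mem_erase ht
      obtain ⟨h1, h2, h3, h4⟩ := hq t (hT t htY)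
      rw [← hbd t htY, hco _ _ _ h1 h2 h3 (h4 ▸ ht), mul_zero]
    rw [← add_sum_erase _ _ hσ, hbd σ hσ, hz, add_zero]
  have hB : ∑ t ∈ Y, s t * ∑ e ∈ powersetCard 2 t, inc t e * N e =
      ∑ e ∈ edges Y, (∑ t ∈ Y.filter (e ⊆ ·), s t * inc t e) * N e := by
    have h1 : ∀ t ∈ Y, s t * ∑ e ∈ powersetCard 2 t, inc t e * N e =
        ∑ e ∈ edges Y, if e ⊆ t then s t * inc t e * N e else 0 := by
      intro t ht
      rw [← sum_filter, mul_sum]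
      refine sum_congr ?_ fun e _ => (mul_assoc _ _ _).symm
      ext e
      rw [mem_filter, mem_powersetCard, mem_edges]
      exact ⟨fun h => ⟨⟨t, ht, h⟩, h.1⟩, fun h => ⟨h.2, by obtain ⟨⟨_, _, _, h⟩, _⟩ := h; exact h⟩⟩
    rw [sum_congr rfl h1, sum_comm]
    refine sum_congr rfl fun e _ => ?_
    rw [← sum_filter, sum_mul]
  have hC : ∑ e ∈ edges Y, (∑ t ∈ Y.filter (e ⊆ ·), s t * inc t e) * N e =
      (∑ t ∈ Y.filter (e₀ ⊆ ·), s t * inc t e₀) * N e₀ := by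
    refine sum_eq_single_of_mem e₀ he₀ fun e he hne => ?_
    by_cases heE : e ∈ E
    · rw [hs3 e heE, zero_mul]
    · obtain ⟨h1, h2⟩ := hp e (card_of_mem_edges he)
      have : N e = 0 := hzero _ _ (h2 ▸ he) (h2 ▸ heE) (h2 ▸ hne)
      rw [this, mul_zero]
  obtain ⟨t₁, t₂, h12, hfil⟩ := card_eq_two.1 (show (Y.filter (e₀ ⊆ ·)).card = 2 from hd e₀ he₀)
  rw [hfil, sum_pair h12] at hC
  obtain ⟨h1, h2⟩ := hp e₀ (card_of_mem_edges he₀)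
  have hN : N e₀ = 1 ∨ N e₀ = -1 := hone _ _ h1 h2.symm
  have hi : ∀ t e, inc t e = 1 ∨ inc t e = -1 := fun t e => by
    simp only [inc]; split_ifs <;> simp
  have htot := hA.symm.trans (hB.trans hC)
  obtain ⟨k1, k2, k3, k4⟩ := hq σ (hT σ hσ)
  have hperm := boundary_sum_perm hn hab hac hbc (habc.symm.trans k4)
  generalize n (q σ).1 (q σ).2.1 + n (q σ).2.1 (q σ).2.2 + n (q σ).2.2 (q σ).1 = m at *
  generalize n a b + n b c + n c a = m' at *
  have hm : m = 0 ∨ m = 2 ∨ m = -2 := by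
    rcases hs1 σ with h | h <;> rcases hs1 t₁ with h' | h' <;> rcases hs1 t₂ with h'' | h'' <;>
    rcases hi t₁ e₀ with i1 | i1 <;> rcases hi t₂ e₀ with i2 | i2 <;> rcases hN with hN | hN <;>
    rw [h, h', h'', i1, i2, hN] at htot <;> omega
  omega

end Cocycles

/-! ### Families of nonpositive excess -/

section Structure

open Finset

variable {V : Type*} [DecidableEq V]

/-- The data that describe a sparse complex all of whose families of triangles have nonpositive
excess: the triangles `core` that survive collapsing, one triangle `cut` from each of the
pseudosurfaces that make up the core, a spanning tree, and for each edge `j` of the remaining graph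
outside of the tree an integer cocycle `coc j`, which counts the passages through `j`. -/
structure CoreData (T F : Finset (Finset V)) where
  /-- The triangles that survive collapsing. -/
  core : Finset (Finset V)
  /-- One triangle from each pseudosurface in the core. -/
  cut : Finset (Finset V)
  /-- The edges through which the triangles outside of the core are collapsed. -/
  outer : Finset (Finset V)
  /-- The edges through which the rest of the core is collapsed. -/
  inner : Finset (Finset V)
  /-- The edges of a spanning forest. -/
  tree : Finset (Finset V)
  /-- The loop edge of the pseudosurface of a triangle in `cut`. -/
  loop : Finset V → Finset V
  /-- The cocycles dual to the edges outside of the forest. -/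
  coc : Finset V → V → V → ℤ
  core_subset : core ⊆ T
  cut_subset : cut ⊆ core
  coll_outer : Coll core (T \ core) outer
  coll_inner : Coll ∅ (core \ cut) inner
  tree_subset : tree ⊆ (F \ outer) \ inner
  cyc_tree : cyc tree = 0
  spn_tree : spn tree = spn F
  loop_mem : ∀ σ ∈ cut, loop σ ∈ ((F \ outer) \ inner) \ tree
  loop_injOn : Set.InjOn loop cut
  coc_anti : ∀ j u v, coc j v u = -coc j u v
  coc_cocycle : ∀ j ∈ ((F \ outer) \ inner) \ tree, IsCocycle (core \ cut) (coc j)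
  coc_eq_zero : ∀ j ∈ ((F \ outer) \ inner) \ tree, ∀ u v, {u, v} ∈ (F \ outer) \ inner →
    ({u, v} : Finset V) ≠ j → coc j u v = 0
  coc_unit : ∀ j ∈ ((F \ outer) \ inner) \ tree, ∀ u v, u ≠ v → {u, v} = j →
    coc j u v = 1 ∨ coc j u v = -1
  coc_single : ∀ t ∈ core, ∃ j₀, ∀ j ∈ ((F \ outer) \ inner) \ tree, j ≠ j₀ →
    ∀ u ∈ t, ∀ v ∈ t, coc j u v = 0
  coc_cut : ∀ σ ∈ cut, ∀ j ∈ ((F \ outer) \ inner) \ tree, j ≠ loop σ →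
    ∀ u ∈ σ, ∀ v ∈ σ, coc j u v = 0
  coc_boundary : ∀ σ ∈ cut, ∀ a b c, a ≠ b → a ≠ c → b ≠ c → σ = {a, b, c} →
    coc (loop σ) a b + coc (loop σ) b c + coc (loop σ) c a = 0 ∨
    coc (loop σ) a b + coc (loop σ) b c + coc (loop σ) c a = 2 ∨
    coc (loop σ) a b + coc (loop σ) b c + coc (loop σ) c a = -2

/-- In a sparse complex, a family of triangles in which all degrees are two has nonnegative
excess. -/
theorem excess_nonneg_of_deg_eq_two : ∀ (n : ℕ) (C : Finset (Finset V)), C.card = n →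
    Triangular C → Sparse C → (∀ e ∈ edges C, deg C e = 2) → 0 ≤ excess C := by
  intro n
  induction n using Nat.strong_induction_on with
  | _ n ih =>
    intro C hn hT hs hd
    by_cases hu : Unsplittable C
    · rcases C.eq_empty_or_nonempty with rfl | hne
      · rw [excess_empty]
      · have h0 := hs C (Subset.refl _) hne
        have h1 := slack_le_of_unsplittable hu
        have h2 := sum_deg hT (Subset.refl _) (fun e he => card_of_mem_edges he)
        rw [sum_congr rfl hd, sum_const, smul_eq_mul] at h2
        omega
    · unfold Unsplittable at hu
      push Not at hu
      obtain ⟨A, hA, hne, hdis, hAC⟩ := hu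
      have hedis := disjoint_edges_of_disjoint_verts hdis
      have hsplit := deg_sdiff_add hA
      have hlt := card_lt_card (hA.ssubset_of_ne hAC)
      have hBlt : (C \ A).card < C.card := by
        have := card_sdiff_add_card_eq_card hA
        have := hne.card_pos
        omega
      have dA : ∀ e ∈ edges A, deg A e = 2 := by
        intro e he
        have h0 : deg (C \ A) e = 0 := by
          by_contra h0
          exact disjoint_left.1 hedis he (mem_edges_of_deg_pos (by omega) (card_of_mem_edges he))
        have := hsplit e; have := hd e (edges_mono hA he); omega
      have dB : ∀ e ∈ edges (C \ A), deg (C \ A) e = 2 := by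
        intro e he
        have h0 : deg A e = 0 := by
          by_contra h0
          exact disjoint_left.1 hedis (mem_edges_of_deg_pos (by omega) (card_of_mem_edges he)) he
        have := hsplit e; have := hd e (edges_mono sdiff_subset he); omega
      have hxA := ih _ (by omega) A rfl (hT.mono hA) (hs.mono hA) dA
      have hxB := ih _ (by omega) (C \ A) rfl (hT.mono sdiff_subset) (hs.mono sdiff_subset) dB
      have hr := rk_add_rk_le_of_disjoint hdis (fun e he => subset_verts_of_mem_edges he)
        (fun e he => subset_verts_of_mem_edges he)
      have hc := card_union_of_disjoint hedis
      have hc2 := card_sdiff_add_card_eq_card hA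
      rw [← edges_union, union_sdiff_of_subset hA] at hr hc
      unfold excess cyc at *
      omega

/-- A closed family is a union of closed unsplittable families. -/
theorem exists_unsplittable_mem {C : Finset (Finset V)} (hc : IsClosedFam C) {t : Finset V}
    (ht : t ∈ C) : ∃ A ⊆ C, t ∈ A ∧ IsClosedFam A ∧ Unsplittable A ∧
      ∀ e ∈ edges A, deg A e = deg C e := by
  classical
  obtain ⟨A, hA, hmin⟩ := exists_min_image
    ((C.powerset).filter fun A => t ∈ A ∧ Disjoint (verts A) (verts (C \ A))) card
    ⟨C, mem_filter.2 ⟨mem_powerset.2 Subset.rfl, ht, by simp [verts]⟩⟩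
  simp only [mem_filter, mem_powerset, and_imp] at hA hmin
  obtain ⟨hAC, htA, hdis⟩ := hA
  have hdeg : ∀ e ∈ edges A, deg A e = deg C e := by
    intro e he
    have h0 : deg (C \ A) e = 0 := by
      by_contra h0
      exact disjoint_left.1 (disjoint_edges_of_disjoint_verts hdis) he
        (mem_edges_of_deg_pos (by omega) (card_of_mem_edges he))
    have := deg_sdiff_add hAC e; omega
  refine ⟨A, hAC, htA, fun e he => by rw [hdeg e he]; exact hc e (edges_mono hAC he), ?_, hdeg⟩
  have key : ∀ B ⊆ A, t ∈ B → Disjoint (verts B) (verts (A \ B)) → B = A := by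
    intro B hB htB hBd
    refine eq_of_subset_of_card_le hB (hmin B (hB.trans hAC) htB ?_)
    have : C \ B = (A \ B) ∪ (C \ A) := by
      ext x; simp only [mem_sdiff, mem_union]
      have := @hB x; have := @hAC x; tauto
    rw [this, verts_union, disjoint_union_right]
    exact ⟨hBd, hdis.mono_left (verts_mono hB)⟩
  intro B hB hne hBd
  by_cases htB : t ∈ B
  · exact key B hB htB hBd
  · exfalso
    have := key (A \ B) sdiff_subset (mem_sdiff.2 ⟨htA, htB⟩) (by
      rw [Finset.sdiff_sdiff_eq_self hB]; exact hBd.symm)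
    obtain ⟨b, hb⟩ := hne
    have hbA := hB hb
    rw [← this] at hbA
    exact (mem_sdiff.1 hbA).2 hb

/-- Extend a forest to a spanning forest. -/
theorem exists_spanning_forest {T₀ G : Finset (Finset V)} (h : T₀ ⊆ G) (h0 : cyc T₀ = 0) :
    ∃ Tr, T₀ ⊆ Tr ∧ Tr ⊆ G ∧ cyc Tr = 0 ∧ spn Tr = spn G := by
  classical
  obtain ⟨Tr, hTr, hmax⟩ := exists_max_image
    ((G.powerset).filter fun A => T₀ ⊆ A ∧ cyc A = 0) card
    ⟨T₀, by simp [h, h0]⟩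
  simp only [mem_filter, mem_powerset, and_imp] at hTr hmax
  refine ⟨Tr, hTr.2.1, hTr.1, hTr.2.2, le_antisymm (spn_mono hTr.1) (Submodule.span_le.2 ?_)⟩
  rintro _ ⟨e, he, rfl⟩
  by_contra hcon
  have heTr : e ∉ Tr := fun hc => hcon (ind_mem_spn hc)
  have hlin : LinearIndepOn (ZMod 2) ind (insert e Tr : Set (Finset V)) :=
    (linearIndepOn_of_cyc hTr.2.2).insert hcon
  rw [← coe_insert] at hlin
  have := hmax (insert e Tr) (insert_subset he hTr.1) (hTr.2.1.trans (subset_insert _ _))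
    (cyc_of_linearIndepOn hlin)
  rw [card_insert_of_notMem heTr] at this
  omega

/-- The core is the largest closed family. It is the union of its minimal closed families, which are
closed pseudosurfaces without common edges, and each of these collapses to a graph with one circuit
once a triangle is cut out of it. -/
theorem exists_coreData {T F : Finset (Finset V)} (hT : Triangular T) (hs : Sparse T)
    (hx : ∀ A ⊆ T, excess A ≤ 0) (hF : edges T ⊆ F) : Nonempty (CoreData T F) := by
  classical
  -- the largest closed family
  let C : Finset (Finset V) := ((T.powerset).filter fun A => IsClosedFam A).biUnion id
  have hCT : C ⊆ T := by
    intro t ht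
    simp only [C, mem_biUnion, mem_filter, mem_powerset, id] at ht
    obtain ⟨A, ⟨hA, -⟩, htA⟩ := ht
    exact hA htA
  have hCmax : ∀ A ⊆ T, IsClosedFam A → A ⊆ C := by
    intro A hA hc t ht
    simp only [C, mem_biUnion, mem_filter, mem_powerset, id]
    exact ⟨A, ⟨hA, hc⟩, ht⟩
  have hCc : IsClosedFam C := by
    intro e he
    obtain ⟨t, ht, het, hce⟩ := mem_edges.1 he
    simp only [C, mem_biUnion, mem_filter, mem_powerset, id] at ht
    obtain ⟨A, ⟨hA, hc⟩, htA⟩ := ht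
    exact (hc e (mem_edges.2 ⟨t, htA, het, hce⟩)).trans (deg_mono (hCmax A hA hc) e)
  have hTC := hT.mono hCT
  have hsC := hs.mono hCT
  have hd : ∀ e ∈ edges C, deg C e = 2 := by
    intro e he
    obtain ⟨t, ht, het, hce⟩ := mem_edges.1 he
    obtain ⟨A, hAC, htA, hAc, hAu, hAd⟩ := exists_unsplittable_mem hCc ht
    have heA := mem_edges.2 ⟨t, htA, het, hce⟩
    rw [← hAd e heA]
    exact (deg_eq_two_of_excess_nonpos (hTC.mono hAC) (hsC.mono hAC) ⟨t, htA⟩ hAc hAu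
      (hx A (hAC.trans hCT))).1 e heA
  -- the minimal closed families
  let P : Finset (Finset (Finset V)) := (C.powerset).filter fun A => MinClosed A
  have hP : ∀ Y, Y ∈ P ↔ Y ⊆ C ∧ MinClosed Y := by
    intro Y; simp only [P, mem_filter, mem_powerset]
  have hfull : ∀ A ⊆ C, IsClosedFam A → ∀ e ∈ edges A, ∀ t ∈ C, e ⊆ t → t ∈ A := by
    intro A hA hc e he t ht het
    have h1 := hc e he
    have h2 := hd e (edges_mono hA he)
    have h3 : A.filter (e ⊆ ·) = C.filter (e ⊆ ·) :=
      eq_of_subset_of_card_le (filter_subset_filter _ hA) (by unfold deg at h1 h2; omega)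
    have : t ∈ A.filter (e ⊆ ·) := by rw [h3]; exact mem_filter.2 ⟨ht, het⟩
    exact (mem_filter.1 this).1
  have hclosed_of_full : ∀ A ⊆ C, (∀ e ∈ edges A, ∀ t ∈ C, e ⊆ t → t ∈ A) → IsClosedFam A := by
    intro A hA hf e he
    have : A.filter (e ⊆ ·) = C.filter (e ⊆ ·) := by
      refine Subset.antisymm (filter_subset_filter _ hA) fun t ht => ?_
      rw [mem_filter] at ht ⊢
      exact ⟨hf e he t ht.1 ht.2, ht.2⟩
    unfold deg
    rw [this]
    exact (hd e (edges_mono hA he)).ge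
  have hinter : ∀ A ⊆ C, ∀ B ⊆ C, IsClosedFam A → IsClosedFam B → IsClosedFam (A ∩ B) := by
    intro A hA B hB hAc hBc
    refine hclosed_of_full _ (inter_subset_left.trans hA) fun e he t ht het => mem_inter.2 ⟨?_, ?_⟩
    · exact hfull A hA hAc e (edges_mono inter_subset_left he) t ht het
    · exact hfull B hB hBc e (edges_mono inter_subset_right he) t ht het
  have hsdiff : ∀ A ⊆ C, IsClosedFam A → IsClosedFam (C \ A) := by
    intro A hA hAc
    refine hclosed_of_full _ sdiff_subset fun e he t ht het => mem_sdiff.2 ⟨ht, fun htA => ?_⟩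
    obtain ⟨s, hs, hes, hce⟩ := mem_edges.1 he
    rw [mem_sdiff] at hs
    exact hs.2 (hfull A hA hAc e (mem_edges.2 ⟨t, htA, het, hce⟩) s hs.1 hes)
  have hPeq : ∀ Y ∈ P, ∀ Y' ∈ P, (Y ∩ Y').Nonempty → Y = Y' := by
    intro Y hY Y' hY' hne
    rw [hP] at hY hY'
    have hc := hinter Y hY.1 Y' hY'.1 hY.2.2.1 hY'.2.2.1
    exact (hY.2.2.2 _ inter_subset_left hne hc).symm.trans
      (hY'.2.2.2 _ inter_subset_right hne hc)
  have hPe : ∀ Y ∈ P, ∀ Y' ∈ P, ∀ e, e ∈ edges Y → e ∈ edges Y' → Y = Y' := by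
    intro Y hY Y' hY' e he he'
    obtain ⟨t, ht, het, hce⟩ := mem_edges.1 he
    have hY2 := (hP Y').1 hY'
    exact hPeq Y hY Y' hY' ⟨t, mem_inter.2 ⟨ht, hfull Y' hY2.1 hY2.2.2.1 e he' t
      (((hP Y).1 hY).1 ht) het⟩⟩
  have hcover : ∀ t ∈ C, ∃ Y ∈ P, t ∈ Y := by
    by_contra! hcon
    obtain ⟨t, ht, htP⟩ := hcon
    have hUc : IsClosedFam (P.biUnion id) := by
      intro e he
      obtain ⟨s, hs, hes, hce⟩ := mem_edges.1 he
      obtain ⟨Y, hY, hsY⟩ := mem_biUnion.1 hs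
      exact (((hP Y).1 hY).2.2.1 e (mem_edges.2 ⟨s, hsY, hes, hce⟩)).trans
        (deg_mono (subset_biUnion_of_mem id hY) e)
    have hUC : P.biUnion id ⊆ C := by
      intro s hs
      obtain ⟨Y, hY, hsY⟩ := mem_biUnion.1 hs
      exact ((hP Y).1 hY).1 hsY
    obtain ⟨Y, hY, hYm⟩ := exists_minClosed ⟨t, mem_sdiff.2 ⟨ht, fun h => by
      obtain ⟨Y, hY, h⟩ := mem_biUnion.1 h
      exact htP Y hY h⟩⟩ (hsdiff _ hUC hUc)
    obtain ⟨y, hy⟩ := hYm.1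
    exact (mem_sdiff.1 (hY hy)).2 (mem_biUnion.2 ⟨Y, (hP Y).2 ⟨hY.trans sdiff_subset, hYm⟩, hy⟩)
  choose! own hownP hown using hcover
  have hownY : ∀ Y ∈ P, ∀ t ∈ Y, own t = Y := by
    intro Y hY t ht
    have htC := ((hP Y).1 hY).1 ht
    exact hPeq _ (hownP t htC) _ hY ⟨t, mem_inter.2 ⟨hown t htC, ht⟩⟩
  have hex : ∀ Y, ∃ t, Y ∈ P → t ∈ Y := by
    intro Y
    by_cases hY : Y ∈ P
    · obtain ⟨t, ht⟩ := ((hP Y).1 hY).2.1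
      exact ⟨t, fun _ => ht⟩
    · exact ⟨∅, fun h => absurd h hY⟩
  choose pick hpick using hex
  let cut : Finset (Finset V) := P.image pick
  have hcutC : cut ⊆ C := by
    intro t ht
    obtain ⟨Y, hY, rfl⟩ := mem_image.1 ht
    exact ((hP Y).1 hY).1 (hpick Y hY)
  have hcutY : ∀ Y ∈ P, (C \ cut) ∩ Y = Y.erase (pick Y) := by
    intro Y hY
    ext t
    simp only [mem_inter, mem_sdiff, mem_erase, cut, mem_image, not_exists, not_and]
    constructor
    · rintro ⟨⟨htC, h⟩, htY⟩
      exact ⟨fun h' => h Y hY h'.symm, htY⟩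
    · rintro ⟨hne, htY⟩
      refine ⟨⟨((hP Y).1 hY).1 htY, fun Y' hY' h => ?_⟩, htY⟩
      have : Y' = Y := (hownY Y' hY' t (h ▸ hpick Y' hY')).symm.trans (hownY Y hY t htY)
      subst this
      exact hne h.symm
  obtain ⟨E₀, hE₀⟩ := exists_coll (R := C) _ (T \ C) rfl (fun A hA hne => by
    have hAT : A ∪ C ⊆ T := union_subset (hA.trans sdiff_subset) hCT
    have hnc : ¬ IsClosedFam (A ∪ C) := fun hc => by
      obtain ⟨a, ha⟩ := hne
      exact (mem_sdiff.1 (hA ha)).2 (hCmax _ hAT hc (mem_union_left _ ha))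
    unfold IsClosedFam at hnc
    push Not at hnc
    obtain ⟨e, he, hlt⟩ := hnc
    have heC : e ∉ edges C := fun h => by
      have := hCc e h
      have := deg_mono (subset_union_right : C ⊆ A ∪ C) e
      omega
    rw [edges_union, mem_union] at he
    have heA := he.resolve_right heC
    have h1 := deg_pos heA
    have h2 := deg_mono (subset_union_left : A ⊆ A ∪ C) e
    exact ⟨e, heA, by omega, heC⟩)
  obtain ⟨E₁, hE₁⟩ := exists_coll (R := ∅) _ (C \ cut) rfl (fun A hA hne => by
    have hnc : ¬ IsClosedFam A := fun hc => by
      obtain ⟨Y, hYA, hYm⟩ := exists_minClosed hne hc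
      have hYP : Y ∈ P := (hP Y).2 ⟨(hYA.trans hA).trans sdiff_subset, hYm⟩
      exact (mem_sdiff.1 (hA (hYA (hpick Y hYP)))).2 (mem_image_of_mem _ hYP)
    unfold IsClosedFam at hnc
    push Not at hnc
    obtain ⟨e, he, hlt⟩ := hnc
    exact ⟨e, he, by have := deg_pos he; omega, by simp [edges]⟩)
  set G := (F \ E₀) \ E₁ with hG
  have hCF : edges C ⊆ F := (edges_mono hCT).trans hF
  have hGC : ∀ e ∈ edges C, e ∉ E₁ → e ∈ G := fun e he h1 =>
    mem_sdiff.2 ⟨mem_sdiff.2 ⟨hCF he, fun h => disjoint_left.1 hE₀.disjoint_edges h he⟩, h1⟩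
  -- the collapse of each pseudosurface
  have hcollY : ∀ Y ∈ P, Coll ∅ (Y.erase (pick Y)) (E₁ ∩ edges Y) := by
    intro Y hY
    rw [← hcutY Y hY]
    refine hE₁.inter ?_
    rw [disjoint_left]
    intro e he he'
    obtain ⟨t, ht, het, hce⟩ := mem_edges.1 he'
    rw [mem_sdiff] at ht
    have hY2 := (hP Y).1 hY
    exact ht.2 (hfull Y hY2.1 hY2.2.2.1 e he t (mem_sdiff.1 ht.1).1 het)
  have hFY : ∀ Y ∈ P, cyc (edges Y \ (E₁ ∩ edges Y)) = 1 := by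
    intro Y hY
    have hY2 := (hP Y).1 hY
    have h1 := ((hcollY Y hY).cyc_sdiff (hTC.mono ((erase_subset _ _).trans hY2.1)) (edges Y)
      (edges_mono (erase_subset _ _))).2
    have h2 := (deg_eq_two_of_excess_nonpos (hTC.mono hY2.1) (hsC.mono hY2.1) hY2.2.1 hY2.2.2.1
      hY2.2.unsplittable (hx Y (hY2.1.trans hCT))).2.1
    have h3 := card_erase_add_one (hpick Y hY)
    unfold excess at h2
    omega
  have hex : ∀ Y, ∃ e, Y ∈ P → e ∈ edges Y \ (E₁ ∩ edges Y) ∧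
      ind e ∈ spn ((edges Y \ (E₁ ∩ edges Y)).erase e) := by
    intro Y
    by_cases hY : Y ∈ P
    · obtain ⟨e, he⟩ := exists_mem_spn_erase (show 0 < cyc (edges Y \ (E₁ ∩ edges Y)) by
        rw [hFY Y hY]; exact one_pos)
      exact ⟨e, fun _ => he⟩
    · exact ⟨∅, fun h => absurd h hY⟩
  choose lp hlp using hex
  have hlpY : ∀ Y ∈ P, lp Y ∈ edges Y := fun Y hY => (mem_sdiff.1 (hlp Y hY).1).1
  have hlpE₁ : ∀ Y ∈ P, lp Y ∉ E₁ := fun Y hY h =>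
    (mem_sdiff.1 (hlp Y hY).1).2 (mem_inter.2 ⟨h, hlpY Y hY⟩)
  have hlpinj : Set.InjOn lp P := fun Y hY Y' hY' h =>
    hPe Y hY Y' hY' (lp Y) (hlpY Y hY) (h ▸ hlpY Y' hY')
  have hpickinj : Set.InjOn pick P := fun Y hY Y' hY' h =>
    (hownY Y hY (pick Y) (hpick Y hY)).symm.trans (hownY Y' hY' (pick Y) (h ▸ hpick Y' hY'))
  -- the forest in the core
  let T₀ : Finset (Finset V) := (edges C \ E₁) \ P.image lp
  have hT₀sp : ∀ Q ⊆ P, spn ((edges C \ E₁) \ Q.image lp) = spn (edges C \ E₁) ∧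
      cyc (edges C \ E₁) = cyc ((edges C \ E₁) \ Q.image lp) + Q.card := by
    intro Q
    induction Q using Finset.induction_on with
    | empty => intro _; simp
    | insert Y Q hYQ ih =>
      intro hQ
      obtain ⟨h1, h2⟩ := ih ((subset_insert _ _).trans hQ)
      have hYP := hQ (mem_insert_self _ _)
      have heq : (edges C \ E₁) \ (insert Y Q).image lp =
          ((edges C \ E₁) \ Q.image lp).erase (lp Y) := by
        rw [image_insert]; ext x; simp only [mem_sdiff, mem_insert, mem_erase]; tauto
      have hmem : lp Y ∈ (edges C \ E₁) \ Q.image lp := by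
        refine mem_sdiff.2 ⟨mem_sdiff.2 ⟨edges_mono ((hP Y).1 hYP).1 (hlpY Y hYP), hlpE₁ Y hYP⟩, ?_⟩
        rw [mem_image]
        rintro ⟨Y', hY', h⟩
        exact hYQ (hlpinj (hQ (mem_insert_of_mem hY')) hYP h ▸ hY')
      have hsp : ind (lp Y) ∈ spn (((edges C \ E₁) \ Q.image lp).erase (lp Y)) := by
        refine spn_mono ?_ (hlp Y hYP).2
        refine erase_subset_erase _ fun x hx => ?_
        rw [mem_sdiff, mem_inter] at hx
        refine mem_sdiff.2 ⟨mem_sdiff.2 ⟨edges_mono ((hP Y).1 hYP).1 hx.1,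
          fun h => hx.2 ⟨h, hx.1⟩⟩, ?_⟩
        rw [mem_image]
        rintro ⟨Y', hY', rfl⟩
        have := hPe Y hYP Y' (hQ (mem_insert_of_mem hY')) _ hx.1
          (hlpY Y' (hQ (mem_insert_of_mem hY')))
        exact hYQ (this ▸ hY')
      rw [heq, spn_erase_of_mem hsp, h1, h2, cyc_erase_of_mem hmem hsp, card_insert_of_notMem hYQ]
      refine ⟨rfl, ?_⟩
      push_cast; ring
  have hT₀ : cyc T₀ = 0 := by
    have h1 := (hE₁.cyc_sdiff (hTC.mono sdiff_subset) (edges C) (edges_mono sdiff_subset)).2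
    have h2 := (hT₀sp P (Subset.refl _)).2
    have h3 := excess_nonneg_of_deg_eq_two _ C rfl hTC hsC hd
    have h4 := hx C hCT
    have h5 := card_sdiff_add_card_eq_card hcutC
    have h6 : cut.card = P.card := card_image_of_injOn hpickinj
    unfold excess at h3 h4
    change cyc (edges C \ E₁) = cyc T₀ + _ at h2
    omega
  obtain ⟨Tr, hTr1, hTr2, hTr3, hTr4⟩ := exists_spanning_forest (T₀ := T₀) (G := G)
    (fun e he => by
      have := mem_sdiff.1 (mem_sdiff.1 he).1
      exact hGC e this.1 this.2) hT₀
  have hspG : spn G = spn F := by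
    rw [hG, (hE₁.cyc_sdiff (hTC.mono sdiff_subset) (F \ E₀) (fun e he =>
      mem_sdiff.2 ⟨hCF (edges_mono sdiff_subset he), fun h =>
        disjoint_left.1 hE₀.disjoint_edges h (edges_mono sdiff_subset he)⟩)).1,
      (hE₀.cyc_sdiff (hT.mono sdiff_subset) F ((edges_mono sdiff_subset).trans hF)).1]
  have hlpTr : ∀ Y ∈ P, lp Y ∉ Tr := by
    intro Y hY h
    have hsp : ind (lp Y) ∈ spn (Tr.erase (lp Y)) := by
      have h1 : ind (lp Y) ∈ spn T₀ := by
        change ind (lp Y) ∈ spn ((edges C \ E₁) \ P.image lp)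
        rw [(hT₀sp P (Subset.refl _)).1]
        exact ind_mem_spn (mem_sdiff.2 ⟨edges_mono ((hP Y).1 hY).1 (hlpY Y hY), hlpE₁ Y hY⟩)
      refine spn_mono (fun x hx => mem_erase.2 ⟨?_, hTr1 hx⟩) h1
      rintro rfl
      exact (mem_sdiff.1 hx).2 (mem_image_of_mem _ hY)
    have := cyc_erase_of_mem h hsp
    have := cyc_nonneg (Tr.erase (lp Y))
    omega
  have hlpJ : ∀ Y ∈ P, lp Y ∈ G \ Tr := fun Y hY => mem_sdiff.2
    ⟨hGC _ (edges_mono ((hP Y).1 hY).1 (hlpY Y hY)) (hlpE₁ Y hY), hlpTr Y hY⟩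
  -- an edge of the core outside of the tree is one of the loop edges
  have hJC : ∀ j ∈ G \ Tr, j ∈ edges C → ∃ Y ∈ P, j = lp Y := by
    intro j hj hjC
    rw [mem_sdiff] at hj
    by_contra! hcon
    refine hj.2 (hTr1 (mem_sdiff.2 ⟨mem_sdiff.2 ⟨hjC, (mem_sdiff.1 hj.1).2⟩, ?_⟩))
    rw [mem_image]
    rintro ⟨Y, hY, h⟩
    exact hcon Y hY h.symm
  -- the cocycles
  have hdir : ∀ j : Finset V, ∃ n : V → V → ℤ, (∀ u v, n v u = -n u v) ∧
      (∀ u v, ({u, v} : Finset V) ≠ j → n u v = 0) ∧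
      (j.card = 2 → ∀ u v, u ≠ v → {u, v} = j → n u v = 1 ∨ n u v = -1) := by
    intro j
    by_cases hj : j.card = 2
    · obtain ⟨a, b, hab, rfl⟩ := card_eq_two.1 hj
      refine ⟨fun u v => if u = a ∧ v = b then 1 else if u = b ∧ v = a then -1 else 0,
        fun u v => ?_, fun u v huv => ?_, fun _ u v _ h => ?_⟩
      · beta_reduce
        by_cases h1 : u = a ∧ v = b
        · obtain ⟨rfl, rfl⟩ := h1
          simp [hab]
        · by_cases h2 : u = b ∧ v = a
          · obtain ⟨rfl, rfl⟩ := h2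
            simp [hab.symm]
          · rw [if_neg (by tauto), if_neg (by tauto), if_neg (by tauto), if_neg (by tauto)]
            simp
      · rw [Ne, pair_eq_iff, not_or] at huv
        simp only
        rw [if_neg huv.1, if_neg huv.2]
      · simp only
        rcases pair_eq_iff.1 h with ⟨rfl, rfl⟩ | ⟨rfl, rfl⟩
        · simp
        · simp [hab.symm]
    · exact ⟨fun _ _ => 0, fun _ _ => by simp, fun _ _ _ => rfl, fun h => absurd h hj⟩
  choose dir hdir1 hdir2 hdir3 using hdir
  have hcoc : ∀ j, ∃ n : V → V → ℤ, (∀ u v, n v u = -n u v) ∧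
      (∀ u v, {u, v} ∉ E₁ → n u v = dir j u v) ∧ IsCocycle (C \ cut) n := fun j =>
    hE₁.exists_cocycle (hTC.mono sdiff_subset) (dir j) (hdir1 j)
  choose ext hext1 hext2 hext3 using hcoc
  -- cut off the cocycles of the loop edges outside of their pseudosurface
  let coc : Finset V → V → V → ℤ := fun j u v =>
    if (∃ Y ∈ P, j = lp Y) then
      (if ∃ Y ∈ P, j = lp Y ∧ {u, v} ∈ edges Y then ext j u v else 0)
    else dir j u v
  have hcocY : ∀ Y ∈ P, ∀ u v, {u, v} ∈ edges Y → coc (lp Y) u v = ext (lp Y) u v := by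
    intro Y hY u v huv
    simp only [coc]
    rw [if_pos ⟨Y, hY, rfl⟩, if_pos ⟨Y, hY, rfl, huv⟩]
  have hcocY0 : ∀ Y ∈ P, ∀ u v, {u, v} ∉ edges Y → coc (lp Y) u v = 0 := by
    intro Y hY u v huv
    simp only [coc]
    rw [if_pos ⟨Y, hY, rfl⟩, if_neg]
    rintro ⟨Y', hY', h, huv'⟩
    rw [← hlpinj hY hY' h] at huv'
    exact huv huv'
  have hcocN : ∀ j, (¬ ∃ Y ∈ P, j = lp Y) → ∀ u v, coc j u v = dir j u v := by
    intro j hj u v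
    simp only [coc]
    rw [if_neg hj]
  have hcard2 : ∀ j ∈ G \ Tr, (∃ Y ∈ P, j = lp Y) → j.card = 2 := by
    rintro j - ⟨Y, hY, rfl⟩
    exact card_of_mem_edges (hlpY Y hY)
  have hanti : ∀ j u v, coc j v u = -coc j u v := by
    intro j u v
    simp only [coc, pair_comm v u, hext1 j u v, hdir1 j u v]
    split_ifs <;> simp
  have hsingle : ∀ t ∈ C, ∀ j ∈ G \ Tr, j ≠ lp (own t) → ∀ u ∈ t, ∀ v ∈ t, coc j u v = 0 := by
    intro t ht j hj hne u hu v hv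
    by_cases huv : u = v
    · have := hanti j u v
      rw [huv] at this ⊢
      omega
    have htY := hown t ht
    have huvY : ({u, v} : Finset V) ∈ edges (own t) := by
      refine mem_edges.2 ⟨t, htY, ?_, card_pair huv⟩
      intro x hx
      simp only [mem_insert, mem_singleton] at hx
      rcases hx with rfl | rfl <;> assumption
    by_cases hjl : ∃ Y ∈ P, j = lp Y
    · obtain ⟨Y, hY, rfl⟩ := hjl
      refine hcocY0 Y hY u v fun h => hne ?_
      rw [hPe Y hY _ (hownP t ht) _ h huvY]
    · rw [hcocN j hjl]
      refine hdir2 j u v ?_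
      rintro rfl
      exact hjl (hJC _ hj (edges_mono ((hP _).1 (hownP t ht)).1 huvY))
  have hsub3 : ∀ a b c : V, ∀ t : Finset V, {a, b, c} = t →
      ({a, b} : Finset V) ⊆ t ∧ ({b, c} : Finset V) ⊆ t ∧ ({c, a} : Finset V) ⊆ t := by
    rintro a b c _ rfl
    refine ⟨?_, ?_, ?_⟩ <;> · intro w; simp; tauto
  have hcocyc : ∀ j ∈ G \ Tr, IsCocycle (C \ cut) (coc j) := by
    intro j hj a b c hab hac hbc ht
    have htC := (mem_sdiff.1 ht).1
    by_cases hjt : j = lp (own {a, b, c})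
    · have hY := hownP _ htC
      have htY := hown _ htC
      obtain ⟨s1, s2, s3⟩ := hsub3 a b c _ rfl
      rw [hjt, hcocY _ hY a b (mem_edges.2 ⟨_, htY, s1, card_pair hab⟩),
        hcocY _ hY b c (mem_edges.2 ⟨_, htY, s2, card_pair hbc⟩),
        hcocY _ hY c a (mem_edges.2 ⟨_, htY, s3, card_pair hac.symm⟩)]
      exact hext3 _ a b c hab hac hbc ht
    · rw [hsingle _ htC j hj hjt a (by simp) b (by simp),
        hsingle _ htC j hj hjt b (by simp) c (by simp),
        hsingle _ htC j hj hjt c (by simp) a (by simp)]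
      rfl
  have hzero : ∀ j ∈ G \ Tr, ∀ u v, {u, v} ∈ G → ({u, v} : Finset V) ≠ j → coc j u v = 0 := by
    intro j hj u v huv hne
    by_cases hjl : ∃ Y ∈ P, j = lp Y
    · obtain ⟨Y, hY, rfl⟩ := hjl
      by_cases huvY : {u, v} ∈ edges Y
      · rw [hcocY Y hY u v huvY, hext2 _ u v (mem_sdiff.1 huv).2, hdir2 _ u v hne]
      · exact hcocY0 Y hY u v huvY
    · rw [hcocN j hjl, hdir2 _ u v hne]
  have hunit : ∀ j ∈ G \ Tr, ∀ u v, u ≠ v → {u, v} = j → coc j u v = 1 ∨ coc j u v = -1 := by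
    intro j hj u v huv h
    have hjc : j.card = 2 := by rw [← h, card_pair huv]
    by_cases hjl : ∃ Y ∈ P, j = lp Y
    · obtain ⟨Y, hY, rfl⟩ := hjl
      rw [hcocY Y hY u v (h ▸ hlpY Y hY), hext2 _ u v (h ▸ hlpE₁ Y hY)]
      exact hdir3 _ hjc u v huv h
    · rw [hcocN j hjl]
      exact hdir3 _ hjc u v huv h
  have hcutown : ∀ σ ∈ cut, σ = pick (own σ) ∧ own σ ∈ P := by
    intro σ hσ
    obtain ⟨Y, hY, rfl⟩ := mem_image.1 hσ
    rw [hownY Y hY _ (hpick Y hY)]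
    exact ⟨rfl, hY⟩
  exact ⟨{
    core := C
    cut := cut
    outer := E₀
    inner := E₁
    tree := Tr
    loop := fun σ => lp (own σ)
    coc := coc
    core_subset := hCT
    cut_subset := hcutC
    coll_outer := hE₀
    coll_inner := hE₁
    tree_subset := hTr2
    cyc_tree := hTr3
    spn_tree := hTr4.trans hspG
    loop_mem := fun σ hσ => hlpJ _ (hcutown σ hσ).2
    loop_injOn := fun σ hσ σ' hσ' h => by
      rw [(hcutown σ hσ).1, (hcutown σ' hσ').1,
        hlpinj (hcutown σ hσ).2 (hcutown σ' hσ').2 h]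
    coc_anti := hanti
    coc_cocycle := hcocyc
    coc_eq_zero := hzero
    coc_unit := hunit
    coc_single := fun t ht => ⟨lp (own t), hsingle t ht⟩
    coc_cut := fun σ hσ => hsingle σ (hcutC hσ)
    coc_boundary := fun σ hσ a b c hab hac hbc habc => by
      obtain ⟨h1, hY⟩ := hcutown σ hσ
      have hY2 := (hP _).1 hY
      have hσY : σ ∈ own σ := hown σ (hcutC hσ)
      have hdY : ∀ e ∈ edges (own σ), deg (own σ) e = 2 := fun e he =>
        le_antisymm ((deg_mono hY2.1 e).trans (hd e (edges_mono hY2.1 he)).le) (hY2.2.2.1 e he)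
      have hc := hcollY _ hY
      rw [← h1] at hc
      refine hc.boundary_sum (hTC.mono hY2.1) hσY hdY (hanti _) ?_ (hlpY _ hY) ?_ ?_ hab hac hbc
        habc
      · intro x y z hxy hxz hyz ht
        refine hcocyc _ (hlpJ _ hY) x y z hxy hxz hyz ?_
        have := hcutY _ hY
        rw [← h1] at this
        rw [← this] at ht
        exact (mem_inter.1 ht).1
      · intro u v huv hE hne
        rw [mem_inter, not_and'] at hE
        exact hzero _ (hlpJ _ hY) u v (hGC _ (edges_mono hY2.1 huv) (hE huv)) hne
      · exact hunit _ (hlpJ _ hY) }⟩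

end Structure

/-! ### Homotopy equivalences -/

section HomotopyEquivalences

open scoped unitInterval

variable {X Y Z W : Type*} [TopologicalSpace X] [TopologicalSpace Y] [TopologicalSpace Z]
  [TopologicalSpace W]

/-- A continuous map that is a homotopy equivalence. -/
def IsHEq (f : C(X, Y)) : Prop :=
  ∃ g : C(Y, X), (g.comp f).Homotopic (.id X) ∧ (f.comp g).Homotopic (.id Y)

theorem IsHEq.nonempty {f : C(X, Y)} : IsHEq f → Nonempty (X ≃ₕ Y)
  | ⟨g, h₁, h₂⟩ => ⟨⟨f, g, h₁, h₂⟩⟩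

theorem isHEq_toFun (e : X ≃ₕ Y) : IsHEq e.toFun := ⟨e.invFun, e.left_inv, e.right_inv⟩

theorem isHEq_homeomorph (e : X ≃ₜ Y) : IsHEq (e : C(X, Y)) := isHEq_toFun e.toHomotopyEquiv

theorem isHEq_id : IsHEq (.id X) := ⟨.id X, .refl _, .refl _⟩

theorem IsHEq.congr {f f' : C(X, Y)} (hf : IsHEq f) (h : f.Homotopic f') : IsHEq f' := by
  obtain ⟨g, h₁, h₂⟩ := hf
  exact ⟨g, ((ContinuousMap.Homotopic.refl g).comp h.symm).trans h₁,
    (h.symm.comp (ContinuousMap.Homotopic.refl g)).trans h₂⟩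

theorem IsHEq.comp {g : C(Y, Z)} {f : C(X, Y)} (hg : IsHEq g) (hf : IsHEq f) :
    IsHEq (g.comp f) := by
  obtain ⟨g', h₁, h₂⟩ := hg
  obtain ⟨f', h₃, h₄⟩ := hf
  refine ⟨f'.comp g', ?_, ?_⟩
  · exact (((ContinuousMap.Homotopic.refl f').comp h₁).comp (.refl f)).trans h₃
  · exact (((ContinuousMap.Homotopic.refl g).comp h₄).comp (.refl g')).trans h₂

theorem isHEq_of_inverses {f : C(X, Y)} {l r : C(Y, X)} (hl : (l.comp f).Homotopic (.id X))
    (hr : (f.comp r).Homotopic (.id Y)) : IsHEq f := by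
  have : l.Homotopic r :=
    ((ContinuousMap.Homotopic.refl l).comp hr.symm).trans (hl.comp (.refl r))
  exact ⟨l, hl, ((ContinuousMap.Homotopic.refl f).comp this).trans hr⟩

theorem IsHEq.of_comp_right {g : C(Y, Z)} {f : C(X, Y)} (h : IsHEq (g.comp f)) (hg : IsHEq g) :
    IsHEq f := by
  obtain ⟨g', h₁, h₂⟩ := hg
  have : IsHEq (g'.comp (g.comp f)) := IsHEq.comp ⟨g, h₂, h₁⟩ h
  exact this.congr (h₁.comp (.refl f))

theorem IsHEq.of_comp_left {g : C(Y, Z)} {f : C(X, Y)} (h : IsHEq (g.comp f)) (hf : IsHEq f) :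
    IsHEq g := by
  obtain ⟨f', h₁, h₂⟩ := hf
  have : IsHEq ((g.comp f).comp f') := IsHEq.comp h ⟨f, h₂, h₁⟩
  exact this.congr ((ContinuousMap.Homotopic.refl g).comp h₂)

/-- If both `g ∘ f` and `h ∘ g` are homotopy equivalences, then so is `f`. -/
theorem isHEq_of_two_of_six {f : C(X, Y)} {g : C(Y, Z)} {h : C(Z, W)} (h₁ : IsHEq (g.comp f))
    (h₂ : IsHEq (h.comp g)) : IsHEq f := by
  obtain ⟨u, hu', hu⟩ := h₁
  obtain ⟨v, hv, -⟩ := h₂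
  exact IsHEq.of_comp_right ⟨u, hu', hu⟩ (isHEq_of_inverses (l := v.comp h) (r := f.comp u) hv hu)

/-- The inclusion of a subset is a homotopy equivalence when the ambient set deforms into the
subset, keeping the subset fixed. -/
theorem isHEq_inclusion {M : Type*} [TopologicalSpace M] {A B : Set M} (hAB : A ⊆ B)
    (H : ℝ → M → M) (hc : Continuous fun x : ℝ × M => H x.1 x.2)
    (h0 : ∀ p ∈ B, H 0 p = p) (hB : ∀ t ∈ I, ∀ p ∈ B, H t p ∈ B) (h1 : ∀ p ∈ B, H 1 p ∈ A)
    (hA : ∀ p ∈ A, ∀ t ∈ I, H t p = p) :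
    IsHEq (⟨Set.inclusion hAB, continuous_inclusion hAB⟩ : C(A, B)) := by
  refine ⟨⟨fun p => ⟨H 1 p, h1 p p.2⟩, by fun_prop⟩, ?_, ?_⟩
  · have : ((⟨fun p => ⟨H 1 p, h1 p p.2⟩, by fun_prop⟩ : C(B, A)).comp
        ⟨Set.inclusion hAB, continuous_inclusion hAB⟩) = ContinuousMap.id A := by
      ext p
      simp [hA p p.2 1 ⟨zero_le_one, le_rfl⟩]
    rw [this]
  · refine ContinuousMap.Homotopic.symm ⟨⟨⟨fun x => ⟨H x.1 x.2, hB _ x.1.2 _ x.2.2⟩, ?_⟩, ?_, ?_⟩⟩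
    · fun_prop
    · intro p; ext; simp [h0 p p.2]
    · intro p; ext; simp

end HomotopyEquivalences

/-! ### Attaching cones -/

section Attaching

open scoped unitInterval

variable {J S B B' Y : Type*} [TopologicalSpace S] [TopologicalSpace B] [TopologicalSpace B']
  [TopologicalSpace Y]

/-- The relation that glues the bottom of the `j`-th cylinder `S × I` to `B` along `f j` and
collapses its top to a point. -/
inductive AttRel (f : J → C(S, B)) : B ⊕ (Σ _ : J, S × I) → B ⊕ (Σ _ : J, S × I) → Prop
  | bottom (j : J) (s : S) : AttRel f (.inr ⟨j, s, 0⟩) (.inl (f j s))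
  | top (j : J) (s s' : S) : AttRel f (.inr ⟨j, s, 1⟩) (.inr ⟨j, s', 1⟩)

/-- The space obtained from `B` by attaching, for every `j`, the cone over `S` along `f j`. For the
circle this attaches discs, for the two-point space it attaches arcs. -/
def Att (f : J → C(S, B)) : Type _ := Quot (AttRel f)

instance (f : J → C(S, B)) : TopologicalSpace (Att f) :=
  inferInstanceAs (TopologicalSpace (Quot (AttRel f)))

instance (f : J → C(S, B)) [CompactSpace S] [CompactSpace B] [Finite J] : CompactSpace (Att f) :=
  inferInstanceAs (CompactSpace (Quot (AttRel f)))

namespace Att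

variable (f : J → C(S, B))

/-- The inclusion of the base. -/
def inl : C(B, Att f) := ⟨fun b => Quot.mk _ (.inl b), continuous_quot_mk.comp continuous_inl⟩

/-- The `j`-th cell, as a map on the cylinder. -/
def cell (j : J) : C(S × I, Att f) :=
  ⟨fun x => Quot.mk _ (.inr ⟨j, x⟩),
    continuous_quot_mk.comp (continuous_inr.comp continuous_sigmaMk)⟩

variable {f}

@[simp] theorem cell_zero (j : J) (s : S) : cell f j (s, 0) = inl f (f j s) :=
  Quot.sound (.bottom j s)

theorem cell_one (j : J) (s s' : S) : cell f j (s, 1) = cell f j (s', 1) :=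
  Quot.sound (.top j s s')

theorem cases {P : Att f → Prop} (h₁ : ∀ b, P (inl f b)) (h₂ : ∀ j s u, P (cell f j (s, u))) :
    ∀ x, P x := by
  rintro ⟨b | ⟨j, s, u⟩⟩
  exacts [h₁ b, h₂ j s u]

/-- The universal property of `Att f`. -/
def lift (g : C(B, Y)) (c : J → C(S × I, Y)) (h₀ : ∀ j s, c j (s, 0) = g (f j s))
    (h₁ : ∀ j s s', c j (s, 1) = c j (s', 1)) : C(Att f, Y) :=
  ⟨Quot.lift (Sum.elim g fun x => c x.1 x.2) (by
      rintro _ _ (⟨j, s⟩ | ⟨j, s, s'⟩)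
      exacts [h₀ j s, h₁ j s s']),
    continuous_quot_lift _ (g.continuous.sumElim (continuous_sigma fun j => (c j).continuous))⟩

@[simp] theorem lift_inl (g : C(B, Y)) (c : J → C(S × I, Y)) (h₀ h₁) (b : B) :
    lift (f := f) g c h₀ h₁ (inl f b) = g b := rfl

@[simp] theorem lift_cell (g : C(B, Y)) (c : J → C(S × I, Y)) (h₀ h₁) (j : J) (x : S × I) :
    lift (f := f) g c h₀ h₁ (cell f j x) = c j x := rfl

/-- Homotopies of maps on `Att f` are given by homotopies on the base and on the cells. -/
theorem homotopic {F G : C(Att f, Y)} (K : C(I × B, Y)) (c : J → C(I × (S × I), Y))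
    (hK₀ : ∀ b, K (0, b) = F (inl f b)) (hK₁ : ∀ b, K (1, b) = G (inl f b))
    (hc₀ : ∀ j x, c j (0, x) = F (cell f j x)) (hc₁ : ∀ j x, c j (1, x) = G (cell f j x))
    (h₀ : ∀ j t s, c j (t, (s, 0)) = K (t, f j s))
    (h₁ : ∀ j t s s', c j (t, (s, 1)) = c j (t, (s', 1))) : F.Homotopic G := by
  let L : C(Att f, C(I, Y)) := lift (K.comp .prodSwap).curry
    (fun j => ((c j).comp .prodSwap).curry) (fun j s => by ext t; simp [h₀])
    (fun j s s' => by ext t; simp [h₁ j t s s'])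
  have h : ∀ t : I, ∀ x : Att f, L.uncurry (x, t) = L x t := fun t x => rfl
  refine ⟨⟨L.uncurry.comp .prodSwap, fun x => ?_, fun x => ?_⟩⟩
  · refine cases (P := fun x => L x 0 = F x) (fun b => ?_) (fun j s u => ?_) x
    · simp [L, hK₀]
    · simp [L, hc₀]
  · refine cases (P := fun x => L x 1 = G x) (fun b => ?_) (fun j s u => ?_) x
    · simp [L, hK₁]
    · simp [L, hc₁]

/-- A collar of the `j`-th cell: the cell on `S × [0, 1]`, extended to `S × [-1, 0]` by a homotopy
in the base that ends with the attaching map. -/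
def collar (j : J) (L : C(S × I, B)) (hL : ∀ s, L (s, 1) = f j s) : C(S × ℝ, Att f) :=
  ⟨fun x => if x.2 ≤ 0 then inl f (L (x.1, Set.projIcc 0 1 zero_le_one (1 + x.2)))
      else cell f j (x.1, Set.projIcc 0 1 zero_le_one x.2), by
    refine Continuous.if_le (by fun_prop) (by fun_prop) continuous_snd continuous_const ?_
    rintro ⟨s, v⟩ (rfl : v = 0)
    simp [hL]⟩

theorem collar_of_nonpos {j : J} {L : C(S × I, B)} (hL : ∀ s, L (s, 1) = f j s) (s : S) {v : ℝ}
    (hv : v ≤ 0) :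
    collar j L hL (s, v) = inl f (L (s, Set.projIcc 0 1 zero_le_one (1 + v))) :=
  if_pos hv

theorem collar_of_nonneg {j : J} {L : C(S × I, B)} (hL : ∀ s, L (s, 1) = f j s) (s : S) {v : ℝ}
    (hv : 0 ≤ v) : collar j L hL (s, v) = cell f j (s, Set.projIcc 0 1 zero_le_one v) := by
  rcases hv.eq_or_lt with rfl | hv
  · simp [collar_of_nonpos, hL]
  · exact if_neg hv.not_ge

theorem collar_one {j : J} {L : C(S × I, B)} (hL : ∀ s, L (s, 1) = f j s) (s s' : S) :
    collar j L hL (s, 1) = collar j L hL (s', 1) := by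
  rw [collar_of_nonneg _ _ zero_le_one, collar_of_nonneg _ _ zero_le_one, Set.projIcc_right]
  exact cell_one j s s'

/-- The map induced by a map `h` of the bases that commutes with the attaching maps up to
homotopy. -/
def mapHomotopy {f : J → C(S, B)} {f' : J → C(S, B')} (h : C(B, B'))
    (L : J → C(S × I, B')) (h₀ : ∀ j s, L j (s, 0) = h (f j s))
    (h₁ : ∀ j s, L j (s, 1) = f' j s) : C(Att f, Att f') :=
  lift ((inl f').comp h)
    (fun j => ⟨fun x => collar j (L j) (h₁ j) (x.1, 2 * x.2 - 1), by fun_prop⟩)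
    (fun j s => by simp [collar_of_nonpos, h₀])
    (fun j s s' => by
      have : (2 * ((1 : I) : ℝ) - 1) = 1 := by norm_num
      simp only [ContinuousMap.coe_mk, this]
      exact collar_one _ s s')

/-- The map induced by a map of the bases. -/
def map (f : J → C(S, B)) (h : C(B, B')) : C(Att f, Att fun j => h.comp (f j)) :=
  lift ((inl _).comp h) (cell _) (fun j s => by simp) (fun j s s' => cell_one j s s')

/-- Homotopic attaching maps give homotopy equivalent spaces: one half of the claim. -/
theorem mapHomotopy_comp {f f' : J → C(S, B)} (L L' : J → C(S × I, B))
    (h₀ : ∀ j s, L j (s, 0) = f j s) (h₁ : ∀ j s, L j (s, 1) = f' j s)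
    (h₀' : ∀ j s, L' j (s, 0) = f' j s) (h₁' : ∀ j s, L' j (s, 1) = f j s)
    (hL : ∀ j s u, L' j (s, u) = L j (s, σ u)) :
    ((mapHomotopy (f := f') (.id B) L' h₀' h₁').comp
      (mapHomotopy (f := f) (.id B) L h₀ h₁)).Homotopic (.id _) := by
  -- On a cell the composite runs through the collar from `0` to `-1`, then from `-1` to `1`.
  let C : ∀ j, C(S × ℝ, Att f) := fun j => collar j (L' j) (h₁' j)
  refine homotopic ⟨fun x => inl f x.2, by fun_prop⟩
    (fun j => ⟨fun x => C j (x.2.1, (1 - (x.1 : ℝ)) * max (-2 * (x.2.2 : ℝ))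
      (4 * (x.2.2 : ℝ) - 3) + (x.1 : ℝ) * x.2.2), by fun_prop⟩) (fun b => rfl) (fun b => rfl) ?_ ?_ ?_ ?_
  · rintro j ⟨s, u⟩
    have hu0 := u.2.1
    have hu1 := u.2.2
    simp only [ContinuousMap.coe_mk, Set.Icc.coe_zero, sub_zero, one_mul, zero_mul, add_zero,
      ContinuousMap.comp_apply]
    change _ = mapHomotopy (.id B) L' h₀' h₁' (collar j (L j) (h₁ j) (s, 2 * (u : ℝ) - 1))
    rcases le_total (u : ℝ) (1 / 2) with h | h
    · rw [collar_of_nonpos (h₁ j) s (by linarith), max_eq_left (by linarith)]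
      refine (collar_of_nonpos (h₁' j) s (by linarith)).trans ?_
      rw [hL]
      have : σ (Set.projIcc 0 1 zero_le_one (1 + -2 * (u : ℝ))) =
          Set.projIcc 0 1 zero_le_one (1 + (2 * (u : ℝ) - 1)) := by
        rw [Set.projIcc_of_mem (x := 1 + -2 * (u : ℝ)) zero_le_one ⟨by linarith, by linarith⟩,
          Set.projIcc_of_mem (x := 1 + (2 * (u : ℝ) - 1)) zero_le_one
            ⟨by linarith, by linarith⟩]
        ext; simp
      rw [this]
      rfl
    · rw [collar_of_nonneg (h₁ j) s (by linarith), max_eq_right (by linarith),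
        Set.projIcc_of_mem (x := 2 * (u : ℝ) - 1) zero_le_one ⟨by linarith, by linarith⟩]
      change C j _ = C j _
      congr 2
      simp only
      ring
  · rintro j ⟨s, u⟩
    simp only [ContinuousMap.coe_mk, Set.Icc.coe_one, sub_self, one_mul, zero_mul, zero_add, C]
    rw [collar_of_nonneg _ _ u.2.1]
    simp
  · intro j t s
    have : (1 - (t : ℝ)) * max (-2 * ((0 : I) : ℝ)) (4 * ((0 : I) : ℝ) - 3) + t * ((0 : I) : ℝ)
        = 0 := by norm_num
    simp only [ContinuousMap.coe_mk, this, C]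
    rw [collar_of_nonneg _ _ le_rfl]
    simp
  · intro j t s s'
    have : (1 - (t : ℝ)) * max (-2 * ((1 : I) : ℝ)) (4 * ((1 : I) : ℝ) - 3) + t * ((1 : I) : ℝ)
        = 1 := by norm_num
    simp only [ContinuousMap.coe_mk, this, C]
    exact collar_one _ s s'

/-- The two ends of a homotopy of attaching maps give homotopy equivalent spaces. -/
theorem isHEq_mapHomotopy {f f' : J → C(S, B)} (L : J → C(S × I, B))
    (h₀ : ∀ j s, L j (s, 0) = f j s) (h₁ : ∀ j s, L j (s, 1) = f' j s) :
    IsHEq (mapHomotopy (f := f) (.id B) L h₀ h₁) := by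
  let L' : J → C(S × I, B) := fun j => ⟨fun x => L j (x.1, σ x.2), by fun_prop⟩
  exact ⟨mapHomotopy (.id B) L' (fun j s => by simp [L', h₁]) (fun j s => by simp [L', h₀]),
    mapHomotopy_comp L L' _ _ _ _ fun _ _ _ => rfl,
    mapHomotopy_comp L' L _ _ _ _ fun _ _ _ => by simp [L']⟩

/-- Homotopic attaching maps give homotopy equivalent spaces. -/
theorem nonempty_homotopyEquiv {f f' : J → C(S, B)} (h : ∀ j, (f j).Homotopic (f' j)) :
    Nonempty (Att f ≃ₕ Att f') :=
  (isHEq_mapHomotopy (f := f) (f' := f')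
    (fun j => ((h j).some : C(I × S, B)).comp .prodSwap) (fun j s => by simp)
    (fun j s => by simp)).nonempty

/-- Up to homotopy a map of bases homotopic to the identity induces a homotopy equivalence. -/
theorem isHEq_map_of_homotopic_id (f : J → C(S, B)) {k : C(B, B)} (hk : k.Homotopic (.id B)) :
    IsHEq (map f k) := by
  obtain ⟨K⟩ := hk.symm
  let L : J → C(S × I, B) := fun j => ⟨fun x => K (x.2, f j x.1), by fun_prop⟩
  have h₁ : ∀ j s, L j (s, 1) = k.comp (f j) s := fun j s => by simp [L]
  refine (isHEq_mapHomotopy (f := f) (f' := fun j => k.comp (f j)) L (fun j s => by simp [L])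
    h₁).congr ?_
  refine homotopic ⟨fun x => inl _ (K x), by fun_prop⟩
    (fun j => ⟨fun x => collar j (L j) (h₁ j)
      (x.2.1, (1 - (x.1 : ℝ)) * (2 * x.2.2 - 1) + x.1 * x.2.2), by fun_prop⟩) ?_ ?_ ?_ ?_ ?_ ?_
  · intro b
    simp [mapHomotopy]
  · intro b
    simp [map]
  · rintro j ⟨s, u⟩
    simp [mapHomotopy]
  · rintro j ⟨s, u⟩
    simp only [ContinuousMap.coe_mk, Set.Icc.coe_one, sub_self, one_mul, zero_mul, zero_add]
    rw [collar_of_nonneg _ _ u.2.1, map, lift_cell]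
    simp
  · intro j t s
    have ht := t.2.2
    simp only [ContinuousMap.coe_mk, Set.Icc.coe_zero, mul_zero, add_zero, zero_sub]
    rw [collar_of_nonpos _ _ (by linarith)]
    have : Set.projIcc 0 1 zero_le_one (1 + (1 - (t : ℝ)) * -1) = t := by
      rw [Set.projIcc_of_mem zero_le_one ⟨by linarith [t.2.1], by linarith⟩]
      ext; simp
    rw [this]
    rfl
  · intro j t s s'
    have : (1 - (t : ℝ)) * (2 * ((1 : I) : ℝ) - 1) + t * ((1 : I) : ℝ) = 1 := by
      simp only [Set.Icc.coe_one]; ring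
    simp only [ContinuousMap.coe_mk, this]
    exact collar_one _ s s'

/-- A homotopy equivalence of the bases induces a homotopy equivalence. -/
theorem isHEq_map (f : J → C(S, B)) {h : C(B, B')} (hh : IsHEq h) : IsHEq (map f h) := by
  obtain ⟨h', h₁, h₂⟩ := hh
  let f₁ : J → C(S, B') := fun j => h.comp (f j)
  let f₂ : J → C(S, B) := fun j => h'.comp (f₁ j)
  have e₁ : (map f₁ h').comp (map f h) = map f (h'.comp h) := by
    ext x
    exact cases (P := fun x => (map f₁ h').comp (map f h) x = map f (h'.comp h) x)
      (fun _ => rfl) (fun _ _ _ => rfl) x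
  have e₂ : (map f₂ h).comp (map f₁ h') = map f₁ (h.comp h') := by
    ext x
    exact cases (P := fun x => (map f₂ h).comp (map f₁ h') x = map f₁ (h.comp h') x)
      (fun _ => rfl) (fun _ _ _ => rfl) x
  refine isHEq_of_two_of_six (g := map f₁ h') (h := map f₂ h) ?_ ?_
  · rw [e₁]; exact isHEq_map_of_homotopic_id f h₁
  · rw [e₂]; exact isHEq_map_of_homotopic_id f₁ h₂

end Att

end Attaching

/-! ### Geometric realizations and collapses -/

section Realizations

open Finset

variable {V : Type*}

/-- The geometric realization of a family of faces, in barycentric coordinates. The family need not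
be closed under passing to subsets. -/
def geom (K : Set (Finset V)) : Set (V → ℝ) :=
  {p | ∃ s ∈ K, (∀ v, 0 ≤ p v) ∧ (∀ v, v ∉ s → p v = 0) ∧ ∑ v ∈ s, p v = 1}

theorem geom_mono {K L : Set (Finset V)} (h : K ⊆ L) : geom K ⊆ geom L := by
  rintro p ⟨s, hs, hp⟩
  exact ⟨s, h hs, hp⟩

/-- The inclusion of realizations. -/
def geomIncl {K L : Set (Finset V)} (h : K ⊆ L) : C(geom K, geom L) :=
  ⟨Set.inclusion (geom_mono h), continuous_inclusion _⟩

theorem geom_insert (K : Set (Finset V)) (s : Finset V) :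
    geom (insert s K) = geom {s} ∪ geom K := by
  ext p
  simp [geom]

theorem isCompact_geom_singleton (s : Finset V) : IsCompact (geom {s}) := by
  have h : geom {s} ⊆ Set.pi Set.univ fun _ => Set.Icc (0 : ℝ) 1 := by
    rintro p ⟨s, rfl, h0, h1, h2⟩ v -
    refine ⟨h0 v, ?_⟩
    by_cases hv : v ∈ s
    · rw [← h2]; exact single_le_sum (fun w _ => h0 w) hv
    · rw [h1 v hv]; exact zero_le_one
  refine (isCompact_univ_pi fun _ => isCompact_Icc).of_isClosed_subset ?_ h
  have : geom {s} = (⋂ v, {p : V → ℝ | 0 ≤ p v}) ∩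
      (⋂ v, ⋂ (_ : v ∉ s), {p : V → ℝ | p v = 0}) ∩ {p | ∑ v ∈ s, p v = 1} := by
    ext p; simp [geom, and_assoc]
  rw [this]
  refine ((isClosed_iInter fun v => isClosed_le continuous_const (continuous_apply v)).inter
    (isClosed_iInter fun v => isClosed_iInter fun _ =>
      isClosed_eq (continuous_apply v) continuous_const)).inter
    (isClosed_eq (by fun_prop) continuous_const)

theorem isCompact_geom {K : Set (Finset V)} (hK : K.Finite) : IsCompact (geom K) := by
  induction K, hK using Set.Finite.induction_on with
  | empty => simp [geom]
  | insert _ _ ih => rw [geom_insert]; exact (isCompact_geom_singleton _).union ih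

/-- Elementary collapse: if `s` is a proper face only of `insert c s`, then the realization deforms
onto the part without these two faces. -/
theorem isHEq_elementary_collapse [DecidableEq V] {K K' : Set (Finset V)} {s : Finset V} {c : V}
    (hs : s.Nonempty) (hc : c ∉ s) (hτ : insert c s ∈ K)
    (hK : ∀ x ∈ K, s ⊆ x → x = s ∨ x = insert c s)
    (hcl : ∀ v ∈ s, (insert c s).erase v ∈ K) (hK' : K' = K \ {s, insert c s}) (hle : K' ⊆ K) :
    IsHEq (geomIncl hle) := by
  subst hK'
  -- Move mass from `s` to `c` at the rate of the least coordinate over `s`.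
  let m : (V → ℝ) → ℝ := fun p => s.inf' hs fun v => p v
  have hm : Continuous m := Continuous.finset_inf'_apply hs fun v _ => continuous_apply v
  let w : V → ℝ := fun v => if v ∈ s then 1 else if v = c then -(s.card : ℝ) else 0
  let H : ℝ → (V → ℝ) → V → ℝ := fun t p v => p v - t * m p * w v
  have hm0 : ∀ p ∈ geom K, p ∉ geom ({s, insert c s} : Set (Finset V)) → m p = 0 := by
    rintro p ⟨x, hx, h0, h1, h2⟩ hp
    have hsx : ¬ s ⊆ x := fun h => hp ⟨x, by
      rcases hK x hx h with rfl | rfl <;> simp, h0, h1, h2⟩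
    obtain ⟨v, hv, hvx⟩ := not_subset.1 hsx
    refine le_antisymm ((inf'_le _ hv).trans_eq (h1 v hvx)) (le_inf' _ _ fun v _ => h0 v)
  have hm0' : ∀ p ∈ geom (K \ {s, insert c s}), m p = 0 := by
    rintro p ⟨x, ⟨hx, hx'⟩, h0, h1, h2⟩
    have hsx : ¬ s ⊆ x := fun h => hx' (by rcases hK x hx h with rfl | rfl <;> simp)
    obtain ⟨v, hv, hvx⟩ := not_subset.1 hsx
    refine le_antisymm ((inf'_le _ hv).trans_eq (h1 v hvx)) (le_inf' _ _ fun v _ => h0 v)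
  have hH0 : ∀ t p, m p = 0 → H t p = p := fun t p h => by ext v; simp [H, h]
  have hmem : ∀ p ∈ geom ({s, insert c s} : Set (Finset V)), p ∈ geom {insert c s} := by
    rintro p ⟨x, rfl | rfl, h0, h1, h2⟩
    · refine ⟨insert c x, rfl, h0, fun v hv => h1 v fun h => hv (mem_insert_of_mem h), ?_⟩
      rw [sum_insert hc, h1 c hc, h2, zero_add]
    · exact ⟨_, rfl, h0, h1, h2⟩
  have hHτ : ∀ t ∈ unitInterval, ∀ p ∈ geom {insert c s}, H t p ∈ geom {insert c s} := by
    rintro t ht p ⟨_, rfl, h0, h1, h2⟩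
    have hm1 : 0 ≤ m p := le_inf' _ _ fun v _ => h0 v
    refine ⟨_, rfl, fun v => ?_, fun v hv => ?_, ?_⟩
    · by_cases hv : v ∈ s
      · have : m p ≤ p v := inf'_le _ hv
        simp only [H, w, if_pos hv, mul_one]
        nlinarith [ht.1, ht.2]
      · by_cases hvc : v = c
        · simp only [H, w, if_neg hv, if_pos hvc]
          have := mul_nonneg (mul_nonneg ht.1 hm1) (Nat.cast_nonneg (α := ℝ) s.card)
          linarith [h0 v]
        · simpa only [H, w, if_neg hv, if_neg hvc, mul_zero, sub_zero] using h0 v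
    · rw [mem_insert, not_or] at hv
      simp only [H, w, if_neg hv.2, if_neg hv.1, mul_zero, sub_zero]
      exact h1 v (by simp [hv])
    · have hw : ∑ v ∈ insert c s, w v = 0 := by
        rw [sum_insert hc, sum_congr rfl (fun v hv => show w v = 1 from if_pos hv)]
        simp [w, hc]
      simp only [H]
      rw [sum_sub_distrib, ← mul_sum, hw, h2, mul_zero, sub_zero]
  have hKτ : geom {insert c s} ⊆ geom K := geom_mono (Set.singleton_subset_iff.2 hτ)
  refine isHEq_inclusion (geom_mono hle) H ?_ (fun p _ => by ext v; simp [H]) ?_ ?_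
    fun p hp t _ => hH0 t p (hm0' p hp)
  · refine continuous_pi fun v => ?_
    simp only [H]
    fun_prop
  · intro t ht p hp
    by_cases h : p ∈ geom ({s, insert c s} : Set (Finset V))
    · exact hKτ (hHτ t ht p (hmem p h))
    · rwa [hH0 t p (hm0 p hp h)]
  · intro p hp
    by_cases h : p ∈ geom ({s, insert c s} : Set (Finset V))
    · obtain ⟨_, rfl, h0, h1, h2⟩ := hHτ 1 ⟨zero_le_one, le_rfl⟩ p (hmem p h)
      obtain ⟨v, hv, hpv⟩ := exists_mem_eq_inf' hs fun v => p v
      have hv0 : H 1 p v = 0 := by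
        simp only [H, w, if_pos hv, one_mul, mul_one]
        exact sub_eq_zero.2 hpv.symm
      refine ⟨(insert c s).erase v, ⟨hcl v hv, ?_⟩, h0, fun u hu => ?_, ?_⟩
      · rintro (h | h)
        · have : c ∈ (insert c s).erase v :=
            mem_erase.2 ⟨fun h => hc (h ▸ hv), mem_insert_self _ _⟩
          rw [h] at this; exact hc this
        · have := mem_insert_of_mem (a := v) (b := c) hv
          rw [← h] at this; exact notMem_erase _ _ this
      · by_cases huv : u = v
        · rw [huv, hv0]
        · exact h1 u fun h => hu (mem_erase.2 ⟨huv, h⟩)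
      · rwa [← add_sum_erase _ _ (mem_insert_of_mem (a := v) (b := c) hv), hv0, zero_add] at h2
    · rw [hH0 1 p (hm0 p hp h)]
      obtain ⟨x, hx, hpx⟩ := hp
      exact ⟨x, ⟨hx, fun hx' => h ⟨x, hx', hpx⟩⟩, hpx⟩

/-- The faces of the complex with vertices `U`, edges `F` and triangles `T`. -/
def fc (U : Finset V) (F T : Finset (Finset V)) : Set (Finset V) :=
  {s | (∃ v ∈ U, s = {v}) ∨ s ∈ F ∨ s ∈ T}

theorem fc_mono {U U' : Finset V} {F F' T T' : Finset (Finset V)} (hU : U ⊆ U') (hF : F ⊆ F')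
    (hT : T ⊆ T') : fc U F T ⊆ fc U' F' T' := by
  rintro s (⟨v, hv, rfl⟩ | h | h)
  exacts [Or.inl ⟨v, hU hv, rfl⟩, Or.inr (Or.inl (hF h)), Or.inr (Or.inr (hT h))]

variable [DecidableEq V]

/-- Removing collapsible triangles does not change the homotopy type. -/
theorem Coll.isHEq {R T E : Finset (Finset V)} (h : Coll R T E) : ∀ {K : Set (Finset V)},
    Triangular T → (∀ t ∈ T, t ∈ K) → (∀ e ∈ edges T, e ∈ K) →
    (∀ e ∈ E, ∀ x ∈ K, e ⊆ x → x = e ∨ x ∈ T) → ∀ {K' : Set (Finset V)},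
    K' = K \ (T ∪ E) → ∀ hle : K' ⊆ K, IsHEq (geomIncl hle) := by
  induction h with
  | nil =>
    intro K _ _ _ _ K' hK' hle
    have : K' = K := by simp [hK']
    subst this
    exact isHEq_id
  | @cons T E t e hTE htT he hef ih =>
    intro K hT hTK hEK hfree K' hK' hle
    have ht3 := hT t (mem_insert_self _ _)
    rw [mem_powersetCard] at he
    obtain ⟨c, hc⟩ : ∃ c, t \ e = {c} := card_eq_one.1 (by
      rw [card_sdiff_of_subset he.1]; omega)
    have hcm : c ∈ t \ e := hc ▸ mem_singleton_self c
    have hce : c ∉ e := (mem_sdiff.1 hcm).2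
    have hte : insert c e = t := by
      rw [insert_eq, ← hc]; exact sdiff_union_of_subset he.1
    have hEe : ∀ x ∈ edges T, x ≠ e := by
      rintro x hx rfl
      exact hef (edges_mono subset_union_left hx)
    have hcard : ∀ x ∈ edges T, x ∈ edges (insert t T) := fun x hx =>
      edges_mono (subset_insert _ _) hx
    have hedge : ∀ x ⊆ t, x.card = 2 → x ∈ K := fun x hx hx2 =>
      hEK x (mem_edges.2 ⟨t, mem_insert_self _ _, hx, hx2⟩)
    have h1 : IsHEq (geomIncl (K := K \ {e, insert c e}) (L := K) Set.sdiff_subset) := by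
      refine isHEq_elementary_collapse (card_pos.1 (by omega)) hce
        (hte ▸ hTK t (mem_insert_self _ _)) (fun x hx hex => ?_) (fun v hv => ?_) rfl _
      · rw [hte]
        rcases hfree e (mem_insert_self _ _) x hx hex with h | h
        · exact Or.inl h
        · rcases mem_insert.1 h with h | h
          · exact Or.inr h
          · exact absurd rfl (hEe e (mem_edges.2 ⟨x, h, hex, he.2⟩))
      · rw [hte]
        exact hedge _ (erase_subset _ _) (by
          rw [card_erase_of_mem (he.1 hv)]; omega)
    have h2 : K' ⊆ K \ {e, insert c e} := by
      rw [hK', hte]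
      intro x hx
      refine ⟨hx.1, fun h => hx.2 ?_⟩
      rcases h with rfl | rfl <;> simp
    refine h1.comp (ih (K := K \ {e, insert c e}) (K' := K') (hT.mono (subset_insert _ _))
      (fun x hx => ?_) (fun x hx => ?_) (fun x hx y hy hxy => ?_) ?_ h2)
    · refine ⟨hTK x (mem_insert_of_mem hx), ?_⟩
      rw [hte]
      rintro (rfl | rfl)
      · have := hT x (mem_insert_of_mem hx); omega
      · exact htT hx
    · refine ⟨hEK x (hcard x hx), ?_⟩
      rw [hte]
      rintro (rfl | rfl)
      · exact hEe x hx rfl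
      · have := card_of_mem_edges hx; omega
    · rw [hte] at hy
      rcases hfree x (mem_insert_of_mem hx) y hy.1 hxy with h | h
      · exact Or.inl h
      · exact Or.inr ((mem_insert.1 h).resolve_left fun h => hy.2 (Or.inr h))
    · rw [hK', hte]
      ext x
      simp only [Set.mem_sdiff, Set.mem_union, mem_coe, mem_insert, Set.mem_insert_iff,
        Set.mem_singleton_iff]
      tauto

theorem finite_fc (U : Finset V) (F T : Finset (Finset V)) : (fc U F T).Finite := by
  refine ((U.image singleton ∪ F ∪ T).finite_toSet).subset fun s hs => ?_
  rcases hs with ⟨v, hv, rfl⟩ | h | h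
  · simp [hv]
  · simp [h]
  · simp [h]

instance (U : Finset V) (F T : Finset (Finset V)) : CompactSpace (geom (fc U F T)) :=
  isCompact_iff_compactSpace.1 (isCompact_geom (finite_fc U F T))

/-- The realization of a tree is contractible. -/
theorem contractibleSpace_tree : ∀ (n : ℕ) (U : Finset V) (F : Finset (Finset V)), F.card = n →
    U.card = n + 1 → (∀ e ∈ F, e ⊆ U ∧ e.card = 2) → cyc F = 0 →
    ContractibleSpace (geom (fc U F ∅)) := by
  intro n
  induction n with
  | zero =>
    intro U F hF hU _ _
    rw [card_eq_zero] at hF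
    obtain ⟨v, rfl⟩ := card_eq_one.1 hU
    subst hF
    have hmem : ∀ p : V → ℝ, p ∈ geom (fc {v} ∅ ∅) ↔ p = Pi.single v 1 := by
      intro p
      constructor
      · rintro ⟨s, hs, h0, h1, h2⟩
        have : s = {v} := by simpa [fc] using hs
        subst this
        ext u
        by_cases hu : u = v
        · subst hu; simpa using h2
        · rw [h1 u (by simpa using hu), Pi.single_eq_of_ne hu]
      · rintro rfl
        refine ⟨{v}, Or.inl ⟨v, by simp, rfl⟩, fun u => ?_, fun u hu => ?_, by simp⟩
        · by_cases hu : u = v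
          · subst hu; simp
          · simp [Pi.single_eq_of_ne hu]
        · exact Pi.single_eq_of_ne (by simpa using hu) _
    have : Unique (geom (fc {v} ∅ ∅)) :=
      { default := ⟨_, (hmem _).2 rfl⟩
        uniq := fun p => Subtype.ext ((hmem p).1 p.2) }
    infer_instance
  | succ n ih =>
    intro U F hF hU hFU hcyc
    have hrk : rk F = n + 1 := by unfold cyc at hcyc; omega
    -- a leaf
    obtain ⟨v, hv, hdv⟩ : ∃ v ∈ U, (F.filter (v ∈ ·)).card ≤ 1 := by
      by_contra! hcon
      have h1 : ∑ v ∈ U, (F.filter (v ∈ ·)).card = ∑ e ∈ F, (U.filter (· ∈ e)).card := by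
        simp only [card_filter]
        exact sum_comm
      have h2 : ∑ e ∈ F, (U.filter (· ∈ e)).card = ∑ e ∈ F, 2 := by
        refine sum_congr rfl fun e he => ?_
        rw [filter_mem_eq_inter, inter_eq_right.2 (hFU e he).1, (hFU e he).2]
      have h3 : ∑ v ∈ U, 2 ≤ ∑ v ∈ U, (F.filter (v ∈ ·)).card := sum_le_sum hcon
      simp only [sum_const, smul_eq_mul] at h2 h3
      omega
    have hne : (U.erase v).Nonempty := by
      rw [← card_pos, card_erase_of_mem hv]; omega
    have hd1 : (F.filter (v ∈ ·)).card = 1 := by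
      by_contra h
      have h0 : F.filter (v ∈ ·) = ∅ := card_eq_zero.1 (by omega)
      have := rk_add_one_le hne (E := F) fun e he => ⟨fun u hu => mem_erase.2 ⟨?_, (hFU e he).1 hu⟩,
        (hFU e he).2⟩
      · rw [card_erase_of_mem hv] at this; omega
      · rintro rfl
        exact (h0 ▸ notMem_empty e : e ∉ F.filter (u ∈ ·)) (mem_filter.2 ⟨he, hu⟩)
    obtain ⟨e, he⟩ := card_eq_one.1 hd1
    have heF : e ∈ F ∧ v ∈ e := mem_filter.1 (he ▸ mem_singleton_self e)
    have heu : ∀ x ∈ F, v ∈ x → x = e := fun x hx hvx =>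
      mem_singleton.1 (he ▸ mem_filter.2 ⟨hx, hvx⟩)
    obtain ⟨c, hc⟩ : ∃ c, e.erase v = {c} := card_eq_one.1 (by
      rw [card_erase_of_mem heF.2, (hFU e heF.1).2])
    have hce : c ∈ e.erase v := hc ▸ mem_singleton_self c
    have hcv : c ≠ v := ne_of_mem_erase hce
    have hcU : c ∈ U := (hFU e heF.1).1 (mem_of_mem_erase hce)
    have hev : insert c {v} = e := by
      rw [← insert_erase heF.2, hc]; exact pair_comm _ _
    have hcon := ih (U.erase v) (F.erase e) (by rw [card_erase_of_mem heF.1, hF]; rfl)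
      (by rw [card_erase_of_mem hv, hU]; rfl) (fun x hx => ⟨fun u hu => mem_erase.2 ⟨?_,
        (hFU x (mem_of_mem_erase hx)).1 hu⟩, (hFU x (mem_of_mem_erase hx)).2⟩)
      (le_antisymm ((cyc_mono (erase_subset _ _)).trans hcyc.le) (cyc_nonneg _))
    · have hle : fc (U.erase v) (F.erase e) ∅ ⊆ fc U F ∅ :=
        fc_mono (erase_subset _ _) (erase_subset _ _) subset_rfl
      have := isHEq_elementary_collapse (K := fc U F ∅) (K' := fc (U.erase v) (F.erase e) ∅)
        (s := {v}) (c := c) (singleton_nonempty v) (by simpa using hcv)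
        (by rw [hev]; exact Or.inr (Or.inl heF.1)) ?_ ?_ ?_ hle
      · obtain ⟨φ⟩ := this.nonempty
        exact φ.symm.contractibleSpace
      · rw [hev]
        rintro x (⟨u, hu, rfl⟩ | hx | hx) hvx
        · left; rw [singleton_subset_singleton] at hvx; rw [hvx]
        · right; exact heu x hx (hvx (mem_singleton_self v))
        · simp at hx
      · intro u hu
        rw [mem_singleton] at hu; subst hu
        refine Or.inl ⟨c, hcU, ?_⟩
        rw [hev, hc]
      · rw [hev]
        ext x
        simp only [fc, Set.mem_ofPred_eq, Set.mem_sdiff, Set.mem_insert_iff, Set.mem_singleton_iff,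
          mem_erase, notMem_empty, or_false]
        constructor
        · rintro (⟨u, ⟨huv, hu⟩, rfl⟩ | ⟨hxe, hx⟩)
          · refine ⟨Or.inl ⟨u, hu, rfl⟩, ?_⟩
            rintro (h | h)
            · exact huv (singleton_inj.1 h)
            · have := (hFU e heF.1).2
              rw [← h] at this; simp at this
          · refine ⟨Or.inr hx, ?_⟩
            rintro (rfl | h)
            · have := (hFU _ hx).2; simp at this
            · exact hxe h
        · rintro ⟨⟨u, hu, rfl⟩ | hx, h⟩
          · exact Or.inl ⟨u, ⟨fun h' => h (Or.inl (by rw [h'])), hu⟩, rfl⟩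
          · exact Or.inr ⟨fun h' => h (Or.inr h'), hx⟩
    · rintro rfl
      have hx' := mem_erase.1 hx
      exact hx'.1 (heu x hx'.2 hu)

end Realizations

/-! ### Complexes as attaching spaces -/

section Charts

open Finset
open scoped unitInterval

/-- A continuous bijection criterion for attaching spaces: a map out of `Att f` to a Hausdorff
space is a homeomorphism if it is injective on the base and on the interiors of the cells, and these
have disjoint images that cover. -/
theorem Att.isHomeomorph_lift {J S B Y : Type*} [TopologicalSpace S] [TopologicalSpace B]
    [TopologicalSpace Y] [CompactSpace S] [CompactSpace B] [Finite J] [T2Space Y]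
    {f : J → C(S, B)} {i : C(B, Y)} {χ : J → C(S × I, Y)} (h₀ : ∀ j s, χ j (s, 0) = i (f j s))
    (h₁ : ∀ j s s', χ j (s, 1) = χ j (s', 1)) (hi : Function.Injective i)
    (hd : ∀ j s u, 0 < u → ∀ b, χ j (s, u) ≠ i b)
    (hχ : ∀ j j' s s' u u', 0 < u → 0 < u' → χ j (s, u) = χ j' (s', u') →
      j = j' ∧ u = u' ∧ (u < 1 → s = s'))
    (hs : ∀ y, (∃ b, i b = y) ∨ ∃ j s u, χ j (s, u) = y) :
    IsHomeomorph (Att.lift i χ h₀ h₁ : Att f → Y) := by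
  rw [isHomeomorph_iff_continuous_bijective]
  refine ⟨(Att.lift i χ h₀ h₁).continuous, fun x => ?_, fun y => ?_⟩
  · have key : ∀ j s u, (∃ b, Att.cell f j (s, u) = Att.inl f b) ∨ 0 < u := by
      intro j s u
      rcases eq_or_lt_of_le (unitInterval.nonneg' : (0 : I) ≤ u) with h | h
      · left; subst h; exact ⟨_, Att.cell_zero j s⟩
      · exact Or.inr h
    refine Att.cases (P := fun x => ∀ y, Att.lift i χ h₀ h₁ x = Att.lift i χ h₀ h₁ y → x = y)
      ?_ ?_ x
    · intro b
      refine Att.cases (fun b' h => ?_) (fun j s u => ?_)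
      · rw [hi h]
      · rcases key j s u with ⟨b', hb'⟩ | hu
        · intro h; rw [hb'] at h ⊢; rw [hi h]
        · intro h; exact absurd h.symm (hd j s u hu b)
    · intro j s u
      refine Att.cases (fun b' => ?_) (fun j' s' u' => ?_)
      · rcases key j s u with ⟨b, hb⟩ | hu
        · intro h; rw [hb] at h ⊢; rw [hi h]
        · intro h; exact absurd h (hd j s u hu b')
      · rcases key j s u with ⟨b, hb⟩ | hu <;> rcases key j' s' u' with ⟨b', hb'⟩ | hu'
        · intro h; rw [hb, hb'] at h ⊢; rw [hi h]
        · intro h; rw [hb] at h; exact absurd h.symm (hd j' s' u' hu' b)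
        · intro h; rw [hb'] at h; exact absurd h (hd j s u hu b')
        · intro h
          obtain ⟨rfl, rfl, hss⟩ := hχ j j' s s' u u' hu hu' h
          rcases eq_or_lt_of_le (unitInterval.le_one' : u ≤ 1) with h' | h'
          · subst h'; exact Att.cell_one j s s'
          · rw [hss h']
  · rcases hs y with ⟨b, rfl⟩ | ⟨j, s, u, rfl⟩
    exacts [⟨Att.inl f b, rfl⟩, ⟨Att.cell f j (s, u), rfl⟩]

/-- A chart of the standard simplex with `n` vertices as a cone over `S`: the base of the cone goes
to the boundary and the apex to a point of the interior. -/
structure SimplexChart (S : Type*) [TopologicalSpace S] (n : ℕ) where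
  /-- the chart -/
  map : C(S × I, Fin n → ℝ)
  sum_eq : ∀ x, ∑ k, map x k = 1
  bdry_nonneg : ∀ z k, 0 ≤ map (z, 0) k
  bdry : ∀ z, ∃ k, map (z, 0) k = 0
  pos : ∀ z u, 0 < u → ∀ k, 0 < map (z, u) k
  apex : ∀ z z', map (z, 1) = map (z', 1)
  inj : ∀ z z' u u', map (z, u) = map (z', u') → u = u' ∧ (u < 1 → z = z')
  surj : ∀ q : Fin n → ℝ, (∀ k, 0 ≤ q k) → ∑ k, q k = 1 → ∃ z u, map (z, u) = q

theorem SimplexChart.nonneg {S : Type*} [TopologicalSpace S] {n : ℕ} (c : SimplexChart S n)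
    (x : S × I) (k : Fin n) : 0 ≤ c.map x k := by
  obtain ⟨z, u⟩ := x
  rcases eq_or_lt_of_le (unitInterval.nonneg' : (0 : I) ≤ u) with h | h
  · subst h; exact c.bdry_nonneg z k
  · exact (c.pos z u h k).le

variable {V : Type*} [DecidableEq V]

/-- The point with coordinates `q` with respect to the vertices `w`. -/
def embCoord {n : ℕ} (w : Fin n ↪ V) (q : Fin n → ℝ) : V → ℝ :=
  fun v => ∑ k, if w k = v then q k else 0

theorem continuous_embCoord {n : ℕ} (w : Fin n ↪ V) : Continuous (embCoord w) := by
  refine continuous_pi fun v => continuous_finsetSum _ fun k _ => ?_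
  split_ifs <;> fun_prop

@[simp] theorem embCoord_apply {n : ℕ} (w : Fin n ↪ V) (q : Fin n → ℝ) (k : Fin n) :
    embCoord w q (w k) = q k := by
  simp [embCoord]

theorem embCoord_of_notMem {n : ℕ} (w : Fin n ↪ V) (q : Fin n → ℝ) {v : V}
    (hv : v ∉ univ.map w) : embCoord w q v = 0 := by
  refine sum_eq_zero fun k _ => if_neg ?_
  rintro rfl
  simp at hv

theorem embCoord_nonneg {n : ℕ} (w : Fin n ↪ V) {q : Fin n → ℝ} (hq : ∀ k, 0 ≤ q k) (v : V) :
    0 ≤ embCoord w q v := by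
  refine sum_nonneg fun k _ => ?_
  split_ifs
  exacts [hq k, le_rfl]

theorem embCoord_injective {n : ℕ} (w : Fin n ↪ V) : Function.Injective (embCoord w) := by
  intro q q' h
  ext k
  have := congrFun h (w k)
  simpa using this

theorem embCoord_mem {n : ℕ} (w : Fin n ↪ V) {q : Fin n → ℝ} (hq : ∀ k, 0 ≤ q k)
    (h1 : ∑ k, q k = 1) : embCoord w q ∈ geom {univ.map w} :=
  ⟨_, rfl, embCoord_nonneg w hq, fun _ hv => embCoord_of_notMem w q hv, by simpa using h1⟩

theorem exists_embCoord {n : ℕ} (w : Fin n ↪ V) {p : V → ℝ} (hp : p ∈ geom {univ.map w}) :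
    ∃ q, (∀ k, 0 ≤ q k) ∧ ∑ k, q k = 1 ∧ embCoord w q = p := by
  obtain ⟨s, rfl, h0, h1, h2⟩ := hp
  refine ⟨fun k => p (w k), fun k => h0 _, by simpa using h2, ?_⟩
  ext v
  by_cases hv : v ∈ univ.map w
  · obtain ⟨k, -, rfl⟩ := mem_map.1 hv
    simp
  · rw [embCoord_of_notMem w _ hv, h1 v hv]

variable {S ι : Type*} [TopologicalSpace S] {n : ℕ}

theorem embCoord_bdry_mem (c : SimplexChart S n) (w : Fin n ↪ V) {K : Set (Finset V)}
    (hK : ∀ k, (univ.map w).erase (w k) ∈ K) (z : S) : embCoord w (c.map (z, 0)) ∈ geom K := by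
  obtain ⟨k, hk⟩ := c.bdry z
  obtain ⟨_, rfl, h0, h1, h2⟩ := embCoord_mem w (c.bdry_nonneg z) (c.sum_eq _)
  refine ⟨_, hK k, h0, fun v hv => ?_, ?_⟩
  · by_cases hvk : v = w k
    · rw [hvk, embCoord_apply, hk]
    · exact h1 v fun h => hv (mem_erase.2 ⟨hvk, h⟩)
  · have hmem : w k ∈ univ.map w := mem_map_of_mem _ (mem_univ k)
    rwa [← add_sum_erase _ _ hmem, embCoord_apply, hk, zero_add] at h2

/-- The attaching map of the cell given by the vertices `w`. -/
def attachMap (c : SimplexChart S n) (w : Fin n ↪ V) {K : Set (Finset V)}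
    (hK : ∀ k, (univ.map w).erase (w k) ∈ K) : C(S, geom K) :=
  ⟨fun z => ⟨embCoord w (c.map (z, 0)), embCoord_bdry_mem c w hK z⟩,
    ((continuous_embCoord w).comp (by fun_prop)).subtype_mk _⟩

/-- The characteristic map of the cell given by the vertices `w`. -/
def charMap (c : SimplexChart S n) (w : Fin n ↪ V) {L : Set (Finset V)}
    (hL : univ.map w ∈ L) : C(S × I, geom L) :=
  ⟨fun x => ⟨embCoord w (c.map x), geom_mono (Set.singleton_subset_iff.2 hL)
    (embCoord_mem w (c.nonneg x) (c.sum_eq x))⟩,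
    ((continuous_embCoord w).comp c.map.continuous).subtype_mk _⟩

/-- Adding simplices to a complex attaches cells to its realization. -/
theorem isHomeomorph_att [Finite ι] [CompactSpace S] (c : SimplexChart S n) (w : ι → Fin n ↪ V)
    (hw : Function.Injective fun i => univ.map (w i)) {K L : Set (Finset V)}
    [CompactSpace (geom K)] (hK : ∀ i k, (univ.map (w i)).erase (w i k) ∈ K)
    (hno : ∀ i, ∀ x ∈ K, ¬ univ.map (w i) ⊆ x) (hKL : K ⊆ L) (hL : ∀ i, univ.map (w i) ∈ L)
    (hLK : ∀ x ∈ L, x ∈ K ∨ ∃ i, x = univ.map (w i)) :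
    IsHomeomorph (Att.lift (f := fun i => attachMap c (w i) (hK i)) (geomIncl hKL)
      (fun i => charMap c (w i) (hL i)) (fun _ _ => rfl)
      (fun i z z' => Subtype.ext (congrArg (embCoord (w i)) (c.apex z z'))) :
      Att (fun i => attachMap c (w i) (hK i)) → geom L) := by
  refine Att.isHomeomorph_lift _ _ (Set.inclusion_injective (geom_mono hKL)) ?_ ?_ ?_
  · rintro i z u hu ⟨p, x, hx, h0, h1, h2⟩ h
    have h := congrArg Subtype.val h
    refine hno i x hx fun v hv => ?_
    by_contra hvx
    obtain ⟨k, -, rfl⟩ := mem_map.1 hv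
    have h3 := c.pos z u hu k
    have h4 : embCoord (w i) (c.map (z, u)) (w i k) = p (w i k) := congrFun h _
    rw [embCoord_apply, h1 _ hvx] at h4
    exact h3.ne' h4
  · intro i j z z' u u' hu hu' h
    have h : embCoord (w i) (c.map (z, u)) = embCoord (w j) (c.map (z', u')) :=
      congrArg Subtype.val h
    have hsub : ∀ {i j z z' u u'}, 0 < u → embCoord (w i) (c.map (z, u)) =
        embCoord (w j) (c.map (z', u')) → univ.map (w i) ⊆ univ.map (w j) := by
      intro i j z z' u u' hu h v hv
      by_contra hvj
      obtain ⟨k, -, rfl⟩ := mem_map.1 hv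
      have h4 := congrFun h (w i k)
      rw [embCoord_apply, embCoord_of_notMem _ _ hvj] at h4
      exact (c.pos z u hu k).ne' h4
    obtain rfl : i = j := hw (Subset.antisymm (hsub hu h) (hsub hu' h.symm))
    exact ⟨rfl, c.inj z z' u u' (embCoord_injective _ h)⟩
  · rintro ⟨p, x, hx, hp⟩
    rcases hLK x hx with h | ⟨i, rfl⟩
    · exact Or.inl ⟨⟨p, x, h, hp⟩, rfl⟩
    · obtain ⟨q, h0, h1, rfl⟩ := exists_embCoord (w i) ⟨_, rfl, hp⟩
      obtain ⟨z, u, rfl⟩ := c.surj q h0 h1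
      exact Or.inr ⟨i, z, u, rfl⟩

/-- The chart of the edge as a cone over two points. -/
def edgeChart : SimplexChart Bool 2 where
  map := ⟨fun x => bif x.1 then ![(x.2 : ℝ) / 2, 1 - x.2 / 2] else ![1 - (x.2 : ℝ) / 2, x.2 / 2], by
    refine continuous_prod_of_discrete_left.2 fun b => ?_
    cases b
    · refine continuous_pi fun k => ?_
      fin_cases k <;> simp <;> fun_prop
    · refine continuous_pi fun k => ?_
      fin_cases k <;> simp <;> fun_prop⟩
  sum_eq := by rintro ⟨b, u⟩; cases b <;> simp
  bdry_nonneg := by intro b k; cases b <;> fin_cases k <;> simp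
  bdry := by
    intro b
    cases b
    exacts [⟨1, by simp⟩, ⟨0, by simp⟩]
  pos := by
    intro b u hu k
    have h0 : (0 : ℝ) < u := hu
    have h1 : (u : ℝ) ≤ 1 := u.2.2
    cases b <;> fin_cases k <;> simp <;> first | exact hu | linarith
  apex := by
    intro b b'
    ext k
    cases b <;> cases b' <;> fin_cases k <;> simp <;> norm_num
  inj := by
    intro b b' u u' h
    have h0 := congrFun h 0
    have h1 := congrFun h 1
    have hu1 : (u : ℝ) ≤ 1 := u.2.2
    have hu1' : (u' : ℝ) ≤ 1 := u'.2.2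
    cases b <;> cases b' <;> simp at h0 h1
    · exact ⟨Subtype.ext (by linarith), fun _ => rfl⟩
    · refine ⟨Subtype.ext (by linarith), fun h => ?_⟩
      have : (u : ℝ) < 1 := h
      exfalso; linarith
    · refine ⟨Subtype.ext (by linarith), fun h => ?_⟩
      have : (u : ℝ) < 1 := h
      exfalso; linarith
    · exact ⟨Subtype.ext (by linarith), fun _ => rfl⟩
  surj := by
    intro q h0 h1
    rw [Fin.sum_univ_two] at h1
    have := h0 0
    have := h0 1
    rcases le_total (q 0) (q 1) with h | h
    · refine ⟨true, ⟨2 * q 0, by linarith, by linarith⟩, ?_⟩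
      ext k; fin_cases k <;> simp; linarith
    · refine ⟨false, ⟨2 * q 1, by linarith, by linarith⟩, ?_⟩
      ext k; fin_cases k <;> simp; linarith

/-- The scalar products of `z` with the third roots of unity. -/
def triForm (z : ℂ) : Fin 3 → ℝ :=
  ![-z.re / 2 + √3 / 2 * z.im, -z.re / 2 - √3 / 2 * z.im, z.re]

/-- The gauge of the triangle spanned by the negatives of the third roots of unity, up to
scale. -/
def triGauge (z : ℂ) : ℝ := max (-triForm z 0) (max (-triForm z 1) (-triForm z 2))

theorem triForm_sum (z : ℂ) : ∑ k, triForm z k = 0 := by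
  simp [triForm, Fin.sum_univ_three]

theorem triForm_smul (r : ℝ) (z : ℂ) (k : Fin 3) : triForm (r * z) k = r * triForm z k := by
  fin_cases k <;> simp [triForm] <;> ring

theorem le_triGauge (z : ℂ) (k : Fin 3) : -triForm z k ≤ triGauge z := by
  unfold triGauge
  fin_cases k <;> simp

theorem exists_triGauge (z : ℂ) : ∃ k, triGauge z = -triForm z k := by
  unfold triGauge
  rcases max_choice (-triForm z 0) (max (-triForm z 1) (-triForm z 2)) with h | h
  · exact ⟨0, h⟩
  · rcases max_choice (-triForm z 1) (-triForm z 2) with h' | h'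
    · exact ⟨1, h.trans h'⟩
    · exact ⟨2, h.trans h'⟩

theorem triForm_injective : Function.Injective triForm := by
  intro z z' h
  have h0 := congrFun h 0
  have h2 := congrFun h 2
  simp only [triForm, Matrix.cons_val] at h0 h2
  refine Complex.ext h2 ?_
  rw [h2] at h0
  have : √3 ≠ 0 := by positivity
  exact mul_left_cancel₀ (div_ne_zero this two_ne_zero) (by linarith)

theorem triGauge_pos {z : ℂ} (hz : z ≠ 0) : 0 < triGauge z := by
  by_contra! h
  have h1 : ∀ k, 0 ≤ triForm z k := fun k => by linarith [le_triGauge z k]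
  have h2 := triForm_sum z
  rw [sum_eq_zero_iff_of_nonneg fun k _ => h1 k] at h2
  refine hz (triForm_injective ?_)
  ext k
  rw [h2 k (mem_univ k)]
  fin_cases k <;> simp [triForm]

theorem triGauge_smul {r : ℝ} (hr : 0 ≤ r) (z : ℂ) : triGauge (r * z) = r * triGauge z := by
  simp only [triGauge, triForm_smul]
  rw [mul_max_of_nonneg _ _ hr, mul_max_of_nonneg _ _ hr]
  simp only [mul_neg]

@[fun_prop] theorem continuous_triForm (k : Fin 3) : Continuous fun z => triForm z k := by
  fin_cases k <;> simp only [triForm] <;> simp <;> fun_prop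

@[fun_prop] theorem continuous_triGauge : Continuous triGauge := by
  unfold triGauge; fun_prop

/-- The chart of the triangle as a cone over the circle, by radial projection from the barycenter;
the vertices are put at the third roots of unity. -/
def triangleChart : SimplexChart Circle 3 where
  map := ⟨fun x k => (1 + (1 - (x.2 : ℝ)) * (triForm x.1 k / triGauge x.1)) / 3, by
    refine continuous_pi fun k => ?_
    have : ∀ x : Circle × I, triGauge x.1 ≠ 0 := fun x => (triGauge_pos x.1.coe_ne_zero).ne'
    have h1 : Continuous fun x : Circle × I => triForm x.1 k :=
      (continuous_triForm k).comp (by fun_prop)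
    have h2 : Continuous fun x : Circle × I => triGauge x.1 :=
      continuous_triGauge.comp (by fun_prop)
    have h3 := h1.div h2 this
    fun_prop⟩
  sum_eq := by
    rintro ⟨z, u⟩
    simp only [ContinuousMap.coe_mk]
    rw [← sum_div, sum_add_distrib, ← mul_sum, ← sum_div, triForm_sum]
    simp
  bdry_nonneg := by
    intro z k
    have h1 := triGauge_pos z.coe_ne_zero
    have h2 : -1 ≤ triForm z k / triGauge z := by
      rw [le_div_iff₀ h1]; linarith [le_triGauge z k]
    simp only [ContinuousMap.coe_mk, Set.Icc.coe_zero, sub_zero, one_mul]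
    linarith
  bdry := by
    intro z
    obtain ⟨k, hk⟩ := exists_triGauge z
    have h1 := triGauge_pos z.coe_ne_zero
    refine ⟨k, ?_⟩
    have : triForm z k / triGauge z = -1 := by
      rw [div_eq_iff h1.ne']; linarith
    simp [this]
  pos := by
    intro z u hu k
    have hu : (0 : ℝ) < u := hu
    have hu1 : (u : ℝ) ≤ 1 := u.2.2
    have h1 := triGauge_pos z.coe_ne_zero
    have h2 : -1 ≤ triForm z k / triGauge z := by
      rw [le_div_iff₀ h1]; linarith [le_triGauge z k]
    simp only [ContinuousMap.coe_mk]
    have : -(1 - (u : ℝ)) ≤ (1 - u) * (triForm z k / triGauge z) := by nlinarith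
    linarith
  apex := by
    intro z z'
    ext k
    simp
  inj := by
    intro z z' u u' h
    have hk : ∀ k, (1 - (u : ℝ)) * (triForm z k / triGauge z) =
        (1 - u') * (triForm z' k / triGauge z') := by
      intro k
      have := congrFun h k
      simp only [ContinuousMap.coe_mk] at this
      linarith
    have key : ∀ {z z' : Circle} {u u' : I}, (∀ k, (1 - (u : ℝ)) * (triForm z k / triGauge z) =
        (1 - u') * (triForm z' k / triGauge z')) → (u' : ℝ) ≤ u := by
      intro z z' u u' hk
      obtain ⟨k, hk'⟩ := exists_triGauge z
      have h1 := triGauge_pos z.coe_ne_zero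
      have h1' := triGauge_pos z'.coe_ne_zero
      have h2 : -1 ≤ triForm z' k / triGauge z' := by
        rw [le_div_iff₀ h1']; linarith [le_triGauge z' k]
      have h3 : triForm z k / triGauge z = -1 := by rw [div_eq_iff h1.ne']; linarith
      have h4 := hk k
      rw [h3] at h4
      have : (u' : ℝ) ≤ 1 := u'.2.2
      nlinarith
    have huu : (u : ℝ) = u' := le_antisymm (key fun k => (hk k).symm) (key hk)
    refine ⟨Subtype.ext huu, fun hu => ?_⟩
    have hu : (u : ℝ) < 1 := hu
    have h1 := triGauge_pos z.coe_ne_zero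
    have h1' := triGauge_pos z'.coe_ne_zero
    have h2 : ((triGauge z)⁻¹ : ℝ) * (z : ℂ) = ((triGauge z')⁻¹ : ℝ) * (z' : ℂ) := by
      refine triForm_injective ?_
      ext k
      rw [triForm_smul, triForm_smul]
      have h3 := hk k
      rw [← huu] at h3
      have h4 := mul_left_cancel₀ (by linarith : (1 - (u : ℝ)) ≠ 0) h3
      rw [div_eq_inv_mul, div_eq_inv_mul] at h4
      exact h4
    have h3 := congrArg norm h2
    simp only [norm_mul, Circle.norm_coe, mul_one, Complex.norm_real, norm_inv, Real.norm_eq_abs,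
      inv_inj, abs_of_pos h1, abs_of_pos h1'] at h3
    rw [h3] at h2
    have h4 : ((triGauge z')⁻¹ : ℝ) ≠ 0 := (inv_pos.2 h1').ne'
    exact Circle.coe_injective (mul_left_cancel₀ (Complex.ofReal_ne_zero.2 h4) h2)
  surj := by
    intro q h0 h1
    rw [Fin.sum_univ_three] at h1
    let w : ℂ := ⟨3 * q 2 - 1, (3 * q 0 - 3 * q 1) / √3⟩
    have h3 : √3 * √3 = 3 := Real.mul_self_sqrt (by norm_num)
    have h3' : √3 ≠ 0 := by positivity
    have hw : ∀ k, triForm w k = 3 * q k - 1 := by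
      have e : √3 / 2 * ((3 * q 0 - 3 * q 1) / √3) = (3 * q 0 - 3 * q 1) / 2 := by field_simp
      intro k
      fin_cases k <;> simp only [triForm, w] <;> simp [e] <;> linarith
    by_cases hw0 : w = 0
    · refine ⟨1, 1, ?_⟩
      ext k
      have h4 := hw k
      have h5 : triForm 0 k = 0 := by fin_cases k <;> simp [triForm]
      rw [hw0, h5] at h4
      simp only [ContinuousMap.coe_mk, Set.Icc.coe_one, sub_self, zero_mul, add_zero]
      linarith
    · have hr : 0 < ‖w‖ := norm_pos_iff.2 hw0
      have hg := triGauge_pos hw0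
      have hg1 : triGauge w ≤ 1 := by
        obtain ⟨k, hk⟩ := exists_triGauge w
        rw [hk, hw]; linarith [h0 k]
      have hz : ((‖w‖⁻¹ : ℝ) : ℂ) * w ∈ Submonoid.unitSphere ℂ := by
        rw [← SetLike.mem_coe, Submonoid.coe_unitSphere, mem_sphere_zero_iff_norm]
        simp [hr.ne']
      refine ⟨⟨_, hz⟩, ⟨1 - triGauge w, by linarith, by linarith⟩, ?_⟩
      ext k
      change (1 + (1 - (1 - triGauge w)) * (triForm (((‖w‖⁻¹ : ℝ) : ℂ) * w) k /
        triGauge (((‖w‖⁻¹ : ℝ) : ℂ) * w))) / 3 = q k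
      rw [triForm_smul, triGauge_smul (inv_nonneg.2 hr.le), hw]
      field_simp
      ring

end Charts

/-! ### Maps to the circle given by integer cocycles -/

section Cocycles

open Finset
open scoped unitInterval

/-- The point of the circle at the fraction `x` of a full turn. -/
def turn : C(ℝ, Circle) := Circle.exp.comp ⟨fun x => 2 * Real.pi * x, by fun_prop⟩

theorem turn_apply (x : ℝ) : turn x = Circle.exp (2 * Real.pi * x) := rfl

theorem turn_add (x y : ℝ) : turn (x + y) = turn x * turn y := by
  simp [turn_apply, mul_add, Circle.exp_add]

@[simp] theorem turn_zero : turn 0 = 1 := by simp [turn_apply]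

@[simp] theorem turn_int (m : ℤ) : turn m = 1 := Circle.exp_two_pi_mul_int m

theorem turn_int_mul (m : ℤ) (x : ℝ) : turn (m * x) = turn x ^ m := by
  rw [turn_apply, turn_apply, ← Circle.exp_intCast_mul]
  congr 1
  ring

theorem turn_eq_one {x : ℝ} : turn x = 1 ↔ ∃ m : ℤ, x = m := by
  rw [turn_apply, Circle.exp_eq_one]
  refine exists_congr fun m => ?_
  have := Real.pi_pos
  constructor
  · intro h; nlinarith
  · rintro rfl; ring

theorem turn_eq_turn {x y : ℝ} : turn x = turn y ↔ ∃ m : ℤ, x = y + m := by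
  have : turn x = turn y ↔ turn (x - y) = 1 := by
    rw [sub_eq_add_neg, turn_add, show turn (-y) = (turn y)⁻¹ by simp [turn_apply],
      ← div_eq_mul_inv, div_eq_one]
  rw [this, turn_eq_one]
  exact exists_congr fun m => ⟨fun h => by linarith, fun h => by linarith⟩

/-- Two maps to the circle that are nowhere antipodal are homotopic. -/
theorem homotopic_of_ne_neg {X : Type*} [TopologicalSpace X] {f g : C(X, Circle)}
    (h : ∀ x, f x ≠ -g x) : f.Homotopic g := by
  have hc : Continuous fun x => Complex.arg (f x / g x : Circle) := by
    refine continuous_iff_continuousAt.2 fun x => ContinuousAt.comp (g := Complex.arg)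
      (Complex.continuousAt_arg ?_) (continuous_subtype_val.comp
        (f.continuous.div' g.continuous)).continuousAt
    rw [Complex.mem_slitPlane_iff_arg]
    refine ⟨fun h' => h x ?_, Circle.coe_ne_zero _⟩
    have h1 : f x / g x = Circle.exp Real.pi := by rw [← h', Circle.exp_arg]
    have h2 : Circle.exp Real.pi = -1 := by
      ext; simp [Circle.coe_exp, Complex.exp_pi_mul_I]
    rw [h2, div_eq_iff_eq_mul] at h1
    rw [h1, neg_one_mul]
  refine ContinuousMap.Homotopic.symm
    ⟨⟨⟨fun x => g x.2 * Circle.exp ((x.1 : ℝ) * Complex.arg (f x.2 / g x.2 : Circle)), ?_⟩,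
      fun x => ?_, fun x => ?_⟩⟩
  · exact (g.continuous.comp continuous_snd).mul (Circle.exp.continuous.comp
      ((continuous_subtype_val.comp continuous_fst).mul (hc.comp continuous_snd)))
  · simp
  · simp only [Set.Icc.coe_one, one_mul, Circle.exp_arg, mul_div_cancel]

variable {V : Type*}

/-- The map to the circle given by an integer cocycle `n` on the vertices `U`: on the open star of
`u` it is `p ↦ turn (∑ v, n u v * p v)`. -/
def cocMap (U : Finset V) (n : V → V → ℤ) (p : V → ℝ) : Circle :=
  open Classical in if h : ∃ u, 0 < p u then turn (∑ v ∈ U, n h.choose v * p v) else 1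

/-- `n` is an additive cocycle on every face of `K`, and `U` contains the vertices of `K`. -/
def CocOn (K : Set (Finset V)) (U : Finset V) (n : V → V → ℤ) : Prop :=
  ∀ s ∈ K, s ⊆ U ∧ ∀ u ∈ s, ∀ u' ∈ s, ∀ v ∈ s, n u v = n u u' + n u' v

theorem exists_pos_of_mem_geom {K : Set (Finset V)} {p : V → ℝ} (hp : p ∈ geom K) :
    ∃ u, 0 < p u := by
  by_contra! h
  obtain ⟨s, -, h0, -, h2⟩ := hp
  have := sum_nonpos (s := s) fun v _ => h v
  linarith

theorem cocMap_eq {K : Set (Finset V)} {U : Finset V} {n : V → V → ℤ} (h : CocOn K U n)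
    {p : V → ℝ} (hp : p ∈ geom K) {u : V} (hu : 0 < p u) :
    cocMap U n p = turn (∑ v ∈ U, n u v * p v) := by
  have hex : ∃ u, 0 < p u := ⟨u, hu⟩
  have hu' := hex.choose_spec
  rw [cocMap, dif_pos hex]
  set u' := hex.choose
  obtain ⟨s, hs, h0, h1, h2⟩ := hp
  have hmem : ∀ v, 0 < p v → v ∈ s := fun v hv => by
    by_contra hvs; exact hv.ne' (h1 v hvs)
  have hsum : ∀ x, ∑ v ∈ U, n x v * p v = ∑ v ∈ s, n x v * p v := fun x =>
    (sum_subset (h s hs).1 fun v _ hv => by rw [h1 v hv, mul_zero]).symm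
  refine turn_eq_turn.2 ⟨n u' u, ?_⟩
  rw [hsum, hsum]
  calc ∑ v ∈ s, n u' v * p v = ∑ v ∈ s, (n u v * p v + n u' u * p v) := by
        refine sum_congr rfl fun v hv => ?_
        rw [(h s hs).2 u' (hmem _ hu') u (hmem _ hu) v hv]
        push_cast
        ring
    _ = _ := by rw [sum_add_distrib, ← mul_sum, h2, mul_one]

/-- The map `cocMap` on the realization. -/
def cocMapC {K : Set (Finset V)} {U : Finset V} {n : V → V → ℤ} (h : CocOn K U n) :
    C(geom K, Circle) :=
  ⟨fun p => cocMap U n p, continuous_iff_continuousAt.2 fun p => by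
    obtain ⟨u, hu⟩ := exists_pos_of_mem_geom p.2
    have h1 : ContinuousAt (fun q : geom K => turn (∑ v ∈ U, n u v * (q : V → ℝ) v)) p :=
      Continuous.continuousAt (turn.continuous.comp (continuous_finsetSum _ fun v _ =>
        continuous_const.mul ((continuous_apply v).comp continuous_subtype_val)))
    have h2 : ∀ᶠ q : geom K in nhds p, 0 < (q : V → ℝ) u :=
      (isOpen_lt continuous_const ((continuous_apply u).comp continuous_subtype_val)).mem_nhds hu
    exact h1.congr (h2.mono fun q hq => (cocMap_eq h q.2 hq).symm)⟩

variable [DecidableEq V]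

theorem cocMap_embCoord {K : Set (Finset V)} {U : Finset V} {n : V → V → ℤ} (h : CocOn K U n)
    {m : ℕ} {w : Fin m ↪ V} {q : Fin m → ℝ} (hp : embCoord w q ∈ geom K) (hw : ∀ k, w k ∈ U)
    {k₀ : Fin m} (hk : 0 < q k₀) :
    cocMap U n (embCoord w q) = turn (∑ k, n (w k₀) (w k) * q k) := by
  rw [cocMap_eq h hp (u := w k₀) (by simpa using hk)]
  congr 1
  simp only [embCoord, mul_sum]
  rw [sum_comm]
  refine sum_congr rfl fun k _ => ?_
  simp [hw k]

/-- The cochain on a triangle that counts the passages through the edge from `0` to `1`. -/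
def edgeCochain (u v : Fin 3) : ℤ :=
  if u = 0 ∧ v = 1 then 1 else if u = 1 ∧ v = 0 then -1 else 0

theorem cocOn_edgeCochain : CocOn {s : Finset (Fin 3) | s.card = 2} univ edgeCochain := by
  have : ∀ s : Finset (Fin 3), s.card = 2 → s ⊆ univ ∧ ∀ u ∈ s, ∀ u' ∈ s, ∀ v ∈ s,
    edgeCochain u v = edgeCochain u u' + edgeCochain u' v := by decide
  exact this

/-- The map from the boundary of the triangle to the circle that winds once around along the edge
from `0` to `1`. -/
def windMap : C(Circle, Circle) :=
  (cocMapC cocOn_edgeCochain).comp (attachMap triangleChart (Function.Embedding.refl _)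
    (fun k => by simp [card_erase_of_mem]))

theorem exists_pos_triangleChart (z : Circle) : ∃ k, 0 < triangleChart.map (z, 0) k := by
  by_contra! h
  have h1 := triangleChart.sum_eq (z, 0)
  have := sum_nonpos (s := univ) fun k _ => h k
  linarith

theorem windMap_apply (z : Circle) {k₀ : Fin 3} (hk : 0 < triangleChart.map (z, 0) k₀) :
    windMap z = turn (∑ k, edgeCochain k₀ k * triangleChart.map (z, 0) k) :=
  cocMap_embCoord cocOn_edgeCochain (attachMap triangleChart (Function.Embedding.refl _)
    (fun k => by simp [card_erase_of_mem]) z).2 (fun _ => mem_univ _) hk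

theorem windMap_homotopic_id : windMap.Homotopic (.id Circle) := by
  refine homotopic_of_ne_neg fun z h => ?_
  have hg := triGauge_pos z.coe_ne_zero
  have hq : ∀ k, triangleChart.map (z, 0) k = (1 + triForm z k / triGauge z) / 3 := by
    intro k; simp [triangleChart]
  have hs := triangleChart.sum_eq (z, 0)
  have h0 := triangleChart.bdry_nonneg z
  rw [Fin.sum_univ_three] at hs
  -- the coordinates of `z` in terms of those of the boundary point
  have hx : (z : ℂ).re = (3 * triangleChart.map (z, 0) 2 - 1) * triGauge z := by
    rw [hq]; simp only [triForm, Matrix.cons_val]; field_simp; ring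
  have hy : √3 * (z : ℂ).im = 3 * (triangleChart.map (z, 0) 0 - triangleChart.map (z, 0) 1) *
      triGauge z := by
    rw [hq, hq]; simp only [triForm, Matrix.cons_val]; field_simp; ring
  set q := triangleChart.map (z, 0)
  have h3 : 0 < √3 := by positivity
  have hpi := Real.pi_pos
  have hre := congrArg (fun w : Circle => (w : ℂ).re) h
  have him := congrArg (fun w : Circle => (w : ℂ).im) h
  simp only [ContinuousMap.id_apply, Circle.coe_neg, Complex.neg_re, Complex.neg_im] at hre him
  rcases (h0 2).eq_or_lt with h2 | h2
  · have hw : windMap z = turn (q 1) := by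
      rcases (h0 0).eq_or_lt with h4 | h4
      · have h5 : q 1 = 1 := by linarith
        rw [windMap_apply z (k₀ := 1) (by change 0 < q 1; rw [h5]; exact one_pos)]
        change turn (∑ k, edgeCochain 1 k * q k) = _
        rw [Fin.sum_univ_three, ← h4, ← h2, h5]
        have := turn_int 1
        simp at this
        simp [edgeCochain, this]
      · rw [windMap_apply z h4]
        change turn (∑ k, edgeCochain 0 k * q k) = _
        rw [Fin.sum_univ_three]
        simp [edgeCochain]
    rw [hw, turn_apply, Circle.coe_exp, Complex.exp_ofReal_mul_I_re] at hre
    rw [hw, turn_apply, Circle.coe_exp, Complex.exp_ofReal_mul_I_im] at him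
    rw [← h2] at hx
    have h01 := h0 0
    have h1 := h0 1
    rcases lt_trichotomy (q 1) (1 / 2) with h4 | h4 | h4
    · have h5 : 0 ≤ Real.sin (2 * Real.pi * q 1) :=
        Real.sin_nonneg_of_nonneg_of_le_pi (by positivity) (by nlinarith)
      have h6 : 0 < √3 * (z : ℂ).im := by rw [hy]; refine mul_pos ?_ hg; linarith
      have h7 := pos_of_mul_pos_right h6 h3.le
      linarith
    · rw [h4, show 2 * Real.pi * (1 / 2) = Real.pi by ring, Real.cos_pi] at hre
      nlinarith
    · have h5 : Real.sin (2 * Real.pi * q 1) ≤ 0 := by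
        rw [← Real.sin_sub_two_pi]
        exact Real.sin_nonpos_of_nonpos_of_neg_pi_le (by nlinarith) (by nlinarith)
      have h6 : √3 * (z : ℂ).im < 0 := by
        rw [hy]; refine mul_neg_of_neg_of_pos ?_ hg; linarith
      have h7 := neg_of_mul_neg_right h6 h3.le
      linarith
  · have hw : windMap z = 1 := by
      rw [windMap_apply z h2]
      change turn (∑ k, edgeCochain 2 k * q k) = _
      rw [Fin.sum_univ_three]
      simp [edgeCochain]
    rw [hw] at hre him
    simp only [Circle.coe_one, Complex.one_re, Complex.one_im] at hre him
    have hzre : (z : ℂ).re = -1 := by linarith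
    have hzim : (z : ℂ).im = 0 := by linarith
    have h5 : triGauge z = 1 := by
      simp only [triGauge, triForm, Matrix.cons_val, hzre, hzim]
      norm_num
    rw [h5] at hx
    linarith

/-- The `d`-th power map of the circle. -/
def powMap (d : ℤ) : C(Circle, Circle) := ⟨fun z => z ^ d, continuous_zpow d⟩

/-- On the boundary of a triangle, the map given by a cochain has degree the sum of the cochain
around the boundary. -/
theorem cocMapC_comp_attachMap_homotopic {K : Set (Finset V)} {U : Finset V} {n : V → V → ℤ}
    (h : CocOn K U n) (hn : ∀ u v, n v u = -n u v) (w : Fin 3 ↪ V)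
    (hK : ∀ k, (univ.map w).erase (w k) ∈ K) :
    ((cocMapC h).comp (attachMap triangleChart w hK)).Homotopic
      (powMap (n (w 0) (w 1) + n (w 1) (w 2) + n (w 2) (w 0))) := by
  set d := n (w 0) (w 1) + n (w 1) (w 2) + n (w 2) (w 0) with hd
  have hU : ∀ k, w k ∈ U := by
    intro k
    obtain ⟨k', hk'⟩ : ∃ k', k ≠ k' := ⟨k + 1, by fin_cases k <;> decide⟩
    exact (h _ (hK k')).1 (mem_erase.2 ⟨fun h => hk' (w.injective h), mem_map_of_mem _ (mem_univ k)⟩)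
  -- the cochain is cohomologous to a multiple of `edgeCochain`
  let g : Fin 3 → ℤ := ![0, n (w 0) (w 1) - d, n (w 0) (w 2)]
  have h00 : ∀ v, n v v = 0 := fun v => by have := hn v v; omega
  have hng : ∀ k l, n (w k) (w l) = d * edgeCochain k l + g l - g k := by
    have h10 := hn (w 0) (w 1)
    have h20 := hn (w 0) (w 2)
    have h21 := hn (w 1) (w 2)
    intro k l
    fin_cases k <;> fin_cases l <;> simp [edgeCochain, g, h00] <;> omega
  let G : C(Circle, ℝ) := ⟨fun z => ∑ k, g k * triangleChart.map (z, 0) k, by fun_prop⟩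
  have hF : ∀ z, (cocMapC h).comp (attachMap triangleChart w hK) z =
      windMap z ^ d * turn (G z) := by
    intro z
    obtain ⟨k₀, hk₀⟩ := exists_pos_triangleChart z
    have h1 : (cocMapC h).comp (attachMap triangleChart w hK) z =
        turn (∑ k, n (w k₀) (w k) * triangleChart.map (z, 0) k) :=
      cocMap_embCoord h (attachMap triangleChart w hK z).2 hU hk₀
    rw [h1, windMap_apply z hk₀, ← turn_int_mul, ← turn_add]
    refine turn_eq_turn.2 ⟨-g k₀, ?_⟩
    have hs := triangleChart.sum_eq (z, 0)
    have : ∀ k, (n (w k₀) (w k) : ℝ) * triangleChart.map (z, 0) k =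
        d * (edgeCochain k₀ k * triangleChart.map (z, 0) k) + g k * triangleChart.map (z, 0) k
          - g k₀ * triangleChart.map (z, 0) k := by
      intro k
      rw [hng k₀ k]
      push_cast
      ring
    simp only [this, sum_sub_distrib, sum_add_distrib, ← mul_sum, hs, G, ContinuousMap.coe_mk]
    push_cast
    ring
  obtain ⟨H⟩ := windMap_homotopic_id
  refine ⟨⟨⟨fun x => H x ^ d * turn ((1 - (x.1 : ℝ)) * G x.2), ?_⟩, fun z => ?_, fun z => ?_⟩⟩
  · have := continuous_zpow (G := Circle) d
    fun_prop
  · rw [hF]; simp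
  · simp [powMap]

end Cocycles

/-! ### Complexes with a spanning tree map to bouquets -/

section Bouquets

open Finset
open scoped unitInterval

/-- The wedge of circles indexed by `J`, inside the torus. -/
def Bouquet (J : Type*) : Set (J → Circle) := {x | ∀ i j, i ≠ j → x i = 1 ∨ x j = 1}

variable {J : Type*} [DecidableEq J]

theorem mulSingle_mem_bouquet (j : J) (z : Circle) : Pi.mulSingle j z ∈ Bouquet J := by
  intro i i' hii
  by_cases h : i = j
  · exact Or.inr (Pi.mulSingle_eq_of_ne (fun h' => hii (h.trans h'.symm)) _)
  · exact Or.inl (Pi.mulSingle_eq_of_ne h _)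

/-- The inclusion of the `j`-th circle. -/
def bouquetIncl (j : J) : C(Circle, Bouquet J) :=
  ⟨fun z => ⟨Pi.mulSingle j z, mulSingle_mem_bouquet j z⟩, by
    refine Continuous.subtype_mk ?_ _
    exact continuous_mulSingle (A := fun _ => Circle) j⟩

theorem turn_injOn {s t : ℝ} (hs : 0 < s) (hs1 : s < 1) (ht : 0 < t) (ht1 : t < 1)
    (h : turn s = turn t) : s = t := by
  obtain ⟨m, hm⟩ := turn_eq_turn.1 h
  have h1 : (m : ℝ) < 1 := by linarith
  have h2 : (-1 : ℝ) < m := by linarith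
  have h3 : m < 1 := by exact_mod_cast h1
  have h4 : -1 < m := by exact_mod_cast h2
  have h5 : m = 0 := by omega
  simpa [h5] using hm

theorem turn_ne_one {t : ℝ} (ht : 0 < t) (ht1 : t < 1) : turn t ≠ 1 := by
  intro h
  obtain ⟨m, hm⟩ := turn_eq_one.1 h
  rw [hm] at ht ht1
  have h3 : m < 1 := by exact_mod_cast ht1
  have h4 : 0 < m := by exact_mod_cast ht
  omega

theorem exists_turn_eq {z : Circle} (hz : z ≠ 1) : ∃ t, 0 < t ∧ t < 1 ∧ turn t = z := by
  obtain ⟨x, rfl⟩ : ∃ x, turn x = z := by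
    obtain ⟨y, rfl⟩ := Circle.exp_surjective z
    refine ⟨y / (2 * Real.pi), ?_⟩
    rw [turn_apply]
    congr 1
    have := Real.pi_ne_zero
    field_simp
  have h1 : turn (Int.fract x) = turn x :=
    turn_eq_turn.2 ⟨-⌊x⌋, by rw [Int.fract]; push_cast; ring⟩
  refine ⟨Int.fract x, lt_of_le_of_ne (Int.fract_nonneg x) fun h => hz ?_, Int.fract_lt_one x, h1⟩
  rw [← h1, ← h, turn_zero]

theorem edgeChart_coord_pos (b : Bool) {u : I} (hu : 0 < u) :
    0 < edgeChart.map (b, u) 1 ∧ edgeChart.map (b, u) 1 < 1 := by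
  have h := edgeChart.sum_eq (b, u)
  rw [Fin.sum_univ_two] at h
  exact ⟨edgeChart.pos b u hu 1, by linarith [edgeChart.pos b u hu 0]⟩

/-- The map from a point with arcs attached to the bouquet. -/
def arcsToBouquet : C(Att fun _ : J => ContinuousMap.const Bool (), Bouquet J) :=
  Att.lift (.const _ ⟨1, fun _ _ _ => Or.inl rfl⟩)
    (fun j => (bouquetIncl j).comp ⟨fun x => turn (edgeChart.map x 1), by fun_prop⟩)
    (fun j b => by
      have h1 := turn_int 1
      simp only [Int.cast_one] at h1
      ext1
      cases b <;> simp [bouquetIncl, edgeChart, h1])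
    (fun j b b' => by
      simp only [ContinuousMap.comp_apply, ContinuousMap.coe_mk]
      rw [edgeChart.apex b b'])

theorem isHomeomorph_arcsToBouquet [Finite J] : IsHomeomorph (arcsToBouquet (J := J)) := by
  have hval : ∀ (j : J) (x : Bool × I), ((bouquetIncl j).comp
      (⟨fun x => turn (edgeChart.map x 1), by fun_prop⟩ : C(Bool × I, Circle)) x).1 =
      Pi.mulSingle j (turn (edgeChart.map x 1)) := fun _ _ => rfl
  refine Att.isHomeomorph_lift _ _ (fun _ _ _ => rfl) ?_ ?_ ?_
  · intro j b u hu _ h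
    have h := congrArg (fun x : Bouquet J => x.1 j) h
    simp only [hval, Pi.mulSingle_eq_same] at h
    exact turn_ne_one (edgeChart_coord_pos b hu).1 (edgeChart_coord_pos b hu).2 h
  · intro j j' b b' u u' hu hu' h
    have h := congrArg Subtype.val h
    rw [hval, hval] at h
    have h1 := edgeChart_coord_pos b hu
    have h1' := edgeChart_coord_pos b' hu'
    have hj : j = j' := by
      by_contra hne
      have h2 := congrFun h j
      rw [Pi.mulSingle_eq_same, Pi.mulSingle_eq_of_ne hne] at h2
      exact turn_ne_one h1.1 h1.2 h2
    subst hj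
    have h2 := turn_injOn h1.1 h1.2 h1'.1 h1'.2 (Pi.mulSingle_injective j h)
    refine ⟨rfl, edgeChart.inj _ _ _ _ ?_⟩
    have h3 := edgeChart.sum_eq (b, u)
    have h3' := edgeChart.sum_eq (b', u')
    rw [Fin.sum_univ_two] at h3 h3'
    ext k
    fin_cases k
    · change edgeChart.map (b, u) 0 = edgeChart.map (b', u') 0
      linarith
    · exact h2
  · rintro ⟨x, hx⟩
    by_cases h : ∀ j, x j = 1
    · exact Or.inl ⟨(), Subtype.ext (funext fun j => (h j).symm)⟩
    · push Not at h
      obtain ⟨j, hj⟩ := h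
      obtain ⟨t, ht0, ht1, ht⟩ := exists_turn_eq hj
      obtain ⟨b, u, hbu⟩ := edgeChart.surj ![1 - t, t]
        (fun k => by fin_cases k <;> simp <;> linarith) (by simp)
      refine Or.inr ⟨j, b, u, Subtype.ext ?_⟩
      rw [hval, hbu]
      simp only [Matrix.cons_val, ht]
      ext i : 1
      by_cases hi : i = j
      · subst hi; simp
      · rw [Pi.mulSingle_eq_of_ne hi, (hx i j hi).resolve_right hj]

variable {V : Type*}

theorem cocMap_eq_one {K : Set (Finset V)} {U : Finset V} {n : V → V → ℤ} (h : CocOn K U n)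
    {p : V → ℝ} (hp : p ∈ geom K) {s : Finset V} (hs : ∀ v, v ∉ s → p v = 0)
    (h0 : ∀ u ∈ s, ∀ v ∈ s, n u v = 0) : cocMap U n p = 1 := by
  obtain ⟨u, hu⟩ := exists_pos_of_mem_geom hp
  rw [cocMap_eq h hp hu, sum_eq_zero, turn_zero]
  intro v _
  by_cases hv : v ∈ s
  · rw [h0 u (by by_contra hus; exact hu.ne' (hs u hus)) v hv]; simp
  · rw [hs v hv, mul_zero]

/-- The map to the bouquet given by cocycles of which at most one is nonzero on each face. -/
def bouquetMap {K : Set (Finset V)} {U : Finset V} {n : J → V → V → ℤ}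
    (h : ∀ j, CocOn K U (n j))
    (hs : ∀ s ∈ K, ∀ i j, i ≠ j → (∀ u ∈ s, ∀ v ∈ s, n i u v = 0) ∨
      ∀ u ∈ s, ∀ v ∈ s, n j u v = 0) :
    C(geom K, Bouquet J) :=
  ⟨fun p => ⟨fun j => cocMapC (h j) p, by
    intro i j hij
    obtain ⟨s, hsK, -, h1, -⟩ := p.2
    exact (hs s hsK i j hij).imp (cocMap_eq_one (h i) p.2 h1) (cocMap_eq_one (h j) p.2 h1)⟩, by
    refine Continuous.subtype_mk (continuous_pi fun j => (cocMapC (h j)).continuous) _⟩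

variable [DecidableEq V]

/-- A connected graph maps to the bouquet of the edges outside of a spanning tree by a homotopy
equivalence. -/
theorem isHEq_bouquetMap_graph [Finite J] {U : Finset V} {Tr G : Finset (Finset V)}
    (htree : ContractibleSpace (geom (fc U Tr ∅))) (w : J → Fin 2 ↪ V)
    (hw : Function.Injective fun j => univ.map (w j)) (hwU : ∀ j k, w j k ∈ U)
    (hwTr : ∀ j, univ.map (w j) ∉ Tr) (hTr : ∀ e ∈ Tr, e.card = 2)
    (hG : ∀ x, x ∈ G ↔ x ∈ Tr ∨ ∃ j, x = univ.map (w j)) {n : J → V → V → ℤ}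
    (h : ∀ j, CocOn (fc U G ∅) U (n j)) (hn : ∀ j u v, n j v u = -n j u v)
    (hone : ∀ j, n j (w j 0) (w j 1) = 1)
    (hzero : ∀ j u v, {u, v} ∈ G → {u, v} ≠ univ.map (w j) → n j u v = 0)
    (hs : ∀ s ∈ fc U G ∅, ∀ i j, i ≠ j → (∀ u ∈ s, ∀ v ∈ s, n i u v = 0) ∨
      ∀ u ∈ s, ∀ v ∈ s, n j u v = 0) :
    IsHEq (bouquetMap h hs) := by
  have hcardw : ∀ j, (univ.map (w j)).card = 2 := fun j => by simp
  have hdiag : ∀ j v, n j v v = 0 := fun j v => by have := hn j v v; omega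
  have hK : ∀ j k, (univ.map (w j)).erase (w j k) ∈ fc U Tr ∅ := by
    intro j k
    obtain ⟨v, hv⟩ := card_eq_one.1 (show ((univ.map (w j)).erase (w j k)).card = 1 by
      rw [card_erase_of_mem (mem_map_of_mem _ (mem_univ k)), hcardw])
    have : v ∈ univ.map (w j) := mem_of_mem_erase (hv ▸ mem_singleton_self v)
    obtain ⟨l, -, rfl⟩ := mem_map.1 this
    exact Or.inl ⟨_, hwU j l, hv⟩
  have hKL : fc U Tr ∅ ⊆ fc U G ∅ := fc_mono subset_rfl (fun x hx => (hG x).2 (Or.inl hx)) subset_rfl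
  have hL : ∀ j, univ.map (w j) ∈ fc U G ∅ := fun j => Or.inr (Or.inl ((hG _).2 (Or.inr ⟨j, rfl⟩)))
  have hhom := isHomeomorph_att edgeChart w hw hK (fun j x hx hsub => by
      rcases hx with ⟨v, -, rfl⟩ | hx | hx
      · have := card_le_card hsub; rw [hcardw] at this; simp at this
      · have := eq_of_subset_of_card_le hsub (by rw [hcardw, hTr x hx])
        exact hwTr j (this ▸ hx)
      · simp at hx) hKL hL (fun x hx => by
      rcases hx with hx | hx | hx
      · exact Or.inl (Or.inl hx)
      · rcases (hG x).1 hx with hx | hx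
        exacts [Or.inl (Or.inr (Or.inl hx)), Or.inr hx]
      · simp at hx)
  set f := fun j => attachMap edgeChart (w j) (hK j)
  set Λ := Att.lift (f := f) (geomIncl hKL) (fun j => charMap edgeChart (w j) (hL j))
    (fun _ _ => rfl) (fun j z z' => Subtype.ext (congrArg (embCoord (w j)) (edgeChart.apex z z')))
  let pt : C(geom (fc U Tr ∅), Unit) := .const _ ()
  have hpt : IsHEq pt := by
    obtain ⟨e⟩ := htree.hequiv_unit
    exact (isHEq_toFun e).congr (by rw [show e.toFun = pt from by ext])
  have hcomp : (bouquetMap h hs).comp Λ = arcsToBouquet.comp (Att.map f pt) := by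
    ext x : 1
    refine Att.cases (P := fun x => (bouquetMap h hs).comp Λ x =
      arcsToBouquet.comp (Att.map f pt) x) (fun p => ?_) (fun j b u => ?_) x
    · refine Subtype.ext (funext fun j => ?_)
      obtain ⟨s, hsK, -, h1, -⟩ := p.2
      refine cocMap_eq_one (h j) (geom_mono hKL p.2) h1 fun u hu v hv => ?_
      by_cases huv : u = v
      · rw [huv, hdiag]
      · rcases hsK with ⟨v', -, rfl⟩ | hsK | hsK
        · rw [mem_singleton] at hu hv; exact absurd (hu.trans hv.symm) huv
        · have : s = {u, v} := (eq_of_subset_of_card_le (insert_subset hu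
            (singleton_subset_iff.2 hv)) (by rw [hTr s hsK, card_pair huv])).symm
          refine hzero j u v (this ▸ (hG s).2 (Or.inl hsK)) fun h' => hwTr j ?_
          rw [← h', ← this]; exact hsK
        · simp at hsK
    · refine Subtype.ext (funext fun i => ?_)
      change cocMap U (n i) (embCoord (w j) (edgeChart.map (b, u))) =
        (Pi.mulSingle j (turn (edgeChart.map (b, u) 1)) : J → Circle) i
      have hmem := (charMap edgeChart (w j) (hL j) (b, u)).2
      by_cases hij : i = j
      · subst hij
        rw [Pi.mulSingle_eq_same]
        rcases (edgeChart.nonneg (b, u) 0).eq_or_lt with h0 | h0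
        · have h1 : edgeChart.map (b, u) 1 = 1 := by
            have := edgeChart.sum_eq (b, u)
            rw [Fin.sum_univ_two] at this; linarith
          rw [cocMap_embCoord (h i) hmem (hwU i) (k₀ := 1) (by rw [h1]; exact one_pos),
            Fin.sum_univ_two, ← h0, h1, hdiag]
          have := turn_int 1
          simp only [Int.cast_one] at this
          simp [this]
        · rw [cocMap_embCoord (h i) hmem (hwU i) h0, Fin.sum_univ_two, hdiag, hone]
          simp
      · rw [Pi.mulSingle_eq_of_ne hij]
        refine cocMap_eq_one (h i) hmem (fun v hv => embCoord_of_notMem (w j) _ hv) ?_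
        intro u hu v hv
        by_cases huv : u = v
        · rw [huv, hdiag]
        · have : univ.map (w j) = {u, v} := (eq_of_subset_of_card_le (insert_subset hu
            (singleton_subset_iff.2 hv)) (by rw [hcardw, card_pair huv])).symm
          refine hzero i u v (this ▸ (hG _).2 (Or.inr ⟨j, rfl⟩)) ?_
          rw [← this]
          exact fun h' => hij (hw h').symm
  have h1 : IsHEq (arcsToBouquet.comp (Att.map f pt)) :=
    IsHEq.comp (isHEq_homeomorph isHomeomorph_arcsToBouquet.homeomorph) (Att.isHEq_map f hpt)
  rw [← hcomp] at h1
  exact h1.of_comp_left (isHEq_homeomorph hhom.homeomorph)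

/-- The embedding of two different vertices. -/
def emb2 {a b : V} (h : a ≠ b) : Fin 2 ↪ V :=
  ⟨![a, b], by
    intro i j hij
    fin_cases i <;> fin_cases j <;> simp_all [h.symm]⟩

/-- The embedding of three different vertices. -/
def emb3 {a b c : V} (hab : a ≠ b) (hac : a ≠ c) (hbc : b ≠ c) : Fin 3 ↪ V :=
  ⟨![a, b, c], by
    intro i j hij
    fin_cases i <;> fin_cases j <;> simp_all [hab.symm, hac.symm, hbc.symm]⟩

theorem map_emb2 {a b : V} (h : a ≠ b) : univ.map (emb2 h) = {a, b} := by
  ext v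
  simp only [emb2, mem_map, mem_univ, true_and, Fin.exists_fin_two, mem_insert, mem_singleton,
    @eq_comm _ v]
  exact Iff.rfl

theorem map_emb3 {a b c : V} (hab : a ≠ b) (hac : a ≠ c) (hbc : b ≠ c) :
    univ.map (emb3 hab hac hbc) = {a, b, c} := by
  ext v
  simp only [emb3, mem_map, mem_univ, true_and, Fin.exists_fin_succ, mem_insert, mem_singleton,
    @eq_comm _ v]
  simp
  exact Iff.rfl

end Bouquets

/-! ### The triangles of the core as cells attached to a bouquet -/

section Models

open Finset

variable {V : Type*} [DecidableEq V]

theorem cocOn_of_isCocycle {U : Finset V} {F T : Finset (Finset V)} {n : V → V → ℤ}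
    (hF : ∀ e ∈ F, e ⊆ U ∧ e.card = 2) (hT : Triangular T) (hTU : ∀ t ∈ T, t ⊆ U)
    (hn : ∀ u v, n v u = -n u v) (hc : IsCocycle T n) : CocOn (fc U F T) U n := by
  have hd : ∀ v, n v v = 0 := fun v => by have := hn v v; omega
  intro s hs
  have hsU : s ⊆ U := by
    rcases hs with ⟨v, hv, rfl⟩ | hs | hs
    exacts [singleton_subset_iff.2 hv, (hF s hs).1, hTU s hs]
  refine ⟨hsU, fun u hu u' hu' v hv => ?_⟩
  by_cases h1 : u = u'
  · subst h1; rw [hd]; ring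
  by_cases h2 : u' = v
  · subst h2; rw [hd]; ring
  by_cases h3 : u = v
  · subst h3; rw [hd, hn u u']; ring
  have h4 : ({u, u', v} : Finset V) ⊆ s := by
    intro x hx
    simp only [mem_insert, mem_singleton] at hx
    rcases hx with rfl | rfl | rfl <;> assumption
  have h5 : ({u, u', v} : Finset V).card = 3 := card_eq_three.2 ⟨u, u', v, h1, h3, h2, rfl⟩
  have h6 := card_le_card h4
  rcases hs with ⟨x, hx, rfl⟩ | hs | hs
  · simp at h6; omega
  · have := (hF s hs).2; omega
  · have := eq_of_subset_of_card_le h4 (by rw [h5, hT s hs])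
    have h7 := hc u u' v h1 h3 h2 (this ▸ hs)
    have := hn u v
    omega

theorem erase_mem_fc {U : Finset V} {F T : Finset (Finset V)} {w : Fin 3 ↪ V}
    (h : ∀ e ∈ powersetCard 2 (univ.map w), e ∈ F) (k : Fin 3) :
    (univ.map w).erase (w k) ∈ fc U F T := by
  refine Or.inr (Or.inl (h _ (mem_powersetCard.2 ⟨erase_subset _ _, ?_⟩)))
  rw [card_erase_of_mem (mem_map_of_mem _ (mem_univ k))]; simp

/-- A connected complex whose triangle families have nonpositive excess maps, after removal of the
triangles `cut`, to a bouquet by a homotopy equivalence that takes the boundaries of the removed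
triangles to points or to squares of different circles. -/
theorem CoreData.exists_model {U : Finset V} {F T : Finset (Finset V)} (D : CoreData T F)
    (hF : ∀ e ∈ F, e ⊆ U ∧ e.card = 2) (hT : Triangular T) (hTF : edges T ⊆ F)
    (hTU : ∀ t ∈ T, t ⊆ U) (hcard : U.card = D.tree.card + 1) :
    ∃ (J : Finset (Finset V)) (K : Set (Finset V)) (hK : K ⊆ fc U F (T \ D.cut))
      (k : C(geom K, Bouquet J)), IsHEq (geomIncl hK) ∧ IsHEq k ∧
      ∃ loop : D.cut → J, Function.Injective loop ∧ ∀ σ : D.cut, ∃ w : Fin 3 ↪ V,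
        univ.map w = σ ∧ ∃ hw : ∀ i, (univ.map w).erase (w i) ∈ K,
        (k.comp (attachMap triangleChart w hw)).Homotopic
          ((bouquetIncl (loop σ)).comp (powMap 0)) ∨
        (k.comp (attachMap triangleChart w hw)).Homotopic
          ((bouquetIncl (loop σ)).comp (powMap 2)) := by
  obtain ⟨C, cut, E₀, E₁, Tr, loop, coc, hCT, hcut, hc₀, hc₁, hTr, hcyc, hspn, hloop, hinj, hanti,
    hcoc, hzero, hunit, hsingle, hcutz, hbd⟩ := D
  simp only at hcard ⊢
  set G := (F \ E₀) \ E₁ with hGdef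
  have hGF : G ⊆ F := sdiff_subset.trans sdiff_subset
  have hCF : edges C ⊆ F \ E₀ := fun e he => mem_sdiff.2 ⟨hTF (edges_mono hCT he), fun h =>
    disjoint_left.1 hc₀.disjoint_edges h he⟩
  have hCU : ∀ t ∈ C, t ⊆ U := fun t ht => hTU t (hCT ht)
  have hTC := hT.mono hCT
  have hE₀ : ∀ e ∈ E₀, e.card = 2 := fun e he => card_of_mem_edges (hc₀.subset_edges he)
  have hE₁ : ∀ e ∈ E₁, e.card = 2 := fun e he => card_of_mem_edges (hc₁.subset_edges he)
  have hTrF : ∀ e ∈ Tr, e ⊆ U ∧ e.card = 2 := fun e he => hF e (hGF (hTr he))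
  have htree := contractibleSpace_tree _ U Tr rfl hcard hTrF hcyc
  have hdiag : ∀ j v, coc j v v = 0 := fun j v => by have := hanti j v v; omega
  let J := G \ Tr
  let K := fc U (F \ E₀) (C \ cut)
  have hKZ : K ⊆ fc U F (T \ cut) := fc_mono subset_rfl sdiff_subset (sdiff_subset_sdiff hCT subset_rfl)
  have hGK : fc U G ∅ ⊆ K := fc_mono subset_rfl sdiff_subset (empty_subset _)
  have hKF : ∀ e ∈ F \ E₀, e ⊆ U ∧ e.card = 2 := fun e he => hF e (mem_sdiff.1 he).1
  have hGU : ∀ e ∈ G, e ⊆ U ∧ e.card = 2 := fun e he => hF e (hGF he)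
  -- the two collapses
  have hout : IsHEq (geomIncl hKZ) := by
    refine hc₀.isHEq (K := fc U F (T \ cut)) (hT.mono sdiff_subset) (fun t ht => ?_)
      (fun e he => ?_) (fun e he x hx hex => ?_) ?_ hKZ
    · rw [mem_sdiff] at ht
      exact Or.inr (Or.inr (mem_sdiff.2 ⟨ht.1, fun h => ht.2 (hcut h)⟩))
    · exact Or.inr (Or.inl (hTF (edges_mono sdiff_subset he)))
    · have he2 := hE₀ e he
      rcases hx with ⟨v, -, rfl⟩ | hx | hx
      · have := card_le_card hex; simp at this; omega
      · exact Or.inl (eq_of_subset_of_card_le hex (by rw [he2, (hF x hx).2])).symm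
      · right
        rw [mem_sdiff] at hx
        refine mem_sdiff.2 ⟨hx.1, fun hxC => ?_⟩
        exact disjoint_left.1 hc₀.disjoint_edges he (mem_edges.2 ⟨x, hxC, hex, he2⟩)
    · ext x
      simp only [K, fc, Set.mem_ofPred_eq, Set.mem_sdiff, Set.mem_union, mem_coe, mem_sdiff]
      constructor
      · rintro (⟨v, hv, rfl⟩ | ⟨hx, hx'⟩ | ⟨hx, hx'⟩)
        · refine ⟨Or.inl ⟨v, hv, rfl⟩, ?_⟩
          rintro (h | h)
          · have := hT _ h.1; simp at this
          · have := hE₀ _ h; simp at this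
        · refine ⟨Or.inr (Or.inl hx), ?_⟩
          rintro (h | h)
          · have := hT _ h.1; have := (hF x hx).2; omega
          · exact hx' h
        · refine ⟨Or.inr (Or.inr ⟨hCT hx, hx'⟩), ?_⟩
          rintro (h | h)
          · exact h.2 hx
          · have := hE₀ _ h; have := hTC x hx; omega
      · rintro ⟨⟨v, hv, rfl⟩ | hx | ⟨hx, hx'⟩, h⟩
        · exact Or.inl ⟨v, hv, rfl⟩
        · exact Or.inr (Or.inl ⟨hx, fun h' => h (Or.inr h')⟩)
        · refine Or.inr (Or.inr ⟨?_, hx'⟩)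
          by_contra h'; exact h (Or.inl ⟨hx, h'⟩)
  have hinn : IsHEq (geomIncl hGK) := by
    refine hc₁.isHEq (K := K) (hTC.mono sdiff_subset) (fun t ht => Or.inr (Or.inr ht))
      (fun e he => Or.inr (Or.inl (hCF (edges_mono sdiff_subset he)))) (fun e he x hx hex => ?_)
      ?_ hGK
    · have he2 := hE₁ e he
      rcases hx with ⟨v, -, rfl⟩ | hx | hx
      · have := card_le_card hex; simp at this; omega
      · exact Or.inl (eq_of_subset_of_card_le hex (by rw [he2, (hKF x hx).2])).symm
      · exact Or.inr hx
    · ext x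
      simp only [K, fc, hGdef, Set.mem_ofPred_eq, Set.mem_sdiff, Set.mem_union, mem_coe, mem_sdiff,
        notMem_empty, or_false]
      constructor
      · rintro (⟨v, hv, rfl⟩ | ⟨hx, hx'⟩)
        · refine ⟨Or.inl ⟨v, hv, rfl⟩, ?_⟩
          rintro (h | h)
          · have := hTC _ h.1; simp at this
          · have := hE₁ _ h; simp at this
        · refine ⟨Or.inr (Or.inl hx), ?_⟩
          rintro (h | h)
          · have := hTC _ h.1; have := (hF x hx.1).2; omega
          · exact hx' h
      · rintro ⟨⟨v, hv, rfl⟩ | hx | hx, h⟩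
        · exact Or.inl ⟨v, hv, rfl⟩
        · exact Or.inr ⟨hx, fun h' => h (Or.inr h')⟩
        · exact absurd (Or.inl hx) h
  -- the cocycles
  have hcocK : ∀ j : J, CocOn K U (coc j) := fun j =>
    cocOn_of_isCocycle hKF (hTC.mono sdiff_subset) (fun t ht => hCU t (mem_sdiff.1 ht).1)
      (hanti j) (hcoc j j.2)
  have hcocG : ∀ j : J, CocOn (fc U G ∅) U (coc j) := fun j s hs => hcocK j s (hGK hs)
  have hone : ∀ s ∈ K, ∀ i j : J, i ≠ j → (∀ u ∈ s, ∀ v ∈ s, coc i u v = 0) ∨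
      ∀ u ∈ s, ∀ v ∈ s, coc j u v = 0 := by
    intro s hs
    have key : ∀ x : Finset V, (∀ j ∈ G \ Tr, j ≠ x → ∀ u ∈ s, ∀ v ∈ s, coc j u v = 0) →
        ∀ i j : J, i ≠ j → (∀ u ∈ s, ∀ v ∈ s, coc i u v = 0) ∨
          ∀ u ∈ s, ∀ v ∈ s, coc j u v = 0 := by
      intro x hx i j hij
      by_cases hi : (i : Finset V) = x
      · exact Or.inr (hx j j.2 fun h => hij (Subtype.ext (hi.trans h.symm)))
      · exact Or.inl (hx i i.2 hi)
    rcases hs with ⟨v, -, rfl⟩ | hs | hs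
    · refine key ∅ fun j _ _ u hu v hv => ?_
      rw [mem_singleton] at hu hv
      rw [hu, hv, hdiag]
    · by_cases h1 : s ∈ E₁
      · obtain ⟨t, ht, hst, -⟩ := mem_edges.1 (hc₁.subset_edges h1)
        obtain ⟨x, hx⟩ := hsingle t (mem_sdiff.1 ht).1
        exact key x fun j hj hjx u hu v hv => hx j hj hjx u (hst hu) v (hst hv)
      · refine key s fun j hj hjs u hu v hv => ?_
        by_cases huv : u = v
        · rw [huv, hdiag]
        · have : s = {u, v} := (eq_of_subset_of_card_le (insert_subset hu
            (singleton_subset_iff.2 hv)) (by rw [(hKF s hs).2, card_pair huv])).symm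
          exact hzero j hj u v (this ▸ mem_sdiff.2 ⟨hs, h1⟩) (this ▸ hjs.symm)
    · obtain ⟨x, hx⟩ := hsingle s (mem_sdiff.1 hs).1
      exact key x hx
  -- orient the edges outside of the tree
  have hor : ∀ j : J, ∃ w : Fin 2 ↪ V, univ.map w = j ∧ coc j (w 0) (w 1) = 1 := by
    intro j
    obtain ⟨a, b, hab, hj⟩ := card_eq_two.1 (hGU j (mem_sdiff.1 j.2).1).2
    rcases hunit j j.2 a b hab hj.symm with h | h
    · exact ⟨emb2 hab, by rw [map_emb2, hj], h⟩
    · refine ⟨emb2 hab.symm, by rw [map_emb2, hj, pair_comm], ?_⟩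
      have := hanti j a b
      change coc j b a = 1
      omega
  choose w hwj hw1 using hor
  have hgraph : IsHEq (bouquetMap hcocG fun s hs => hone s (hGK hs)) := by
    refine isHEq_bouquetMap_graph htree w (fun i j h => Subtype.ext ?_) (fun j k => ?_)
      (fun j => ?_) (fun e he => (hTrF e he).2) (fun x => ?_) hcocG (fun j => hanti j) hw1
      (fun j u v huv hne => hzero j j.2 u v huv (hwj j ▸ hne)) _
    · simpa only [hwj] using h
    · exact (hGU j (mem_sdiff.1 j.2).1).1 (hwj j ▸ mem_map_of_mem _ (mem_univ k))
    · rw [hwj]; exact (mem_sdiff.1 j.2).2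
    · constructor
      · intro hx
        by_cases hxT : x ∈ Tr
        · exact Or.inl hxT
        · exact Or.inr ⟨⟨x, mem_sdiff.2 ⟨hx, hxT⟩⟩, (hwj ⟨x, mem_sdiff.2 ⟨hx, hxT⟩⟩).symm⟩
      · rintro (hx | ⟨j, rfl⟩)
        · exact hTr hx
        · rw [hwj]; exact (mem_sdiff.1 j.2).1
  have hk : IsHEq (bouquetMap hcocK hone) :=
    IsHEq.of_comp_left (f := geomIncl hGK) (g := bouquetMap hcocK hone) hgraph hinn
  refine ⟨J, K, hKZ, bouquetMap hcocK hone, hout, hk, fun σ => ⟨loop σ, hloop σ σ.2⟩,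
    fun σ τ h => Subtype.ext (hinj σ.2 τ.2 (congrArg Subtype.val h)), fun σ => ?_⟩
  have hσC := hcut σ.2
  have hσF : ∀ e ∈ powersetCard 2 (σ : Finset V), e ∈ F \ E₀ := fun e he =>
    hCF (mem_edges.2 ⟨σ, hσC, mem_powersetCard.1 he⟩)
  obtain ⟨a, b, c, hab, hac, hbc, hσ⟩ := card_eq_three.1 (hTC σ hσC)
  set l : J := ⟨loop σ, hloop σ σ.2⟩
  have main : ∀ (w : Fin 3 ↪ V) (hw : univ.map w = σ), ∃ hw : ∀ i, (univ.map w).erase (w i) ∈ K,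
      ((bouquetMap hcocK hone).comp (attachMap triangleChart w hw)).Homotopic
        ((bouquetIncl l).comp (powMap (coc l (w 0) (w 1) + coc l (w 1) (w 2) +
          coc l (w 2) (w 0)))) := by
    intro w hw
    have hwK : ∀ i, (univ.map w).erase (w i) ∈ K := erase_mem_fc (hw ▸ hσF)
    refine ⟨hwK, ?_⟩
    have h1 := cocMapC_comp_attachMap_homotopic (hcocK l) (hanti l) w hwK
    have h2 : (bouquetMap hcocK hone).comp (attachMap triangleChart w hwK) =
        (bouquetIncl l).comp ((cocMapC (hcocK l)).comp (attachMap triangleChart w hwK)) := by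
      ext z : 1
      refine Subtype.ext (funext fun j => ?_)
      change cocMap U (coc j) (embCoord w (triangleChart.map (z, 0))) =
        (Pi.mulSingle l (cocMap U (coc l) (embCoord w (triangleChart.map (z, 0)))) : J → Circle) j
      by_cases hj : j = l
      · rw [hj, Pi.mulSingle_eq_same]
      · rw [Pi.mulSingle_eq_of_ne hj]
        refine cocMap_eq_one (hcocK j) (attachMap triangleChart w hwK z).2
          (fun v hv => embCoord_of_notMem w _ hv) ?_
        rw [hw]
        exact hcutz σ σ.2 j j.2 fun h => hj (Subtype.ext h)
    rw [h2]
    exact (ContinuousMap.Homotopic.refl _).comp h1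
  rcases hbd σ σ.2 a b c hab hac hbc hσ with h | h | h
  · obtain ⟨hw, hh⟩ := main (emb3 hab hac hbc) (by rw [map_emb3, hσ])
    refine ⟨_, by rw [map_emb3, hσ], hw, Or.inl ?_⟩
    rw [← h]; exact hh
  · obtain ⟨hw, hh⟩ := main (emb3 hab hac hbc) (by rw [map_emb3, hσ])
    refine ⟨_, by rw [map_emb3, hσ], hw, Or.inr ?_⟩
    rw [← h]; exact hh
  · have hswap : (univ.map (emb3 hac hab hbc.symm) : Finset V) = σ := by
      rw [map_emb3, hσ, pair_comm c b]
    obtain ⟨hw, hh⟩ := main (emb3 hac hab hbc.symm) hswap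
    refine ⟨_, hswap, hw, Or.inr ?_⟩
    have h2 : coc (loop σ) a c + coc (loop σ) c b + coc (loop σ) b a = 2 := by
      have h3 := hanti (loop σ) a b
      have h4 := hanti (loop σ) b c
      have h5 := hanti (loop σ) c a
      omega
    rw [← h2]; exact hh

end Models

/-! ### Wedges as subspaces of products -/

section WedgeProducts

variable {ι : Type*} {X : ι → Type*} {p : ∀ i, X i}

/-- The points of the product with at most one coordinate different from the base point. -/
def WedgeSub (p : ∀ i, X i) : Set (∀ i, X i) := {x | ∀ i j, i ≠ j → x i = p i ∨ x j = p j}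

theorem base_mem_wedgeSub : p ∈ WedgeSub p := fun _ _ _ => Or.inl rfl

variable [DecidableEq ι]

theorem update_mem_wedgeSub (i : ι) (x : X i) : Function.update p i x ∈ WedgeSub p := by
  intro j k hjk
  by_cases h : j = i
  · exact Or.inr (Function.update_of_ne (fun h' => hjk (h.trans h'.symm)) _ _)
  · exact Or.inl (Function.update_of_ne h _ _)

theorem eq_update_of_mem_wedgeSub {x : ∀ i, X i} (hx : x ∈ WedgeSub p) {i : ι} (hi : x i ≠ p i) :
    x = Function.update p i (x i) := by
  ext j
  by_cases h : j = i
  · subst h; simp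
  · rw [Function.update_of_ne h, (hx j i h).resolve_right hi]

variable [∀ i, TopologicalSpace (X i)]

/-- The inclusion of a piece in the wedge. -/
def wedgeIncl (p : ∀ i, X i) (i : ι) : C(X i, Wedge X p) :=
  ⟨fun x => Quotient.mk _ (Sum.inr ⟨i, x⟩),
    continuous_quotient_mk'.comp (continuous_inr.comp continuous_sigmaMk)⟩

/-- The base point of the wedge. -/
def wedgePt (p : ∀ i, X i) : Wedge X p := Quotient.mk _ (Sum.inl ())

omit [DecidableEq ι] in
theorem wedgeIncl_base (i : ι) : wedgeIncl p i (p i) = wedgePt p :=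
  Quotient.sound (Or.inr ⟨Or.inr ⟨i, rfl⟩, Or.inl rfl⟩)

omit [DecidableEq ι] in
theorem wedge_cases {P : Wedge X p → Prop} (h₀ : P (wedgePt p))
    (h : ∀ i x, P (wedgeIncl p i x)) : ∀ x, P x := by
  rintro ⟨⟨⟩ | ⟨i, x⟩⟩
  exacts [h₀, h i x]

/-- The map from the wedge to the product of the pieces. -/
def wedgeToSub (p : ∀ i, X i) : C(Wedge X p, WedgeSub p) :=
  ⟨Quotient.lift (Sum.elim (fun _ => ⟨p, base_mem_wedgeSub⟩)
      fun x => ⟨Function.update p x.1 x.2, update_mem_wedgeSub x.1 x.2⟩) (by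
    have key : ∀ x ∈ wedgeBase X p, Sum.elim (fun _ => (⟨p, base_mem_wedgeSub⟩ : WedgeSub p))
        (fun x => ⟨Function.update p x.1 x.2, update_mem_wedgeSub x.1 x.2⟩) x =
        ⟨p, base_mem_wedgeSub⟩ := by
      rintro _ (rfl | ⟨i, rfl⟩)
      · rfl
      · simp
    rintro x y (rfl | ⟨hx, hy⟩)
    · rfl
    · rw [key x hx, key y hy]), by
    refine Continuous.quotient_lift ?_ _
    refine Continuous.sumElim continuous_const (continuous_sigma fun i => ?_)
    exact (continuous_const.update i continuous_id).subtype_mk _⟩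

theorem wedgeToSub_incl (i : ι) (x : X i) :
    (wedgeToSub p (wedgeIncl p i x) : ∀ i, X i) = Function.update p i x := rfl

theorem wedgeToSub_bijective : Function.Bijective (wedgeToSub p) := by
  constructor
  · intro x y
    refine wedge_cases (P := fun x => wedgeToSub p x = wedgeToSub p y → x = y) ?_ ?_ x
    · refine wedge_cases (P := fun y => wedgeToSub p (wedgePt p) = wedgeToSub p y →
        wedgePt p = y) (fun _ => rfl) (fun i x h => ?_) y
      have h := congrFun (congrArg Subtype.val h) i
      rw [wedgeToSub_incl, Function.update_self] at h
      rw [← h]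
      exact (wedgeIncl_base i).symm
    · intro i x
      refine wedge_cases (P := fun y => wedgeToSub p (wedgeIncl p i x) = wedgeToSub p y →
        wedgeIncl p i x = y) (fun h => ?_) (fun j y h => ?_) y
      · have h := congrFun (congrArg Subtype.val h) i
        rw [wedgeToSub_incl, Function.update_self] at h
        rw [h]
        exact wedgeIncl_base i
      · have h := congrArg Subtype.val h
        rw [wedgeToSub_incl, wedgeToSub_incl] at h
        by_cases hij : i = j
        · subst hij
          rw [Function.update_injective _ _ h]
        · have h1 := congrFun h i
          have h2 := congrFun h j
          rw [Function.update_self, Function.update_of_ne hij] at h1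
          rw [Function.update_self, Function.update_of_ne (Ne.symm hij)] at h2
          rw [h1, ← h2, wedgeIncl_base, wedgeIncl_base]
  · rintro ⟨x, hx⟩
    by_cases h : ∃ i, x i ≠ p i
    · obtain ⟨i, hi⟩ := h
      exact ⟨wedgeIncl p i (x i), Subtype.ext (eq_update_of_mem_wedgeSub hx hi).symm⟩
    · push Not at h
      exact ⟨wedgePt p, Subtype.ext (funext fun i => (h i).symm)⟩

instance [Finite ι] [∀ i, CompactSpace (X i)] : CompactSpace (Wedge X p) :=
  inferInstanceAs (CompactSpace (Quotient (wedgeSetoid X p)))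

/-- A finite wedge of compact Hausdorff spaces is a subspace of the product. -/
def wedgeHomeo (p : ∀ i, X i) [Finite ι] [∀ i, CompactSpace (X i)] [∀ i, T2Space (X i)] :
    Wedge X p ≃ₜ WedgeSub p :=
  (isHomeomorph_iff_continuous_bijective.2 ⟨(wedgeToSub p).continuous,
    wedgeToSub_bijective⟩).homeomorph

omit [DecidableEq ι] in
theorem pathConnectedSpace_wedge [∀ i, PathConnectedSpace (X i)] :
    PathConnectedSpace (Wedge X p) := by
  have key : ∀ x : Wedge X p, Joined (wedgePt p) x :=
    wedge_cases (Joined.refl _) fun i x => by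
      have := (PathConnectedSpace.joined (p i) x).map (wedgeIncl p i).continuous
      rwa [wedgeIncl_base] at this
  exact ⟨⟨wedgePt p⟩, fun x y => (key x).symm.trans (key y)⟩

end WedgeProducts

/-! ### Spheres and projective planes -/

section Surfaces

open scoped unitInterval

/-- The point of the sphere with given coordinates. -/
def spherePt (x y z : ℝ) (h : x ^ 2 + y ^ 2 + z ^ 2 = 1) : Sphere2 :=
  ⟨!₂[x, y, z], by
    rw [mem_sphere_zero_iff_norm, EuclideanSpace.norm_eq, Real.sqrt_eq_one, Fin.sum_univ_three]
    simpa using h⟩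

theorem sphere_ext {x y : Sphere2} (h : ∀ k, x.1 k = y.1 k) : x = y :=
  Subtype.ext (PiLp.ext h)

theorem sphere_sum (x : Sphere2) : x.1 0 ^ 2 + x.1 1 ^ 2 + x.1 2 ^ 2 = 1 := by
  have h := x.2
  rw [mem_sphere_zero_iff_norm, EuclideanSpace.norm_eq, Real.sqrt_eq_one, Fin.sum_univ_three] at h
  simpa using h

@[simp] theorem spherePt_zero (x y z : ℝ) (h) : (spherePt x y z h).1 0 = x := rfl
@[simp] theorem spherePt_one (x y z : ℝ) (h) : (spherePt x y z h).1 1 = y := rfl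
@[simp] theorem spherePt_two (x y z : ℝ) (h) : (spherePt x y z h).1 2 = z := rfl

theorem sphere_ext_iff {x y : Sphere2} :
    x = y ↔ x.1 0 = y.1 0 ∧ x.1 1 = y.1 1 ∧ x.1 2 = y.1 2 :=
  ⟨fun h => h ▸ ⟨rfl, rfl, rfl⟩, fun h => sphere_ext fun k => by
    fin_cases k
    exacts [h.1, h.2.1, h.2.2]⟩

theorem neg_spherePt (x y z : ℝ) (h) :
    -spherePt x y z h = spherePt (-x) (-y) (-z) (by linarith) :=
  sphere_ext fun k => by fin_cases k <;> simp [spherePt]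

theorem sphere2Pt_eq : sphere2Pt = spherePt 1 0 0 (by norm_num) :=
  sphere_ext fun k => by fin_cases k <;> simp [sphere2Pt, spherePt]

theorem continuous_spherePt {X : Type*} [TopologicalSpace X] {f g h : X → ℝ} (hf : Continuous f)
    (hg : Continuous g) (hh : Continuous h) (e : ∀ x, f x ^ 2 + g x ^ 2 + h x ^ 2 = 1) :
    Continuous fun x => spherePt (f x) (g x) (h x) (e x) := by
  refine Continuous.subtype_mk ?_ _
  refine (PiLp.continuous_toLp 2 _).comp (continuous_pi fun k => ?_)
  fin_cases k
  exacts [hf, hg, hh]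

theorem circle_sum (z : Circle) : (z : ℂ).re ^ 2 + (z : ℂ).im ^ 2 = 1 := by
  have := Circle.normSq_coe z
  rw [Complex.normSq_apply] at this
  nlinarith

theorem continuous_circle_re : Continuous fun z : Circle => (z : ℂ).re :=
  Complex.continuous_re.comp continuous_subtype_val

theorem continuous_circle_im : Continuous fun z : Circle => (z : ℂ).im :=
  Complex.continuous_im.comp continuous_subtype_val

/-- Polar coordinates in the plane. -/
theorem exists_circle (x y : ℝ) :
    ∃ z : Circle, x = √(x ^ 2 + y ^ 2) * (z : ℂ).re ∧ y = √(x ^ 2 + y ^ 2) * (z : ℂ).im := by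
  by_cases h : x ^ 2 + y ^ 2 = 0
  · have hx : x = 0 := by nlinarith [sq_nonneg x, sq_nonneg y]
    have hy : y = 0 := by nlinarith [sq_nonneg x, sq_nonneg y]
    exact ⟨1, by simp [hx, hy], by simp [hx, hy]⟩
  · have h0 : 0 < x ^ 2 + y ^ 2 := lt_of_le_of_ne (by positivity) (Ne.symm h)
    set r := √(x ^ 2 + y ^ 2) with hr
    have hr0 : 0 < r := Real.sqrt_pos.2 h0
    have hr2 : r ^ 2 = x ^ 2 + y ^ 2 := Real.sq_sqrt h0.le
    refine ⟨⟨⟨x / r, y / r⟩, ?_⟩, ?_, ?_⟩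
    · rw [← SetLike.mem_coe, Submonoid.coe_unitSphere, mem_sphere_zero_iff_norm, Complex.norm_def,
        Real.sqrt_eq_one, Complex.normSq_mk]
      field_simp
      linarith
    · change x = r * (x / r)
      field_simp
    · change y = r * (y / r)
      field_simp

/-- The sphere as a disc with its boundary collapsed to the base point. -/
def sphereCell : C(Circle × I, Sphere2) :=
  ⟨fun x => spherePt (1 - 2 * x.2) (2 * √((x.2 : ℝ) * (1 - x.2)) * (x.1 : ℂ).re)
      (2 * √((x.2 : ℝ) * (1 - x.2)) * (x.1 : ℂ).im) (by
        have h0 : 0 ≤ (x.2 : ℝ) * (1 - x.2) := mul_nonneg x.2.2.1 (by linarith [x.2.2.2])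
        have h1 := Real.sq_sqrt h0
        have h2 := circle_sum x.1
        nlinarith [h1, h2]), by
    have := continuous_circle_re
    have := continuous_circle_im
    exact continuous_spherePt (by fun_prop) (by fun_prop) (by fun_prop) _⟩

theorem sphereCell_coord (z : Circle) (u : I) : (sphereCell (z, u)).1 0 = 1 - 2 * u ∧
    (sphereCell (z, u)).1 1 = 2 * √((u : ℝ) * (1 - u)) * (z : ℂ).re ∧
    (sphereCell (z, u)).1 2 = 2 * √((u : ℝ) * (1 - u)) * (z : ℂ).im := ⟨rfl, rfl, rfl⟩

theorem sphereCell_zero (z : Circle) : sphereCell (z, 0) = sphere2Pt := by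
  obtain ⟨h0, h1, h2⟩ := sphereCell_coord z 0
  rw [sphere2Pt_eq, sphere_ext_iff, h0, h1, h2]
  simp

theorem sphereCell_one (z z' : Circle) : sphereCell (z, 1) = sphereCell (z', 1) := by
  obtain ⟨h0, h1, h2⟩ := sphereCell_coord z 1
  obtain ⟨h0', h1', h2'⟩ := sphereCell_coord z' 1
  rw [sphere_ext_iff, h0, h1, h2, h0', h1', h2']
  simp

theorem sphereCell_ne {z : Circle} {u : I} (hu : 0 < u) : sphereCell (z, u) ≠ sphere2Pt := by
  rw [sphere2Pt_eq]
  intro h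
  have h1 := (sphere_ext_iff.1 h).1
  rw [(sphereCell_coord z u).1, spherePt_zero] at h1
  have hu : (0 : ℝ) < u := hu
  linarith

theorem sphereCell_inj {z z' : Circle} {u u' : I} (hu : 0 < u)
    (h : sphereCell (z, u) = sphereCell (z', u')) : u = u' ∧ (u < 1 → z = z') := by
  obtain ⟨h1, h2, h3⟩ := sphere_ext_iff.1 h
  obtain ⟨e1, e2, e3⟩ := sphereCell_coord z u
  obtain ⟨f1, f2, f3⟩ := sphereCell_coord z' u'
  rw [e1, f1] at h1
  rw [e2, f2] at h2
  rw [e3, f3] at h3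
  have huu : u = u' := Subtype.ext (by linarith)
  subst huu
  refine ⟨rfl, fun hu1 => ?_⟩
  have hu : (0 : ℝ) < u := hu
  have hu1 : (u : ℝ) < 1 := hu1
  have : 2 * √((u : ℝ) * (1 - u)) ≠ 0 := by
    have : 0 < (u : ℝ) * (1 - u) := mul_pos hu (by linarith)
    positivity
  exact Circle.ext (Complex.ext (mul_left_cancel₀ this h2) (mul_left_cancel₀ this h3))

theorem exists_sphereCell (x : Sphere2) : ∃ z u, sphereCell (z, u) = x := by
  have h := sphere_sum x
  obtain ⟨z, hz1, hz2⟩ := exists_circle (x.1 1) (x.1 2)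
  have hx1 : x.1 0 ≤ 1 := by nlinarith [sq_nonneg (x.1 1), sq_nonneg (x.1 2)]
  have hx2 : -1 ≤ x.1 0 := by nlinarith [sq_nonneg (x.1 1), sq_nonneg (x.1 2)]
  refine ⟨z, ⟨(1 - x.1 0) / 2, by linarith, by linarith⟩, ?_⟩
  have e : 2 * √((1 - x.1 0) / 2 * (1 - (1 - x.1 0) / 2)) = √(x.1 1 ^ 2 + x.1 2 ^ 2) := by
    rw [show x.1 1 ^ 2 + x.1 2 ^ 2 = 2 ^ 2 * ((1 - x.1 0) / 2 * (1 - (1 - x.1 0) / 2)) by linarith,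
      Real.sqrt_mul (by norm_num : (0 : ℝ) ≤ 2 ^ 2), Real.sqrt_sq (by norm_num)]
  obtain ⟨e1, e2, e3⟩ := sphereCell_coord z ⟨(1 - x.1 0) / 2, by linarith, by linarith⟩
  rw [sphere_ext_iff, e1, e2, e3]
  refine ⟨?_, ?_, ?_⟩
  · simp only; ring
  · simp only; rw [e]; exact hz1.symm
  · simp only; rw [e]; exact hz2.symm

theorem projPlane_mk_eq {x y : Sphere2} :
    (Quotient.mk antipodal x : ProjPlane) = Quotient.mk antipodal y ↔ x = y ∨ x = -y :=
  Quotient.eq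

instance : T2Space ProjPlane := by
  -- the projections onto the lines embed the projective plane in the space of matrices
  let f : ProjPlane → Fin 3 → Fin 3 → ℝ := Quotient.lift (fun x i j => x.1 i * x.1 j) (by
    rintro x y (rfl | rfl)
    · rfl
    · ext i j; simp)
  have hf : Continuous f := by
    refine Continuous.quotient_lift (continuous_pi fun i => continuous_pi fun j => ?_) _
    fun_prop
  refine T2Space.of_injective_continuous (f := f) ?_ hf
  rintro ⟨x⟩ ⟨y⟩ h
  have h : ∀ i j, x.1 i * x.1 j = y.1 i * y.1 j := fun i j => congrFun (congrFun h i) j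
  refine projPlane_mk_eq.2 ?_
  obtain ⟨i, hi⟩ : ∃ i, x.1 i ≠ 0 := by
    by_contra! h0
    have := sphere_sum x
    simp [h0] at this
  rcases mul_self_eq_mul_self_iff.1 (h i i) with h1 | h1
  · left
    refine sphere_ext fun j => mul_left_cancel₀ hi ?_
    rw [h i j, h1]
  · right
    refine sphere_ext fun j => mul_left_cancel₀ hi ?_
    rw [h i j, h1]
    simp

instance : PathConnectedSpace Sphere2 :=
  isPathConnected_iff_pathConnectedSpace.1
    (isPathConnected_sphere (by rw [← Module.finrank_eq_rank]; simp) 0 zero_le_one)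

/-- The equator of the projective plane, parametrized by the circle `{±z}` of antipodal pairs. -/
theorem exists_equator : ∃ g : C(Circle, ProjPlane), ∀ z : Circle, g (z ^ 2) =
    Quotient.mk antipodal (spherePt (z : ℂ).re (z : ℂ).im 0 (by
      have := circle_sum z; linarith)) := by
  let sq : C(Circle, Circle) := ⟨fun z => z ^ 2, by fun_prop⟩
  let e : C(Circle, ProjPlane) := ⟨fun z => Quotient.mk antipodal
    (spherePt (z : ℂ).re (z : ℂ).im 0 (by have := circle_sum z; linarith)),
    continuous_quotient_mk'.comp
      (continuous_spherePt continuous_circle_re continuous_circle_im continuous_const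
        fun z => by have := circle_sum z; linarith)⟩
  have hsurj : Function.Surjective sq := fun w => by
    obtain ⟨t, rfl⟩ := Circle.exp_surjective w
    refine ⟨Circle.exp (t / 2), ?_⟩
    change Circle.exp (t / 2) ^ 2 = _
    rw [← Circle.exp_natCast_mul]
    congr 1; push_cast; ring
  have hq : Topology.IsQuotientMap sq := sq.continuous.isClosedMap.isQuotientMap sq.continuous hsurj
  have hfac : Function.FactorsThrough e sq := by
    intro z z' h
    have h' : z ^ 2 = z' ^ 2 := h
    have h1 : (z : ℂ) ^ 2 = (z' : ℂ) ^ 2 := by exact_mod_cast congrArg Circle.coeHom h'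
    refine projPlane_mk_eq.2 ?_
    rcases sq_eq_sq_iff_eq_or_eq_neg.1 h1 with h2 | h2
    · left; exact sphere_ext_iff.2 (by simp [h2])
    · right; rw [neg_spherePt]; exact sphere_ext_iff.2 (by simp [h2])
  exact ⟨hq.lift e hfac, fun z => DFunLike.congr_fun (hq.lift_comp e hfac) z⟩

/-- The equator of the projective plane. -/
def equator : C(Circle, ProjPlane) := exists_equator.choose

theorem equator_sq (z : Circle) : equator (z ^ 2) =
    Quotient.mk antipodal (spherePt (z : ℂ).re (z : ℂ).im 0 (by
      have := circle_sum z; linarith)) := exists_equator.choose_spec z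

theorem exists_circle_sq (w : Circle) : ∃ z : Circle, z ^ 2 = w := by
  obtain ⟨t, rfl⟩ := Circle.exp_surjective w
  refine ⟨Circle.exp (t / 2), ?_⟩
  rw [← Circle.exp_natCast_mul]
  congr 1; push_cast; ring

theorem equator_one : equator 1 = Quotient.mk antipodal sphere2Pt := by
  have := equator_sq 1
  rw [one_pow] at this
  rw [this, sphere2Pt_eq]
  congr 1

theorem equator_injective : Function.Injective equator := by
  intro w w' h
  obtain ⟨z, rfl⟩ := exists_circle_sq w
  obtain ⟨z', rfl⟩ := exists_circle_sq w'
  rw [equator_sq, equator_sq, projPlane_mk_eq, neg_spherePt, sphere_ext_iff, sphere_ext_iff] at h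
  rcases h with ⟨h1, h2, -⟩ | ⟨h1, h2, -⟩
  · rw [Circle.ext (Complex.ext h1 h2)]
  · have : z = -z' := Circle.ext (Complex.ext h1 h2)
    rw [this, neg_sq]

/-- The upper hemisphere, parametrized by the disc. -/
def hemisphere : C(Circle × I, Sphere2) :=
  ⟨fun x => spherePt (√(1 - (x.2 : ℝ) ^ 2) * (x.1 : ℂ).re)
      (√(1 - (x.2 : ℝ) ^ 2) * (x.1 : ℂ).im) x.2 (by
        have h0 : 0 ≤ 1 - (x.2 : ℝ) ^ 2 := by nlinarith [x.2.2.1, x.2.2.2]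
        have h1 := Real.sq_sqrt h0
        have h2 := circle_sum x.1
        nlinarith [h1, h2]), by
    have := continuous_circle_re
    have := continuous_circle_im
    exact continuous_spherePt (by fun_prop) (by fun_prop) (by fun_prop) _⟩

theorem hemisphere_coord (z : Circle) (u : I) :
    (hemisphere (z, u)).1 0 = √(1 - (u : ℝ) ^ 2) * (z : ℂ).re ∧
    (hemisphere (z, u)).1 1 = √(1 - (u : ℝ) ^ 2) * (z : ℂ).im ∧
    (hemisphere (z, u)).1 2 = u := ⟨rfl, rfl, rfl⟩

/-- The projective plane as a disc attached to the circle by the squaring map. -/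
def projCell : C(Circle × I, ProjPlane) :=
  ⟨fun x => Quotient.mk antipodal (hemisphere x),
    continuous_quotient_mk'.comp hemisphere.continuous⟩

theorem projCell_apply (x : Circle × I) : projCell x = Quotient.mk antipodal (hemisphere x) := rfl

theorem projCell_zero (z : Circle) : projCell (z, 0) = equator (z ^ 2) := by
  obtain ⟨h1, h2, h3⟩ := hemisphere_coord z 0
  rw [equator_sq, projCell_apply]
  refine congrArg _ (sphere_ext_iff.2 ?_)
  rw [h1, h2, h3]
  simp

theorem projCell_one (z z' : Circle) : projCell (z, 1) = projCell (z', 1) := by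
  obtain ⟨h1, h2, h3⟩ := hemisphere_coord z 1
  obtain ⟨h1', h2', h3'⟩ := hemisphere_coord z' 1
  rw [projCell_apply, projCell_apply]
  refine congrArg _ (sphere_ext_iff.2 ?_)
  rw [h1, h2, h3, h1', h2', h3']
  simp

theorem projCell_ne {z w : Circle} {u : I} (hu : 0 < u) : projCell (z, u) ≠ equator w := by
  obtain ⟨w, rfl⟩ := exists_circle_sq w
  rw [equator_sq, projCell_apply]
  intro h
  have hu : (0 : ℝ) < u := hu
  rcases projPlane_mk_eq.1 h with h | h
  · have h3 := (sphere_ext_iff.1 h).2.2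
    rw [(hemisphere_coord z u).2.2, spherePt_two] at h3
    exact hu.ne' h3
  · rw [neg_spherePt] at h
    have h3 := (sphere_ext_iff.1 h).2.2
    rw [(hemisphere_coord z u).2.2, spherePt_two, neg_zero] at h3
    exact hu.ne' h3

theorem projCell_inj {z z' : Circle} {u u' : I} (hu : 0 < u) (hu' : 0 < u')
    (h : projCell (z, u) = projCell (z', u')) : u = u' ∧ (u < 1 → z = z') := by
  have hu : (0 : ℝ) < u := hu
  have hu' : (0 : ℝ) < u' := hu'
  obtain ⟨e1, e2, e3⟩ := hemisphere_coord z u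
  obtain ⟨f1, f2, f3⟩ := hemisphere_coord z' u'
  rcases projPlane_mk_eq.1 h with h | h
  · obtain ⟨h1, h2, h3⟩ := sphere_ext_iff.1 h
    rw [e1, f1] at h1
    rw [e2, f2] at h2
    rw [e3, f3] at h3
    have huu : u = u' := Subtype.ext h3
    subst huu
    refine ⟨rfl, fun hu1 => ?_⟩
    have hu1 : (u : ℝ) < 1 := hu1
    have : √(1 - (u : ℝ) ^ 2) ≠ 0 := by
      have : 0 < 1 - (u : ℝ) ^ 2 := by nlinarith
      positivity
    exact Circle.ext (Complex.ext (mul_left_cancel₀ this h1) (mul_left_cancel₀ this h2))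
  · have h3 : (hemisphere (z, u)).1 2 = -(hemisphere (z', u')).1 2 := (sphere_ext_iff.1 h).2.2
    rw [e3, f3] at h3
    linarith

theorem exists_projCell (x : ProjPlane) :
    (∃ w, equator w = x) ∨ ∃ z u, 0 < u ∧ projCell (z, u) = x := by
  obtain ⟨x, rfl⟩ := Quotient.exists_rep x
  have key : ∀ x : Sphere2, 0 < x.1 2 →
      ∃ z u, 0 < u ∧ projCell (z, u) = Quotient.mk antipodal x := by
    intro x hx
    have h := sphere_sum x
    obtain ⟨z, hz1, hz2⟩ := exists_circle (x.1 0) (x.1 1)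
    have hx1 : x.1 2 ≤ 1 := by nlinarith [sq_nonneg (x.1 0), sq_nonneg (x.1 1)]
    refine ⟨z, ⟨x.1 2, hx.le, hx1⟩, hx, ?_⟩
    have e : 1 - x.1 2 ^ 2 = x.1 0 ^ 2 + x.1 1 ^ 2 := by linarith
    obtain ⟨e1, e2, e3⟩ := hemisphere_coord z ⟨x.1 2, hx.le, hx1⟩
    refine congrArg _ (sphere_ext_iff.2 ?_)
    rw [e1, e2, e3]
    refine ⟨?_, ?_, rfl⟩
    · simp only; rw [e]; exact hz1.symm
    · simp only; rw [e]; exact hz2.symm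
  rcases lt_trichotomy (x.1 2) 0 with h | h | h
  · obtain ⟨z, u, hu, hzu⟩ := key (-x) (by simpa using h)
    exact Or.inr ⟨z, u, hu, hzu.trans (projPlane_mk_eq.2 (Or.inr rfl))⟩
  · left
    have hs := sphere_sum x
    obtain ⟨z, hz1, hz2⟩ := exists_circle (x.1 0) (x.1 1)
    rw [h] at hs
    rw [show x.1 0 ^ 2 + x.1 1 ^ 2 = 1 by linarith, Real.sqrt_one, one_mul] at hz1 hz2
    refine ⟨z ^ 2, ?_⟩
    rw [equator_sq]
    exact congrArg _ (sphere_ext_iff.2 ⟨hz1.symm, hz2.symm, h.symm⟩)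
  · exact Or.inr (key x h)

end Surfaces

/-! ### Attaching discs to wedges -/

section WedgeModels

open scoped unitInterval

instance (a b c : ℕ) : ∀ i, CompactSpace (Piece a b c i)
  | .inl _ => inferInstanceAs (CompactSpace Circle)
  | .inr (.inl _) => inferInstanceAs (CompactSpace Sphere2)
  | .inr (.inr _) => inferInstanceAs (CompactSpace ProjPlane)

instance (a b c : ℕ) : ∀ i, T2Space (Piece a b c i)
  | .inl _ => inferInstanceAs (T2Space Circle)
  | .inr (.inl _) => inferInstanceAs (T2Space Sphere2)
  | .inr (.inr _) => inferInstanceAs (T2Space ProjPlane)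

instance : PathConnectedSpace Circle :=
  Circle.exp_surjective.pathConnectedSpace Circle.exp.continuous

instance (a b c : ℕ) : ∀ i, PathConnectedSpace (Piece a b c i)
  | .inl _ => inferInstanceAs (PathConnectedSpace Circle)
  | .inr (.inl _) => inferInstanceAs (PathConnectedSpace Sphere2)
  | .inr (.inr _) => inferInstanceAs (PathConnectedSpace ProjPlane)

/-- The wedge of `a` circles, `b` spheres and `c` projective planes, inside their product. -/
abbrev PieceSub (a b c : ℕ) : Set (∀ i, Piece a b c i) := WedgeSub (piecePt a b c)

/-- The inclusion of a piece. -/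
def subIncl (a b c : ℕ) (i) : C(Piece a b c i, PieceSub a b c) :=
  ⟨fun x => ⟨Function.update (piecePt a b c) i x, update_mem_wedgeSub i x⟩,
    (continuous_const.update i continuous_id).subtype_mk _⟩

theorem subIncl_self (a b c : ℕ) (i) (x : Piece a b c i) : (subIncl a b c i x).1 i = x :=
  Function.update_self ..

theorem subIncl_of_ne {a b c : ℕ} {i j} (h : j ≠ i) (x : Piece a b c i) :
    (subIncl a b c i x).1 j = piecePt a b c j :=
  Function.update_of_ne h ..

theorem subIncl_base (a b c : ℕ) (i) :
    subIncl a b c i (piecePt a b c i) = ⟨piecePt a b c, base_mem_wedgeSub⟩ :=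
  Subtype.ext (Function.update_eq_self ..)

theorem eq_subIncl {a b c : ℕ} (x : PieceSub a b c) {i} (hi : x.1 i ≠ piecePt a b c i) :
    x = subIncl a b c i (x.1 i) := Subtype.ext (eq_update_of_mem_wedgeSub x.2 hi)

/-- The inclusion of a circle in the wedge. -/
def circleIncl (a b c : ℕ) (i : Fin a) : C(Circle, PieceSub a b c) := subIncl a b c (.inl i)

/-- The inclusion of a sphere in the wedge. -/
def sphereIncl (a b c : ℕ) (i : Fin b) : C(Sphere2, PieceSub a b c) :=
  subIncl a b c (.inr (.inl i))

/-- The inclusion of a projective plane in the wedge. -/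
def projIncl (a b c : ℕ) (i : Fin c) : C(ProjPlane, PieceSub a b c) :=
  subIncl a b c (.inr (.inr i))

theorem circleIncl_self (a b c : ℕ) (i) (x) : (circleIncl a b c i x).1 (.inl i) = x :=
  subIncl_self ..

theorem sphereIncl_self (a b c : ℕ) (i) (x) : (sphereIncl a b c i x).1 (.inr (.inl i)) = x :=
  subIncl_self ..

theorem projIncl_self (a b c : ℕ) (i) (x) : (projIncl a b c i x).1 (.inr (.inr i)) = x :=
  subIncl_self ..

theorem circleIncl_of_ne {a b c : ℕ} {i : Fin a} {j} (h : j ≠ .inl i) (x) :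
    (circleIncl a b c i x).1 j = piecePt a b c j := subIncl_of_ne h x

theorem projIncl_of_ne {a b c : ℕ} {i : Fin c} {j} (h : j ≠ .inr (.inr i)) (x) :
    (projIncl a b c i x).1 j = piecePt a b c j := subIncl_of_ne h x

variable {J : Type*} {a b c : ℕ}

/-- The coordinates of the map `bouquetToSub`. -/
def bouquetToFun (e : Fin a ⊕ Fin c ≃ J) (x : J → Circle) : ∀ i, Piece a 0 c i
  | .inl i => x (e (.inl i))
  | .inr (.inl k) => k.elim0
  | .inr (.inr k) => equator (x (e (.inr k)))

/-- The inclusion of the circles and of the equators of the projective planes in the wedge. -/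
def bouquetToSub (e : Fin a ⊕ Fin c ≃ J) : C(Bouquet J, PieceSub a 0 c) :=
  ⟨fun x => ⟨bouquetToFun e x, by
    rintro (i | i | i) (j | j | j) hij
    · exact x.2 _ _ fun h => hij (congrArg _ (Sum.inl.inj (e.injective h)))
    · exact j.elim0
    · refine (x.2 (e (.inl i)) (e (.inr j)) fun h => ?_).imp id fun h => ?_
      · cases e.injective h
      · exact (congrArg equator h).trans equator_one
    · exact i.elim0
    · exact i.elim0
    · exact i.elim0
    · refine (x.2 (e (.inr i)) (e (.inl j)) fun h => ?_).imp (fun h => ?_) id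
      · cases e.injective h
      · exact (congrArg equator h).trans equator_one
    · exact j.elim0
    · refine (x.2 (e (.inr i)) (e (.inr j)) fun h => hij ?_).imp (fun h => ?_) fun h => ?_
      · exact congrArg (fun k => Sum.inr (Sum.inr k)) (Sum.inr.inj (e.injective h))
      · exact (congrArg equator h).trans equator_one
      · exact (congrArg equator h).trans equator_one⟩, by
    refine Continuous.subtype_mk (continuous_pi ?_) _
    rintro (i | i | i)
    · exact (continuous_apply (e (.inl i))).comp continuous_subtype_val
    · exact i.elim0
    · exact equator.continuous.comp ((continuous_apply (e (.inr i))).comp continuous_subtype_val)⟩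

variable [DecidableEq J]

theorem bouquetToSub_incl_inl (e : Fin a ⊕ Fin c ≃ J) (i : Fin a) (z : Circle) :
    bouquetToSub e (bouquetIncl (e (.inl i)) z) = circleIncl a 0 c i z := by
  refine Subtype.ext (funext ?_)
  rintro (j | j | j)
  · by_cases h : j = i
    · subst h
      exact (Pi.mulSingle_eq_same (M := fun _ => Circle) _ _).trans (circleIncl_self ..).symm
    · refine Eq.trans ?_ (circleIncl_of_ne (by simpa using h) z).symm
      exact Pi.mulSingle_eq_of_ne (M := fun _ => Circle) (by simpa using h) _
  · exact j.elim0
  · refine Eq.trans ?_ (circleIncl_of_ne (by simp) z).symm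
    exact (congrArg equator (Pi.mulSingle_eq_of_ne (M := fun _ => Circle) (by simp) _)).trans
      equator_one

theorem bouquetToSub_incl_inr (e : Fin a ⊕ Fin c ≃ J) (i : Fin c) (z : Circle) :
    bouquetToSub e (bouquetIncl (e (.inr i)) z) = projIncl a 0 c i (equator z) := by
  refine Subtype.ext (funext ?_)
  rintro (j | j | j)
  · refine Eq.trans ?_ (projIncl_of_ne (by simp) _).symm
    exact Pi.mulSingle_eq_of_ne (M := fun _ => Circle) (by simp) _
  · exact j.elim0
  · by_cases h : j = i
    · subst h
      exact (congrArg equator (Pi.mulSingle_eq_same (M := fun _ => Circle) _ _)).trans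
        (projIncl_self ..).symm
    · refine Eq.trans ?_ (projIncl_of_ne (by simpa using h) _).symm
      exact (congrArg equator (Pi.mulSingle_eq_of_ne (M := fun _ => Circle)
        (by simpa using h) _)).trans equator_one

/-- The attaching maps of the `2`-cells of the projective planes. -/
def projAttach (e : Fin a ⊕ Fin c ≃ J) (k : Fin c) : C(Circle, Bouquet J) :=
  (bouquetIncl (e (.inr k))).comp (powMap 2)

instance [Finite J] : CompactSpace (Bouquet J) := by
  have : IsClosed (Bouquet J) := by
    simp only [Bouquet, Set.ofPred_forall]
    refine isClosed_iInter fun i => isClosed_iInter fun j => isClosed_iInter fun _ => ?_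
    exact (isClosed_eq (continuous_apply i) continuous_const).union
      (isClosed_eq (continuous_apply j) continuous_const)
  exact isCompact_iff_compactSpace.1 this.isCompact

/-- The map from the bouquet with discs attached along squares of circles to the wedge. -/
def bouquetModel (e : Fin a ⊕ Fin c ≃ J) : C(Att (projAttach e), PieceSub a 0 c) :=
  Att.lift (bouquetToSub e) (fun k => (projIncl a 0 c k).comp projCell)
    (fun k z => by
      change projIncl a 0 c k (projCell (z, 0)) = bouquetToSub e (bouquetIncl _ _)
      rw [bouquetToSub_incl_inr, projCell_zero]
      rfl)
    (fun k z z' => congrArg (projIncl a 0 c k) (projCell_one z z'))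

theorem isHomeomorph_bouquetModel [Finite J] (e : Fin a ⊕ Fin c ≃ J) :
    IsHomeomorph (bouquetModel e) := by
  have hbase : ∀ k, piecePt a 0 c (.inr (.inr k)) = equator 1 := fun k => equator_one.symm
  refine Att.isHomeomorph_lift _ _ ?_ ?_ ?_ ?_
  · intro x y h
    have h := fun i => congrFun (congrArg Subtype.val h) i
    refine Subtype.ext (funext fun j => ?_)
    obtain ⟨i | k, rfl⟩ := e.surjective j
    · exact h (.inl i)
    · exact equator_injective (h (.inr (.inr k)))
  · intro k z u hu x h
    have h := congrFun (congrArg Subtype.val h) (.inr (.inr k))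
    exact projCell_ne hu ((projIncl_self a 0 c k (projCell (z, u))).symm.trans h)
  · intro k k' z z' u u' hu hu' h
    have h := congrFun (congrArg Subtype.val h) (.inr (.inr k))
    have h1 := (projIncl_self a 0 c k (projCell (z, u))).symm.trans h
    by_cases hk : k = k'
    · subst hk
      exact ⟨rfl, projCell_inj hu hu' (h1.trans (projIncl_self a 0 c k _))⟩
    · refine absurd (h1.trans ((projIncl_of_ne (by simpa using hk) _).trans (hbase k))) ?_
      exact projCell_ne hu
  · intro y
    by_cases h : ∃ k, ∀ w, y.1 (.inr (.inr k)) ≠ equator w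
    · obtain ⟨k, hk⟩ := h
      have hy := eq_subIncl y (i := .inr (.inr k)) (by rw [hbase]; exact hk 1)
      right
      rcases exists_projCell (y.1 (.inr (.inr k))) with ⟨w, hw⟩ | ⟨z, u, -, hzu⟩
      · exact absurd hw.symm (hk w)
      · refine ⟨k, z, u, ?_⟩
        rw [hy]
        exact congrArg (projIncl a 0 c k) hzu
    · push Not at h
      choose w hw using h
      left
      refine ⟨⟨fun j => Sum.elim (fun i => y.1 (.inl i)) w (e.symm j), fun i j hij => ?_⟩, ?_⟩
      · obtain ⟨i, rfl⟩ := e.surjective i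
        obtain ⟨j, rfl⟩ := e.surjective j
        have key : ∀ i : Fin a ⊕ Fin c, y.1 (i.map id .inr) = piecePt a 0 c (i.map id .inr) →
            Sum.elim (fun i => y.1 (.inl i)) w i = (1 : Circle) := by
          rintro (i | k) h
          · exact h
          · exact equator_injective ((hw k).symm.trans (h.trans (hbase k)))
        simp only [Equiv.symm_apply_apply]
        refine (y.2 (i.map id .inr) (j.map id .inr) fun h => hij ?_).imp (key i) (key j)
        rw [Sum.map_injective.2 ⟨Function.injective_id, Sum.inr_injective⟩ h]
      · refine Subtype.ext (funext ?_)
        rintro (i | i | i)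
        · change Sum.elim (fun i => y.1 (.inl i)) w (e.symm (e (.inl i))) = _
          rw [Equiv.symm_apply_apply]; rfl
        · exact i.elim0
        · change equator (Sum.elim (fun i => y.1 (.inl i)) w (e.symm (e (.inr i)))) = _
          rw [Equiv.symm_apply_apply]; exact (hw i).symm

/-- The coordinates of the map `addSphere`. -/
def addSphereFun (x : ∀ i, Piece a b c i) : ∀ i, Piece a (b + 1) c i
  | .inl i => x (.inl i)
  | .inr (.inl k) => Fin.cases (motive := fun _ => Sphere2) sphere2Pt (fun k => x (.inr (.inl k))) k
  | .inr (.inr k) => x (.inr (.inr k))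

/-- The inclusion of a wedge in the wedge with one more sphere. -/
def addSphere (a b c : ℕ) : C(PieceSub a b c, PieceSub a (b + 1) c) :=
  ⟨fun x => ⟨addSphereFun x, by
    have key : ∀ i : Fin a ⊕ (Fin (b + 1) ⊕ Fin c),
        addSphereFun x.1 i = piecePt a (b + 1) c i ∨ ∃ i', i = i'.map id (Sum.map Fin.succ id) ∧
          (x.1 i' = piecePt a b c i' → addSphereFun x.1 i = piecePt a (b + 1) c i) := by
      rintro (i | k | k)
      · exact Or.inr ⟨.inl i, rfl, id⟩
      · refine Fin.cases (Or.inl rfl) (fun k => Or.inr ⟨.inr (.inl k), rfl, id⟩) k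
      · exact Or.inr ⟨.inr (.inr k), rfl, id⟩
    intro i j hij
    rcases key i with hi | ⟨i', rfl, hi⟩
    · exact Or.inl hi
    rcases key j with hj | ⟨j', rfl, hj⟩
    · exact Or.inr hj
    exact (x.2 i' j' fun h => hij (h ▸ rfl)).imp hi hj⟩, by
    refine Continuous.subtype_mk (continuous_pi ?_) _
    rintro (i | k | k)
    · exact (continuous_apply (A := Piece a b c) (Sum.inl i)).comp continuous_subtype_val
    · refine Fin.cases ?_ (fun k => ?_) k
      · exact continuous_const
      · exact (continuous_apply (A := Piece a b c) (Sum.inr (Sum.inl k))).comp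
          continuous_subtype_val
    · exact (continuous_apply (A := Piece a b c) (Sum.inr (Sum.inr k))).comp
        continuous_subtype_val⟩

/-- The base point of the wedge. -/
def subPt (a b c : ℕ) : PieceSub a b c := ⟨piecePt a b c, base_mem_wedgeSub⟩

theorem addSphere_base : addSphere a b c (subPt a b c) = subPt a (b + 1) c := by
  refine Subtype.ext (funext ?_)
  rintro (i | k | k)
  · rfl
  · exact Fin.cases rfl (fun _ => rfl) k
  · rfl

/-- The map from the wedge with a disc attached along a constant map. -/
def sphereModel (a b c : ℕ) :
    C(Att fun _ : Unit => ContinuousMap.const Circle (subPt a b c), PieceSub a (b + 1) c) :=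
  Att.lift (addSphere a b c) (fun _ => (sphereIncl a (b + 1) c 0).comp sphereCell)
    (fun _ z => by
      change sphereIncl a (b + 1) c 0 (sphereCell (z, 0)) =
        addSphere a b c (subPt a b c)
      rw [sphereCell_zero, addSphere_base]
      exact subIncl_base a (b + 1) c (.inr (.inl 0)))
    (fun _ z z' => congrArg (sphereIncl a (b + 1) c 0) (sphereCell_one z z'))

instance (a b c : ℕ) : CompactSpace (PieceSub a b c) :=
  (wedgeHomeo (piecePt a b c)).compactSpace

theorem isHomeomorph_sphereModel (a b c : ℕ) : IsHomeomorph (sphereModel a b c) := by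
  refine Att.isHomeomorph_lift _ _ ?_ ?_ ?_ ?_
  · intro x y h
    have h := fun i => congrFun (congrArg Subtype.val h) i
    refine Subtype.ext (funext ?_)
    rintro (i | k | k)
    exacts [h (.inl i), h (.inr (.inl k.succ)), h (.inr (.inr k))]
  · intro _ z u hu x h
    have h := congrFun (congrArg Subtype.val h) (.inr (.inl 0))
    exact sphereCell_ne hu
      ((sphereIncl_self a (b + 1) c 0 (sphereCell (z, u))).symm.trans h)
  · intro _ _ z z' u u' hu hu' h
    have h := congrFun (congrArg Subtype.val h) (.inr (.inl 0))
    exact ⟨rfl, sphereCell_inj hu (((sphereIncl_self a (b + 1) c 0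
      (sphereCell (z, u))).symm.trans h).trans (sphereIncl_self a (b + 1) c 0 _))⟩
  · intro y
    by_cases h : y.1 (.inr (.inl 0)) = sphere2Pt
    · left
      refine ⟨⟨fun i => match i with
        | .inl i => y.1 (.inl i)
        | .inr (.inl k) => y.1 (.inr (.inl k.succ))
        | .inr (.inr k) => y.1 (.inr (.inr k)), ?_⟩, ?_⟩
      · rintro (i | i | i) (j | j | j) hij
        · exact y.2 (.inl i) (.inl j) (by simpa using hij)
        · exact y.2 (.inl i) (.inr (.inl j.succ)) (by simp)
        · exact y.2 (.inl i) (.inr (.inr j)) (by simp)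
        · exact y.2 (.inr (.inl i.succ)) (.inl j) (by simp)
        · exact y.2 (.inr (.inl i.succ)) (.inr (.inl j.succ)) (by simpa using hij)
        · exact y.2 (.inr (.inl i.succ)) (.inr (.inr j)) (by simp)
        · exact y.2 (.inr (.inr i)) (.inl j) (by simp)
        · exact y.2 (.inr (.inr i)) (.inr (.inl j.succ)) (by simp)
        · exact y.2 (.inr (.inr i)) (.inr (.inr j)) (by simpa using hij)
      · refine Subtype.ext (funext ?_)
        rintro (i | k | k)
        · rfl
        · exact Fin.cases h.symm (fun _ => rfl) k
        · rfl
    · right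
      obtain ⟨z, u, hzu⟩ := exists_sphereCell (y.1 (.inr (.inl 0)))
      refine ⟨(), z, u, ?_⟩
      rw [eq_subIncl y h]
      exact congrArg (sphereIncl a (b + 1) c 0) hzu

end WedgeModels

/-! ### The homotopy type of a connected complex -/

section HomotopyType

open Finset

/-- Attaching a disc along a null-homotopic map adds a sphere to a wedge. -/
theorem nonempty_homotopyEquiv_addSphere {B : Type*} [TopologicalSpace B] {a b c : ℕ}
    {f : C(Circle, B)} (hf : f.Nullhomotopic) (hB : Nonempty (B ≃ₕ PieceSub a b c)) :
    Nonempty (Att (fun _ : Unit => f) ≃ₕ PieceSub a (b + 1) c) := by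
  obtain ⟨h⟩ := hB
  obtain ⟨y, hy⟩ := hf
  have : PathConnectedSpace (PieceSub a b c) :=
    have : PathConnectedSpace (WedgeOfPieces a b c) := pathConnectedSpace_wedge
    (wedgeHomeo (piecePt a b c)).surjective.pathConnectedSpace (wedgeHomeo _).continuous
  have h1 : (h.toFun.comp f).Homotopic (.const Circle (subPt a b c)) := by
    refine ((ContinuousMap.Homotopic.refl h.toFun).comp hy).trans ?_
    obtain ⟨γ⟩ := PathConnectedSpace.joined (h y) (subPt a b c)
    exact ⟨⟨⟨fun x => γ x.1, by fun_prop⟩, fun z => by simp, fun z => by simp⟩⟩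
  obtain ⟨e₁⟩ := (Att.isHEq_map (fun _ : Unit => f) (isHEq_toFun h)).nonempty
  obtain ⟨e₂⟩ := Att.nonempty_homotopyEquiv (f := fun _ : Unit => h.toFun.comp f) fun _ => h1
  exact ⟨(e₁.trans e₂).trans ((isHomeomorph_sphereModel a b c).homeomorph).toHomotopyEquiv⟩

variable {V : Type*} [DecidableEq V]

omit [DecidableEq V] in
theorem exists_embedding {σ : Finset V} {n : ℕ} (h : σ.card = n) :
    ∃ w : Fin n ↪ V, univ.map w = σ := by
  subst h
  refine ⟨σ.equivFin.symm.toEmbedding.trans (Function.Embedding.subtype _), ?_⟩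
  ext v
  simp only [mem_map, mem_univ, true_and, Function.Embedding.trans_apply, Equiv.coe_toEmbedding,
    Function.Embedding.subtype_apply]
  constructor
  · rintro ⟨i, rfl⟩
    exact (σ.equivFin.symm i).2
  · exact fun h => ⟨σ.equivFin ⟨v, h⟩, by simp⟩

theorem powersetCard_subset {σ : Finset V} {T F : Finset (Finset V)} (hσ : σ ∈ T)
    (hTF : edges T ⊆ F) : ∀ e ∈ powersetCard 2 σ, e ∈ F := fun _ he =>
  hTF (mem_edges.2 ⟨σ, hσ, (mem_powersetCard.1 he).1, (mem_powersetCard.1 he).2⟩)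

/-- The realization of a complex with some more triangles. -/
theorem isHomeomorph_triangles {ι : Type*} [Finite ι] {U : Finset V} {F T : Finset (Finset V)}
    (hF : ∀ e ∈ F, e.card = 2) (hT : Triangular T) {w : ι → Fin 3 ↪ V}
    (hw : Function.Injective fun i => univ.map (w i)) (hwT : ∀ i, univ.map (w i) ∉ T)
    (hK : ∀ i k, (univ.map (w i)).erase (w i k) ∈ fc U F T) {T' : Finset (Finset V)}
    (hT' : T ⊆ T') (hL : ∀ i, univ.map (w i) ∈ fc U F T')
    (hTT : ∀ t ∈ T', t ∈ T ∨ ∃ i, t = univ.map (w i)) :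
    IsHomeomorph (Att.lift (f := fun i => attachMap triangleChart (w i) (hK i))
      (geomIncl (fc_mono (subset_refl U) (subset_refl F) hT'))
      (fun i => charMap triangleChart (w i) (hL i)) (fun _ _ => rfl)
      (fun i z z' => Subtype.ext (congrArg (embCoord (w i)) (triangleChart.apex z z')))) := by
  refine isHomeomorph_att triangleChart w hw hK (fun i x hx h => ?_) _ hL fun x hx => ?_
  · have hc : (univ.map (w i)).card = 3 := by simp
    have := card_le_card h
    rcases hx with ⟨v, -, rfl⟩ | hx | hx
    · simp at this
    · have := hF x hx
      omega
    · exact hwT i ((eq_of_subset_of_card_le h (by rw [hT x hx, hc])) ▸ hx)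
  · rcases hx with hx | hx | hx
    · exact Or.inl (Or.inl hx)
    · exact Or.inl (Or.inr (Or.inl hx))
    · exact (hTT x hx).imp (fun h => Or.inr (Or.inr h)) id

/-- Adding a triangle with null-homotopic boundary adds a sphere to a wedge. -/
theorem homotopyEquiv_insert {U : Finset V} {F T : Finset (Finset V)} (hF : ∀ e ∈ F, e.card = 2)
    (hT : Triangular T) {w : Fin 3 ↪ V} (hwT : univ.map w ∉ T)
    (hK : ∀ k, (univ.map w).erase (w k) ∈ fc U F T)
    (hnull : (attachMap triangleChart w hK).Nullhomotopic) {a b c : ℕ}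
    (h : Nonempty (geom (fc U F T) ≃ₕ PieceSub a b c)) :
    Nonempty (geom (fc U F (insert (univ.map w) T)) ≃ₕ PieceSub a (b + 1) c) := by
  obtain ⟨e⟩ := nonempty_homotopyEquiv_addSphere hnull h
  have := isHomeomorph_triangles (ι := Unit) (w := fun _ => w) (T' := insert (univ.map w) T) hF hT
    (fun _ _ _ => rfl) (fun _ => hwT) (fun _ => hK) (subset_insert _ _)
    (fun _ => Or.inr (Or.inr (mem_insert_self _ _)))
    (fun t ht => (mem_insert.1 ht).elim (fun h => Or.inr ⟨(), h⟩) Or.inl)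
  exact ⟨this.homeomorph.symm.toHomotopyEquiv.trans e⟩

/-- A family of triangles of positive excess contains a triangle whose boundary is contractible in
the complex without the triangle. -/
theorem exists_triangle_nullhomotopic {T A : Finset (Finset V)} (hT : Triangular T)
    (hs : Sparse T) (hA : A ⊆ T) (hx : 1 ≤ excess A) :
    ∃ w : Fin 3 ↪ V, univ.map w ∈ T ∧ ∀ (U : Finset V) (F : Finset (Finset V)),
      (∀ t ∈ T, t ⊆ U) → edges T ⊆ F →
      ∃ hK : ∀ k, (univ.map w).erase (w k) ∈ fc U F (T.erase (univ.map w)),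
        (attachMap triangleChart w hK).Nullhomotopic := by
  obtain ⟨S, hST, σ, hσ, E, hc, hes, hcyc, hcard⟩ := exists_triangle_collapsible hT hs hA hx
  obtain ⟨w, hw⟩ := exists_embedding (hT σ (hST hσ))
  subst hw
  refine ⟨w, hST hσ, fun U F hTU hTF => ?_⟩
  have hE : E ⊆ edges S := hes ▸ hc.subset_edges
  have hsub : fc (verts S) (edges S) (S.erase (univ.map w)) ⊆ fc U F (T.erase (univ.map w)) :=
    fc_mono (biUnion_subset.2 fun t ht => hTU t (hST ht)) ((edges_mono hST).trans hTF)
      (erase_subset_erase _ hST)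
  have hK' : ∀ k, (univ.map w).erase (w k) ∈ fc (verts S) (edges S) (S.erase (univ.map w)) :=
    erase_mem_fc (powersetCard_subset hσ subset_rfl)
  refine ⟨fun k => hsub (hK' k), ?_⟩
  have hedge : ∀ e ∈ edges S, e ⊆ verts S ∧ e.card = 2 := fun e he => by
    obtain ⟨t, ht, het, hc⟩ := mem_edges.1 he
    exact ⟨het.trans (subset_biUnion_of_mem id ht), hc⟩
  have htree := contractibleSpace_tree _ (verts S) (edges S \ E) rfl hcard
    (fun e he => hedge e (mem_sdiff.1 he).1) hcyc
  have hle : fc (verts S) (edges S \ E) ∅ ⊆ fc (verts S) (edges S) (S.erase (univ.map w)) :=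
    fc_mono subset_rfl sdiff_subset (empty_subset _)
  have hT3 : Triangular (S.erase (univ.map w)) := fun t ht => hT t (hST (mem_of_mem_erase ht))
  have hcoll : IsHEq (geomIncl hle) := by
    refine hc.isHEq (K := fc (verts S) (edges S) (S.erase (univ.map w))) hT3
      (fun t ht => Or.inr (Or.inr ht)) (fun e he => Or.inr (Or.inl (hes ▸ he)))
      (fun e he x hx hex => ?_) ?_ hle
    · have he2 := (hedge e (hE he)).2
      rcases hx with ⟨v, -, rfl⟩ | hx | hx
      · have := card_le_card hex
        simp at this; omega
      · exact Or.inl (eq_of_subset_of_card_le hex (by rw [he2, (hedge x hx).2])).symm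
      · exact Or.inr hx
    · ext x
      simp only [fc, Set.mem_sdiff, Set.mem_ofPred_eq, Set.mem_union, mem_coe, mem_sdiff,
        notMem_empty, or_false]
      constructor
      · rintro (⟨v, hv, rfl⟩ | ⟨h1, h2⟩)
        · refine ⟨Or.inl ⟨v, hv, rfl⟩, ?_⟩
          rintro (h | h)
          · have := hT3 _ h
            simp at this
          · have := (hedge _ (hE h)).2
            simp at this
        · refine ⟨Or.inr (Or.inl h1), ?_⟩
          rintro (h | h)
          · have := hT3 _ h
            have := (hedge _ h1).2
            omega
          · exact h2 h
      · rintro ⟨h | h | h, hn⟩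
        · exact Or.inl h
        · exact Or.inr ⟨h, fun h' => hn (Or.inr h')⟩
        · exact absurd (Or.inl h) hn
  have hcontr : ContractibleSpace (geom (fc (verts S) (edges S) (S.erase (univ.map w)))) :=
    hcoll.nonempty.some.symm.contractibleSpace
  exact ((id_nullhomotopic _).comp_left (attachMap triangleChart w hK')).comp_right (geomIncl hsub)

theorem exists_sum_equiv {J : Type*} [Finite J] {c : ℕ} (l : Fin c → J)
    (hl : Function.Injective l) : ∃ (a : ℕ) (e : Fin a ⊕ Fin c ≃ J), ∀ k, e (.inr k) = l k := by
  classical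
  obtain ⟨a, ⟨f⟩⟩ := Finite.exists_equiv_fin ((Set.range l)ᶜ : Set J)
  exact ⟨a, ((Equiv.sumComm _ _).trans ((Equiv.ofInjective l hl).sumCongr f.symm)).trans
    (Equiv.Set.sumCompl _), fun k => rfl⟩

/-- The homotopy type when no subfamily of the triangles has positive excess. -/
theorem CoreData.homotopyEquiv {U : Finset V} {F T : Finset (Finset V)} (D : CoreData T F)
    (hF : ∀ e ∈ F, e ⊆ U ∧ e.card = 2) (hT : Triangular T) (hTF : edges T ⊆ F)
    (hTU : ∀ t ∈ T, t ⊆ U) (hcard : U.card = D.tree.card + 1) :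
    ∃ a b c : ℕ, Nonempty (geom (fc U F T) ≃ₕ PieceSub a b c) := by
  classical
  obtain ⟨J, K, hK, k, hKi, hk, loop, hloop, hdeg⟩ := D.exists_model hF hT hTF hTU hcard
  have hcutT : D.cut ⊆ T := D.cut_subset.trans D.core_subset
  choose w hwσ hw hdeg using hdeg
  -- the triangles whose boundary wraps twice around a circle
  let P : D.cut → Prop := fun σ => (k.comp (attachMap triangleChart (w σ) (hw σ))).Homotopic
    ((bouquetIncl (loop σ)).comp (powMap 2))
  obtain ⟨c, ⟨g⟩⟩ := Finite.exists_equiv_fin {σ // P σ}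
  obtain ⟨a, e, he⟩ := exists_sum_equiv (fun k => loop (g.symm k).1)
    (hloop.comp (Subtype.val_injective.comp g.symm.injective))
  let T₂ : Finset (Finset V) := (T \ D.cut) ∪ univ.image fun i => univ.map (w (g.symm i).1)
  have hF2 : ∀ e ∈ F, e.card = 2 := fun e he => (hF e he).2
  have hwT : ∀ σ, univ.map (w σ) ∈ T := fun σ => by rw [hwσ]; exact hcutT σ.2
  have hinj : Function.Injective fun σ => univ.map (w σ) := fun σ τ h => by
    simp only [hwσ] at h
    exact Subtype.ext h
  have hinj' : Function.Injective fun i => univ.map (w (g.symm i).1) :=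
    hinj.comp (Subtype.val_injective.comp g.symm.injective)
  have hT₂ : T₂ ⊆ T := union_subset sdiff_subset (image_subset_iff.2 fun i _ => hwT _)
  have h₂ : Nonempty (geom (fc U F T₂) ≃ₕ PieceSub a 0 c) := by
    have h := isHomeomorph_triangles (U := U) (T := T \ D.cut) (T' := T₂) hF2
      (fun t ht => hT t (mem_sdiff.1 ht).1)
      (w := fun i => w (g.symm i).1) hinj' (fun i h => (mem_sdiff.1 h).2 (hwσ _ ▸ (g.symm i).1.2))
      (fun i k => hK (hw _ k)) subset_union_left
      (fun i => Or.inr (Or.inr (mem_union_right _ (mem_image_of_mem _ (mem_univ i)))))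
      (fun t ht => (mem_union.1 ht).imp id fun h => by
        obtain ⟨i, -, hi⟩ := mem_image.1 h
        exact ⟨i, hi.symm⟩)
    let f : Fin c → C(Circle, geom K) := fun i => attachMap triangleChart _ (hw (g.symm i).1)
    obtain ⟨e₁⟩ := (Att.isHEq_map f hKi).nonempty
    obtain ⟨e₂⟩ := (Att.isHEq_map f hk).nonempty
    obtain ⟨e₃⟩ := Att.nonempty_homotopyEquiv (f := fun i => k.comp (f i)) (f' := projAttach e)
      fun i => by rw [projAttach, he]; exact (g.symm i).2
    have e₄ := (isHomeomorph_bouquetModel e).homeomorph.toHomotopyEquiv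
    exact ⟨h.homeomorph.symm.toHomotopyEquiv.trans
      (e₁.symm.trans (e₂.trans (e₃.trans e₄)))⟩
  -- the other triangles have null-homotopic boundary
  have hnull : ∀ σ, ¬ P σ → (attachMap triangleChart (w σ) (hw σ)).Nullhomotopic := by
    intro σ hσ
    have h0 := (hdeg σ).resolve_right hσ
    obtain ⟨k', hk', -⟩ := hk
    have h1 : (bouquetIncl (loop σ)).comp (powMap 0) =
        ContinuousMap.const Circle (bouquetIncl (loop σ) 1) := by
      ext z
      simp [powMap]
    rw [h1] at h0
    exact ⟨k' (bouquetIncl (loop σ) 1), (hk'.symm.comp (.refl _)).trans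
      ((ContinuousMap.Homotopic.refl k').comp h0)⟩
  have hadd : ∀ R : Finset D.cut, (∀ σ ∈ R, ¬ P σ) → ∃ b, Nonempty
      (geom (fc U F (T₂ ∪ R.image fun σ => univ.map (w σ))) ≃ₕ PieceSub a b c) := by
    intro R
    induction R using Finset.induction_on with
    | empty => intro _; exact ⟨0, by rwa [image_empty, union_empty]⟩
    | insert σ R hσR ih =>
      intro hR
      obtain ⟨b, hb⟩ := ih fun τ hτ => hR τ (mem_insert_of_mem hτ)
      have hsub : T₂ ∪ R.image (fun σ => univ.map (w σ)) ⊆ T :=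
        union_subset hT₂ (image_subset_iff.2 fun τ _ => hwT _)
      have hle : K ⊆ fc U F (T₂ ∪ R.image fun σ => univ.map (w σ)) :=
        hK.trans (fc_mono subset_rfl subset_rfl (subset_union_left.trans subset_union_left))
      have hPσ := hR σ (mem_insert_self _ _)
      have := homotopyEquiv_insert (w := w σ) hF2 (hT.mono hsub) (fun h => ?_)
        (fun k => hle (hw σ k)) ((hnull σ hPσ).comp_right (geomIncl hle)) hb
      · refine ⟨b + 1, ?_⟩
        rwa [image_insert, union_insert]
      · rcases mem_union.1 h with h | h
        · rcases mem_union.1 h with h | h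
          · exact (mem_sdiff.1 h).2 (hwσ σ ▸ σ.2)
          · obtain ⟨i, -, hi⟩ := mem_image.1 h
            exact hPσ (hinj hi ▸ (g.symm i).2)
        · obtain ⟨τ, hτ, h⟩ := mem_image.1 h
          exact hσR (hinj h ▸ hτ)
  obtain ⟨b, hb⟩ := hadd (univ.filter fun σ => ¬ P σ) fun σ hσ => (mem_filter.1 hσ).2
  refine ⟨a, b, c, ?_⟩
  suffices h : T₂ ∪ (univ.filter fun σ => ¬ P σ).image (fun σ => univ.map (w σ)) = T by
    rwa [h] at hb
  refine subset_antisymm (union_subset hT₂ (image_subset_iff.2 fun τ _ => hwT _)) fun t ht => ?_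
  by_cases htc : t ∈ D.cut
  · by_cases hPt : P ⟨t, htc⟩
    · refine mem_union_left _ (mem_union_right _ (mem_image.2 ⟨g ⟨⟨t, htc⟩, hPt⟩, mem_univ _, ?_⟩))
      rw [Equiv.symm_apply_apply, hwσ]
    · exact mem_union_right _ (mem_image.2 ⟨⟨t, htc⟩, by simpa using hPt, hwσ _⟩)
  · exact mem_union_left _ (mem_union_left _ (mem_sdiff.2 ⟨ht, htc⟩))

/-- A connected sparse complex is homotopy equivalent to a wedge of circles, spheres and projective
planes. -/
theorem exists_homotopyEquiv {U : Finset V} {F : Finset (Finset V)} (hU : U.Nonempty)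
    (hF : ∀ e ∈ F, e ⊆ U ∧ e.card = 2) (hconn : ConnGraph U F) : ∀ {T : Finset (Finset V)},
    Triangular T → Sparse T → edges T ⊆ F → (∀ t ∈ T, t ⊆ U) →
    ∃ a b c : ℕ, Nonempty (geom (fc U F T) ≃ₕ PieceSub a b c) := by
  intro T
  induction T using Finset.strongInduction with
  | H T ih =>
    intro hT hs hTF hTU
    by_cases hx : ∀ A ⊆ T, excess A ≤ 0
    · obtain ⟨D⟩ := exists_coreData hT hs hx hTF
      have h1 := card_le_rk_add_one hF hconn
      have h2 := rk_add_one_le hU hF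
      have h3 := D.cyc_tree
      have h4 : rk D.tree = rk F := by rw [rk, rk, D.spn_tree]
      refine D.homotopyEquiv hF hT hTF hTU ?_
      rw [cyc] at h3
      omega
    · push Not at hx
      obtain ⟨A, hA, hx⟩ := hx
      obtain ⟨w, hwT, hw⟩ := exists_triangle_nullhomotopic hT hs hA hx
      obtain ⟨hK, hnull⟩ := hw U F hTU hTF
      have hsub := erase_subset (univ.map w) T
      obtain ⟨a, b, c, h⟩ := ih _ (erase_ssubset hwT) (hT.mono hsub) (hs.mono hsub)
        ((edges_mono hsub).trans hTF) fun t ht => hTU t (hsub ht)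
      refine ⟨a, b + 1, c, ?_⟩
      have := homotopyEquiv_insert (fun e he => (hF e he).2) (hT.mono hsub)
        (notMem_erase _ _) hK hnull h
      rwa [insert_erase hwT] at this

end HomotopyType

/-! ### Paths in a space with cones attached -/

section Paths

open scoped unitInterval

variable {X Y : Type*} [TopologicalSpace X] [TopologicalSpace Y]

/-- The homotopy classes of paths from `x` to `y`. -/
abbrev PathClass (x y : X) : Type _ := Path.Homotopic.Quotient x y

theorem PathClass.trans_symm_trans {x y z : X} (p : PathClass x y) (q : PathClass x z) :
    p.trans (p.symm.trans q) = q := by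
  rw [← Path.Homotopic.Quotient.trans_assoc, Path.Homotopic.Quotient.trans_symm, Path.Homotopic.Quotient.refl_trans]

theorem PathClass.symm_trans_trans {x y z : X} (p : PathClass x y) (q : PathClass y z) :
    p.symm.trans (p.trans q) = q := by
  rw [← Path.Homotopic.Quotient.trans_assoc, Path.Homotopic.Quotient.symm_trans, Path.Homotopic.Quotient.refl_trans]

theorem PathClass.symm_trans_rev {x y z : X} (p : PathClass x y) (q : PathClass y z) :
    (p.trans q).symm = q.symm.trans p.symm := by
  induction p using Path.Homotopic.Quotient.ind with | mk p =>
  induction q using Path.Homotopic.Quotient.ind with | mk q =>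
  rw [← Path.Homotopic.Quotient.mk_trans, ← Path.Homotopic.Quotient.mk_symm, Path.trans_symm, Path.Homotopic.Quotient.mk_trans,
    Path.Homotopic.Quotient.mk_symm, Path.Homotopic.Quotient.mk_symm]

theorem PathClass.conj_eq {a a' x x' y y' : X} (τ : PathClass a x) (τ' : PathClass a' x')
    {p : PathClass x x'} {d : PathClass x y} {d' : PathClass x' y'} {q : PathClass y y'}
    (h : p.trans d' = d.trans q) :
    τ.trans (p.trans τ'.symm) = (τ.trans d).trans (q.trans (τ'.trans d').symm) := by
  rw [PathClass.symm_trans_rev, Path.Homotopic.Quotient.trans_assoc,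
    ← Path.Homotopic.Quotient.trans_assoc d, ← h, Path.Homotopic.Quotient.trans_assoc p,
    PathClass.trans_symm_trans]

theorem PathClass.map_trans {x y z : X} (p : PathClass x y) (q : PathClass y z) (f : C(X, Y)) :
    (p.trans q).map f = (p.map f).trans (q.map f) := by
  induction p using Path.Homotopic.Quotient.ind with | mk p =>
  induction q using Path.Homotopic.Quotient.ind with | mk q =>
  rw [← Path.Homotopic.Quotient.mk_trans, ← Path.Homotopic.Quotient.mk_map, Path.map_trans,
    Path.Homotopic.Quotient.mk_trans]
  rfl

/-- A property of path classes that is compatible with composition holds for all path classes if it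
holds for the paths inside the members of an open cover. -/
theorem PathClass.induction {P : ∀ {x y : X}, PathClass x y → Prop}
    (htrans : ∀ {x y z : X} (p : PathClass x y) (q : PathClass y z), P p → P q → P (p.trans q))
    {ι : Type*} (U : ι → Set X) (hU : ∀ i, IsOpen (U i)) (hcov : ∀ x, ∃ i, x ∈ U i)
    (h : ∀ i {x y : X} (γ : Path x y), (∀ t, γ t ∈ U i) → P (Path.Homotopic.Quotient.mk γ)) {x y : X}
    (p : PathClass x y) : P p := by
  induction p using Path.Homotopic.Quotient.ind with | mk γ =>
  obtain ⟨t, ht0, hmono, ⟨n, hn⟩, ht⟩ := exists_monotone_Icc_subset_open_cover_unitInterval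
    (c := fun i => γ ⁻¹' U i) (fun i => (hU i).preimage γ.continuous) (fun s _ => by
      obtain ⟨i, hi⟩ := hcov (γ s)
      exact Set.mem_iUnion.2 ⟨i, hi⟩)
  have key : ∀ k, P (Path.Homotopic.Quotient.mk (γ.subpath 0 (t k))) := by
    intro k
    induction k with
    | zero =>
      rw [ht0, Path.subpath_self]
      obtain ⟨i, hi⟩ := hcov (γ 0)
      exact h i _ fun _ => hi
    | succ k ih =>
      have h1 := Path.Homotopic.Quotient.eq.2 ⟨Path.Homotopy.subpathTransSubpath γ 0 (t k) (t (k + 1))⟩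
      rw [← h1, Path.Homotopic.Quotient.mk_trans]
      refine htrans _ _ ih ?_
      obtain ⟨i, hi⟩ := ht k
      refine h i _ fun s => ?_
      have hs : γ.subpath (t k) (t (k + 1)) s ∈ Set.range (γ.subpath (t k) (t (k + 1))) := ⟨s, rfl⟩
      rw [Path.range_subpath_of_le _ _ _ (hmono k.le_succ)] at hs
      obtain ⟨r, hr, hrs⟩ := hs
      rw [← hrs]
      exact hi hr
  have h1 := key n
  rw [hn n le_rfl, Path.subpath_zero_one, Path.Homotopic.Quotient.mk_cast] at h1
  have hcast : ∀ {a b a' b' : X} (q : PathClass a b) (ha : a' = a) (hb : b' = b),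
      P (q.cast ha hb) → P q := by
    rintro a b _ _ q rfl rfl hq
    rwa [Path.Homotopic.Quotient.cast_rfl_rfl] at hq
  exact hcast _ _ _ h1

/-- Two ways along a map of the interval are homotopic. -/
theorem PathClass.trans_eq_of_interval (g : C(I, X)) {x y z : X} {p : Path x y} {q : Path y z}
    {r : Path x z} {u v w : I} (α : Path u v) (β : Path v w) (γ : Path u w)
    (hp : ∀ t, p t = g (α t)) (hq : ∀ t, q t = g (β t)) (hr : ∀ t, r t = g (γ t)) :
    (Path.Homotopic.Quotient.mk p).trans (Path.Homotopic.Quotient.mk q) = Path.Homotopic.Quotient.mk r := by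
  obtain rfl : x = g u := by simpa using hp 0
  obtain rfl : y = g v := by simpa using hp 1
  obtain rfl : z = g w := by simpa using hq 1
  obtain rfl : p = α.map g.continuous := Path.ext (funext hp)
  obtain rfl : q = β.map g.continuous := Path.ext (funext hq)
  obtain rfl : r = γ.map g.continuous := Path.ext (funext hr)
  rw [← Path.Homotopic.Quotient.mk_trans, ← Path.map_trans]
  have : ContractibleSpace I := (convex_Icc (0 : ℝ) 1).contractibleSpace ⟨0, by simp⟩
  exact Path.Homotopic.Quotient.eq.2 ((SimplyConnectedSpace.paths_homotopic _ _).map g)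

theorem PathClass.cast_trans_cast_symm {x y x' y' : X} (p : PathClass x y) (hx : x = x')
    (hy : y = y') : ((Path.Homotopic.Quotient.refl x').cast rfl hx).trans
      (p.trans ((Path.Homotopic.Quotient.refl y').cast rfl hy).symm) = p.cast hx.symm hy.symm := by
  subst hx hy
  simp only [Path.Homotopic.Quotient.cast_rfl_rfl, Path.Homotopic.Quotient.refl_trans]
  rw [← Path.Homotopic.Quotient.mk_refl, ← Path.Homotopic.Quotient.mk_symm, Path.refl_symm, Path.Homotopic.Quotient.mk_refl, Path.Homotopic.Quotient.trans_refl]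

end Paths

namespace Att

open scoped unitInterval

variable {J S B Y : Type*} [TopologicalSpace S] [TopologicalSpace B] [TopologicalSpace Y]
  {f : J → C(S, B)}

/-- The map of `Att f` to itself that reparametrizes the cells by a family of maps of the
interval. -/
def deform (f : J → C(S, B)) (φ : C(I × I, I)) (h₀ : ∀ t, φ (t, 0) = 0) (h₁ : ∀ t, φ (t, 1) = 1) :
    C(I × Att f, Att f) :=
  (lift (f := f) ((inl f).comp .fst : C(B × I, Att f)).curry
    (fun j => (⟨fun x => cell f j (x.1.1, φ (x.2, x.1.2)), by fun_prop⟩ :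
      C((S × I) × I, Att f)).curry)
    (fun j s => by ext t; simp [h₀]) (fun j s s' => by
      ext t
      simp only [ContinuousMap.curry_apply, ContinuousMap.coe_mk, h₁]
      exact cell_one j s s')).uncurry.comp .prodSwap

variable {φ : C(I × I, I)} (h₀ : ∀ t, φ (t, 0) = 0) (h₁ : ∀ t, φ (t, 1) = 1)

theorem deform_cell (t : I) (j : J) (s : S) (u : I) :
    deform f φ h₀ h₁ (t, cell f j (s, u)) = cell f j (s, φ (t, u)) := rfl

/-- The end of the deformation. -/
def deformEnd (f : J → C(S, B)) (φ : C(I × I, I)) (h₀ : ∀ t, φ (t, 0) = 0)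
    (h₁ : ∀ t, φ (t, 1) = 1) : C(Att f, Att f) :=
  (deform f φ h₀ h₁).comp (.prodMk (.const _ 1) (.id _))

theorem deformEnd_cell (j : J) (s : S) (u : I) :
    deformEnd f φ h₀ h₁ (cell f j (s, u)) = cell f j (s, φ (1, u)) := rfl

theorem deform_start (h : ∀ u, φ (0, u) = u) :
    ∀ x : Att f, deform f φ h₀ h₁ (0, x) = x :=
  cases (fun _ => rfl) (fun j s u => by rw [deform_cell, h])

/-- The track of a point under the deformation. -/
def track (h : ∀ u, φ (0, u) = u) (x : Att f) : Path x (deformEnd f φ h₀ h₁ x) where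
  toFun t := deform f φ h₀ h₁ (t, x)
  continuous_toFun := by fun_prop
  source' := deform_start h₀ h₁ h x
  target' := rfl

theorem mk_trans_track (h : ∀ u, φ (0, u) = u) {x y : Att f} (p : Path x y) :
    (Path.Homotopic.Quotient.mk p).trans (Path.Homotopic.Quotient.mk (track h₀ h₁ h y)) =
      (Path.Homotopic.Quotient.mk (track h₀ h₁ h x)).trans
        (Path.Homotopic.Quotient.mk (p.map (deformEnd f φ h₀ h₁).continuous)) := by
  let F : (ContinuousMap.id (Att f)).Homotopy (deformEnd f φ h₀ h₁) :=
    { toContinuousMap := deform f φ h₀ h₁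
      map_zero_left := deform_start h₀ h₁ h
      map_one_left := fun _ => rfl }
  have := Path.Homotopic.Quotient.eq.2 (Path.Homotopic.map_trans_evalAt F p)
  rw [Path.Homotopic.Quotient.mk_trans, Path.Homotopic.Quotient.mk_trans] at this
  exact this

/-- The radial path in a cell, from the base to the point with parameter `u`. -/
def radial (f : J → C(S, B)) (j : J) (s : S) (u : I) : Path (inl f (f j s)) (cell f j (s, u)) where
  toFun t := cell f j (s, t * u)
  continuous_toFun := by fun_prop
  source' := by simp
  target' := by simp

/-- The path through the apex of a cell. -/
def apexPath (f : J → C(S, B)) (j : J) (s s' : S) : Path (inl f (f j s)) (inl f (f j s')) :=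
  (radial f j s 1).trans ((radial f j s' 1).symm.cast (cell_one j s s') rfl)

/-- The standard path classes from the base to the points of `Att f`. -/
inductive Tame (f : J → C(S, B)) : ∀ {b : B} {x : Att f}, PathClass (inl f b) x → Prop
  | base (b : B) : Tame f (.refl (inl f b))
  | radial (j : J) (s : S) (u : I) : Tame f (.mk (Att.radial f j s u))

theorem exists_tame (x : Att f) : ∃ (b : B) (τ : PathClass (inl f b) x), Tame f τ :=
  cases (P := fun x => ∃ (b : B) (τ : PathClass (inl f b) x), Tame f τ)
    (fun b => ⟨b, _, .base b⟩) (fun j s u => ⟨_, _, .radial j s u⟩) x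

/-- The height of a point above the base. -/
def height (f : J → C(S, B)) : C(Att f, I) :=
  lift (.const B 0) (fun _ => .snd) (fun _ _ => rfl) (fun _ _ _ => rfl)

/-- The part of the `j`-th cell above height `1/3`. -/
def upper (f : J → C(S, B)) (j : J) : Set (Att f) :=
  {x | Quot.lift (Sum.elim (fun _ => False) fun y => y.1 = j ∧ 1 / 3 < (y.2.2 : ℝ)) (by
    rintro _ _ (⟨j', s⟩ | ⟨j', s, s'⟩)
    · simp
    · rfl) x}

theorem isOpen_upper (j : J) : IsOpen (upper f j) := by
  refine isOpen_coinduced.2 (isOpen_sum_iff.2 ⟨?_, isOpen_sigma_iff.2 fun j' => ?_⟩)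
  · convert isOpen_empty
    ext b
    exact Iff.rfl
  · by_cases h : j' = j
    · have : IsOpen {y : S × I | 1 / 3 < (y.2 : ℝ)} := isOpen_lt (by fun_prop) (by fun_prop)
      convert this using 1
      ext y
      exact ⟨fun h => h.2, fun h' => ⟨h, h'⟩⟩
    · convert isOpen_empty
      ext y
      exact ⟨fun h' => h h'.1, False.elim⟩

open Classical in
/-- A normal form for the points of `Att f`. -/
def normalForm [Nonempty S] (f : J → C(S, B)) : Att f → B ⊕ (J × S × I) :=
  Quot.lift (Sum.elim .inl fun y => if y.2.2 = 0 then .inl (f y.1 y.2.1)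
    else if y.2.2 = 1 then .inr (y.1, Classical.arbitrary S, 1) else .inr (y.1, y.2)) (by
    rintro _ _ (⟨j', s⟩ | ⟨j', s, s'⟩)
    · simp
    · simp)

theorem inl_injective [Nonempty S] : Function.Injective (inl f) := fun _ _ h =>
  Sum.inl_injective (congrArg (normalForm f) h)

theorem isClosedEmbedding_inl [Nonempty S] [CompactSpace S] [T2Space B] :
    Topology.IsClosedEmbedding (inl f) := by
  refine .of_continuous_injective_isClosedMap (inl f).continuous inl_injective fun C hC => ?_
  refine isClosed_coinduced.2 (isClosed_sum_iff.2 ⟨?_, isClosed_sigma_iff.2 fun j => ?_⟩)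
  · convert hC
    ext b
    exact ⟨fun ⟨b', hb', h⟩ => inl_injective h ▸ hb', fun h => ⟨b, h, rfl⟩⟩
  · have : IsClosed {y : S × I | y.2 = 0 ∧ f j y.1 ∈ C} :=
      (isClosed_eq (by fun_prop) (by fun_prop)).inter (hC.preimage (by fun_prop))
    convert this using 1
    ext ⟨s, u⟩
    constructor
    · rintro ⟨b, hb, h⟩
      have h : inl f b = cell f j (s, u) := h
      have hu : (0 : I) = u := congrArg (height f) h
      subst hu
      rw [cell_zero] at h
      exact ⟨rfl, inl_injective h ▸ hb⟩
    · rintro ⟨h, h'⟩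
      obtain rfl : u = 0 := h
      exact ⟨_, h', (cell_zero j s).symm⟩

/-- The function of `u` that pushes everything below `2/3` to the base. -/
def pushDown : C(I × I, I) :=
  ⟨fun x => Set.projIcc 0 1 zero_le_one
    ((1 - (x.1 : ℝ)) * x.2 + x.1 * max 0 (3 * (x.2 : ℝ) - 2)), by fun_prop⟩

/-- The function of `u` that pushes everything above `1/3` to the apex. -/
def pushUp : C(I × I, I) :=
  ⟨fun x => Set.projIcc 0 1 zero_le_one
    ((1 - (x.1 : ℝ)) * x.2 + x.1 * min 1 (3 * (x.2 : ℝ))), by fun_prop⟩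

theorem pushDown_zero (t : I) : pushDown (t, 0) = 0 := by simp [pushDown]

theorem pushDown_one (t : I) : pushDown (t, 1) = 1 := by
  have : (1 - (t : ℝ)) * 1 + t * max 0 (3 * 1 - 2) = 1 := by norm_num
  simp [pushDown]; norm_num

theorem pushDown_start (u : I) : pushDown (0, u) = u := by simp [pushDown]

theorem pushDown_end {u : I} (h : (u : ℝ) < 2 / 3) : pushDown (1, u) = 0 := by
  simp [pushDown, max_eq_left (show 3 * (u : ℝ) - 2 ≤ 0 by linarith)]

theorem pushUp_zero (t : I) : pushUp (t, 0) = 0 := by simp [pushUp]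

theorem pushUp_one (t : I) : pushUp (t, 1) = 1 := by
  simp [pushUp]

theorem pushUp_start (u : I) : pushUp (0, u) = u := by simp [pushUp]

theorem pushUp_end {u : I} (h : 1 / 3 < (u : ℝ)) : pushUp (1, u) = 1 := by
  simp [pushUp, min_eq_left (show 1 ≤ 3 * (u : ℝ) by linarith)]

/-- The straight path in the interval. -/
def straight (u : I) : Path (0 : I) u where
  toFun t := t * u
  continuous_toFun := by fun_prop
  source' := by simp
  target' := by simp

theorem Tame.trans_pushDown {b : B} {x : Att f} {τ : PathClass (inl f b) x} (hτ : Tame f τ)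
    (hx : (height f x : ℝ) < 2 / 3) :
    ∃ e : deformEnd f pushDown pushDown_zero pushDown_one x = inl f b,
      τ.trans (Path.Homotopic.Quotient.mk (track pushDown_zero pushDown_one pushDown_start x)) =
        (Path.Homotopic.Quotient.refl (inl f b)).cast rfl e := by
  cases hτ with
  | base b =>
    refine ⟨rfl, ?_⟩
    rw [Path.Homotopic.Quotient.refl_trans]
    exact congrArg Path.Homotopic.Quotient.mk (Path.ext (funext fun t => rfl))
  | radial j s u =>
    have hx : (u : ℝ) < 2 / 3 := hx
    have e : deformEnd f pushDown pushDown_zero pushDown_one (cell f j (s, u)) =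
        inl f (f j s) := by rw [deformEnd_cell, pushDown_end hx, cell_zero]
    refine ⟨e, ?_⟩
    rw [← Path.Homotopic.Quotient.mk_refl, ← Path.Homotopic.Quotient.mk_cast]
    let β : Path u 0 := ⟨⟨fun t => pushDown (t, u), by fun_prop⟩, pushDown_start u,
      pushDown_end hx⟩
    exact PathClass.trans_eq_of_interval ⟨fun u => cell f j (s, u), by fun_prop⟩ (straight u) β
      (Path.refl 0) (fun t => rfl) (fun t => rfl) (fun t => (cell_zero j s).symm)

theorem Tame.trans_pushUp {b : B} {x : Att f} {τ : PathClass (inl f b) x} (hτ : Tame f τ) {j : J}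
    (hx : x ∈ upper f j) :
    ∃ (s : S) (hb : b = f j s)
      (e : deformEnd f pushUp pushUp_zero pushUp_one x = cell f j (s, 1)),
      τ.trans (Path.Homotopic.Quotient.mk (track pushUp_zero pushUp_one pushUp_start x)) =
        (Path.Homotopic.Quotient.mk (Att.radial f j s 1)).cast (congrArg _ hb) e := by
  cases hτ with
  | base b => exact hx.elim
  | radial j' s u =>
    obtain ⟨rfl, hx⟩ : j' = j ∧ 1 / 3 < (u : ℝ) := hx
    have e : deformEnd f pushUp pushUp_zero pushUp_one (cell f j' (s, u)) =
        cell f j' (s, 1) := by rw [deformEnd_cell, pushUp_end hx]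
    refine ⟨s, rfl, e, ?_⟩
    rw [← Path.Homotopic.Quotient.mk_cast]
    let β : Path u 1 := ⟨⟨fun t => pushUp (t, u), by fun_prop⟩, pushUp_start u, pushUp_end hx⟩
    exact PathClass.trans_eq_of_interval ⟨fun u => cell f j' (s, u), by fun_prop⟩ (straight u) β
      (straight 1) (fun t => rfl) (fun t => rfl) (fun t => rfl)

/-- The path classes in `Att f` between points of the base are generated by the paths in the base
and the paths through the apexes of the cells. -/
theorem pathClass_induction [Nonempty S] [CompactSpace S] [T2Space B]
    {H : ∀ {b b' : B}, PathClass (inl f b) (inl f b') → Prop}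
    (htrans : ∀ {b₁ b₂ b₃ : B} (p : PathClass (inl f b₁) (inl f b₂))
      (q : PathClass (inl f b₂) (inl f b₃)), H p → H q → H (p.trans q))
    (hbase : ∀ {b b' : B} (q : Path b b'), H (.mk (q.map (inl f).continuous)))
    (hapex : ∀ j s s', H (.mk (apexPath f j s s'))) {b b' : B}
    (p : PathClass (inl f b) (inl f b')) : H p := by
  suffices h : ∀ {x y : Att f} (p : PathClass x y) {b b' : B} (τ : PathClass (inl f b) x)
      (τ' : PathClass (inl f b') y), Tame f τ → Tame f τ' → H (τ.trans (p.trans τ'.symm)) by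
    have := h p _ _ (.base b) (.base b')
    rwa [Path.Homotopic.Quotient.refl_trans, ← Path.Homotopic.Quotient.mk_refl, ← Path.Homotopic.Quotient.mk_symm, Path.refl_symm,
      Path.Homotopic.Quotient.mk_refl, Path.Homotopic.Quotient.trans_refl] at this
  intro x y p
  refine PathClass.induction (P := fun {x y} p => ∀ {b b' : B} (τ : PathClass (inl f b) x)
      (τ' : PathClass (inl f b') y), Tame f τ → Tame f τ' → H (τ.trans (p.trans τ'.symm)))
    (fun {x y z} p q hp hq b b' τ τ' hτ hτ' => ?_)
    (fun i : Option J => i.elim {x | (height f x : ℝ) < 2 / 3} (upper f)) ?_ ?_ ?_ p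
  · obtain ⟨c, ρ, hρ⟩ := exists_tame y
    have := htrans _ _ (hp τ ρ hτ hρ) (hq ρ τ' hρ hτ')
    have e : (τ.trans (p.trans ρ.symm)).trans (ρ.trans (q.trans τ'.symm)) =
        τ.trans ((p.trans q).trans τ'.symm) := by
      rw [Path.Homotopic.Quotient.trans_assoc, Path.Homotopic.Quotient.trans_assoc, PathClass.symm_trans_trans,
        Path.Homotopic.Quotient.trans_assoc]
    rwa [e] at this
  · rintro (_ | j)
    · exact isOpen_lt (by fun_prop) (by fun_prop)
    · exact isOpen_upper j
  · refine cases (fun b => ⟨none, ?_⟩) (fun j s u => ?_)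
    · change ((0 : I) : ℝ) < 2 / 3
      norm_num
    · by_cases h : (u : ℝ) < 2 / 3
      · exact ⟨none, h⟩
      · exact ⟨some j, rfl, by change 1 / 3 < (u : ℝ); linarith⟩
  · rintro (_ | j) x y γ hγ b b' τ τ' hτ hτ'
    · have hγ : ∀ t, (height f (γ t) : ℝ) < 2 / 3 := hγ
      obtain ⟨e, he⟩ := hτ.trans_pushDown (by simpa using hγ 0)
      obtain ⟨e', he'⟩ := hτ'.trans_pushDown (by simpa using hγ 1)
      let D : C(Att f, Att f) := deformEnd f pushDown pushDown_zero pushDown_one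
      have h2 : τ.trans ((Path.Homotopic.Quotient.mk γ).trans τ'.symm) =
          (Path.Homotopic.Quotient.mk (γ.map D.continuous)).cast e.symm e'.symm := by
        rw [PathClass.conj_eq τ τ' (mk_trans_track pushDown_zero pushDown_one pushDown_start γ),
          he, he']
        exact PathClass.cast_trans_cast_symm _ e e'
      rw [h2, ← Path.Homotopic.Quotient.mk_cast]
      -- the deformed path lies in the base
      have h3 : ∀ t, ∃ b, inl f b = D (γ t) := by
        intro t
        obtain ⟨b, ρ, hρ⟩ := exists_tame (γ t)
        obtain ⟨e, -⟩ := hρ.trans_pushDown (hγ t)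
        exact ⟨b, e.symm⟩
      choose q hq using h3
      have hemb := isClosedEmbedding_inl (f := f)
      let q' : Path b b' := ⟨⟨q, by
          rw [hemb.isInducing.continuous_iff, show inl f ∘ q = fun t => D (γ t) from funext hq]
          fun_prop⟩,
        inl_injective (by simpa using (hq 0).trans ((congrArg D γ.source).trans e)),
        inl_injective (by simpa using (hq 1).trans ((congrArg D γ.target).trans e'))⟩
      have h4 : (γ.map D.continuous).cast e.symm e'.symm = q'.map (inl f).continuous :=
        Path.ext (funext fun t => (hq t).symm)
      rw [h4]
      exact hbase q'
    · have hγ : ∀ t, γ t ∈ upper f j := hγ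
      obtain ⟨s, rfl, e, he⟩ := hτ.trans_pushUp (by simpa using hγ 0)
      obtain ⟨s', rfl, e', he'⟩ := hτ'.trans_pushUp (by simpa using hγ 1)
      let D : C(Att f, Att f) := deformEnd f pushUp pushUp_zero pushUp_one
      have h3 : ∀ t, D (γ t) = cell f j (s, 1) := by
        intro t
        obtain ⟨b, ρ, hρ⟩ := exists_tame (γ t)
        obtain ⟨s'', -, e, -⟩ := hρ.trans_pushUp (hγ t)
        exact e.trans (cell_one j _ _)
      have h4 : γ.map D.continuous = (Path.refl (cell f j (s, 1))).cast e
          (e'.trans (cell_one j _ _)) := Path.ext (funext fun t => h3 t)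
      have hE : ∀ {a a' x x' z : Att f} (r : PathClass a x) (r' : PathClass a' x')
          (hz : z = x) (hz' : z = x'), ∀ {v v' : Att f} (hv : v = x) (hv' : v' = x')
          (hvz : v = z) (hvz' : v' = z),
          (r.cast rfl hv).trans (((Path.Homotopic.Quotient.refl z).cast hvz hvz').trans
            (r'.cast rfl hv').symm) = r.trans (r'.symm.cast (hz.symm.trans hz') rfl) := by
        rintro a a' x x' z r r' rfl rfl v v' rfl rfl - -
        simp only [Path.Homotopic.Quotient.cast_rfl_rfl, Path.Homotopic.Quotient.refl_trans]
      have h2 : τ.trans ((Path.Homotopic.Quotient.mk γ).trans τ'.symm) = .mk (apexPath f j s s') := by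
        have h5 : τ.trans ((Path.Homotopic.Quotient.mk γ).trans τ'.symm) =
            ((Path.Homotopic.Quotient.mk (Att.radial f j s 1)).cast rfl e).trans
              ((Path.Homotopic.Quotient.mk (γ.map D.continuous)).trans
                ((Path.Homotopic.Quotient.mk (Att.radial f j s' 1)).cast rfl e').symm) := by
          rw [PathClass.conj_eq τ τ' (mk_trans_track pushUp_zero pushUp_one pushUp_start γ),
            he, he']
        rw [h5, h4, Path.Homotopic.Quotient.mk_cast, Path.Homotopic.Quotient.mk_refl, apexPath, Path.Homotopic.Quotient.mk_trans,
          Path.Homotopic.Quotient.mk_cast, Path.Homotopic.Quotient.mk_symm]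
        exact hE _ _ rfl (cell_one j _ _) _ _ _ _
      rw [h2]
      exact hapex j s s'

end Att

/-! ### Generators of the fundamental groups -/

section Generation

open scoped unitInterval

variable {X Y Z : Type*} [TopologicalSpace X] [TopologicalSpace Y] [TopologicalSpace Z]

/-- Every path between points of the image is homotopic to the image of a path. -/
def PathSurj (f : C(X, Y)) : Prop :=
  ∀ ⦃x x' : X⦄ (p : PathClass (f x) (f x')), ∃ q : PathClass x x', q.map f = p

theorem PathSurj.comp {g : C(Y, Z)} {f : C(X, Y)} (hg : PathSurj g) (hf : PathSurj f) :
    PathSurj (g.comp f) := fun _ _ p => by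
  obtain ⟨q, rfl⟩ := hg p
  obtain ⟨r, rfl⟩ := hf q
  exact ⟨r, Path.Homotopic.Quotient.map_comp ..⟩

theorem pathSurj_homeomorph {f : C(X, Y)} (hf : IsHomeomorph f) : PathSurj f := fun x x' p => by
  induction p using Path.Homotopic.Quotient.ind with | mk p =>
  let e := hf.homeomorph
  have he : ∀ x, e.symm (f x) = x := e.symm_apply_apply
  refine ⟨.mk ((p.map e.symm.continuous).cast (he x).symm (he x').symm), ?_⟩
  rw [← Path.Homotopic.Quotient.mk_map]
  congr 1
  exact Path.ext (funext fun t => e.apply_symm_apply (p t))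

/-- The map induces bijections of fundamental groups at all base points. -/
def PiIso (f : C(X, Y)) : Prop := ∀ x, Function.Bijective (FundamentalGroup.map f x)

theorem PiIso.comp {g : C(Y, Z)} {f : C(X, Y)} (hg : PiIso g) (hf : PiIso f) :
    PiIso (g.comp f) := fun x => by
  have : (FundamentalGroup.map (g.comp f) x : _ → _) =
      (FundamentalGroup.map g (f x)) ∘ FundamentalGroup.map f x :=
    funext fun p => Path.Homotopic.Quotient.map_comp (p := (p : PathClass x x)) ..
  rw [this]
  exact (hg (f x)).comp (hf x)

theorem piIso_id : PiIso (ContinuousMap.id X) := fun x => by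
  have : (FundamentalGroup.map (ContinuousMap.id X) x : _ → _) = id := by
    funext p
    induction p using Path.Homotopic.Quotient.ind with | mk p => rfl
  rw [this]
  exact Function.bijective_id

/-- A map with a left inverse that is surjective on paths induces bijections of fundamental
groups. -/
theorem PathSurj.piIso {f : C(X, Y)} (hf : PathSurj f) {r : C(Y, X)}
    (hr : ∀ x, r (f x) = x) : PiIso f := fun x => by
  refine ⟨fun p q h => ?_, fun p => hf p⟩
  have key : ∀ p : PathClass x x, (p.map f).map r = p.cast (hr x) (hr x) := fun p => by
    induction p using Path.Homotopic.Quotient.ind with | mk p =>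
    rw [← Path.Homotopic.Quotient.mk_map, ← Path.Homotopic.Quotient.mk_map,
      ← Path.Homotopic.Quotient.mk_cast]
    exact congrArg _ (Path.ext (funext fun t => hr (p t)))
  have h : Path.Homotopic.Quotient.map (p : PathClass x x) f =
    Path.Homotopic.Quotient.map (q : PathClass x x) f := h
  have h1 := (key p).symm.trans ((congrArg (fun s => Path.Homotopic.Quotient.map s r) h).trans
    (key q))
  have h2 := congrArg (fun s => Path.Homotopic.Quotient.cast s (hr x).symm (hr x).symm) h1
  simp only [Path.Homotopic.Quotient.cast_cast, Path.Homotopic.Quotient.cast_rfl_rfl] at h2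
  exact h2

theorem piIso_homeomorph {f : C(X, Y)} (hf : IsHomeomorph f) : PiIso f :=
  (pathSurj_homeomorph hf).piIso (r := hf.homeomorph.symm) hf.homeomorph.symm_apply_apply

variable {J S B : Type*} [TopologicalSpace S] [TopologicalSpace B] [CompactSpace S] [T2Space B]

theorem Att.pathSurj_inl [PathConnectedSpace S] (f : J → C(S, B)) : PathSurj (Att.inl f) := by
  intro b b' p
  refine Att.pathClass_induction
    (H := fun {b b'} p => ∃ q : PathClass b b', q.map (Att.inl f) = p) ?_
    (fun q => ⟨.mk q, rfl⟩) (fun j s s' => ?_) p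
  · rintro b₁ b₂ b₃ _ _ ⟨p, rfl⟩ ⟨q, rfl⟩
    exact ⟨p.trans q, PathClass.map_trans p q _⟩
  · let γ := PathConnectedSpace.somePath s s'
    refine ⟨.mk (γ.map (f j).continuous), ?_⟩
    let F : ((Att.inl f).comp (f j)).Homotopy (.const S (Att.cell f j (s, 1))) :=
      { toFun := fun x => Att.cell f j (x.2, x.1)
        map_zero_left := fun s => Att.cell_zero j s
        map_one_left := fun s' => Att.cell_one j s' s }
    have h2 : F.evalAt s = Att.radial f j s 1 :=
      Path.ext (funext fun t => congrArg (fun u => Att.cell f j (s, u)) (mul_one t).symm)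
    have h3 : F.evalAt s' = (Att.radial f j s' 1).cast rfl (Att.cell_one j s s') :=
      Path.ext (funext fun t => congrArg (fun u => Att.cell f j (s', u)) (mul_one t).symm)
    have h : (Path.Homotopic.Quotient.mk (γ.map ((Att.inl f).comp (f j)).continuous)).trans
        (Path.Homotopic.Quotient.mk ((Att.radial f j s' 1).cast rfl (Att.cell_one j s s'))) =
        Path.Homotopic.Quotient.mk (Att.radial f j s 1) := by
      have h := Path.Homotopic.Quotient.eq.2 (Path.Homotopic.map_trans_evalAt F γ)
      rw [Path.Homotopic.Quotient.mk_trans, Path.Homotopic.Quotient.mk_trans, h2, h3] at h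
      exact h.trans (Path.Homotopic.Quotient.trans_refl _)
    rw [Att.apexPath, Path.Homotopic.Quotient.mk_trans, ← h, Path.Homotopic.Quotient.trans_assoc,
      ← Path.Homotopic.Quotient.mk_map]
    have h4 : ((Att.radial f j s' 1).symm.cast (Att.cell_one j s s') rfl) =
      ((Att.radial f j s' 1).cast rfl (Att.cell_one j s s')).symm := rfl
    rw [h4, Path.Homotopic.Quotient.mk_symm, Path.Homotopic.Quotient.trans_symm,
      Path.Homotopic.Quotient.trans_refl]
    rfl

/-- Attaching cones along null-homotopic maps does not change the fundamental groups. -/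
theorem Att.piIso_inl [PathConnectedSpace S] {f : J → C(S, B)}
    (hf : ∀ j, (f j).Nullhomotopic) : PiIso (Att.inl f) := by
  choose y hy using hf
  refine (Att.pathSurj_inl f).piIso (r := Att.lift (.id B)
    (fun j => ⟨fun x => (hy j).some (x.2, x.1), by fun_prop⟩) (fun j s => ?_)
    (fun j s s' => ?_)) fun b => rfl
  · simp
  · simp

variable [DecidableEq J]

theorem bouquetIncl_one (j : J) : bouquetIncl j 1 = ⟨1, fun _ _ _ => Or.inl rfl⟩ :=
  Subtype.ext (Pi.mulSingle_one j)

theorem turn_one : turn 1 = 1 := turn_eq_one.2 ⟨1, by norm_num⟩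

/-- The loop that runs once around the `j`-th circle. -/
def circleLoop (f : C(Circle, X)) {x : X} (hx : f 1 = x) : Path x x where
  toFun t := f (turn t)
  continuous_toFun := by fun_prop
  source' := by simp [turn_zero, hx]
  target' := by simp [turn_one, hx]

/-- The fundamental group of a space that a bouquet maps onto is generated by the loops around the
circles. -/
theorem closure_circleLoop [Finite J] {g : C(Bouquet J, X)} (hg : PathSurj g) {x : X}
    (hx : ∀ j, g (bouquetIncl j 1) = x) (hx' : g ⟨1, fun _ _ _ => Or.inl rfl⟩ = x)
    {K : Subgroup (FundamentalGroup X x)}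
    (hK : ∀ j, (Path.Homotopic.Quotient.mk (circleLoop (g.comp (bouquetIncl j)) (hx j)) :
      FundamentalGroup X x) ∈ K) : K = ⊤ := by
  let f : J → C(Bool, Unit) := fun _ => ContinuousMap.const Bool ()
  let G : C(Att f, X) := g.comp arcsToBouquet
  have hG : ∀ b, x = G (Att.inl f b) := fun _ => hx'.symm
  have key : ∀ {b b' : Unit} (p : PathClass (Att.inl f b) (Att.inl f b')),
      ((p.map G).cast (hG b) (hG b') : FundamentalGroup X x) ∈ K := by
    intro b b' p
    refine Att.pathClass_induction (H := fun {b b'} p =>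
      ((p.map G).cast (hG b) (hG b') : FundamentalGroup X x) ∈ K) ?_ ?_ ?_ p
    · intro b₁ b₂ b₃ p q hp hq
      have h := K.mul_mem hq hp
      rw [FundamentalGroup.mul_def] at h
      rw [PathClass.map_trans]
      have aux : ∀ {y₁ y₂ y₃ : X} (p : PathClass y₁ y₂) (q : PathClass y₂ y₃) (h₁ : x = y₁)
          (h₂ : x = y₂) (h₃ : x = y₃), (p.cast h₁ h₂).trans (q.cast h₂ h₃) =
          (p.trans q).cast h₁ h₃ := by
        rintro _ _ _ p q rfl rfl rfl
        simp only [Path.Homotopic.Quotient.cast_rfl_rfl]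
      rwa [aux] at h
    · intro b b' q
      have h : ((q.map (Att.inl f).continuous).map G.continuous).cast (hG b) (hG b') =
          Path.refl x := Path.ext (funext fun t => (hG _).symm)
      rw [← Path.Homotopic.Quotient.mk_map, ← Path.Homotopic.Quotient.mk_cast, h]
      exact K.one_mem
    · intro j s s'
      have hss : ∀ s, Path.Homotopic.Quotient.mk (Att.apexPath f j s s) =
          Path.Homotopic.Quotient.refl (Att.inl f ()) := fun s => by
        have h : (Att.radial f j s 1).symm.cast (Att.cell_one j s s) rfl =
          (Att.radial f j s 1).symm := rfl
        rw [Att.apexPath, Path.Homotopic.Quotient.mk_trans, h, Path.Homotopic.Quotient.mk_symm]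
        exact Path.Homotopic.Quotient.trans_symm _
      have hone : ((Path.Homotopic.Quotient.map (Path.Homotopic.Quotient.refl (Att.inl f ()))
          G).cast (hG ()) (hG ()) : FundamentalGroup X x) ∈ K := by
        have h : ((Path.refl (Att.inl f ())).map G.continuous).cast (hG ()) (hG ()) =
          Path.refl x := Path.ext (funext fun t => (hG _).symm)
        rw [← Path.Homotopic.Quotient.mk_refl, ← Path.Homotopic.Quotient.mk_map,
          ← Path.Homotopic.Quotient.mk_cast, h]
        exact K.one_mem
      have hcell : ∀ s (u : I), G (Att.cell f j (s, u)) =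
          g (bouquetIncl j (turn (if s then 1 - (u : ℝ) / 2 else u / 2))) := fun s _ => by
        cases s <;> rfl
      have hapex : ∀ s s' (t : I),
          ((Att.apexPath f j s s').map G.continuous).cast (hG ()) (hG ()) t =
          if (t : ℝ) ≤ 1 / 2 then
            g (bouquetIncl j (turn (if s then 1 - t else t)))
          else g (bouquetIncl j (turn (if s' then t else 1 - t))) := by
        intro s s' t
        change G ((Att.apexPath f j s s') t) = _
        rw [Att.apexPath, Path.trans_apply]
        split_ifs with h h'
        all_goals
          change G (Att.cell f j (_, _)) = _
          rw [hcell]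
          congr 3
          simp [*]
          try ring
      cases s <;> cases s'
      · rw [hss]; exact hone
      · have h : ((Att.apexPath f j false true).map G.continuous).cast (hG ()) (hG ()) =
            circleLoop (g.comp (bouquetIncl j)) (hx j) :=
          Path.ext (funext fun t => (hapex false true t).trans (by simp [circleLoop]))
        rw [← Path.Homotopic.Quotient.mk_map, ← Path.Homotopic.Quotient.mk_cast, h]
        exact hK j
      · have h : ((Att.apexPath f j true false).map G.continuous).cast (hG ()) (hG ()) =
            (circleLoop (g.comp (bouquetIncl j)) (hx j)).symm :=
          Path.ext (funext fun t => (hapex true false t).trans (by simp [circleLoop]))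
        rw [← Path.Homotopic.Quotient.mk_map, ← Path.Homotopic.Quotient.mk_cast, h]
        exact K.inv_mem (hK j)
      · rw [hss]; exact hone
  rw [eq_top_iff]
  rintro p -
  obtain ⟨q, hq⟩ := hg.comp (pathSurj_homeomorph isHomeomorph_arcsToBouquet) (x := Att.inl f ())
    (x' := Att.inl f ()) (Path.Homotopic.Quotient.cast p (hG ()).symm (hG ()).symm)
  have h := key q
  rw [hq, Path.Homotopic.Quotient.cast_cast, Path.Homotopic.Quotient.cast_rfl_rfl] at h
  exact h

end Generation

/-! ### The fundamental group of a wedge -/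

section WedgeGroup

open scoped unitInterval

variable {a b c : ℕ}


theorem addSphere_circleIncl (i : Fin a) (z : Circle) :
    addSphere a b c (circleIncl a b c i z) = circleIncl a (b + 1) c i z := by
  refine Subtype.ext (funext ?_)
  rintro (j | j | j)
  · change (circleIncl a b c i z).1 (.inl j) = _
    by_cases h : j = i
    · subst h
      exact (circleIncl_self ..).trans (circleIncl_self ..).symm
    · exact (circleIncl_of_ne (j := .inl j) (by simpa using h) z).trans
        (circleIncl_of_ne (b := b + 1) (j := .inl j) (by simpa using h) z).symm
  · refine Eq.trans ?_ (circleIncl_of_ne (by simp) z).symm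
    exact Fin.cases rfl (fun k => circleIncl_of_ne (a := a) (c := c) (i := i) (j := .inr (.inl k)) (by simp) z) j
  · exact (circleIncl_of_ne (b := b) (i := i) (j := .inr (.inr j)) (by simp) z).trans
      (circleIncl_of_ne (b := b + 1) (i := i) (j := .inr (.inr j)) (by simp) z).symm

theorem addSphere_projIncl (i : Fin c) (z : ProjPlane) :
    addSphere a b c (projIncl a b c i z) = projIncl a (b + 1) c i z := by
  refine Subtype.ext (funext ?_)
  rintro (j | j | j)
  · exact (projIncl_of_ne (b := b) (i := i) (j := .inl j) (by simp) z).trans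
      (projIncl_of_ne (b := b + 1) (i := i) (j := .inl j) (by simp) z).symm
  · refine Eq.trans ?_ (projIncl_of_ne (by simp) z).symm
    exact Fin.cases rfl (fun k => projIncl_of_ne (a := a) (c := c) (i := i) (j := .inr (.inl k)) (by simp) z) j
  · change (projIncl a b c i z).1 (.inr (.inr j)) = _
    by_cases h : j = i
    · subst h
      exact (projIncl_self ..).trans (projIncl_self ..).symm
    · exact (projIncl_of_ne (j := .inr (.inr j)) (by simpa using h) z).trans
        (projIncl_of_ne (b := b + 1) (j := .inr (.inr j)) (by simpa using h) z).symm

/-- The circles and the equators of the projective planes carry the fundamental group of the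
wedge. -/
theorem exists_bouquet_pathSurj (a b c : ℕ) :
    ∃ g : C(Bouquet (Fin a ⊕ Fin c), PieceSub a b c), PathSurj g ∧
      g ⟨1, fun _ _ _ => Or.inl rfl⟩ = subPt a b c ∧
      (∀ i z, g (bouquetIncl (.inl i) z) = circleIncl a b c i z) ∧
      ∀ i z, g (bouquetIncl (.inr i) z) = projIncl a b c i (equator z) := by
  induction b with
  | zero =>
    let e : Fin a ⊕ Fin c ≃ Fin a ⊕ Fin c := .refl _
    refine ⟨bouquetToSub e, ?_, ?_, bouquetToSub_incl_inl e, bouquetToSub_incl_inr e⟩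
    · exact (pathSurj_homeomorph (isHomeomorph_bouquetModel e)).comp
        (Att.pathSurj_inl (projAttach e))
    · refine Subtype.ext (funext ?_)
      rintro (j | j | j)
      exacts [rfl, j.elim0, equator_one]
  | succ b ih =>
    obtain ⟨g, hg, h1, h2, h3⟩ := ih
    refine ⟨(addSphere a b c).comp g, ?_, ?_, fun i z => ?_, fun i z => ?_⟩
    · have : PathSurj (addSphere a b c) :=
        (pathSurj_homeomorph (isHomeomorph_sphereModel a b c)).comp
          (Att.pathSurj_inl fun _ : Unit => ContinuousMap.const Circle (subPt a b c))
      exact this.comp hg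
    · rw [ContinuousMap.comp_apply, h1, addSphere_base]
    · rw [ContinuousMap.comp_apply, h2, addSphere_circleIncl]
    · rw [ContinuousMap.comp_apply, h3, addSphere_projIncl]

/-- The space of the fundamental group of the wedge. -/
abbrev WedgeGroup (a b c : ℕ) : Type := FundamentalGroup (PieceSub a b c) (subPt a b c)

theorem projIncl_equator_one (i : Fin c) :
    ((projIncl a b c i).comp equator) 1 = subPt a b c := by
  rw [ContinuousMap.comp_apply, equator_one]
  exact subIncl_base a b c (.inr (.inr i))

/-- The loops around the circles and along the equators. -/
def wedgeLoop (a b c : ℕ) : Fin a ⊕ Fin c → Path (subPt a b c) (subPt a b c)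
  | .inl i => circleLoop (circleIncl a b c i) (subIncl_base a b c (.inl i))
  | .inr i => circleLoop ((projIncl a b c i).comp equator) (projIncl_equator_one i)

/-- The generators of the fundamental group. -/
def wedgeGen (a b c : ℕ) (i : Fin a ⊕ Fin c) : WedgeGroup a b c :=
  Path.Homotopic.Quotient.mk (wedgeLoop a b c i)

theorem eq_top_of_wedgeGen_mem {K : Subgroup (WedgeGroup a b c)}
    (hK : ∀ i, wedgeGen a b c i ∈ K) : K = ⊤ := by
  obtain ⟨g, hg, h1, h2, h3⟩ := exists_bouquet_pathSurj a b c
  refine closure_circleLoop hg (fun j => ?_) h1 fun j => ?_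
  · rw [bouquetIncl_one, h1]
  · have : circleLoop (g.comp (bouquetIncl j)) (by
        rw [ContinuousMap.comp_apply, bouquetIncl_one, h1]) = wedgeLoop a b c j := by
      refine Path.ext (funext fun t => ?_)
      rcases j with i | i
      exacts [h2 i _, h3 i _]
    rw [this]
    exact hK j

/-- The equator has order two. -/
theorem wedgeGen_mul_self (i : Fin c) : wedgeGen a b c (.inr i) * wedgeGen a b c (.inr i) = 1 := by
  rw [FundamentalGroup.mul_def, wedgeGen, ← Path.Homotopic.Quotient.mk_trans]
  let p := projIncl a b c i
  let F : (p.comp (equator.comp (powMap 2))).Homotopy (.const Circle (p (projCell (1, 1)))) :=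
    { toFun := fun x => p (projCell (x.2, x.1))
      map_zero_left := fun z => congrArg p (projCell_zero z)
      map_one_left := fun z => congrArg p (projCell_one z 1) }
  let γ : Path (1 : Circle) 1 := circleLoop (.id Circle) rfl
  have hx : (p.comp (equator.comp (powMap 2))) 1 = subPt a b c := by
    have h : powMap 2 1 = 1 := one_zpow 2
    rw [ContinuousMap.comp_apply, ContinuousMap.comp_apply, h]
    exact projIncl_equator_one i
  have h := Path.Homotopic.Quotient.eq.2 (Path.Homotopic.map_trans_evalAt F γ)
  rw [Path.Homotopic.Quotient.mk_trans, Path.Homotopic.Quotient.mk_trans] at h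
  have h := h.trans (Path.Homotopic.Quotient.trans_refl _)
  have h' := congrArg (fun q => Path.Homotopic.Quotient.trans q
    (Path.Homotopic.Quotient.mk (F.evalAt 1)).symm) h
  simp only [Path.Homotopic.Quotient.trans_assoc, Path.Homotopic.Quotient.trans_symm] at h'
  have h' := (Path.Homotopic.Quotient.trans_refl _).symm.trans h'
  have h'' := congrArg (fun q => Path.Homotopic.Quotient.cast q hx.symm hx.symm) h'
  rw [← Path.Homotopic.Quotient.mk_cast] at h''
  have e : (γ.map (map_continuous (p.comp (equator.comp (powMap 2))))).cast hx.symm hx.symm =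
      (wedgeLoop a b c (.inr i)).trans (wedgeLoop a b c (.inr i)) := by
    refine Path.ext (funext fun t => ?_)
    have h1 : ((γ.map (map_continuous (p.comp (equator.comp (powMap 2))))).cast hx.symm hx.symm) t =
        p (equator (turn (2 * t))) := by
      change p (equator (turn t ^ (2 : ℤ))) = _
      rw [zpow_two, ← turn_add]
      congr 3
      ring
    rw [h1, Path.trans_apply]
    split_ifs with h
    · rfl
    · change _ = p (equator (turn (2 * (t : ℝ) - 1)))
      congr 2
      exact turn_eq_turn.2 ⟨1, by push_cast; ring⟩
  rw [← e, h'']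
  have aux : ∀ {x y : PieceSub a b c} (h : x = y),
      (Path.Homotopic.Quotient.refl y).cast h h = Path.Homotopic.Quotient.refl x := by
    rintro x _ rfl; rfl
  exact aux hx.symm

/-- The standard generators of the free product. -/
def freeGen (a c : ℕ) : Fin a ⊕ Fin c → FreeProductZZ2 a c
  | .inl i => .inl (Monoid.CoprodI.of (i := i) (Multiplicative.ofAdd 1))
  | .inr i => .inr (Monoid.CoprodI.of (i := i) (Multiplicative.ofAdd 1))

/-- The universal property of the free product. -/
def freeLift {M : Type*} [Group M] (x : Fin a ⊕ Fin c → M)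
    (hx : ∀ i, x (.inr i) * x (.inr i) = 1) : FreeProductZZ2 a c →* M :=
  Monoid.Coprod.lift (Monoid.CoprodI.lift fun i => zpowersHom _ (x (.inl i)))
    (Monoid.CoprodI.lift fun i => AddMonoidHom.toMultiplicativeLeft
      (ZMod.lift 2 ⟨zmultiplesHom _ (Additive.ofMul (x (.inr i))), by
        rw [zmultiplesHom_apply, Nat.cast_ofNat]
        exact congrArg Additive.ofMul ((zpow_two _).trans (hx i))⟩))

theorem freeLift_gen {M : Type*} [Group M] (x : Fin a ⊕ Fin c → M)
    (hx : ∀ i, x (.inr i) * x (.inr i) = 1) (i : Fin a ⊕ Fin c) :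
    freeLift x hx (freeGen a c i) = x i := by
  rcases i with i | i
  · simp [freeLift, freeGen]
  · have h := ZMod.lift_coe 2 ⟨zmultiplesHom _ (Additive.ofMul (x (.inr i))), by
        rw [zmultiplesHom_apply, Nat.cast_ofNat]
        exact congrArg Additive.ofMul ((zpow_two _).trans (hx i))⟩ 1
    simp only [Int.cast_one] at h
    simp only [freeLift, freeGen, Monoid.Coprod.lift_apply_inr, Monoid.CoprodI.lift_of]
    refine (congrArg Additive.toMul h).trans ?_
    simp

/-- Homomorphisms on the free product that agree on the generators are equal. -/
theorem freeProduct_hom_ext {M : Type*} [Monoid M] {f g : FreeProductZZ2 a c →* M}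
    (h : ∀ i, f (freeGen a c i) = g (freeGen a c i)) : f = g := by
  refine Monoid.Coprod.hom_ext ?_ ?_
  · refine Monoid.CoprodI.ext_hom _ _ fun i => ?_
    refine MonoidHom.ext_mint ?_
    exact h (.inl i)
  · refine Monoid.CoprodI.ext_hom _ _ fun i => ?_
    refine MonoidHom.ext fun x => ?_
    obtain rfl | rfl : x = 1 ∨ x = Multiplicative.ofAdd 1 := by
      revert x; decide
    · simp
    · exact h (.inr i)

theorem freeGen_mul_self (i : Fin c) :
    freeGen a c (.inr i) * freeGen a c (.inr i) = 1 := by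
  have : (Multiplicative.ofAdd (1 : ZMod 2)) * Multiplicative.ofAdd 1 = 1 := by decide
  simp only [freeGen]
  rw [← map_mul, ← map_mul, this, map_one, map_one]

/-- The homomorphism from the free product to the fundamental group of the wedge. -/
def freeToWedge (a b c : ℕ) : FreeProductZZ2 a c →* WedgeGroup a b c :=
  freeLift (wedgeGen a b c) wedgeGen_mul_self

theorem freeToWedge_gen (i : Fin a ⊕ Fin c) :
    freeToWedge a b c (freeGen a c i) = wedgeGen a b c i := freeLift_gen _ wedgeGen_mul_self i

theorem freeToWedge_surjective : Function.Surjective (freeToWedge a b c) := by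
  let K : Subgroup (WedgeGroup a b c) :=
    { carrier := Set.range (freeToWedge a b c)
      mul_mem' := by
        rintro _ _ ⟨x, rfl⟩ ⟨y, rfl⟩
        exact ⟨x * y, map_mul _ x y⟩
      one_mem' := ⟨1, map_one _⟩
      inv_mem' := by
        rintro _ ⟨x, rfl⟩
        refine ⟨x⁻¹, eq_inv_of_mul_eq_one_left ?_⟩
        exact (map_mul _ x⁻¹ x).symm.trans ((congrArg _ (inv_mul_cancel x)).trans (map_one _)) }
  have h : K = ⊤ := eq_top_of_wedgeGen_mem fun i => ⟨freeGen a c i, freeToWedge_gen i⟩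
  intro x
  have hx : x ∈ K := h ▸ Subgroup.mem_top x
  exact hx

end WedgeGroup

/-! ### Coverings from multivalued functions -/

section Potentials

open scoped unitInterval
open Topology Filter

/-- A covering with fibre `G`, given by `G`-valued functions on the members of an open cover whose
quotients are locally constant. -/
structure Potential (X G ι : Type*) [TopologicalSpace X] [Group G] where
  /-- the open cover -/
  U : ι → Set X
  isOpen_U : ∀ κ, IsOpen (U κ)
  /-- a member of the cover around a point -/
  idx : X → ι
  mem_idx : ∀ x, x ∈ U (idx x)
  /-- the functions -/
  h : ι → X → G
  loc : ∀ κ κ' x, x ∈ U κ → x ∈ U κ' →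
    ∀ᶠ y in 𝓝 x, (h κ' y)⁻¹ * h κ y = (h κ' x)⁻¹ * h κ x

namespace Potential

variable {X G ι : Type*} [TopologicalSpace X] [Group G] [TopologicalSpace G] [DiscreteTopology G]
  (P : Potential X G ι)

/-- The bundle. -/
def core : FiberBundleCore ι X G where
  baseSet := P.U
  isOpen_baseSet := P.isOpen_U
  indexAt := P.idx
  mem_baseSet_at := P.mem_idx
  coordChange κ κ' x v := (P.h κ' x)⁻¹ * P.h κ x * v
  coordChange_self κ x _ v := by simp
  continuousOn_coordChange κ κ' := by
    rintro ⟨x, v⟩ ⟨⟨hx, hx'⟩, -⟩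
    refine ContinuousAt.continuousWithinAt ?_
    have h1 : ContinuousAt (fun p : X × G => (P.h κ' x)⁻¹ * P.h κ x * p.2) (x, v) :=
      (continuous_of_discreteTopology.comp continuous_snd).continuousAt
    refine h1.congr ?_
    filter_upwards [continuousAt_fst.eventually (P.loc κ κ' x hx hx')] with p hp
    rw [hp]
  coordChange_comp i j k x _ v := by group

theorem isCoveringMap : IsCoveringMap (Bundle.TotalSpace.proj : P.core.TotalSpace → X) :=
  FiberBundle.isCoveringMap (F := G) (E := P.core.Fiber)

/-- The points of the fibres. -/
def pt (x : X) (w : G) : (Bundle.TotalSpace.proj : P.core.TotalSpace → X) ⁻¹' {x} :=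
  ⟨⟨x, (P.h (P.idx x) x)⁻¹ * w⟩, rfl⟩

theorem pt_injective (x : X) : Function.Injective (P.pt x) := fun w w' h => by
  have h : (⟨x, (P.h (P.idx x) x)⁻¹ * w⟩ : P.core.TotalSpace) =
    ⟨x, (P.h (P.idx x) x)⁻¹ * w'⟩ := congrArg Subtype.val h
  exact mul_left_cancel (Bundle.TotalSpace.mk_inj.1 h)

theorem pt_surjective (x : X) : Function.Surjective (P.pt x) := by
  rintro ⟨⟨y, v⟩, rfl⟩
  let v' : G := v
  exact ⟨P.h (P.idx y) y * v', Subtype.ext (congrArg (fun u : G => (⟨y, u⟩ : P.core.TotalSpace))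
    (inv_mul_cancel_left _ v'))⟩

/-- Along a path in a member of the cover, the monodromy is given by the function on it. -/
theorem monodromy_of_mem {x y : X} (γ : Path x y) (κ : ι) (hγ : ∀ t, γ t ∈ P.U κ) (w : G) :
    P.isCoveringMap.monodromy (.mk γ) (P.pt x w) = P.pt y (P.h κ y * ((P.h κ x)⁻¹ * w)) := by
  let v : G := (P.h κ x)⁻¹ * w
  let l : I → P.core.TotalSpace := fun t => ⟨γ t, (P.h (P.idx (γ t)) (γ t))⁻¹ * P.h κ (γ t) * v⟩
  have hl : Continuous l := by
    have h1 : ∀ t, l t = (P.core.localTriv κ).toOpenPartialHomeomorph.symm (γ t, v) := fun t => rfl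
    rw [show l = _ from funext h1]
    refine (P.core.localTriv κ).toOpenPartialHomeomorph.symm.continuousOn.comp_continuous
      (by fun_prop) fun t => ?_
    exact (P.core.mem_localTriv_target κ _).2 (hγ t)
  let Γ : Path (P.pt x w).1 (P.pt y (P.h κ y * ((P.h κ x)⁻¹ * w))).1 :=
    ⟨⟨l, hl⟩, by
      change (⟨γ 0, _⟩ : P.core.TotalSpace) = ⟨x, _⟩
      rw [γ.source]
      refine congrArg (fun u : G => (⟨x, u⟩ : P.core.TotalSpace)) ?_
      simp only [v]
      group, by
      change (⟨γ 1, _⟩ : P.core.TotalSpace) = ⟨y, _⟩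
      rw [γ.target, mul_assoc]⟩
  refine P.isCoveringMap.monodromy_eq_of_map_eq (.mk Γ) ?_
  exact congrArg Path.Homotopic.Quotient.mk (Path.ext (funext fun t => rfl))

theorem monodromy_cast {x y x' y' : X} (p : PathClass x y) (hx : x' = x) (hy : y' = y) {w w' : G}
    (h : P.isCoveringMap.monodromy p (P.pt x w) = P.pt y w') :
    P.isCoveringMap.monodromy (p.cast hx hy) (P.pt x' w) = P.pt y' w' := by
  subst hx hy
  rwa [Path.Homotopic.Quotient.cast_rfl_rfl]

/-- The monodromy along a loop that leaves and reenters a member of the cover once. -/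
theorem monodromy_loop {x : X} (γ : Path x x) (κ κ' : ι) {a b : I} (hab : a ≤ b)
    (h₁ : ∀ t ≤ a, γ t ∈ P.U κ) (h₂ : ∀ t, a ≤ t → t ≤ b → γ t ∈ P.U κ')
    (h₃ : ∀ t, b ≤ t → γ t ∈ P.U κ) (hx : P.h κ x = 1) (w : G) :
    P.isCoveringMap.monodromy (.mk γ) (P.pt x w) =
      P.pt x ((P.h κ (γ b))⁻¹ * P.h κ' (γ b) * ((P.h κ' (γ a))⁻¹ * P.h κ (γ a)) * w) := by
  have hmem : ∀ (s t : I) (hst : s ≤ t) (κ : ι), (∀ r, s ≤ r → r ≤ t → γ r ∈ P.U κ) →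
      ∀ r, γ.subpath s t r ∈ P.U κ := by
    intro s t hst κ h r
    have : γ.subpath s t r ∈ Set.range (γ.subpath s t) := ⟨r, rfl⟩
    rw [Path.range_subpath_of_le _ _ _ hst] at this
    obtain ⟨q, hq, hqr⟩ := this
    rw [← hqr]
    exact h q hq.1 hq.2
  have e₁ := P.monodromy_of_mem (γ.subpath 0 a) κ
    (hmem _ _ unitInterval.nonneg' κ fun r _ hr => h₁ r hr) w
  have e₂ := P.monodromy_of_mem (γ.subpath a b) κ' (hmem _ _ hab κ' h₂)
    (P.h κ (γ a) * ((P.h κ (γ 0))⁻¹ * w))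
  have e₃ := P.monodromy_of_mem (γ.subpath b 1) κ
    (hmem _ _ unitInterval.le_one' κ fun r hr _ => h₃ r hr)
    (P.h κ' (γ b) * ((P.h κ' (γ a))⁻¹ * (P.h κ (γ a) * ((P.h κ (γ 0))⁻¹ * w))))
  rw [← e₂, ← e₁, ← P.isCoveringMap.monodromy_trans_apply,
    ← P.isCoveringMap.monodromy_trans_apply, ← Path.Homotopic.Quotient.mk_trans,
    Path.Homotopic.Quotient.eq.2 ⟨Path.Homotopy.subpathTransSubpath γ a b 1⟩,
    ← Path.Homotopic.Quotient.mk_trans,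
    Path.Homotopic.Quotient.eq.2 ⟨Path.Homotopy.subpathTransSubpath γ 0 a 1⟩,
    Path.subpath_zero_one, Path.Homotopic.Quotient.mk_cast] at e₃
  have e := P.monodromy_cast _ γ.source.symm γ.target.symm e₃
  rw [Path.Homotopic.Quotient.cast_cast, Path.Homotopic.Quotient.cast_rfl_rfl] at e
  rw [e, γ.source, γ.target, hx]
  congr 1
  group

end Potential

/-- A covering of a piece for each piece gives a covering of the wedge. -/
def wedgePotential {I₀ K G : Type*} [Finite I₀] [DecidableEq I₀] [Group G] {X : I₀ → Type*}
    [∀ i, TopologicalSpace (X i)] [∀ i, T2Space (X i)] {p : ∀ i, X i}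
    (P : ∀ i, Potential (X i) G K) (hP : ∀ i κ, (P i).h κ (p i) = 1) :
    Potential (WedgeSub p) G (I₀ → K) :=
  open Classical in
  let h : (I₀ → K) → WedgeSub p → G := fun κ x =>
    if hx : ∃ i, x.1 i ≠ p i then (P hx.choose).h (κ hx.choose) (x.1 hx.choose) else 1
  have hh : ∀ κ (x : WedgeSub p) i, x.1 i ≠ p i → h κ x = (P i).h (κ i) (x.1 i) := by
    intro κ x i hi
    have hx : ∃ i, x.1 i ≠ p i := ⟨i, hi⟩
    have he : hx.choose = i := by
      by_contra hne
      exact (x.2 _ _ hne).elim hx.choose_spec hi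
    simp only [h, dif_pos hx]
    rw [he]
  have h1 : ∀ κ (x : WedgeSub p), (∀ i, x.1 i = p i) → h κ x = 1 := by
    intro κ x hx
    simp only [h, dif_neg (show ¬ ∃ i, x.1 i ≠ p i by push Not; exact hx)]
  { U := fun κ => {x | ∀ i, x.1 i ∈ (P i).U (κ i)}
    isOpen_U := fun κ => by
      simp only [Set.ofPred_forall]
      exact isOpen_iInter_of_finite fun i => ((P i).isOpen_U (κ i)).preimage
        ((continuous_apply i).comp continuous_subtype_val)
    idx := fun x i => (P i).idx (x.1 i)
    mem_idx := fun x i => (P i).mem_idx _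
    h := h
    loc := by
      intro κ κ' x hx hx'
      have hproj : ∀ i, ContinuousAt (fun y : WedgeSub p => y.1 i) x := fun i =>
        ((continuous_apply i).comp continuous_subtype_val).continuousAt
      by_cases hp : ∃ i, x.1 i ≠ p i
      · obtain ⟨i, hi⟩ := hp
        filter_upwards [(hproj i).eventually ((P i).loc _ _ _ (hx i) (hx' i)),
          (hproj i).eventually (isOpen_ne.mem_nhds hi)] with y hy hyi
        rw [hh κ y i hyi, hh κ' y i hyi, hh κ x i hi, hh κ' x i hi, hy]
      · push Not at hp
        have hev : ∀ᶠ y : WedgeSub p in 𝓝 x, ∀ i,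
            ((P i).h (κ' i) (y.1 i))⁻¹ * (P i).h (κ i) (y.1 i) = 1 := by
          refine eventually_all.2 fun i => ?_
          filter_upwards [(hproj i).eventually ((P i).loc _ _ _ (hx i) (hx' i))] with y hy
          rw [hy, hp i, hP, hP, inv_one, one_mul]
        filter_upwards [hev] with y hy
        rw [h1 κ x hp, h1 κ' x hp, inv_one, one_mul]
        by_cases hyp : ∃ i, y.1 i ≠ p i
        · obtain ⟨i, hi⟩ := hyp
          rw [hh κ y i hi, hh κ' y i hi, hy i]
        · push Not at hyp
          rw [h1 κ y hyp, h1 κ' y hyp, inv_one, one_mul] }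

theorem wedgePotential_h {I₀ K G : Type*} [Finite I₀] [DecidableEq I₀] [Group G] {X : I₀ → Type*}
    [∀ i, TopologicalSpace (X i)] [∀ i, T2Space (X i)] {p : ∀ i, X i}
    (P : ∀ i, Potential (X i) G K) (hP : ∀ i κ, (P i).h κ (p i) = 1) (κ : I₀ → K)
    (x : WedgeSub p) (i : I₀) (hx : ∀ j, j ≠ i → x.1 j = p j) :
    (wedgePotential P hP).h κ x = (P i).h (κ i) (x.1 i) := by
  classical
  by_cases hi : x.1 i = p i
  · rw [hi, hP]
    refine dif_neg ?_
    push Not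
    intro j
    by_cases hj : j = i
    · rw [hj, hi]
    · exact hx j hj
  · have hx' : ∃ i, x.1 i ≠ p i := ⟨i, hi⟩
    have he : hx'.choose = i := by
      by_contra hne
      exact hx'.choose_spec (hx _ hne)
    refine (dif_pos hx').trans ?_
    rw [he]

/-- The trivial covering. -/
def trivialPotential (X G : Type*) [TopologicalSpace X] [Group G] : Potential X G (Fin 3) where
  U _ := Set.univ
  isOpen_U _ := isOpen_univ
  idx _ := 0
  mem_idx _ := trivial
  h _ _ := 1
  loc _ _ _ _ _ := by simp

/-- A function that takes one value where `ψ` is negative and another one elsewhere is locally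
constant where `ψ` does not vanish. -/
theorem eventually_ite_eq {X G : Type*} [TopologicalSpace X] {ψ : X → ℝ} (hψ : Continuous ψ) {x : X}
    (hx : ψ x ≠ 0) (g g' : G) :
    ∀ᶠ y in 𝓝 x, (if ψ y < 0 then g else g') = if ψ x < 0 then g else g' := by
  rcases lt_or_gt_of_ne hx with h | h
  · filter_upwards [hψ.continuousAt.eventually (gt_mem_nhds h)] with y hy
    rw [if_pos hy, if_pos h]
  · filter_upwards [hψ.continuousAt.eventually (lt_mem_nhds h)] with y hy
    rw [if_neg (not_lt.2 (le_of_lt hy)), if_neg (not_lt.2 h.le)]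

theorem turn_half : (turn (1 / 2) : ℂ) = -1 := by
  rw [turn_apply, Circle.coe_exp, ← Complex.exp_pi_mul_I]
  congr 1
  push_cast
  ring

variable {G : Type*} [Group G]

/-- The covering of the circle with monodromy `g`. -/
def circlePotential (g : G) : Potential Circle G (Fin 3) where
  U κ := if κ = 0 then {z | z ≠ turn (1 / 2)} else {z | z ≠ 1}
  isOpen_U κ := by split_ifs <;> exact isOpen_ne
  idx z := open Classical in if z = 1 then 0 else 1
  mem_idx z := by
    by_cases h : z = 1
    · rw [if_pos h, if_pos rfl, h]
      exact (turn_ne_one (by norm_num) (by norm_num)).symm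
    · simp [h]
  h κ z := if κ = 0 then 1 else if (z : ℂ).im < 0 then g else 1
  loc κ κ' z hz hz' := by
    have him : z ≠ turn (1 / 2) → z ≠ 1 → (z : ℂ).im ≠ 0 := by
      intro h1 h2 h
      have h3 := circle_sum z
      rw [h] at h3
      have h4 : (z : ℂ).re = 1 ∨ (z : ℂ).re = -1 := by
        have h5 : ((z : ℂ).re - 1) * ((z : ℂ).re + 1) = 0 := by nlinarith
        rcases mul_eq_zero.1 h5 with h5 | h5
        · exact Or.inl (by linarith)
        · exact Or.inr (by linarith)
      rcases h4 with h4 | h4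
      · exact h2 (Circle.ext (Complex.ext (by simpa using h4) (by simpa using h)))
      · refine h1 (Circle.ext (Complex.ext ?_ ?_))
        · rw [h4, turn_half]; simp
        · rw [h, turn_half]; simp
    by_cases h : κ = 0 <;> by_cases h' : κ' = 0 <;> simp only [h, h', if_true, if_false] at hz hz' ⊢
    · simp
    · simp only [mul_one]
      filter_upwards [eventually_ite_eq continuous_circle_im (him hz hz') g 1] with y hy
      rw [hy]
    · simp only [inv_one, one_mul]
      exact eventually_ite_eq continuous_circle_im (him hz' hz) g 1
    · exact Eventually.of_forall fun y => by rw [inv_mul_cancel, inv_mul_cancel]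

/-- A lift of the points of the projective plane to the sphere. -/
def sphereRep (x : ProjPlane) : Sphere2 :=
  open Classical in if x = Quotient.mk antipodal sphere2Pt then sphere2Pt else x.out

theorem mk_sphereRep (x : ProjPlane) : Quotient.mk antipodal (sphereRep x) = x := by
  rw [sphereRep]
  split_ifs with h
  · exact h.symm
  · exact Quotient.out_eq x

/-- The products of homogeneous coordinates. -/
def coordMul (k l : Fin 3) : ProjPlane → ℝ := Quotient.lift (fun x => x.1 k * x.1 l) (by
  rintro x y (rfl | rfl)
  · rfl
  · simp)

theorem continuous_coordMul (k l : Fin 3) : Continuous (coordMul k l) :=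
  Continuous.quotient_lift (by fun_prop) _

theorem coordMul_mk (k l : Fin 3) (x : Sphere2) :
    coordMul k l (Quotient.mk antipodal x) = x.1 k * x.1 l := rfl

theorem coordMul_eq (k l : Fin 3) (x : ProjPlane) :
    coordMul k l x = (sphereRep x).1 k * (sphereRep x).1 l := by
  conv_lhs => rw [← mk_sphereRep x]
  rfl

theorem coordMul_self_ne (x : ProjPlane) : ∃ k, coordMul k k x ≠ 0 := by
  by_contra! h
  have h1 := sphere_sum (sphereRep x)
  have h2 := fun k => (coordMul_eq k k x).symm.trans (h k)
  nlinarith [h2 0, h2 1, h2 2]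

theorem projPotential_quotient {g : G} (hg : g * g = 1) (k l : Fin 3) (x : ProjPlane)
    (hk : coordMul k k x ≠ 0) (hl : coordMul l l x ≠ 0) :
    (if (sphereRep x).1 l < 0 then g else 1)⁻¹ * (if (sphereRep x).1 k < 0 then g else 1) =
      if coordMul k l x < 0 then g else 1 := by
  rw [coordMul_eq] at hk hl ⊢
  have hk := mul_self_ne_zero.1 hk
  have hl := mul_self_ne_zero.1 hl
  have hinv : g⁻¹ = g := inv_eq_of_mul_eq_one_left hg
  rcases lt_or_gt_of_ne hk with h | h <;> rcases lt_or_gt_of_ne hl with h' | h'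
  · simp [h, h', (mul_pos_of_neg_of_neg h h').le]
  · simp [h, h'.le, mul_neg_of_neg_of_pos h h']
  · simp [h.le, h', mul_neg_of_pos_of_neg h h', hinv]
  · rw [if_neg (not_lt.2 h'.le), if_neg (not_lt.2 h.le), if_neg (not_lt.2 (mul_pos h h').le),
      inv_one, one_mul]

/-- The covering of the projective plane with monodromy `g`. -/
def projPotential (g : G) (hg : g * g = 1) : Potential ProjPlane G (Fin 3) where
  U k := {x | coordMul k k x ≠ 0}
  isOpen_U k := isOpen_ne_fun (continuous_coordMul k k) continuous_const
  idx x := (coordMul_self_ne x).choose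
  mem_idx x := (coordMul_self_ne x).choose_spec
  h k x := if (sphereRep x).1 k < 0 then g else 1
  loc k l x hk hl := by
    have hkl : coordMul k l x ≠ 0 := by
      have hk : coordMul k k x ≠ 0 := hk
      have hl : coordMul l l x ≠ 0 := hl
      rw [coordMul_eq] at hk hl ⊢
      exact mul_ne_zero (mul_self_ne_zero.1 hk) (mul_self_ne_zero.1 hl)
    have hopen : ∀ k, coordMul k k x ≠ 0 → ∀ᶠ y in 𝓝 x, coordMul k k y ≠ 0 := fun k h =>
      (isOpen_ne_fun (continuous_coordMul k k) continuous_const).mem_nhds h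
    filter_upwards [eventually_ite_eq (continuous_coordMul k l) hkl g 1, hopen k hk, hopen l hl]
      with y hy hky hly
    rw [projPotential_quotient hg k l y hky hly, projPotential_quotient hg k l x hk hl, hy]

end Potentials

/-! ### The fundamental group of a wedge of circles, spheres and projective planes -/

section Monodromy

open scoped unitInterval
open Topology Filter

/-- A loop that moves only in the piece `i`, and runs in the chart `κ'` between the parameters `a`
and `b` and in the chart `κ` before and after, acts on the fibre through the transition functions of
that piece alone. -/
theorem wedgePotential_monodromy {I₀ K G : Type*} [Finite I₀] [DecidableEq I₀] [Group G]
    [TopologicalSpace G] [DiscreteTopology G] {X : I₀ → Type*}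
    [∀ i, TopologicalSpace (X i)] [∀ i, T2Space (X i)] {p : ∀ i, X i}
    (P : ∀ i, Potential (X i) G K) (hP : ∀ i κ, (P i).h κ (p i) = 1) (i : I₀) (κ κ' : K)
    (hκ : ∀ j, p j ∈ (P j).U κ)
    (γ : Path (⟨p, base_mem_wedgeSub⟩ : WedgeSub p) ⟨p, base_mem_wedgeSub⟩)
    (hγ : ∀ t j, j ≠ i → (γ t).1 j = p j) {a b : I} (hab : a ≤ b)
    (h₁ : ∀ t ≤ a, (γ t).1 i ∈ (P i).U κ) (h₂ : ∀ t, a ≤ t → t ≤ b → (γ t).1 i ∈ (P i).U κ')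
    (h₃ : ∀ t, b ≤ t → (γ t).1 i ∈ (P i).U κ) (w : G) :
    (wedgePotential P hP).isCoveringMap.monodromy (.mk γ) ((wedgePotential P hP).pt _ w) =
      (wedgePotential P hP).pt _ (((P i).h κ ((γ b).1 i))⁻¹ * (P i).h κ' ((γ b).1 i) *
        (((P i).h κ' ((γ a).1 i))⁻¹ * (P i).h κ ((γ a).1 i)) * w) := by
  have hU : ∀ (t : I) (κ₀ : I₀ → K), (∀ j, j ≠ i → κ₀ j = κ) → (γ t).1 i ∈ (P i).U (κ₀ i) →
      γ t ∈ (wedgePotential P hP).U κ₀ := by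
    intro t κ₀ h h' j
    by_cases hj : j = i
    · rw [hj]; exact h'
    · rw [hγ t j hj, h j hj]; exact hκ j
  have hne : ∀ j, j ≠ i → Function.update (fun _ => κ) i κ' j = κ := fun j hj =>
    Function.update_of_ne hj _ _
  have := (wedgePotential P hP).monodromy_loop γ (fun _ => κ) (Function.update (fun _ => κ) i κ')
    hab (fun t ht => hU t _ (fun _ _ => rfl) (h₁ t ht))
    (fun t ht ht' => hU t _ hne (by rw [Function.update_self]; exact h₂ t ht ht'))
    (fun t ht => hU t _ (fun _ _ => rfl) (h₃ t ht))
    ((wedgePotential_h P hP _ _ i fun _ _ => rfl).trans (hP i κ)) w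
  rwa [wedgePotential_h P hP _ (γ b) i (hγ b), wedgePotential_h P hP _ (γ b) i (hγ b),
    wedgePotential_h P hP _ (γ a) i (hγ a), wedgePotential_h P hP _ (γ a) i (hγ a),
    Function.update_self] at this

theorem turn_ne_turn_half {t : ℝ} (h0 : 0 ≤ t) (h1 : t ≤ 1) (h : t ≠ 1 / 2) :
    turn t ≠ turn (1 / 2) := by
  intro e
  obtain ⟨m, hm⟩ := turn_eq_turn.1 e
  have h2 : (-1 : ℝ) < m := by linarith
  have h3 : (m : ℝ) < 1 := by linarith
  have h4 : m = 0 := by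
    have : (-1 : ℤ) < m := by exact_mod_cast h2
    have : m < (1 : ℤ) := by exact_mod_cast h3
    omega
  rw [h4] at hm
  exact h (by simpa using hm)

theorem turn_re (t : ℝ) : (turn t : ℂ).re = Real.cos (2 * Real.pi * t) := by
  rw [turn_apply, Circle.coe_exp, Complex.exp_ofReal_mul_I_re]

theorem turn_im (t : ℝ) : (turn t : ℂ).im = Real.sin (2 * Real.pi * t) := by
  rw [turn_apply, Circle.coe_exp, Complex.exp_ofReal_mul_I_im]

/-- The equator, parametrized by the interval. -/
theorem equator_turn (t : ℝ) : equator (turn t) = Quotient.mk antipodal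
    (spherePt (Real.cos (Real.pi * t)) (Real.sin (Real.pi * t)) 0 (by
      have := Real.cos_sq_add_sin_sq (Real.pi * t); linarith)) := by
  have h : turn t = turn (t / 2) ^ 2 := by rw [pow_two, ← turn_add, add_halves]
  rw [h, equator_sq]
  refine congrArg _ (sphere_ext fun k => ?_)
  have h2 : 2 * Real.pi * (t / 2) = Real.pi * t := by ring
  fin_cases k <;> simp [spherePt, turn_re, turn_im, h2]

theorem coordMul_equator (t : ℝ) :
    coordMul 0 0 (equator (turn t)) = Real.cos (Real.pi * t) * Real.cos (Real.pi * t) ∧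
    coordMul 1 1 (equator (turn t)) = Real.sin (Real.pi * t) * Real.sin (Real.pi * t) ∧
    coordMul 0 1 (equator (turn t)) = Real.cos (Real.pi * t) * Real.sin (Real.pi * t) ∧
    coordMul 1 0 (equator (turn t)) = Real.sin (Real.pi * t) * Real.cos (Real.pi * t) := by
  rw [equator_turn]
  exact ⟨rfl, rfl, rfl, rfl⟩

variable {a b c : ℕ} {G : Type*} [Group G]

/-- The covering of a piece that belongs to a family of elements of `G`. -/
def piecePotential (x : Fin a ⊕ Fin c → G) (hx : ∀ i, x (.inr i) * x (.inr i) = 1) :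
    ∀ i, Potential (Piece a b c i) G (Fin 3)
  | .inl i => circlePotential (x (.inl i))
  | .inr (.inl _) => trivialPotential Sphere2 G
  | .inr (.inr i) => projPotential (x (.inr i)) (hx i)

theorem sphere2Pt_coord (k : Fin 3) : sphere2Pt.1 k = if k = 0 then 1 else 0 := by
  simp [sphere2Pt]

theorem piecePotential_base (x : Fin a ⊕ Fin c → G) (hx : ∀ i, x (.inr i) * x (.inr i) = 1) :
    ∀ i κ, (piecePotential (b := b) x hx i).h κ (piecePt a b c i) = 1
  | .inl i, κ => by
    change (if κ = 0 then (1 : G) else if ((1 : Circle) : ℂ).im < 0 then x (.inl i) else 1) = 1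
    simp
  | .inr (.inl _), κ => rfl
  | .inr (.inr i), κ => by
    change (if (sphereRep (Quotient.mk antipodal sphere2Pt)).1 κ < 0 then x (.inr i) else 1) = 1
    rw [sphereRep, if_pos rfl, sphere2Pt_coord, if_neg]
    split_ifs <;> norm_num

theorem piecePotential_mem (x : Fin a ⊕ Fin c → G) (hx : ∀ i, x (.inr i) * x (.inr i) = 1) :
    ∀ i, piecePt a b c i ∈ (piecePotential (b := b) x hx i).U 0
  | .inl i => (turn_ne_one (t := 1 / 2) (by norm_num) (by norm_num)).symm
  | .inr (.inl _) => trivial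
  | .inr (.inr i) => by
    change coordMul 0 0 (Quotient.mk antipodal sphere2Pt) ≠ 0
    simp [coordMul_mk, sphere2Pt_coord]

/-- The covering of the wedge that belongs to a family of elements of `G`. -/
def piecesPotential (b : ℕ) (x : Fin a ⊕ Fin c → G) (hx : ∀ i, x (.inr i) * x (.inr i) = 1) :
    Potential (PieceSub a b c) G (Fin a ⊕ (Fin b ⊕ Fin c) → Fin 3) :=
  wedgePotential (piecePotential x hx) (piecePotential_base x hx)

theorem quarter_mem : (1 / 4 : ℝ) ∈ I := ⟨by norm_num, by norm_num⟩

theorem three_quarters_mem : (3 / 4 : ℝ) ∈ I := ⟨by norm_num, by norm_num⟩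

/-- The standard generators of the fundamental group of the wedge act on the fibre over the base
point, which is a copy of `G`, by left multiplication with the prescribed elements of `G`. -/
theorem piecesPotential_monodromy [TopologicalSpace G] [DiscreteTopology G]
    (x : Fin a ⊕ Fin c → G) (hx : ∀ i, x (.inr i) * x (.inr i) = 1) (i : Fin a ⊕ Fin c) (w : G) :
    (piecesPotential b x hx).isCoveringMap.monodromy (.mk (wedgeLoop a b c i))
      ((piecesPotential b x hx).pt _ w) = (piecesPotential b x hx).pt _ (x i * w) := by
  have hab : (⟨1 / 4, quarter_mem⟩ : I) ≤ ⟨3 / 4, three_quarters_mem⟩ :=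
    Subtype.mk_le_mk.2 (by norm_num)
  rcases i with i | i
  · have hval : ∀ t : I, ((wedgeLoop a b c (.inl i)) t).1 (.inl i) = (turn t : Circle) :=
      fun t => circleIncl_self a b c i (turn t)
    have := wedgePotential_monodromy (piecePotential (b := b) x hx) (piecePotential_base x hx)
      (.inl i) 0 1 (piecePotential_mem x hx) (wedgeLoop a b c (.inl i))
      (fun t j hj => circleIncl_of_ne hj _) hab
      (fun t ht h => by
        have : (t : ℝ) ≤ 1 / 4 := ht
        exact turn_ne_turn_half t.2.1 t.2.2 (by linarith) ((hval t).symm.trans h))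
      (fun t ht ht' h => by
        have h1 : 1 / 4 ≤ (t : ℝ) := ht
        have h2 : (t : ℝ) ≤ 3 / 4 := ht'
        exact turn_ne_one (by linarith) (by linarith) ((hval t).symm.trans h))
      (fun t ht h => by
        have : 3 / 4 ≤ (t : ℝ) := ht
        exact turn_ne_turn_half t.2.1 t.2.2 (by linarith) ((hval t).symm.trans h)) w
    refine this.trans (congrArg _ ?_)
    have key : ∀ z z' : Circle, z = turn (3 / 4) → z' = turn (1 / 4) →
        (1 : G)⁻¹ * (if (z : ℂ).im < 0 then x (.inl i) else 1) *
          ((if (z' : ℂ).im < 0 then x (.inl i) else 1)⁻¹ * 1) * w = x (.inl i) * w := by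
      rintro _ _ rfl rfl
      rw [turn_im, turn_im, show 2 * Real.pi * (3 / 4) = Real.pi / 2 + Real.pi by ring,
        show 2 * Real.pi * (1 / 4) = Real.pi / 2 by ring, Real.sin_add_pi, Real.sin_pi_div_two]
      norm_num
    exact key _ _ (hval _) (hval _)
  · have hval : ∀ t : I, ((wedgeLoop a b c (.inr i)) t).1 (.inr (.inr i)) = equator (turn t) :=
      fun t => projIncl_self a b c i (equator (turn t))
    have hpi := Real.pi_pos
    have hcos : ∀ t : I, (t : ℝ) ≠ 1 / 2 → coordMul 0 0 (equator (turn t)) ≠ 0 := by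
      intro t ht
      rw [(coordMul_equator t).1]
      refine mul_self_ne_zero.2 fun h => ht ?_
      have h3 := Real.injOn_cos (x₁ := Real.pi * t) (x₂ := Real.pi / 2)
        ⟨by nlinarith [t.2.1], by nlinarith [t.2.2]⟩ ⟨by linarith, by linarith⟩
        (h.trans Real.cos_pi_div_two.symm)
      exact mul_left_cancel₀ hpi.ne' (h3.trans (by ring))
    have hsin : ∀ t : I, 0 < (t : ℝ) → (t : ℝ) < 1 → coordMul 1 1 (equator (turn t)) ≠ 0 := by
      intro t ht ht'
      rw [(coordMul_equator t).2.1]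
      exact mul_self_ne_zero.2 (Real.sin_pos_of_pos_of_lt_pi (by positivity) (by nlinarith)).ne'
    have hq := hcos ⟨1 / 4, quarter_mem⟩ (by norm_num)
    have hq' := hcos ⟨3 / 4, three_quarters_mem⟩ (by norm_num)
    have hs := hsin ⟨1 / 4, quarter_mem⟩ (by norm_num) (by norm_num)
    have hs' := hsin ⟨3 / 4, three_quarters_mem⟩ (by norm_num) (by norm_num)
    have := wedgePotential_monodromy (piecePotential (b := b) x hx) (piecePotential_base x hx)
      (.inr (.inr i)) 0 1 (piecePotential_mem x hx) (wedgeLoop a b c (.inr i))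
      (fun t j hj => projIncl_of_ne hj _) hab
      (fun t ht h => by
        have : (t : ℝ) ≤ 1 / 4 := ht
        exact hcos t (by linarith) ((congrArg (coordMul 0 0) (hval t)).symm.trans h))
      (fun t ht ht' h => by
        have h1 : 1 / 4 ≤ (t : ℝ) := ht
        have h2 : (t : ℝ) ≤ 3 / 4 := ht'
        exact hsin t (by linarith) (by linarith)
          ((congrArg (coordMul 1 1) (hval t)).symm.trans h))
      (fun t ht h => by
        have : 3 / 4 ≤ (t : ℝ) := ht
        exact hcos t (by linarith) ((congrArg (coordMul 0 0) (hval t)).symm.trans h)) w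
    refine this.trans (congrArg _ ?_)
    have key : ∀ z z' : ProjPlane, z = equator (turn (3 / 4)) → z' = equator (turn (1 / 4)) →
        (if (sphereRep z).1 0 < 0 then x (.inr i) else 1)⁻¹ *
          (if (sphereRep z).1 1 < 0 then x (.inr i) else 1) *
          ((if (sphereRep z').1 1 < 0 then x (.inr i) else 1)⁻¹ *
          (if (sphereRep z').1 0 < 0 then x (.inr i) else 1)) * w = x (.inr i) * w := by
      rintro _ _ rfl rfl
      rw [projPotential_quotient (hx i) 1 0 _ hs' hq', projPotential_quotient (hx i) 0 1 _ hq hs]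
      have hc : 0 < Real.cos (Real.pi / 4) := by rw [Real.cos_pi_div_four]; positivity
      have hs : 0 < Real.sin (Real.pi / 4) := by rw [Real.sin_pi_div_four]; positivity
      rw [(coordMul_equator _).2.2.2, (coordMul_equator _).2.2.1,
        show Real.pi * (3 / 4) = Real.pi - Real.pi / 4 by ring,
        show Real.pi * (1 / 4) = Real.pi / 4 by ring, Real.sin_pi_sub, Real.cos_pi_sub,
        if_pos (by nlinarith), if_neg (by nlinarith), mul_one]
    exact key _ _ (hval _) (hval _)

theorem freeToWedge_injective : Function.Injective (freeToWedge a b c) := by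
  let _ : TopologicalSpace (FreeProductZZ2 a c) := ⊥
  have : DiscreteTopology (FreeProductZZ2 a c) := ⟨rfl⟩
  let P := piecesPotential b (freeGen a c) freeGen_mul_self
  let E := Equiv.ofBijective (P.pt (subPt a b c)) ⟨P.pt_injective _, P.pt_surjective _⟩
  let f := (P.isCoveringMap.monodromyPerm (subPt a b c)).comp (freeToWedge a b c)
  let g := E.permCongrHom.toMonoidHom.comp (MulAction.toPermHom (FreeProductZZ2 a c)
    (FreeProductZZ2 a c))
  have hfg : f = g := freeProduct_hom_ext fun i => Equiv.ext fun z => by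
    obtain ⟨w, rfl⟩ := E.surjective z
    have h1 : f (freeGen a c i) = P.isCoveringMap.monodromyPerm _ (wedgeGen a b c i) :=
      congrArg (P.isCoveringMap.monodromyPerm (subPt a b c)) (freeToWedge_gen i)
    have h2 : g (freeGen a c i) (E w) = E (freeGen a c i * w) :=
      congrArg (fun u => E (freeGen a c i * u)) (E.symm_apply_apply w)
    rw [h1, h2]
    exact piecesPotential_monodromy (freeGen a c) freeGen_mul_self i w
  refine (injective_iff_map_eq_one _).2 fun x hx => ?_
  have h1 : f x = 1 :=
    (congrArg (P.isCoveringMap.monodromyPerm (subPt a b c)) hx).trans (map_one _)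
  rw [hfg] at h1
  have h2 : E (x * E.symm (E 1)) = E 1 := congrArg (fun e => e (E 1)) h1
  rw [E.symm_apply_apply, mul_one] at h2
  exact E.injective h2

/-- The fundamental group of the wedge. -/
def freeEquivWedge (a b c : ℕ) : FreeProductZZ2 a c ≃* WedgeGroup a b c :=
  MulEquiv.ofBijective (freeToWedge a b c) ⟨freeToWedge_injective, freeToWedge_surjective⟩

end Monodromy

/-- Spaces that are homotopy equivalent to the wedge have its fundamental group. -/
theorem nonempty_fundamentalGroup_mulEquiv {X : Type*} [TopologicalSpace X] {a b c : ℕ}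
    (e : X ≃ₕ PieceSub a b c) (x : X) : Nonempty (FundamentalGroup X x ≃* FreeProductZZ2 a c) := by
  have e₁ := (FundamentalGroupoidFunctor.equivOfHomotopyEquiv e).fullyFaithfulFunctor.mulEquivEnd
    (FundamentalGroupoid.mk x)
  have : PathConnectedSpace (PieceSub a b c) :=
    have : PathConnectedSpace (WedgeOfPieces a b c) := pathConnectedSpace_wedge
    (wedgeHomeo (piecePt a b c)).surjective.pathConnectedSpace
      (wedgeHomeo (piecePt a b c)).continuous
  have e₂ := FundamentalGroup.fundamentalGroupMulEquivOfPathConnected (e x) (subPt a b c)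
  have e₃ : FundamentalGroup X x ≃* FundamentalGroup (PieceSub a b c) (e x) := e₁
  exact ⟨e₃.trans (e₂.trans (freeEquivWedge a b c).symm)⟩

/-! ### Hyperbolicity of free products of copies of `ℤ` and `ℤ/2` -/

section Words

variable {A : Type*} [DecidableEq A]

/-- The length of the longest common prefix. -/
def lcp : List A → List A → ℕ
  | x :: u, y :: v => if x = y then lcp u v + 1 else 0
  | _, _ => 0

theorem lcp_comm (u v : List A) : lcp u v = lcp v u := by
  induction u generalizing v with
  | nil => cases v <;> simp [lcp]
  | cons x u ih =>
    cases v with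
    | nil => simp [lcp]
    | cons y v => simp [lcp, ih v, eq_comm]

theorem lcp_le_or (u v w : List A) : lcp u v ≤ lcp u w ∨ lcp v w ≤ lcp u w := by
  induction u generalizing v w with
  | nil => cases v <;> simp [lcp]
  | cons x u ih =>
    cases v with
    | nil => simp [lcp]
    | cons y v =>
      cases w with
      | nil => simp [lcp]
      | cons z w =>
        have := ih v w
        by_cases h1 : x = y <;> by_cases h2 : y = z <;> by_cases h3 : x = z <;>
          simp_all [lcp]

/-- The four point condition for words, with the distance in the tree of words expressed by common
prefixes. -/
theorem lcp_four_points (x y z w : List A) :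
    lcp x z + lcp y w ≤ lcp x y + lcp z w ∨ lcp x w + lcp y z ≤ lcp x y + lcp z w := by
  have h1 := lcp_le_or x z y
  have h2 := lcp_le_or x w y
  have h3 := lcp_le_or z x w
  have h4 := lcp_le_or z y w
  rw [lcp_comm z y] at h1
  rw [lcp_comm w y] at h2
  rw [lcp_comm z x] at h3
  rw [lcp_comm z y] at h4
  omega

variable {inv : A → A}

/-- Reduced words in letters with inverses. -/
abbrev ReducedWord (inv : A → A) : Type _ := {l : List A // l.IsChain fun x y => inv x ≠ y}

/-- Multiplication of a reduced word by a letter. -/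
def pushLetter (inv : A → A) (x : A) : List A → List A
  | [] => [x]
  | y :: l => if inv x = y then l else x :: y :: l

theorem isChain_pushLetter {x : A} {l : List A} (hl : l.IsChain fun x y => inv x ≠ y) :
    (pushLetter inv x l).IsChain fun x y => inv x ≠ y := by
  cases l with
  | nil => simp [pushLetter]
  | cons y l =>
    simp only [pushLetter]
    split_ifs with h
    · exact hl.tail
    · exact hl.cons_cons h

theorem pushLetter_pushLetter (hinv : Function.Involutive inv) {x : A} {l : List A}
    (hl : l.IsChain fun x y => inv x ≠ y) : pushLetter inv (inv x) (pushLetter inv x l) = l := by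
  cases l with
  | nil => simp [pushLetter, hinv x]
  | cons y l =>
    by_cases h : inv x = y
    · subst h
      simp only [pushLetter, if_true]
      cases l with
      | nil => rfl
      | cons z l =>
        have : inv (inv x) ≠ z := (List.isChain_cons_cons.1 hl).1
        simp [this]
    · simp [pushLetter, h, hinv x]

/-- A letter permutes the reduced words. -/
def letterPerm (hinv : Function.Involutive inv) (x : A) : Equiv.Perm (ReducedWord inv) where
  toFun l := ⟨pushLetter inv x l.1, isChain_pushLetter l.2⟩
  invFun l := ⟨pushLetter inv (inv x) l.1, isChain_pushLetter l.2⟩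
  left_inv l := Subtype.ext (pushLetter_pushLetter hinv l.2)
  right_inv l := Subtype.ext (by
    have := pushLetter_pushLetter hinv (x := inv x) l.2
    rwa [hinv x] at this)

theorem letterPerm_inv (hinv : Function.Involutive inv) (x : A) :
    letterPerm hinv (inv x) = (letterPerm hinv x)⁻¹ :=
  Equiv.ext fun _ => Subtype.ext rfl

theorem pushLetter_eq_cons {x : A} {l : List A} (h : (x :: l).IsChain fun x y => inv x ≠ y) :
    pushLetter inv x l = x :: l := by
  cases l with
  | nil => rfl
  | cons y l => exact if_neg (List.isChain_cons_cons.1 h).1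

theorem length_pushLetter_le (x : A) (l : List A) :
    (pushLetter inv x l).length ≤ l.length + 1 := by
  cases l with
  | nil => simp [pushLetter]
  | cons y l =>
    simp only [pushLetter]
    split_ifs <;> simp
    omega

variable {G : Type*} [Group G] {val : A → G}

theorem prod_pushLetter (hval : ∀ x, val (inv x) = (val x)⁻¹) (x : A) (l : List A) :
    ((pushLetter inv x l).map val).prod = val x * (l.map val).prod := by
  cases l with
  | nil => simp [pushLetter]
  | cons y l =>
    simp only [pushLetter]
    split_ifs with h
    · subst h
      simp [hval]
    · simp

/-- A group that acts on the reduced words in a finite generating set as a free product of cyclic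
groups does is hyperbolic: its Cayley graph is a tree. -/
theorem isHyperbolicGroup_of_letterPerm [Finite A] (hinv : Function.Involutive inv)
    (hval : ∀ x, val (inv x) = (val x)⁻¹) {S : Set G} (hS : S ⊆ Set.range val)
    (hSval : ∀ x, val x ∈ S ∨ (val x)⁻¹ ∈ S) (hgen : Subgroup.closure S = ⊤)
    (f : G →* Equiv.Perm (ReducedWord inv)) (hf : ∀ x, f (val x) = letterPerm hinv x) :
    IsHyperbolicGroup G := by
  let nf : G → List A := fun g => (f g ⟨[], List.isChain_nil⟩).1
  have hnf : ∀ g, (nf g).IsChain fun x y => inv x ≠ y := fun g => (f g ⟨[], _⟩).2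
  have hcons : ∀ x g, nf (val x * g) = pushLetter inv x (nf g) := fun x g => by
    simp only [nf, map_mul, hf]
    rfl
  have hword : ∀ l : List G, (∀ x ∈ l, x ∈ S ∨ x⁻¹ ∈ S) → ∃ m : List A, m.map val = l := by
    intro l hl
    have : l ∈ Set.range (List.map val) := by
      rw [Set.range_list_map]
      intro x hx
      rcases hl x hx with h | h
      · exact hS h
      · obtain ⟨y, hy⟩ := hS h
        exact ⟨inv y, by rw [hval, hy, inv_inv]⟩
    exact this
  have hred : ∀ l : List A, (l.IsChain fun x y => inv x ≠ y) → nf (l.map val).prod = l := by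
    intro l
    induction l with
    | nil => intro _; simp [nf]
    | cons x l ih =>
      intro h
      rw [List.map_cons, List.prod_cons, hcons, ih h.tail, pushLetter_eq_cons h]
  have hle : ∀ m : List A, (nf (m.map val).prod).length ≤ m.length := by
    intro m
    induction m with
    | nil => simp [nf]
    | cons x m ih =>
      rw [List.map_cons, List.prod_cons, hcons, List.length_cons]
      exact (length_pushLetter_le _ _).trans (by omega)
  have hprod : ∀ g, ((nf g).map val).prod = g := by
    intro g
    have hg : g ∈ (Subgroup.closure S).toSubmonoid := hgen ▸ Subgroup.mem_top g
    rw [Subgroup.closure_toSubmonoid] at hg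
    obtain ⟨l, hl, rfl⟩ := Submonoid.exists_list_of_mem_closure hg
    obtain ⟨m, rfl⟩ := hword l hl
    clear hl hg
    induction m with
    | nil => simp [nf]
    | cons x m ih => rw [List.map_cons, List.prod_cons, hcons, prod_pushLetter hval, ih]
  have hlen : ∀ g, wordLength S g = (nf g).length := by
    intro g
    refine le_antisymm (Nat.sInf_le ⟨(nf g).map val, List.length_map _, ?_, hprod g⟩) ?_
    · intro x hx
      obtain ⟨y, -, rfl⟩ := List.mem_map.1 hx
      exact hSval y
    · refine le_csInf ⟨_, (nf g).map val, rfl, ?_, hprod g⟩ ?_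
      · intro x hx
        obtain ⟨y, -, rfl⟩ := List.mem_map.1 hx
        exact hSval y
      · rintro _ ⟨l, rfl, hl, rfl⟩
        obtain ⟨m, rfl⟩ := hword l hl
        rw [List.length_map]
        exact hle m
  have hrev : ∀ u : List A, ((u.reverse.map inv).map val).prod = ((u.map val).prod)⁻¹ := by
    intro u
    induction u with
    | nil => simp
    | cons x u ih =>
      rw [List.reverse_cons, List.map_append, List.map_append, List.prod_append, ih]
      simp [hval]
  have hcancel : ∀ u v : List A, (u.IsChain fun x y => inv x ≠ y) →
      (v.IsChain fun x y => inv x ≠ y) →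
      (nf (((u.map val).prod)⁻¹ * (v.map val).prod)).length + 2 * lcp u v =
        u.length + v.length := by
    intro u
    induction u with
    | nil => intro v _ hv; simp [lcp, hred v hv]
    | cons x u ih =>
      intro v hu hv
      have main : ∀ v : List A, (v.IsChain fun x y => inv x ≠ y) → (∀ y ∈ v.head?, x ≠ y) →
          (nf ((((x :: u).map val).prod)⁻¹ * (v.map val).prod)).length =
            (x :: u).length + v.length := by
        intro v hv hxv
        rw [← hrev, ← List.prod_append, ← List.map_append, hred, List.length_append,
          List.length_map, List.length_reverse]
        refine List.IsChain.append ?_ hv ?_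
        · rw [List.isChain_map, List.isChain_reverse]
          refine hu.imp fun y z h h' => h ?_
          rw [hinv] at h'
          exact h'.symm
        · intro y hy z hz
          simp only [List.reverse_cons, List.map_append, List.map_cons, List.map_nil,
            List.getLast?_append, List.getLast?_singleton, Option.some_or, Option.mem_some_iff] at hy
          rw [← hy, hinv]
          exact hxv z hz
      cases v with
      | nil => rw [main [] hv (by simp)]; simp [lcp]
      | cons y v =>
        by_cases h : x = y
        · subst h
          have := ih v hu.tail hv.tail
          simp only [List.map_cons, List.prod_cons, mul_inv_rev, lcp, if_true, List.length_cons]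
          rw [mul_assoc, inv_mul_cancel_left]
          omega
        · rw [main (y :: v) hv (by simpa using h)]
          simp [lcp, h]
  have hdist : ∀ x y, wordDist S x y + 2 * lcp (nf x) (nf y) = (nf x).length + (nf y).length := by
    intro x y
    have := hcancel _ _ (hnf x) (hnf y)
    rwa [hprod, hprod, ← hlen] at this
  refine ⟨S, (Set.finite_range val).subset hS, hgen, 0, fun x y z w => ?_⟩
  have h1 := hdist x y
  have h2 := hdist z w
  have h3 := hdist x z
  have h4 := hdist y w
  have h5 := hdist x w
  have h6 := hdist y z
  have h7 := lcp_four_points (nf x) (nf y) (nf z) (nf w)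
  omega

end Words

section FreeProduct

variable {a c : ℕ}

/-- The letters: the generators of the copies of `ℤ` and their inverses, and the generators of the
copies of `ℤ/2`. -/
abbrev Letter (a c : ℕ) : Type := Fin a × Bool ⊕ Fin c

/-- The inverse of a letter. -/
def Letter.inv : Letter a c → Letter a c
  | .inl (i, ε) => .inl (i, !ε)
  | .inr i => .inr i

theorem Letter.inv_involutive : Function.Involutive (Letter.inv : Letter a c → Letter a c) := by
  rintro (⟨i, ε⟩ | i) <;> simp [Letter.inv]

/-- The value of a letter for given values of the generators. -/
def Letter.val {G : Type*} [Group G] (x : Fin a ⊕ Fin c → G) : Letter a c → G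
  | .inl (i, true) => x (.inl i)
  | .inl (i, false) => (x (.inl i))⁻¹
  | .inr i => x (.inr i)

theorem Letter.val_inv {G : Type*} [Group G] {x : Fin a ⊕ Fin c → G}
    (hx : ∀ i, x (.inr i) * x (.inr i) = 1) : ∀ y : Letter a c, y.inv.val x = (y.val x)⁻¹
  | .inl (_, true) => rfl
  | .inl (_, false) => (inv_inv _).symm
  | .inr i => eq_inv_of_mul_eq_one_left (hx i)

theorem Letter.range_subset {G : Type*} [Group G] (x : Fin a ⊕ Fin c → G) :
    Set.range x ⊆ Set.range (Letter.val x) := by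
  rintro _ ⟨i | i, rfl⟩
  exacts [⟨.inl (i, true), rfl⟩, ⟨.inr i, rfl⟩]

theorem Letter.val_mem {G : Type*} [Group G] (x : Fin a ⊕ Fin c → G) :
    ∀ y : Letter a c, y.val x ∈ Set.range x ∨ (y.val x)⁻¹ ∈ Set.range x
  | .inl (i, true) => Or.inl ⟨.inl i, rfl⟩
  | .inl (i, false) => Or.inr ⟨.inl i, (inv_inv _).symm⟩
  | .inr i => Or.inl ⟨.inr i, rfl⟩

theorem closure_range_freeGen : Subgroup.closure (Set.range (freeGen a c)) = ⊤ := by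
  let K := Subgroup.closure (Set.range (freeGen a c))
  let x : Fin a ⊕ Fin c → K := fun i => ⟨freeGen a c i, Subgroup.subset_closure ⟨i, rfl⟩⟩
  let f : FreeProductZZ2 a c →* K := freeLift x fun i => Subtype.ext (freeGen_mul_self i)
  have hf : K.subtype.comp f = MonoidHom.id _ := freeProduct_hom_ext fun i =>
    congrArg Subtype.val (freeLift_gen x (fun i => Subtype.ext (freeGen_mul_self i)) i)
  refine (Subgroup.eq_top_iff' _).2 fun g => ?_
  have := (f g).2
  rwa [show ((f g : K) : FreeProductZZ2 a c) = g from DFunLike.congr_fun hf g] at this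

theorem isHyperbolicGroup_freeProduct (a c : ℕ) : IsHyperbolicGroup (FreeProductZZ2 a c) := by
  let y : Fin a ⊕ Fin c → Letter a c := Sum.elim (fun i => .inl (i, true)) .inr
  let x : Fin a ⊕ Fin c → Equiv.Perm (ReducedWord (Letter.inv : Letter a c → Letter a c)) :=
    fun i => letterPerm Letter.inv_involutive (y i)
  have hx : ∀ i, x (.inr i) * x (.inr i) = 1 := fun i =>
    mul_eq_one_iff_eq_inv.2 (letterPerm_inv Letter.inv_involutive (.inr i))
  refine isHyperbolicGroup_of_letterPerm Letter.inv_involutive (Letter.val_inv freeGen_mul_self)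
    (Letter.range_subset _) (Letter.val_mem _) closure_range_freeGen (freeLift x hx) ?_
  rintro (⟨i, _ | _⟩ | i)
  · refine (map_inv (freeLift x hx) (freeGen a c (.inl i))).trans ?_
    rw [freeLift_gen]
    exact (letterPerm_inv Letter.inv_involutive (.inl (i, true))).symm
  · exact freeLift_gen x hx (.inl i)
  · exact freeLift_gen x hx (.inr i)

theorem IsHyperbolicGroup.mulEquiv {G H : Type*} [Group G] [Group H] (h : IsHyperbolicGroup G)
    (e : G ≃* H) : IsHyperbolicGroup H := by
  obtain ⟨S, hS, hgen, δ, hδ⟩ := h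
  have hlen : ∀ g : H, wordLength (e '' S) g = wordLength S (e.symm g) := by
    intro g
    refine congrArg sInf (Set.ext fun n => ⟨?_, ?_⟩)
    · rintro ⟨l, hl, hlS, rfl⟩
      refine ⟨l.map e.symm, (List.length_map _).trans hl, ?_, (map_list_prod e.symm l).symm⟩
      intro x hx
      obtain ⟨y, hy, rfl⟩ := List.mem_map.1 hx
      rcases hlS y hy with ⟨z, hz, h⟩ | ⟨z, hz, h⟩
      · exact Or.inl (by simpa [← h] using hz)
      · refine Or.inr ?_
        rw [← map_inv, ← h]
        simpa using hz
    · rintro ⟨l, hl, hlS, h⟩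
      refine ⟨l.map e, (List.length_map _).trans hl, ?_, ?_⟩
      · intro x hx
        obtain ⟨y, hy, rfl⟩ := List.mem_map.1 hx
        rcases hlS y hy with h | h
        · exact Or.inl ⟨y, h, rfl⟩
        · exact Or.inr ⟨y⁻¹, h, map_inv e y⟩
      · rw [← map_list_prod, h, e.apply_symm_apply]
  refine ⟨e '' S, hS.image e, ?_, δ, fun x y z w => ?_⟩
  · have := MonoidHom.map_closure (e : G →* H) S
    rw [hgen, Subgroup.map_top_of_surjective _ e.surjective] at this
    exact this.symm
  · simp only [wordDist, hlen, map_mul, map_inv]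
    exact hδ _ _ _ _

end FreeProduct

/-! ### Complexes of dimension at most two -/

section Complexes

open Finset

variable {V : Type*} [DecidableEq V] {U : Finset V} {F T : Finset (Finset V)}

/-- Vertices, edges and triangles that form a simplicial complex. -/
structure IsComplex (U : Finset V) (F T : Finset (Finset V)) : Prop where
  edge : ∀ e ∈ F, e ⊆ U ∧ e.card = 2
  triangular : Triangular T
  edges_subset : edges T ⊆ F
  subset : ∀ t ∈ T, t ⊆ U

theorem IsComplex.face (h : IsComplex U F T) {s : Finset V} (hs : s ∈ fc U F T) :
    s.Nonempty ∧ s ⊆ U := by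
  rcases hs with ⟨v, hv, rfl⟩ | hs | hs
  · simpa using hv
  · exact ⟨card_pos.1 (by rw [(h.edge s hs).2]; norm_num), (h.edge s hs).1⟩
  · exact ⟨card_pos.1 (by rw [h.triangular s hs]; norm_num), h.subset s hs⟩

theorem IsComplex.pair_mem (h : IsComplex U F T) {s : Finset V} (hs : s ∈ fc U F T) {a b : V}
    (ha : a ∈ s) (hb : b ∈ s) (hab : a ≠ b) : {a, b} ∈ F := by
  have hsub : ({a, b} : Finset V) ⊆ s := insert_subset ha (singleton_subset_iff.2 hb)
  rcases hs with ⟨v, hv, rfl⟩ | hs | hs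
  · exact absurd ((mem_singleton.1 ha).trans (mem_singleton.1 hb).symm) hab
  · rwa [eq_of_subset_of_card_le hsub (by rw [(h.edge s hs).2, card_pair hab])]
  · exact h.edges_subset (mem_edges.2 ⟨s, hs, hsub, card_pair hab⟩)

/-- The complex with given vertices, edges and triangles. -/
def complex (h : IsComplex U F T) : PreAbstractSimplicialComplex V where
  faces := fc U F T
  isRelLowerSet_faces := by
    intro s hs
    refine ⟨(h.face hs).1, fun r hrs hr => ?_⟩
    have hrU : r ⊆ U := le_trans hrs (h.face hs).2
    have h1 := hr.card_pos
    rcases (show r.card = 1 ∨ r.card = 2 ∨ 3 ≤ r.card by omega) with h2 | h2 | h2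
    · obtain ⟨v, rfl⟩ := card_eq_one.1 h2
      exact Or.inl ⟨v, by simpa using hrU, rfl⟩
    · obtain ⟨a, b, hab, rfl⟩ := card_eq_two.1 h2
      exact Or.inr (Or.inl (h.pair_mem hs (hrs (by simp)) (hrs (by simp)) hab))
    · have : r = s := by
        refine eq_of_subset_of_card_le hrs (le_trans ?_ h2)
        rcases hs with ⟨v, hv, rfl⟩ | hs | hs
        · simp
        · rw [(h.edge s hs).2]; norm_num
        · rw [h.triangular s hs]
      exact this ▸ hs

theorem exists_eq_complex (X : PreAbstractSimplicialComplex V) (hfin : X.faces.Finite)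
    (hdim : ∀ s ∈ X, s.card ≤ 3) : ∃ (U : Finset V) (F T : Finset (Finset V))
      (h : IsComplex U F T), X = complex h := by
  have hlow : ∀ s ∈ X, ∀ r ⊆ s, r.Nonempty → r ∈ X := fun s hs r hrs hr =>
    (X.isRelLowerSet_faces hs).2 hrs hr
  have hmem : ∀ {n : ℕ} {s}, s ∈ hfin.toFinset.filter (fun s => s.card = n) ↔ s ∈ X ∧ s.card = n :=
    fun {n s} => by rw [mem_filter, Set.Finite.mem_toFinset]; rfl
  have hU : ∀ {v}, v ∈ hfin.toFinset.biUnion id ↔ {v} ∈ X := fun {v} => by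
    rw [mem_biUnion]
    constructor
    · rintro ⟨s, hs, hv⟩
      exact hlow s ((Set.Finite.mem_toFinset _).1 hs) _ (singleton_subset_iff.2 hv) (by simp)
    · exact fun h => ⟨{v}, (Set.Finite.mem_toFinset _).2 h, by simp⟩
  have hsU : ∀ s ∈ X, s ⊆ hfin.toFinset.biUnion id := fun s hs =>
    subset_biUnion_of_mem id ((Set.Finite.mem_toFinset hfin).2 hs)
  refine ⟨hfin.toFinset.biUnion id, hfin.toFinset.filter (fun s => s.card = 2),
    hfin.toFinset.filter (fun s => s.card = 3), ⟨fun e he => ?_, fun t ht => (hmem.1 ht).2,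
    fun e he => ?_, fun t ht => hsU t (hmem.1 ht).1⟩, SetLike.ext fun s => ?_⟩
  · exact ⟨hsU e (hmem.1 he).1, (hmem.1 he).2⟩
  · obtain ⟨t, ht, het, hc⟩ := mem_edges.1 he
    exact hmem.2 ⟨hlow t (hmem.1 ht).1 e het (card_pos.1 (by omega)), hc⟩
  · change s ∈ X ↔ s ∈ fc _ _ _
    constructor
    · intro hs
      have h1 : 0 < s.card := (X.isRelLowerSet_faces hs).1.card_pos
      have h3 := hdim s hs
      rcases (show s.card = 1 ∨ s.card = 2 ∨ s.card = 3 by omega) with h2 | h2 | h2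
      · obtain ⟨v, rfl⟩ := card_eq_one.1 h2
        exact Or.inl ⟨v, hU.2 hs, rfl⟩
      · exact Or.inr (Or.inl (hmem.2 ⟨hs, h2⟩))
      · exact Or.inr (Or.inr (hmem.2 ⟨hs, h2⟩))
    · rintro (⟨v, hv, rfl⟩ | hs | hs)
      exacts [hU.1 hv, (hmem.1 hs).1, (hmem.1 hs).1]

theorem IsComplex.mem_card_three (h : IsComplex U F T) {s : Finset V} :
    s ∈ complex h ∧ s.card = 2 + 1 ↔ s ∈ T := by
  constructor
  · rintro ⟨⟨v, hv, rfl⟩ | hs | hs, hc⟩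
    · simp at hc
    · rw [(h.edge s hs).2] at hc; omega
    · exact hs
  · exact fun hs => ⟨Or.inr (Or.inr hs), h.triangular s hs⟩

theorem IsComplex.mem_card_two (h : IsComplex U F T) {s : Finset V} :
    s ∈ complex h ∧ s.card = 1 + 1 ↔ s ∈ F := by
  constructor
  · rintro ⟨⟨v, hv, rfl⟩ | hs | hs, hc⟩
    · simp at hc
    · exact hs
    · rw [h.triangular s hs] at hc; omega
  · exact fun hs => ⟨Or.inr (Or.inl hs), (h.edge s hs).2⟩

theorem IsComplex.mem_card_one (h : IsComplex U F T) {s : Finset V} :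
    s ∈ complex h ∧ s.card = 0 + 1 ↔ s ∈ U.image fun v => ({v} : Finset V) := by
  rw [mem_image]
  constructor
  · rintro ⟨⟨v, hv, rfl⟩ | hs | hs, hc⟩
    · exact ⟨v, hv, rfl⟩
    · rw [(h.edge s hs).2] at hc; omega
    · rw [h.triangular s hs] at hc; omega
  · rintro ⟨v, hv, rfl⟩
    exact ⟨Or.inl ⟨v, hv, rfl⟩, by simp⟩

theorem numFaces_complex (h : IsComplex U F T) : numFaces (complex h) 0 = U.card ∧
    numFaces (complex h) 1 = F.card ∧ numFaces (complex h) 2 = T.card := by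
  have key : ∀ (n : ℕ) (S : Finset (Finset V)),
      (∀ s, s ∈ complex h ∧ s.card = n + 1 ↔ s ∈ S) → numFaces (complex h) n = S.card := by
    intro n S hS
    rw [numFaces, ← Set.ncard_coe_finset]
    exact congrArg Set.ncard (Set.ext hS)
  refine ⟨(key 0 _ fun s => h.mem_card_one).trans (card_image_of_injective _ singleton_injective),
    key 1 _ fun s => h.mem_card_two, key 2 _ fun s => h.mem_card_three⟩

theorem IsComplex.sparse (h : IsComplex U F T)
    (hs : ∀ W : PreAbstractSimplicialComplex V, W ≤ complex h → W.faces.Nonempty →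
      numFaces W 2 < 2 * numFaces W 0) : Sparse T := by
  intro S hST ⟨t, ht⟩
  have hS : IsComplex (verts S) (edges S) S :=
    ⟨edges_subset_verts_and_card S, h.triangular.mono hST, subset_rfl,
      fun t ht => subset_biUnion_of_mem id ht⟩
  have h1 : complex hS ≤ complex h := fun s hs =>
    fc_mono (biUnion_subset.2 fun t ht => h.subset t (hST ht))
      ((edges_mono hST).trans h.edges_subset) hST hs
  have h2 := hs _ h1 ⟨t, Or.inr (Or.inr ht)⟩
  rw [(numFaces_complex hS).1, (numFaces_complex hS).2.2] at h2
  unfold slack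
  omega

omit [DecidableEq V] in
theorem sum_eq_one_of_subset {A s : Finset V} {p : V → ℝ} (hp : p ∈ geom {s}) (h : s ⊆ A) :
    ∑ v ∈ A, p v = 1 := by
  obtain ⟨_, rfl, -, h0, h1⟩ := hp
  rw [← h1]
  exact (sum_subset h fun v _ hv => h0 v hv).symm

omit [DecidableEq V] in
theorem sum_eq_zero_of_disjoint {A s : Finset V} {p : V → ℝ} (hp : p ∈ geom {s})
    (h : Disjoint s A) : ∑ v ∈ A, p v = 0 := by
  obtain ⟨_, rfl, -, h0, h1⟩ := hp
  exact sum_eq_zero fun v hv => h0 v fun hvs => disjoint_left.1 h hvs hv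

theorem single_mem_geom {s : Finset V} {v : V} (hv : v ∈ s) : Pi.single v (1 : ℝ) ∈ geom {s} := by
  refine ⟨s, rfl, fun w => ?_, fun w hw => Pi.single_eq_of_ne (fun e : w = v => hw (e.symm ▸ hv)) _, ?_⟩
  · by_cases h : w = v
    · rw [h, Pi.single_eq_same]; norm_num
    · rw [Pi.single_eq_of_ne h]
  · rw [sum_eq_single v (fun w _ hw => Pi.single_eq_of_ne hw _) fun h => absurd hv h,
      Pi.single_eq_same]

/-- The graph of the edges of a connected complex is connected. -/
theorem IsComplex.connGraph (h : IsComplex U F T) [ConnectedSpace (geom (fc U F T))] :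
    U.Nonempty ∧ ConnGraph U F := by
  obtain ⟨x₀⟩ := (inferInstance : Nonempty (geom (fc U F T)))
  refine ⟨?_, fun A hA hne hAU => ?_⟩
  · obtain ⟨_, s, hs, -⟩ := x₀
    exact (h.face hs).1.mono (h.face hs).2
  · by_contra! hno
    have hface : ∀ s ∈ fc U F T, s ⊆ A ∨ Disjoint s A := by
      intro s hs
      by_contra! hn
      obtain ⟨b, hb, hbA⟩ := not_subset.1 hn.1
      obtain ⟨a, ha, haA⟩ := not_disjoint_iff.1 hn.2
      exact hbA (hno _ (h.pair_mem hs ha hb fun e => hbA (e ▸ haA)) a (by simp) b (by simp) haA)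
    have hval : ∀ p : geom (fc U F T), ∑ v ∈ A, p.1 v = 1 ∨ ∑ v ∈ A, p.1 v = 0 := by
      rintro ⟨p, s, hs, hp⟩
      exact (hface s hs).imp (sum_eq_one_of_subset ⟨s, rfl, hp⟩)
        (sum_eq_zero_of_disjoint ⟨s, rfl, hp⟩)
    obtain ⟨a, ha⟩ := hne
    obtain ⟨b, hb, hbA⟩ := exists_of_ssubset (hA.ssubset_of_ne hAU)
    have hmem : ∀ v ∈ U, Pi.single v (1 : ℝ) ∈ geom (fc U F T) := fun v hv =>
      geom_mono (Set.singleton_subset_iff.2 (Or.inl ⟨v, hv, rfl⟩))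
        (single_mem_geom (mem_singleton_self v))
    have hcont : Continuous fun p : geom (fc U F T) => ∑ v ∈ A, p.1 v :=
      continuous_finsetSum _ fun v _ => (continuous_apply v).comp continuous_subtype_val
    obtain ⟨p, hp⟩ := mem_range_of_exists_le_of_exists_ge hcont (c := (1 / 2 : ℝ))
      ⟨⟨_, hmem b hb⟩, by
        rw [sum_eq_zero_of_disjoint (single_mem_geom (mem_singleton_self b)) (by simpa using hbA)]
        norm_num⟩
      ⟨⟨_, hmem a (hA ha)⟩, by
        rw [sum_eq_one_of_subset (single_mem_geom (mem_singleton_self a)) (by simpa using ha)]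
        norm_num⟩
    have hp : ∑ v ∈ A, p.1 v = 1 / 2 := hp
    rcases hval p with h | h <;> rw [h] at hp <;> norm_num at hp

/-- A connected complex has Euler characteristic at most one if no subfamily of its triangles has
positive excess. -/
theorem IsComplex.eulerChar_le (h : IsComplex U F T) [ConnectedSpace (geom (fc U F T))]
    (hx : excess T ≤ 0) : eulerChar (complex h) ≤ 1 := by
  obtain ⟨-, hconn⟩ := h.connGraph
  have h1 := card_le_rk_add_one h.edge hconn
  have h2 := cyc_mono h.edges_subset
  obtain ⟨e0, e1, e2⟩ := numFaces_complex h
  rw [eulerChar, e0, e1, e2]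
  unfold excess at hx
  unfold cyc at h2 hx
  omega

/-- Triangles can be removed without changing the fundamental groups until no subfamily has positive
excess. -/
theorem exists_excess_nonpos {T : Finset (Finset V)} (hT : Triangular T) (hs : Sparse T) :
    ∃ T' ⊆ T, (∀ A ⊆ T', excess A ≤ 0) ∧ ∀ (U : Finset V) (F : Finset (Finset V)),
      (∀ e ∈ F, e.card = 2) → (∀ t ∈ T, t ⊆ U) → edges T ⊆ F →
      ∀ h : fc U F T' ⊆ fc U F T, PiIso (geomIncl h) := by
  induction T using Finset.strongInduction with
  | H T ih =>
    by_cases hx : ∀ A ⊆ T, excess A ≤ 0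
    · exact ⟨T, subset_rfl, hx, fun U F _ _ _ h => piIso_id⟩
    · push Not at hx
      obtain ⟨A, hA, hx⟩ := hx
      obtain ⟨w, hw, hnull⟩ := exists_triangle_nullhomotopic hT hs hA hx
      have hle : T.erase (univ.map w) ⊆ T := erase_subset _ _
      obtain ⟨T', hT', hx', hiso⟩ := ih _ (erase_ssubset hw) (hT.mono hle) (hs.mono hle)
      refine ⟨T', hT'.trans hle, hx', fun U F hF hTU hTF h => ?_⟩
      obtain ⟨hK, hn⟩ := hnull U F hTU hTF
      have hhom := isHomeomorph_triangles (ι := Unit) (w := fun _ => w) (T' := T) hF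
        (hT.mono hle) (fun _ _ _ => rfl) (fun _ => notMem_erase _ _) (fun _ => hK) hle
        (fun _ => Or.inr (Or.inr hw))
        (fun t ht => by
          by_cases htw : t = univ.map w
          · exact Or.inr ⟨(), htw⟩
          · exact Or.inl (mem_erase.2 ⟨htw, ht⟩))
      have h1 := (piIso_homeomorph hhom).comp (Att.piIso_inl (J := Unit) fun _ => hn)
      exact h1.comp (hiso U F hF (fun t ht => hTU t (hle ht)) ((edges_mono hle).trans hTF)
        (fc_mono subset_rfl subset_rfl hT'))

end Complexes

/-! ### Components -/

section Components

open Finset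
open scoped unitInterval

variable {V : Type*} [DecidableEq V] {U : Finset V} {F T : Finset (Finset V)}

omit [DecidableEq V] in
theorem convex_geom_singleton (s : Finset V) : Convex ℝ (geom {s}) := by
  rintro p ⟨r, hr, hp, hp0, hp1⟩ q ⟨t, ht, hq, hq0, hq1⟩ a b ha hb hab
  rw [Set.mem_singleton_iff.1 hr] at hp0 hp1
  rw [Set.mem_singleton_iff.1 ht] at hq0 hq1
  refine ⟨s, rfl, fun v => ?_, fun v hv => ?_, ?_⟩
  · have := mul_nonneg ha (hp v)
    have := mul_nonneg hb (hq v)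
    simp only [Pi.add_apply, Pi.smul_apply, smul_eq_mul]
    linarith
  · simp [hp0 v hv, hq0 v hv]
  · simp only [Pi.add_apply, Pi.smul_apply, smul_eq_mul, sum_add_distrib, ← mul_sum, hp1, hq1]
    linarith

omit [DecidableEq V] in
/-- The points of a face lie in the same component. -/
theorem mem_connectedComponent_of_face {K : Set (Finset V)} {x p q : geom K} {s : Finset V}
    (hp : p.1 ∈ geom {s}) (hq : q.1 ∈ geom {s}) (hs : s ∈ K) (h : p ∈ connectedComponent x) :
    q ∈ connectedComponent x := by
  have hpre : IsPreconnected (Subtype.val ⁻¹' geom {s} : Set (geom K)) := by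
    rw [← Topology.IsInducing.subtypeVal.isPreconnected_image, Subtype.image_preimage_coe,
      Set.inter_eq_right.2 (geom_mono (Set.singleton_subset_iff.2 hs))]
    exact (convex_geom_singleton s).isPreconnected
  rw [connectedComponent_eq h]
  exact hpre.subset_connectedComponent hp hq

/-- Each component of the realization of a complex is the realization of a connected subcomplex. -/
theorem IsComplex.exists_component (h : IsComplex U F T) (x : geom (fc U F T)) :
    ∃ A ⊆ U, ∃ F₁ ⊆ F, ∃ T₁ ⊆ T, IsComplex A F₁ T₁ ∧
      (∀ s ∈ fc U F T, s ∈ fc A F₁ T₁ ∨ Disjoint s A) ∧ (∀ s ∈ fc A F₁ T₁, s ⊆ A) ∧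
      ∀ p : geom (fc U F T), p ∈ connectedComponent x ↔ p.1 ∈ geom (fc A F₁ T₁) := by
  classical
  have hmem : ∀ {s}, s ∈ fc U F T → ∀ v ∈ s, Pi.single v (1 : ℝ) ∈ geom (fc U F T) :=
    fun {s} hs v hv => geom_mono (Set.singleton_subset_iff.2 hs) (single_mem_geom hv)
  let A := U.filter fun v => ∃ hv : Pi.single v (1 : ℝ) ∈ geom (fc U F T),
    (⟨_, hv⟩ : geom (fc U F T)) ∈ connectedComponent x
  have hA : ∀ {s}, s ∈ fc U F T → ∀ v ∈ s, ∀ p : geom (fc U F T), p.1 ∈ geom {s} →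
      (v ∈ A ↔ p ∈ connectedComponent x) := by
    intro s hs v hv p hp
    rw [mem_filter]
    constructor
    · rintro ⟨-, hv', hc⟩
      exact mem_connectedComponent_of_face (single_mem_geom hv) hp hs hc
    · intro hc
      exact ⟨(h.face hs).2 hv, hmem hs v hv,
        mem_connectedComponent_of_face hp (single_mem_geom hv) hs hc⟩
  have hsub : ∀ {s}, s ∈ fc U F T → s ⊆ A → s ∈ fc A (F.filter (· ⊆ A)) (T.filter (· ⊆ A)) := by
    rintro s (⟨v, hv, rfl⟩ | hs | hs) hsA
    · exact Or.inl ⟨v, hsA (mem_singleton_self v), rfl⟩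
    · exact Or.inr (Or.inl (mem_filter.2 ⟨hs, hsA⟩))
    · exact Or.inr (Or.inr (mem_filter.2 ⟨hs, hsA⟩))
  have h₁ : IsComplex A (F.filter (· ⊆ A)) (T.filter (· ⊆ A)) := by
    refine ⟨fun e he => ⟨(mem_filter.1 he).2, (h.edge e (mem_filter.1 he).1).2⟩,
      h.triangular.mono (filter_subset _ _), fun e he => ?_, fun t ht => (mem_filter.1 ht).2⟩
    obtain ⟨t, ht, het, hc⟩ := mem_edges.1 he
    exact mem_filter.2 ⟨h.edges_subset (mem_edges.2 ⟨t, (mem_filter.1 ht).1, het, hc⟩),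
      het.trans (mem_filter.1 ht).2⟩
  refine ⟨A, filter_subset _ _, _, filter_subset _ _, _, filter_subset _ _, h₁,
    fun s hs => ?_, fun s hs => (h₁.face hs).2, ?_⟩
  · by_cases hd : Disjoint s A
    · exact Or.inr hd
    · obtain ⟨v, hv, hvA⟩ := not_disjoint_iff.1 hd
      have hc := (hA hs v hv ⟨_, hmem hs v hv⟩ (single_mem_geom hv)).1 hvA
      exact Or.inl (hsub hs fun w hw => (hA hs w hw _ (single_mem_geom hv)).2 hc)
  · rintro ⟨p, s, hs, hp⟩
    constructor
    · intro hc
      exact ⟨s, hsub hs fun v hv => (hA hs v hv ⟨p, s, hs, hp⟩ ⟨s, rfl, hp⟩).2 hc, hp⟩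
    · rintro ⟨r, hr, hpr⟩
      have hr' : r ∈ fc U F T := fc_mono (filter_subset _ _) (filter_subset _ _)
        (filter_subset _ _) hr
      obtain ⟨v, hv⟩ := (h₁.face hr).1
      exact (hA hr' v hv ⟨p, s, hs, hp⟩ ⟨r, rfl, hpr⟩).1 ((h₁.face hr).2 hv)

omit [DecidableEq V] in
/-- The inclusion of a union of components induces isomorphisms of fundamental groups. The
retraction sends the other components to a base point. -/
theorem piIso_of_separated {K L : Set (Finset V)} (hKL : K ⊆ L) {A : Finset V}
    (hd : ∀ s ∈ L, s ∈ K ∨ Disjoint s A) (hA : ∀ s ∈ K, s ⊆ A) (x : geom K)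
    (hc : ∀ p : geom L, p ∈ connectedComponent (geomIncl hKL x) ↔ p.1 ∈ geom K) :
    PiIso (geomIncl hKL) := by
  have hsurj : PathSurj (geomIncl hKL) := by
    intro a b p
    induction p using Path.Homotopic.Quotient.ind with | mk γ =>
    have hγ : ∀ t, (γ t).1 ∈ geom K := fun t => by
      rw [← hc, connectedComponent_eq ((hc (geomIncl hKL a)).2 a.2)]
      exact (isPreconnected_range γ.continuous).subset_connectedComponent
        ⟨0, γ.source⟩ ⟨t, rfl⟩
    have h0 : (γ 0).1 = a.1 := congrArg Subtype.val γ.source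
    have h1 : (γ 1).1 = b.1 := congrArg Subtype.val γ.target
    let γ' : Path a b :=
      { toFun := fun t => ⟨(γ t).1, hγ t⟩
        continuous_toFun := (continuous_subtype_val.comp γ.continuous).subtype_mk _
        source' := Subtype.ext h0
        target' := Subtype.ext h1 }
    exact ⟨.mk γ', rfl⟩
  have hr : ∀ p : geom L,
      (∑ v ∈ A, p.1 v) • p.1 + (1 - ∑ v ∈ A, p.1 v) • x.1 ∈ geom K := by
    rintro ⟨p, s, hs, hp⟩
    rcases hd s hs with h | h
    · rw [sum_eq_one_of_subset ⟨s, rfl, hp⟩ (hA s h)]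
      simpa using ⟨s, h, hp⟩
    · rw [sum_eq_zero_of_disjoint ⟨s, rfl, hp⟩ h]
      simp
  have hcont : Continuous fun p : geom L => ∑ v ∈ A, p.1 v :=
    continuous_finsetSum _ fun v _ => (continuous_apply v).comp continuous_subtype_val
  refine hsurj.piIso (r := ⟨fun p => ⟨_, hr p⟩, Continuous.subtype_mk ((hcont.smul
    continuous_subtype_val).add ((continuous_const.sub hcont).smul continuous_const)) _⟩) ?_
  rintro ⟨p, s, hs, hp⟩
  refine Subtype.ext ?_
  change (∑ v ∈ A, p v) • p + (1 - ∑ v ∈ A, p v) • x.1 = p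
  rw [sum_eq_one_of_subset ⟨s, rfl, hp⟩ (hA s hs)]
  simp

/-- The homotopy type and the fundamental group of a component. -/
theorem IsComplex.component (h : IsComplex U F T) (hs : Sparse T) (x : geom (fc U F T)) :
    ∃ a b c : ℕ, Nonempty (connectedComponent x ≃ₕ WedgeOfPieces a b c) ∧
      Nonempty (FundamentalGroup (geom (fc U F T)) x ≃* FreeProductZZ2 a c) ∧
      IsHyperbolicGroup (FundamentalGroup (geom (fc U F T)) x) := by
  obtain ⟨A, hA, F₁, hF₁, T₁, hT₁, h₁, hd, hsA, hc⟩ := h.exists_component x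
  have hKL : fc A F₁ T₁ ⊆ fc U F T := fc_mono hA hF₁ hT₁
  let e : connectedComponent x ≃ₜ geom (fc A F₁ T₁) :=
    { toFun := fun p => ⟨p.1.1, (hc p.1).1 p.2⟩
      invFun := fun p => ⟨⟨p.1, geom_mono hKL p.2⟩, (hc _).2 p.2⟩
      left_inv := fun _ => rfl
      right_inv := fun _ => rfl
      continuous_toFun :=
        (continuous_subtype_val.comp continuous_subtype_val).subtype_mk _
      continuous_invFun := (continuous_subtype_val.subtype_mk _).subtype_mk _ }
  have : ConnectedSpace (connectedComponent x) :=
    isConnected_iff_connectedSpace.1 isConnected_connectedComponent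
  have : ConnectedSpace (geom (fc A F₁ T₁)) := e.surjective.connectedSpace e.continuous
  obtain ⟨hne, hconn⟩ := h₁.connGraph
  obtain ⟨a, b, c, ⟨f⟩⟩ := exists_homotopyEquiv hne h₁.edge hconn h₁.triangular (hs.mono hT₁)
    h₁.edges_subset h₁.subset
  let x' : geom (fc A F₁ T₁) := ⟨x.1, (hc x).1 mem_connectedComponent⟩
  obtain ⟨g⟩ := nonempty_fundamentalGroup_mulEquiv f x'
  have hiso := piIso_of_separated hKL hd hsA x' hc
  let k : FundamentalGroup (geom (fc U F T)) x ≃* FreeProductZZ2 a c :=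
    (MulEquiv.ofBijective (FundamentalGroup.map (geomIncl hKL) x') (hiso x')).symm.trans g
  exact ⟨a, b, c, ⟨e.toHomotopyEquiv.trans
    (f.trans (wedgeHomeo (piecePt a b c)).symm.toHomotopyEquiv)⟩, ⟨k⟩,
    (isHyperbolicGroup_freeProduct a c).mulEquiv k.symm⟩

/-- The subcomplex whose connected subcomplexes have Euler characteristic at most one. -/
theorem IsComplex.exists_subcomplex (h : IsComplex U F T) (hs : Sparse T) :
    ∃ (Z : PreAbstractSimplicialComplex V) (hZ : Z ≤ complex h),
      (∀ s : Finset V, s.card ≤ 2 → (s ∈ Z ↔ s ∈ complex h)) ∧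
      (∀ z : Realization Z,
        Function.Bijective (FundamentalGroup.map (realizationIncl hZ) z)) ∧
      ∀ Z' : PreAbstractSimplicialComplex V, Z' ≤ Z →
        ConnectedSpace (Realization Z') → eulerChar Z' ≤ 1 := by
  obtain ⟨T', hT', hx, hiso⟩ := exists_excess_nonpos h.triangular hs
  have h' : IsComplex U F T' := ⟨h.edge, h.triangular.mono hT', (edges_mono hT').trans
    h.edges_subset, fun t ht => h.subset t (hT' ht)⟩
  have hle : fc U F T' ⊆ fc U F T := fc_mono subset_rfl subset_rfl hT'
  refine ⟨complex h', fun s hs => hle hs, fun s hsc => ⟨fun hs => hle hs, ?_⟩,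
    hiso U F (fun e he => (h.edge e he).2) h.subset h.edges_subset hle, fun Z' hZ' hconn => ?_⟩
  · rintro (hs | hs | hs)
    · exact Or.inl hs
    · exact Or.inr (Or.inl hs)
    · have := h.triangular s hs
      omega
  · obtain ⟨U₁, F₁, T₁, h₁, rfl⟩ := exists_eq_complex Z'
      ((finite_fc U F T').subset fun s hs => hZ' hs) fun s hs => by
        rcases hZ' hs with ⟨v, -, rfl⟩ | hs | hs
        · simp
        · rw [(h.edge s hs).2]; norm_num
        · rw [h'.triangular s hs]
    have hconn : ConnectedSpace (geom (fc U₁ F₁ T₁)) := hconn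
    refine h₁.eulerChar_le (hx T₁ fun t ht => ?_)
    have := h₁.mem_card_three.2 ht
    exact h'.mem_card_three.1 ⟨hZ' this.1, this.2⟩

end Components

end TwoComplex

end

theorem theorem1p8 {V : Type*} (X : PreAbstractSimplicialComplex V)
    (hfin : X.faces.Finite)
    (hdim : ∀ s ∈ X, s.card ≤ 3)
    (hsparse : ∀ W : PreAbstractSimplicialComplex V, W ≤ X → W.faces.Nonempty →
      TwoComplex.numFaces W 2 < 2 * TwoComplex.numFaces W 0) :
    (∀ x : TwoComplex.Realization X, ∃ a b c : ℕ,
      Nonempty (connectedComponent x ≃ₕ TwoComplex.WedgeOfPieces a b c) ∧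
      Nonempty (FundamentalGroup (TwoComplex.Realization X) x ≃* TwoComplex.FreeProductZZ2 a c) ∧
      TwoComplex.IsHyperbolicGroup (FundamentalGroup (TwoComplex.Realization X) x)) ∧
    ∃ (Z : PreAbstractSimplicialComplex V) (hZ : Z ≤ X),
      (∀ s : Finset V, s.card ≤ 2 → (s ∈ Z ↔ s ∈ X)) ∧
      (∀ z : TwoComplex.Realization Z,
        Function.Bijective (FundamentalGroup.map (TwoComplex.realizationIncl hZ) z)) ∧
      ∀ Z' : PreAbstractSimplicialComplex V, Z' ≤ Z →
        ConnectedSpace (TwoComplex.Realization Z') → TwoComplex.eulerChar Z' ≤ 1 := by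
  classical
  obtain ⟨U, F, T, h, rfl⟩ := TwoComplex.exists_eq_complex X hfin hdim
  have hs := h.sparse hsparse
  exact ⟨h.component hs, h.exists_subcomplex hs⟩
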